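/- Let $k\ge 0$ and let $c'_i,c''_i\ge 0$ $(1\le i\le k)$ be integers; put $c_i=c'_i+c''_i$. Consider a meromorphic differential $\eta$ on $\mathbb P^1$ with a unique zero $\sigma$, of order $m$, and exactly $k+2$ distinct poles $q_0,\dots,q_{k+1}$, such that $q_i$ has order $c_i+2$ and $\operatorname{Res}_{q_i}\eta=0$ for $1\le i\le k$, and $\operatorname{Res}_{q_0}\eta=-\operatorname{Res}_{q_{k+1}}\eta=\rho\neq 0$. The end poles are of one of the following types. * Type (i): $k\ge 1$, and $q_0,q_{k+1}$ are simple poles; so $m=\sum_{i=1}^k(c_i+2)$. * Type (ii): $q_0$ is a simple pole and $q_{k+1}$ has order $b+2$ with $b\ge 0$; so $m=\sum_{i=1}^k(c_i+2)+(b+1)$. * Type (iii): $q_0$ has order $a+2$ and $q_{k+1}$ has order $b+2$ with $a,b\ge 0$; so $m=\sum_{i=1}^k(c_i+2)+(a+1)+(b+1)$. We say that $\eta$ admits the configuration with these data if it has precisely $k+1$ homologous saddle connections $\gamma_1,\dots,\gamma_{k+1}$ from $\sigma$ to itself, of holonomy $\int_{\gamma_j}\eta=2\pi\sqrt{-1}\,\rho$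 when suitably oriented (that is, with $q_0$ on the left; here two saddle connections are homologous if their holonomies agree up to sign), with the following angles at $\sigma$. The ends of the saddle connections occur around $\sigma$ in the counterclockwise cyclic order $$\text{start of }\gamma_1,\ \text{end of }\gamma_1,\ \text{end of }\gamma_2,\dots,\ \text{end of }\gamma_{k+1},\ \text{start of }\gamma_{k+1},\dots,\ \text{start of }\gamma_2,$$ and for $1\le i\le k$ the flat angle of the sector from the end of $\gamma_i$ to the end of $\gamma_{i+1}$ is $2\pi(c'_i+1)$, and that of the sector from the start of $\gamma_{i+1}$ to the start of $\gamma_i$ is $2\pi(c''_i+1)$. Then a differential admitting a given configuration of type (i), (ii) or (iii) is unique up to scale: if $\eta$ and $\tilde\eta$ both admit the configuration with the same type and data, then there are an automorphism $\varphi$ of $\mathbb P^1$ and a constant $c\in\mathbb C^*$ such that $\varphi^*\tilde\eta=c\,\eta$, and $\varphi$ maps $\sigma,q_0,q_{k+1}$ and the saddle connections $\gamma_1,\dots,\gamma_{k+1}$ to the corresponding points and saddle connections of $\tilde\eta$. If moreover for both differentials the poles are labelled so that $q_i$ lies between $\gamma_i$ and $\gamma_{i+1}$ for $1\le i\le k$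 (that is, for $0\le i\le k+1$ and $1\le j\le k+1$, the points $q_i$ and $q_0$ lie in the same connected component of $\mathbb P^1\setminus\gamma_j$ if and only if $i<j$), then $\varphi(q_i)=\tilde q_i$ for all $i$. -/

import Mathlib

open Filter Topology

noncomputable section

namespace FlatSphere

/-- The Riemann sphere `ℙ¹ = ℂ ∪ {∞}`. -/
abbrev Sphere : Type := OnePoint ℂ

/-- The affine coordinate `z` on `ℙ¹ ∖ {∞}` (the value at `∞` is never used). -/
def zCoord (p : Sphere) : ℂ := Option.elim p 0 (fun z => z)

/-- The coordinate `w = 1/z` on `ℙ¹ ∖ {0}`, with `w(∞) = 0` (the value at `0` is never used). -/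
def wCoord (p : Sphere) : ℂ := Option.elim p 0 (fun z => z⁻¹)

open Classical in
/-- A holomorphic coordinate centred at `p`: it is `z - p` if `p` is finite, and `w` if `p = ∞`. -/
def centredCoord (p x : Sphere) : ℂ :=
  if p = OnePoint.infty then wCoord x else zCoord x - zCoord p

/-- A meromorphic differential `η` on `ℙ¹`, given by its expressions `f(z) dz` and `g(w) dw` in the
two standard charts, `w = 1/z`. The coefficients are meromorphic on `ℂ`; being in normal form means
that they carry no removable singularities and take the value `0` at their poles. -/
structure MeroDifferential where
  f : ℂ → ℂ
  g : ℂ → ℂ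
  meromorphic_f : MeromorphicNFOn f Set.univ
  meromorphic_g : MeromorphicNFOn g Set.univ
  compat : ∀ w : ℂ, w ≠ 0 → g w = -(f w⁻¹) / w ^ 2

namespace MeroDifferential

open Classical in
/-- The order of vanishing of `η` at `p` (negative at poles). -/
def ord (η : MeroDifferential) (p : Sphere) : WithTop ℤ :=
  if p = OnePoint.infty then meromorphicOrderAt η.g 0 else meromorphicOrderAt η.f (zCoord p)

open Classical in
/-- `Res_p η = ρ`: the integral of `η` over small positive circles about `p` (in a chart)
is `2πi ρ`. -/
def HasResidue (η : MeroDifferential) (p : Sphere) (ρ : ℂ) : Prop :=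
  ∀ᶠ R : ℝ in 𝓝[>] 0,
    (if p = OnePoint.infty then (∮ w in C(0, R), η.g w) else (∮ z in C(zCoord p, R), η.f z))
      = 2 * Real.pi * Complex.I * ρ

/-- At time `t` the path `γ` in `ℙ¹` is differentiable and `η(γ'(t)) = V`. -/
def HasVelocity (η : MeroDifferential) (γ : ℝ → Sphere) (V : ℂ) (t : ℝ) : Prop :=
  (γ t ≠ OnePoint.infty →
    ∃ u : ℂ, HasDerivAt (fun s => zCoord (γ s)) u t ∧ η.f (zCoord (γ t)) * u = V) ∧
  (γ t = OnePoint.infty →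
    ∃ u : ℂ, HasDerivAt (fun s => wCoord (γ s)) u t ∧ η.g (wCoord (γ t)) * u = V)

/-- `γ` is a saddle connection from `σ` to itself with holonomy `∫_γ η = V`: it has no zero or pole
of `η` in its interior and is a straight segment for the flat metric of `η`, parametrized on `[0,1]`
with constant velocity (so that `∫ η` over `γ|[0,t]` equals `t V`). -/
def IsSelfSaddle (η : MeroDifferential) {σ : Sphere} (V : ℂ) (γ : Path σ σ) : Prop :=
  ∀ t ∈ Set.Ioo (0 : ℝ) 1, η.ord (γ.extend t) = 0 ∧ η.HasVelocity γ.extend V t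

/-- `φ^* η' = c • η`, where `φ(z) = (a z + b) / (c z + d)` is the Möbius transformation given by the
matrix `A`. (An identity of differentials on the complement of the points `∞` and `φ⁻¹(∞)`, hence
on `ℙ¹`.) -/
def PullsBackTo (η' : MeroDifferential) (A : GL (Fin 2) ℂ) (c : ℂ) (η : MeroDifferential) : Prop :=
  ∀ z : ℂ, A 1 0 * z + A 1 1 ≠ 0 →
    η'.f ((A 0 0 * z + A 0 1) / (A 1 0 * z + A 1 1))
        * ((A 0 0 * A 1 1 - A 0 1 * A 1 0) / (A 1 0 * z + A 1 1) ^ 2)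
      = c * η.f z

end MeroDifferential

/-- The unit tangent vector (in the centred coordinate) in which `γ` leaves `σ`. -/
def DepartsAlong {σ : Sphere} (γ : Path σ σ) (e : ℂ) : Prop :=
  Tendsto (fun t : ℝ => centredCoord σ (γ.extend t) / (‖centredCoord σ (γ.extend t)‖ : ℂ))
    (𝓝[>] 0) (𝓝 e)

/-- The unit tangent vector at `σ` (in the centred coordinate, pointing away from `σ`) of the end
of `γ` by which it returns to `σ`. -/
def ArrivesAlong {σ : Sphere} (γ : Path σ σ) (e : ℂ) : Prop :=
  Tendsto (fun t : ℝ => centredCoord σ (γ.extend t) / (‖centredCoord σ (γ.extend t)‖ : ℂ))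
    (𝓝[<] 1) (𝓝 e)

/-- At a zero of order `m`, where the cone angle is `2π(m+1)`, turning counterclockwise through the
flat angle `θ` leads from the unit tangent vector `e₁` to `e₂`. The flat metric is
`|d(ζ^(m+1))|` in a suitable holomorphic coordinate `ζ`, so flat angles are `m + 1` times the
conformal ones. -/
def FlatTurn (m : ℕ) (e₁ e₂ : ℂ) (θ : ℝ) : Prop :=
  e₂ = e₁ * Complex.exp (Complex.I * ((θ / (m + 1) : ℝ) : ℂ))

/-- What lies at an end of a block of surfaces: a half-cylinder, or a surface with a pair of holes
boundary, with its nonnegative integer (`a₀` or `b_{k+1}`). -/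
inductive BlockEnd where
  | halfCylinder
  | pairOfHoles (a : ℕ)

/-- The order of the pole that the end creates. -/
def BlockEnd.poleOrder : BlockEnd → ℕ
  | .halfCylinder => 1
  | .pairOfHoles a => a + 2

/-- The contribution of the end to the order of the zero. -/
def BlockEnd.zeroOrder : BlockEnd → ℕ
  | .halfCylinder => 0
  | .pairOfHoles a => a + 1

/-- The data of a block: its two ends and the `k` figure eight surfaces in between, with their
integers `c'ᵢ`, `c''ᵢ`. -/
structure Block where
  k : ℕ
  c' : Fin k → ℕ
  c'' : Fin k → ℕ
  first : BlockEnd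
  last : BlockEnd

namespace Block

def IsTypeI (B : Block) : Prop :=
  1 ≤ B.k ∧ B.first = .halfCylinder ∧ B.last = .halfCylinder

def IsTypeII (B : Block) : Prop :=
  B.first = .halfCylinder ∧ ∃ b, B.last = .pairOfHoles b

def IsTypeIII (B : Block) : Prop :=
  (∃ a, B.first = .pairOfHoles a) ∧ ∃ b, B.last = .pairOfHoles b

/-- The order of the zero `σ`. -/
def zeroOrder (B : Block) : ℕ :=
  (∑ i, (B.c' i + B.c'' i + 2)) + B.first.zeroOrder + B.last.zeroOrder

/-- The angles at `σ`. The saddle connections `γ₁, …, γ_{k+1}` (here indexed from `0`) have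
departing ends `depᵢ` and returning ends `arrᵢ`. Counterclockwise around `σ` one meets
`dep₁, arr₁, arr₂, …, arr_{k+1}, dep_{k+1}, …, dep₂, dep₁`, the sectors between consecutive ends
filling the cone angle exactly once, and the angles in between `γᵢ` and `γᵢ₊₁` are `2π(c'ᵢ + 1)`
(between the returning ends) and `2π(c''ᵢ + 1)` (between the departing ends). The two remaining
angles `α` and `β` are not prescribed. -/
def HasAngles (B : Block) {σ : Sphere} (γ : Fin (B.k + 1) → Path σ σ) : Prop :=
  ∃ (dep arr : Fin (B.k + 1) → ℂ) (α β : ℝ),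
    (∀ j, DepartsAlong (γ j) (dep j) ∧ ArrivesAlong (γ j) (arr j)) ∧
    0 < α ∧ 0 < β ∧
    α + (∑ i, (2 * Real.pi * (B.c' i + 1) + 2 * Real.pi * (B.c'' i + 1))) + β
      = 2 * Real.pi * (B.zeroOrder + 1) ∧
    FlatTurn B.zeroOrder (dep 0) (arr 0) α ∧
    FlatTurn B.zeroOrder (arr (Fin.last B.k)) (dep (Fin.last B.k)) β ∧
    ∀ i : Fin B.k,
      FlatTurn B.zeroOrder (arr i.castSucc) (arr i.succ) (2 * Real.pi * (B.c' i + 1)) ∧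
      FlatTurn B.zeroOrder (dep i.succ) (dep i.castSucc) (2 * Real.pi * (B.c'' i + 1))

end Block

/-- The differential `η` on `ℙ¹`, with zero `σ`, poles `q₀, …, q_{k+1}` and saddle connections
`γ₁, …, γ_{k+1}` (indexed from `0`), admits the configuration given by the block `B`; here `ρ` is the
residue at `q₀`. Each saddle connection is oriented so that its holonomy is `2πi ρ`, that is, with
`q₀` on its left. -/
structure Admits (B : Block) (η : MeroDifferential) (σ : Sphere) (q : Fin (B.k + 2) → Sphere)
    (ρ : ℂ) (γ : Fin (B.k + 1) → Path σ σ) : Prop where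
  q_injective : Function.Injective q
  ord_zero : η.ord σ = ((B.zeroOrder : ℤ) : WithTop ℤ)
  ord_first : η.ord (q 0) = ((-(B.first.poleOrder : ℤ) : ℤ) : WithTop ℤ)
  ord_mid : ∀ i : Fin B.k,
    η.ord (q i.castSucc.succ) = ((-((B.c' i + B.c'' i + 2 : ℕ) : ℤ) : ℤ) : WithTop ℤ)
  ord_last : η.ord (q (Fin.last (B.k + 1))) = ((-(B.last.poleOrder : ℤ) : ℤ) : WithTop ℤ)
  ord_other : ∀ p, p ≠ σ → p ∉ Set.range q → η.ord p = 0
  res_ne_zero : ρ ≠ 0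
  res_first : η.HasResidue (q 0) ρ
  res_mid : ∀ i : Fin B.k, η.HasResidue (q i.castSucc.succ) 0
  res_last : η.HasResidue (q (Fin.last (B.k + 1))) (-ρ)
  /-- the `k + 1` saddle connections are distinct -/
  saddles_injective : Function.Injective γ
  /-- they are precisely the homologous ones: those of holonomy `2πi ρ`; the saddle connections of
  holonomy `-2πi ρ` are the same segments traversed backwards -/
  saddles : Set.range γ = {δ : Path σ σ | η.IsSelfSaddle (2 * Real.pi * Complex.I * ρ) δ}
  angles : B.HasAngles γ

/-- The poles are labelled along the chain of saddle connections: `q₀` lies before `γ₁`, `qᵢ` lies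
between `γᵢ` and `γᵢ₊₁`, and `q_{k+1}` lies after `γ_{k+1}`. That is, `γ_{j+1}` does not separate
`qᵢ` from `q₀` exactly if `i ≤ j`. -/
def LabelledInOrder {k : ℕ} {σ : Sphere} (q : Fin (k + 2) → Sphere)
    (γ : Fin (k + 1) → Path σ σ) : Prop :=
  ∀ (i : Fin (k + 2)) (j : Fin (k + 1)),
    q i ∈ connectedComponentIn (Set.range (γ j))ᶜ (q 0) ↔ (i : ℕ) ≤ (j : ℕ)

end FlatSphere

end

/-! Put the zero `σ` at infinity. As `σ` is the only zero, `η` becomes a multiple of `du / P(u)`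
with `P` a polynomial of degree `m + 2` whose roots are the poles of `η`. After division by `2πiρ`
the nonzero residues are `±1/(2πi)`, so `E = exp (2πi ∫ du/P)` is single-valued. It equals `1` at
the zero, and at flat displacement `x` from the zero its modulus is `exp (-2π Im x)`. Hence a
straight ray leaving the zero can return only in one of the `2(m+1)` horizontal directions `ω^n`,
alternately of orientation `+1` and `-1`, and only after an integral time; the given saddle
connections are those of time one. Conversely every regular point lies on a straight ray from the
zero (`exists_ray_eq`).

A pole of order `d` has `d - 1` petals of each orientation, and each petal swallows an infinite
horizontal ray (`exists_petal`). For each orientation there are `m + 1` rays, `k + 1` saddle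
connections and `(m+2) - (k+2) = m - k` petals. The count is tight, so every remaining horizontal
ray is infinite and ends in a petal (`petal_of_card`). The surface is therefore a union of
half-planes, glued as prescribed by the cyclic positions of the ends of the saddle connections.

The angles fix these positions except for the two outer angles, of which only the sum is known. If
the angle cut off by the first loop is `π(2a+1)` with `a ≥ 1`, then the `2a` rays inside converge to
a single pole. Carrying an integration constant through its petals and around the loop compares
holonomy with residue, and shows that the pole is `q₀`, of order `a + 1`
(`rootMultiplicity_of_loop`); the last loop is treated in the same way. In each of the three types
this determines `a`.

Two differentials with the same data thus have the same rays and gluings (`SameRays`). Matching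
points with equal ray coordinates is well defined (`ray_eq_of_ray_eq`) and holomorphic. The map
stays bounded near the poles and grows linearly at infinity, so it is affine. Conjugated back it is
the required Möbius transformation. If the poles are labelled along the chain, the components of the
complements of the saddle connections, which a homeomorphism preserves, recover each label. -/

namespace FlatSphere

/-! ### Flat charts and their uniqueness -/

/-- `G` inverts a primitive of `dz / P` on `U`: a flat chart for the differential `dz / P`. -/
def IsChart (P : Polynomial ℂ) (U : Set ℂ) (G : ℂ → ℂ) : Prop :=
  ∀ w ∈ U, P.eval (G w) ≠ 0 ∧ HasDerivAt G (P.eval (G w)) w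

theorem IsChart.mono {P : Polynomial ℂ} {U V : Set ℂ} {G : ℂ → ℂ} (h : IsChart P U G)
    (hVU : V ⊆ U) : IsChart P V G := fun w hw => h w (hVU hw)

theorem IsChart.shift {P : Polynomial ℂ} {U : Set ℂ} {G : ℂ → ℂ} (h : IsChart P U G) (b : ℂ) :
    IsChart P {w | w + b ∈ U} (fun w => G (w + b)) := fun w hw =>
  ⟨(h _ hw).1, by simpa using (h _ hw).2.comp_add_const w b⟩

theorem IsChart.congr {P : Polynomial ℂ} {U : Set ℂ} {G G' : ℂ → ℂ} (h : IsChart P U G)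
    (hU : IsOpen U) (hG : Set.EqOn G' G U) : IsChart P U G' := fun w hw => by
  rw [hG hw]
  exact ⟨(h w hw).1, (h w hw).2.congr_of_eventuallyEq (hG.eventuallyEq_of_mem (hU.mem_nhds hw))⟩

theorem IsChart.differentiableOn {P : Polynomial ℂ} {U : Set ℂ} {G : ℂ → ℂ} (h : IsChart P U G) :
    DifferentiableOn ℂ G U := fun w hw => (h w hw).2.differentiableAt.differentiableWithinAt

/-- The differential `dz / P` has a locally injective primitive near a point where `P ≠ 0`. -/
theorem exists_local_primitive (P : Polynomial ℂ) {z₀ : ℂ} (h : P.eval z₀ ≠ 0) :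
    ∃ e : OpenPartialHomeomorph ℂ ℂ, z₀ ∈ e.source ∧
      ∀ z ∈ e.source, P.eval z ≠ 0 ∧ HasDerivAt e (P.eval z)⁻¹ z := by
  have hopen : IsOpen {z | P.eval z ≠ 0} := isOpen_ne_fun P.continuous continuous_const
  obtain ⟨r, hr, hball⟩ := Metric.isOpen_iff.1 hopen z₀ h
  have hdiff : DifferentiableOn ℂ (fun z => (P.eval z)⁻¹) (Metric.ball z₀ r) := fun z hz =>
    ((P.differentiable z).inv (hball hz)).differentiableWithinAt
  obtain ⟨F, hF⟩ := hdiff.isExactOn_ball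
  have hFd : DifferentiableOn ℂ F (Metric.ball z₀ r) := fun z hz =>
    (hF z hz).differentiableAt.differentiableWithinAt
  have hz₀ : z₀ ∈ Metric.ball z₀ r := Metric.mem_ball_self hr
  have hstrict : HasStrictDerivAt F (P.eval z₀)⁻¹ z₀ := by
    have := (hFd.analyticAt (Metric.isOpen_ball.mem_nhds hz₀)).hasStrictDerivAt
    rwa [(hF z₀ hz₀).deriv] at this
  have hs := hstrict.hasStrictFDerivAt_equiv (inv_ne_zero h)
  refine ⟨(hs.toOpenPartialHomeomorph F).restrOpen (Metric.ball z₀ r) Metric.isOpen_ball, ?_, ?_⟩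
  · exact ⟨hs.mem_toOpenPartialHomeomorph_source, hz₀⟩
  · intro z hz
    exact ⟨hball hz.2, hF z hz.2⟩

/-- Composed with a local primitive of `dz / P`, each chart has derivative `1`. The two compositions
differ by a constant, which is zero at `w₀`, and the primitive is injective. -/
theorem IsChart.eventuallyEq {P : Polynomial ℂ} {U : Set ℂ} {G₁ G₂ : ℂ → ℂ} (hU : IsOpen U)
    (h₁ : IsChart P U G₁) (h₂ : IsChart P U G₂) {w₀ : ℂ} (hw : w₀ ∈ U) (he : G₁ w₀ = G₂ w₀) :
    G₁ =ᶠ[𝓝 w₀] G₂ := by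
  obtain ⟨e, hz, he'⟩ := exists_local_primitive P (h₁ w₀ hw).1
  have e₁ : ∀ᶠ w in 𝓝 w₀, G₁ w ∈ e.source :=
    (h₁ w₀ hw).2.continuousAt.eventually_mem (e.open_source.mem_nhds hz)
  have e₂ : ∀ᶠ w in 𝓝 w₀, G₂ w ∈ e.source :=
    (h₂ w₀ hw).2.continuousAt.eventually_mem (e.open_source.mem_nhds (he ▸ hz))
  obtain ⟨r, hr, hball⟩ := Metric.eventually_nhds_iff_ball.1
    ((e₁.and e₂).and (hU.mem_nhds hw))
  have hd : ∀ w ∈ Metric.ball w₀ r, HasDerivAt (fun w => e (G₁ w) - e (G₂ w)) 0 w := by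
    intro w hw'
    obtain ⟨⟨m₁, m₂⟩, mU⟩ := hball w hw'
    have a := (he' _ m₁).2.comp w (h₁ w mU).2
    have b := (he' _ m₂).2.comp w (h₂ w mU).2
    exact (a.sub b).congr_deriv (by simp [(h₁ w mU).1, (h₂ w mU).1])
  refine Metric.eventually_nhds_iff_ball.2 ⟨r, hr, fun w hw' => ?_⟩
  have hc := Metric.isOpen_ball.is_const_of_deriv_eq_zero
    (convex_ball w₀ r).isPreconnected
    (fun w hw' => (hd w hw').differentiableAt.differentiableWithinAt)
    (fun w hw' => (hd w hw').deriv) hw' (Metric.mem_ball_self hr)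
  obtain ⟨⟨m₁, m₂⟩, -⟩ := hball w hw'
  exact e.injOn m₁ m₂ (by simpa [he, sub_eq_zero] using hc)

/-- Flat charts are determined by one value. -/
theorem IsChart.eqOn {P : Polynomial ℂ} {U : Set ℂ} {G₁ G₂ : ℂ → ℂ} (hU : IsOpen U)
    (hc : IsPreconnected U) (h₁ : IsChart P U G₁) (h₂ : IsChart P U G₂) {w₀ : ℂ} (hw : w₀ ∈ U)
    (he : G₁ w₀ = G₂ w₀) : Set.EqOn G₁ G₂ U :=
  (h₁.differentiableOn.analyticOnNhd hU).eqOn_of_preconnected_of_eventuallyEq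
    (h₂.differentiableOn.analyticOnNhd hU) hc hw (h₁.eventuallyEq hU h₂ hw he)

/-- Connectedness of the overlap spreads the agreement at `w₀` to all of `U ∩ V`, so the piecewise
definition is consistent. -/
theorem IsChart.union {P : Polynomial ℂ} {U V : Set ℂ} {G₁ G₂ : ℂ → ℂ} (hU : IsOpen U)
    (hV : IsOpen V) (hUV : IsPreconnected (U ∩ V)) (h₁ : IsChart P U G₁) (h₂ : IsChart P V G₂)
    {w₀ : ℂ} (hw : w₀ ∈ U ∩ V) (he : G₁ w₀ = G₂ w₀) :
    ∃ G, IsChart P (U ∪ V) G ∧ Set.EqOn G G₁ U ∧ Set.EqOn G G₂ V := by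
  classical
  have heq := (h₁.mono Set.inter_subset_left).eqOn (hU.inter hV) hUV
    (h₂.mono Set.inter_subset_right) hw he
  have e₁ : Set.EqOn (fun w => if w ∈ U then G₁ w else G₂ w) G₁ U := fun w hw => by simp [hw]
  have e₂ : Set.EqOn (fun w => if w ∈ U then G₁ w else G₂ w) G₂ V := fun w hw => by
    by_cases h : w ∈ U
    · simpa [h] using heq ⟨h, hw⟩
    · simp [h]
  refine ⟨_, ?_, e₁, e₂⟩
  rintro w (hw | hw)
  · exact h₁.congr hU e₁ w hw
  · exact h₂.congr hV e₂ w hw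

/-- Near a point with `P ≠ 0`, flat charts of a uniform size exist. -/
theorem exists_uniform_chart (P : Polynomial ℂ) {z₀ : ℂ} (h : P.eval z₀ ≠ 0) :
    ∃ r > 0, ∀ᶠ z in 𝓝 z₀, ∀ b : ℂ, ∃ G, IsChart P (Metric.ball b r) G ∧ G b = z := by
  obtain ⟨e, hz, he⟩ := exists_local_primitive P h
  obtain ⟨r, hr, hball⟩ := Metric.isOpen_iff.1 e.open_target (e z₀) (e.map_source hz)
  -- One half of the radius absorbs the variation of the starting point `z`, the other half the
  -- displacement, so that one radius serves all nearby `z`.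
  refine ⟨r / 2, by positivity, ?_⟩
  have hcont : ContinuousAt e z₀ := (he z₀ hz).2.continuousAt
  filter_upwards [hcont.eventually_mem (Metric.ball_mem_nhds _ (half_pos hr)),
    e.open_source.mem_nhds hz] with z h₁ h₂ b
  refine ⟨fun w => e.symm (e z + (w - b)), fun w hw => ?_, by simp [e.left_inv h₂]⟩
  have ht : e z + (w - b) ∈ e.target := by
    refine hball ?_
    rw [Metric.mem_ball, dist_eq_norm] at *
    calc ‖e z + (w - b) - e z₀‖ = ‖(e z - e z₀) + (w - b)‖ := by ring_nf
      _ ≤ ‖e z - e z₀‖ + ‖w - b‖ := norm_add_le _ _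
      _ < r := by linarith
  have hs := e.map_target ht
  have hd := e.hasDerivAt_symm ht (inv_ne_zero (he _ hs).1) (he _ hs).2
  refine ⟨(he _ hs).1, ?_⟩
  exact (hd.comp w (((hasDerivAt_id w).sub_const b).const_add (e z))).congr_deriv (by simp)

/-! ### Straight trajectories -/

/-- The displacements along which the straight trajectory starting at `z` exists. -/
def flowDom (P : Polynomial ℂ) (z : ℂ) : Set ℂ :=
  {w | ∃ N G, IsOpen N ∧ Convex ℝ N ∧ (0 : ℂ) ∈ N ∧ w ∈ N ∧ IsChart P N G ∧ G 0 = z}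

open Classical in
/-- The end point of the straight trajectory with displacement `w` starting at `z`. -/
noncomputable def flow (P : Polynomial ℂ) (z w : ℂ) : ℂ :=
  if h : w ∈ flowDom P z then h.choose_spec.choose w else 0

section Flow

variable {P : Polynomial ℂ} {z : ℂ}

/-- The intersection of two convex witnesses is convex and contains `0`, so the charts agree on it
and the choice made in `flow` is immaterial. This is why `flowDom` asks for convex neighbourhoods.
-/
theorem flow_eq {N : Set ℂ} {G : ℂ → ℂ} (hN : IsOpen N) (hc : Convex ℝ N) (h0 : (0 : ℂ) ∈ N)
    (hG : IsChart P N G) (hz : G 0 = z) : Set.EqOn (flow P z) G N := by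
  intro w hw
  have h : w ∈ flowDom P z := ⟨N, G, hN, hc, h0, hw, hG, hz⟩
  obtain ⟨hN', hc', h0', hw', hG', hz'⟩ := h.choose_spec.choose_spec
  rw [flow, dif_pos h]
  exact (hG'.mono Set.inter_subset_left).eqOn (hN'.inter hN) (hc'.inter hc).isPreconnected
    (hG.mono Set.inter_subset_right) ⟨h0', h0⟩ (hz'.trans hz.symm) ⟨hw', hw⟩

theorem isOpen_flowDom : IsOpen (flowDom P z) := by
  rw [isOpen_iff_mem_nhds]
  rintro w ⟨N, G, hN, hc, h0, hw, hG, hz⟩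
  exact mem_of_superset (hN.mem_nhds hw) fun w' hw' => ⟨N, G, hN, hc, h0, hw', hG, hz⟩

theorem isChart_flow : IsChart P (flowDom P z) (flow P z) := by
  rintro w ⟨N, G, hN, hc, h0, hw, hG, hz⟩
  exact hG.congr hN (flow_eq hN hc h0 hG hz) w hw

theorem smul_mem_flowDom {w : ℂ} (hw : w ∈ flowDom P z) {s : ℝ} (hs : s ∈ Set.Icc (0 : ℝ) 1) :
    (s : ℂ) * w ∈ flowDom P z := by
  obtain ⟨N, G, hN, hc, h0, hw, hG, hz⟩ := hw
  refine ⟨N, G, hN, hc, h0, ?_, hG, hz⟩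
  have := hc.smul_mem_of_zero_mem h0 hw hs
  simpa using this

theorem zero_mem_flowDom (hz : P.eval z ≠ 0) : (0 : ℂ) ∈ flowDom P z := by
  obtain ⟨r, hr, h⟩ := exists_uniform_chart P hz
  obtain ⟨G, hG, h0⟩ := h.self_of_nhds 0
  exact ⟨_, G, Metric.isOpen_ball, convex_ball _ _, Metric.mem_ball_self hr,
    Metric.mem_ball_self hr, hG, h0⟩

theorem flow_zero (hz : P.eval z ≠ 0) : flow P z 0 = z := by
  obtain ⟨N, G, hN, hc, h0, hw, hG, hz⟩ := zero_mem_flowDom hz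
  rw [flow_eq hN hc h0 hG hz h0, hz]

theorem starConvex_flowDom : StarConvex ℝ 0 (flowDom P z) := by
  rw [starConvex_zero_iff]
  intro w hw s h0 h1
  simpa using smul_mem_flowDom hw ⟨h0, h1⟩

theorem convex_segment_thickening (w : ℂ) (δ : ℝ) :
    Convex ℝ (Metric.thickening δ (segment ℝ 0 w)) := (convex_segment _ _).thickening δ

/-- A trajectory can be prolonged by a chart of radius `r` at its end. -/
theorem mem_flowDom_of_ball {w w' : ℂ} (hw : w ∈ flowDom P z) {r : ℝ}
    (hww : ∃ t : ℝ, 1 ≤ t ∧ w' = t * w) (hr : ‖w' - w‖ < r) {G₂ : ℂ → ℂ}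
    (hG₂ : IsChart P (Metric.ball w r) G₂) (he : G₂ w = flow P z w) : w' ∈ flowDom P z := by
  obtain ⟨N, G, hN, hc, h0, hwN, hG, hz⟩ := hw
  have hseg : segment ℝ 0 w ⊆ N := hc.segment_subset h0 hwN
  have hcomp : IsCompact (segment ℝ (0 : ℂ) w) := by
    rw [segment_eq_image]
    exact isCompact_Icc.image (by fun_prop)
  obtain ⟨δ, hδ, hsub⟩ := hcomp.exists_thickening_subset_open hN hseg
  obtain ⟨t, ht, rfl⟩ := hww
  obtain ⟨G', hG', h1, h2⟩ := hG.union hN Metric.isOpen_ball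
    (hc.inter (convex_ball w r)).isPreconnected hG₂
    ⟨hwN, Metric.mem_ball_self ((norm_nonneg _).trans_lt hr)⟩
    (by rw [he, flow_eq hN hc h0 hG hz hwN])
  -- A thickening this thin stays in `N` along the segment up to `w`, and in the ball around `w`
  -- beyond it.
  set η := min δ (r - ‖(t : ℂ) * w - w‖) with hη
  have hηpos : 0 < η := lt_min hδ (by linarith)
  refine ⟨Metric.thickening η (segment ℝ 0 ((t : ℂ) * w)), G', Metric.isOpen_thickening,
    convex_segment_thickening _ _, Metric.self_subset_thickening hηpos _ (left_mem_segment _ _ _),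
    Metric.self_subset_thickening hηpos _ (right_mem_segment _ _ _), hG'.mono ?_, ?_⟩
  · intro x hx
    obtain ⟨y, hy, hxy⟩ := Metric.mem_thickening_iff.1 hx
    rw [segment_eq_image] at hy
    obtain ⟨s, ⟨hs0, hs1⟩, rfl⟩ := hy
    simp only [smul_zero, zero_add] at hxy
    by_cases hst : s * t ≤ 1
    · left
      refine hsub (Metric.mem_thickening_iff.2 ⟨(s * t : ℝ) * w, ?_, ?_⟩)
      · rw [segment_eq_image]
        exact ⟨s * t, ⟨by positivity, hst⟩, by simp⟩
      · refine lt_of_eq_of_lt ?_ (hxy.trans_le (min_le_left _ _))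
        congr 1
        simp [mul_assoc]
    · right
      rw [Metric.mem_ball]
      have h3 : dist (s • ((t : ℂ) * w)) w ≤ ‖(t : ℂ) * w - w‖ := by
        have e1 : s • ((t : ℂ) * w) - w = ((s * t - 1 : ℝ) : ℂ) * w := by
          simp; ring
        have e2 : (t : ℂ) * w - w = ((t - 1 : ℝ) : ℂ) * w := by
          simp; ring
        rw [dist_eq_norm, e1, e2, norm_mul, norm_mul, Complex.norm_real, Complex.norm_real,
          Real.norm_of_nonneg (by linarith), Real.norm_of_nonneg (by linarith)]
        gcongr
        nlinarith
      calc dist x w ≤ dist x (s • ((t : ℂ) * w)) + dist (s • ((t : ℂ) * w)) w :=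
            dist_triangle _ _ _
        _ < η + ‖(t : ℂ) * w - w‖ := by linarith
        _ ≤ r := by linarith [min_le_right δ (r - ‖(t : ℂ) * w - w‖)]
  · rw [h1 h0, hz]

end Flow

/-! ### Trajectories that cannot be prolonged run into infinity -/

/-- A trajectory of `P` does not come close to a zero of `P` in bounded time. -/
theorem exists_dist_root_le {P : Polynomial ℂ} {p w : ℂ} (hp : P.eval p = 0) {z : ℝ → ℂ} {T : ℝ}
    (hz : ∀ t ∈ Set.Ico 0 T, z t ≠ p ∧ HasDerivAt z (w * P.eval (z t)) t) :
    ∃ δ > 0, ∀ t ∈ Set.Ico 0 T, δ ≤ ‖z t - p‖ := by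
  obtain ⟨Q, rfl⟩ := Polynomial.dvd_iff_isRoot.2 hp
  obtain ⟨C, hC⟩ := (isCompact_closedBall p 1).exists_bound_of_continuousOn
    (f := fun z => Q.eval z) Q.continuous.continuousOn
  -- With `P = (z - p) Q`, the inverse distance vector satisfies the linear equation `y' = -w Q(z)
  -- y`, so it grows at most exponentially while `z` is near `p`.
  set y : ℝ → ℂ := fun t => (z t - p)⁻¹
  -- The summand `2` forces `‖y‖ ≥ 2` whenever the barrier is touched, hence `z` is then in the unit
  -- ball where `Q` is bounded by `C`. The summand `1` in `L` makes the comparison of derivatives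
  -- strict.
  set A := ‖y 0‖ + 2 with hA
  set L := ‖w‖ * C + 1 with hL
  have hC0 : 0 ≤ C := (norm_nonneg _).trans (hC p (Metric.mem_closedBall_self zero_le_one))
  have hL0 : 0 < L := by positivity
  have hApos : 0 < A := by positivity
  have hyd : ∀ t ∈ Set.Ico 0 T, HasDerivAt y (-w * Q.eval (z t) * y t) t := by
    intro t ht
    obtain ⟨h1, h2⟩ := hz t ht
    have h3 : z t - p ≠ 0 := sub_ne_zero.2 h1
    refine ((h2.sub_const p).inv h3).congr_deriv ?_
    simp only [Polynomial.eval_mul, Polynomial.eval_sub, Polynomial.eval_X, Polynomial.eval_C, y]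
    field_simp
  have hbound : ∀ t ∈ Set.Ico 0 T, ‖y t‖ ≤ A * Real.exp (L * t) := by
    intro t ht
    have hsub : ∀ x ∈ Set.Icc 0 t, x ∈ Set.Ico 0 T := fun x hx => ⟨hx.1, hx.2.trans_lt ht.2⟩
    refine image_norm_le_of_norm_deriv_right_lt_deriv_boundary (f := y) (a := 0) (b := t)
      (f' := fun t => -w * Q.eval (z t) * y t) (B := fun t => A * Real.exp (L * t))
      (B' := fun t => A * (Real.exp (L * t) * L))
      (fun x hx => (hyd x (hsub x hx)).continuousAt.continuousWithinAt)
      (fun x hx => (hyd x (hsub x ⟨hx.1, hx.2.le⟩)).hasDerivWithinAt) (by simp [hA])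
      (fun x => by
        simpa using (((hasDerivAt_id x).const_mul L).exp.const_mul A)) ?_ ⟨ht.1, le_rfl⟩
    intro x hx hxe
    have hexp : 1 ≤ Real.exp (L * x) := Real.one_le_exp (mul_nonneg hL0.le hx.1)
    have hy2 : 2 ≤ ‖y x‖ := by rw [hxe]; nlinarith [norm_nonneg (y 0)]
    have hQ : ‖Q.eval (z x)‖ ≤ C := by
      refine hC _ ?_
      rw [mem_closedBall_iff_norm]
      have h4 : ‖z x - p‖ = ‖y x‖⁻¹ := by simp [y]
      rw [h4]
      exact inv_le_one_of_one_le₀ (by linarith)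
    calc ‖-w * Q.eval (z x) * y x‖ = ‖w‖ * ‖Q.eval (z x)‖ * ‖y x‖ := by simp
      _ ≤ ‖w‖ * C * ‖y x‖ := by gcongr
      _ < L * ‖y x‖ := by
        have : 0 < ‖y x‖ := by linarith
        rw [hL]; nlinarith
      _ = A * (Real.exp (L * x) * L) := by rw [hxe]; ring
  refine ⟨(A * Real.exp (L * T))⁻¹, by positivity, fun t ht => ?_⟩
  have h1 := hbound t ht
  have h2 : ‖z t - p‖ = ‖y t‖⁻¹ := by simp [y]
  have h3 : 0 < ‖y t‖ := norm_pos_iff.2 (inv_ne_zero (sub_ne_zero.2 (hz t ht).1))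
  rw [h2]
  refine inv_anti₀ h3 (h1.trans ?_)
  gcongr
  exact ht.2.le

theorem hasDerivAt_flow_ray {P : Polynomial ℂ} {z w : ℂ} {s : ℝ}
    (h : (s : ℂ) * w ∈ flowDom P z) :
    HasDerivAt (fun s : ℝ => flow P z (s * w)) (w * P.eval (flow P z (s * w))) s := by
  have h1 : HasDerivAt (fun s : ℝ => (s : ℂ) * w) w s := by
    simpa using (Complex.ofRealCLM.hasDerivAt (x := s)).mul_const w
  have h2 := (isChart_flow _ h).2.scomp s h1
  simpa [Function.comp_def] using h2

/-- A straight trajectory that cannot be prolonged tends to `∞`. -/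
theorem exists_blowup {P : Polynomial ℂ} {z w : ℂ} (hz : P.eval z ≠ 0) (hw : w ∉ flowDom P z) :
    ∃ t : ℝ, 0 < t ∧ t ≤ 1 ∧ (∀ s ∈ Set.Ico 0 t, (s : ℂ) * w ∈ flowDom P z) ∧
      Tendsto (fun s : ℝ => flow P z (s * w)) (𝓝[<] t) (Bornology.cobounded ℂ) := by
  have hcl : IsClosed {s : ℝ | (s : ℂ) * w ∉ flowDom P z} :=
    (isOpen_flowDom.preimage (f := fun s : ℝ => (s : ℂ) * w) (by fun_prop)).isClosed_compl
  obtain ⟨t, ⟨⟨ht0, ht1⟩, htw⟩, hmin⟩ := (isCompact_Icc.inter_right hcl).exists_isLeast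
    (⟨1, by simpa using hw⟩ : (Set.Icc (0 : ℝ) 1 ∩ {s : ℝ | (s : ℂ) * w ∉ flowDom P z}).Nonempty)
  have htpos : 0 < t := by
    refine ht0.lt_of_ne fun h => htw ?_
    subst h
    simpa using zero_mem_flowDom hz
  have hdom : ∀ s ∈ Set.Ico 0 t, (s : ℂ) * w ∈ flowDom P z := by
    intro s hs
    by_contra hns
    exact absurd (hmin ⟨⟨hs.1, hs.2.le.trans ht1⟩, hns⟩) (not_le.2 hs.2)
  refine ⟨t, htpos, ht1, hdom, ?_⟩
  by_contra hnt
  rw [Filter.not_tendsto_iff_exists_frequently_notMem] at hnt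
  obtain ⟨S, hS, hfreq⟩ := hnt
  have hSb : Bornology.IsBounded Sᶜ := by
    rwa [← Bornology.isCobounded_compl_iff, compl_compl]
  have hP0 : P ≠ 0 := by rintro rfl; simp at hz
  have hnear : ∀ p : ℂ, ∃ δ > 0, P.eval p = 0 →
      ∀ s ∈ Set.Ico 0 t, δ ≤ ‖flow P z (s * w) - p‖ := by
    intro p
    by_cases hp : P.eval p = 0
    · obtain ⟨δ, hδ, h⟩ := exists_dist_root_le (w := w) (z := fun s : ℝ => flow P z (s * w)) hp
        (T := t) fun s hs => ⟨fun h => (isChart_flow _ (hdom s hs)).1 (by rw [h, hp]),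
          hasDerivAt_flow_ray (hdom s hs)⟩
      exact ⟨δ, hδ, fun _ => h⟩
    · exact ⟨1, one_pos, fun h => absurd h hp⟩
  choose δ hδ hnear using hnear
  -- If the trajectory does not tend to `∞`, it returns again and again to this compact set, which
  -- avoids the roots of `P` because the trajectory does.
  set K : Set ℂ := closure Sᶜ ∩ ⋂ p ∈ P.roots.toFinset, {x | δ p ≤ ‖x - p‖} with hK
  have hKc : IsCompact K := by
    refine hSb.isCompact_closure.inter_right ?_
    refine isClosed_biInter fun p _ => ?_
    exact isClosed_le continuous_const (by fun_prop)
  have hIco : ∀ᶠ s : ℝ in 𝓝[<] t, s ∈ Set.Ico 0 t := by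
    filter_upwards [Ioo_mem_nhdsLT htpos] with s hs using ⟨hs.1.le, hs.2⟩
  have hfreqK : ∃ᶠ s : ℝ in 𝓝[<] t, flow P z (s * w) ∈ K := by
    refine (hfreq.and_eventually hIco).mono fun s hs => ⟨subset_closure hs.1, ?_⟩
    simp only [Set.mem_iInter, Set.mem_ofPred_eq]
    intro p hp
    refine hnear p ?_ s hs.2
    simpa [hP0] using hp
  obtain ⟨x, hxK, hx⟩ := hKc.exists_mapClusterPt_of_frequently hfreqK
  have hPx : P.eval x ≠ 0 := by
    intro h0
    have h1 : δ x ≤ ‖x - x‖ := by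
      have := hxK.2
      simp only [Set.mem_iInter, Set.mem_ofPred_eq] at this
      exact this x (by simpa [hP0] using h0)
    simp at h1
    exact absurd (hδ x) (not_lt.2 h1)
  -- Near the cluster point the charts have a fixed size `r`. At a late time of return the remaining
  -- displacement is shorter than `r`, so the trajectory extends through time `t` after all.
  obtain ⟨r, hr, hunif⟩ := exists_uniform_chart P hPx
  have hclose : ∀ᶠ s : ℝ in 𝓝[<] t, ‖(t : ℂ) * w - s * w‖ < r := by
    have hc : Tendsto (fun s : ℝ => ‖(t : ℂ) * w - s * w‖) (𝓝[<] t) (𝓝 ‖(t : ℂ) * w - t * w‖) :=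
      (Continuous.tendsto (by fun_prop) t).mono_left nhdsWithin_le_nhds
    rw [sub_self, norm_zero] at hc
    exact hc.eventually (gt_mem_nhds hr)
  obtain ⟨s, hs1, hs2, hs3⟩ := ((hx.frequently hunif).and_eventually
    (hclose.and (Ioo_mem_nhdsLT htpos))).exists
  obtain ⟨G, hG, hGs⟩ := hs1 (s * w)
  refine htw (mem_flowDom_of_ball (hdom s ⟨hs3.1.le, hs3.2⟩) ⟨t / s, ?_, ?_⟩ hs2 hG hGs)
  · rw [le_div_iff₀ hs3.1]; linarith [hs3.2]
  · have : (s : ℂ) ≠ 0 := by exact_mod_cast hs3.1.ne'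
    push_cast
    field_simp

/-! ### The coordinate at the zero, placed at infinity -/

/-- A continuous branch of `g ^ n = c` on a preconnected set is constant. -/
theorem eqOn_const_of_pow_eq {X : Type*} [TopologicalSpace X] {S : Set X} (hS : IsPreconnected S)
    {g : X → ℂ} (hg : ContinuousOn g S) {n : ℕ} (hn : n ≠ 0) {c : ℂ}
    (hc : ∀ x ∈ S, g x ^ n = c) {x y : X} (hx : x ∈ S) (hy : y ∈ S) : g x = g y := by
  have hfin : {z : ℂ | z ^ n = c}.Finite := by
    have h0 : (Polynomial.X ^ n - Polynomial.C c : Polynomial ℂ) ≠ 0 :=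
      Polynomial.X_pow_sub_C_ne_zero (Nat.pos_of_ne_zero hn) c
    refine (Polynomial.finite_setOfPred_isRoot h0).subset fun z hz => ?_
    simpa [Polynomial.IsRoot, sub_eq_zero] using hz
  exact hS.constant_of_mapsTo hfin.isDiscrete hg hc hx hy

/-- A coordinate `ζ` at `∞` in which `dz / P = d(ζ ^ (m + 1))`, with inverse `Y`. -/
structure InfCoord (P : Polynomial ℂ) (m : ℕ) where
  Y : ℂ → ℂ
  Z : ℂ → ℂ
  r : ℝ
  R : ℝ
  κ : ℂ
  r_pos : 0 < r
  κ_ne : κ ≠ 0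
  deriv_Y : ∀ ζ, ζ ≠ 0 → ‖ζ‖ < r →
    P.eval (Y ζ) ≠ 0 ∧ HasDerivAt Y ((m + 1) * ζ ^ m * P.eval (Y ζ)) ζ
  inj_Y : ∀ ζ ζ', ζ ≠ 0 → ζ' ≠ 0 → ‖ζ‖ < r → ‖ζ'‖ < r → Y ζ = Y ζ' → ζ = ζ'
  tendsto_Y : Tendsto (fun ζ => (Y ζ)⁻¹ / ζ) (𝓝[≠] 0) (𝓝 κ)
  Z_spec : ∀ z, R < ‖z‖ → Z z ≠ 0 ∧ ‖Z z‖ < r ∧ Y (Z z) = z ∧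
    HasDerivAt Z ((m + 1) * Z z ^ m * P.eval z)⁻¹ z
  tendsto_Z : Tendsto Z (Bornology.cobounded ℂ) (𝓝 0)

theorem eval_inv_eq_reverse (P : Polynomial ℂ) {u : ℂ} (hu : u ≠ 0) :
    P.reverse.eval u = u ^ P.natDegree * P.eval u⁻¹ := by
  let _ : Invertible u⁻¹ := invertibleOfNonzero (inv_ne_zero hu)
  have h := Polynomial.eval₂_reverse_mul_pow (RingHom.id ℂ) u⁻¹ P
  rw [invOf_eq_inv, inv_inv] at h
  simp only [Polynomial.eval₂_id] at h
  rw [← h, inv_pow]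
  field_simp

/-- The function `ζ` in a neighbourhood of `u = 1/z = 0`. -/
theorem exists_root_primitive {S : ℂ → ℂ} (hS : AnalyticAt ℂ S 0) (hS0 : S 0 ≠ 0) (m : ℕ) :
    ∃ e : OpenPartialHomeomorph ℂ ℂ, (0 : ℂ) ∈ e.source ∧ e 0 = 0 ∧
      (∃ κ ≠ 0, HasDerivAt e κ 0) ∧
      ∀ u ∈ e.source, u ≠ 0 → S u ≠ 0 ∧ e u ≠ 0 ∧
        HasDerivAt e (-u ^ m / (S u * ((m + 1) * e u ^ m))) u := by
  have hq : AnalyticAt ℂ (fun u => -u ^ m / S u) 0 := by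
    exact (analyticAt_id.pow m).neg.div hS hS0
  obtain ⟨ρ, hρ, hball⟩ := Metric.eventually_nhds_iff_ball.1
    (hq.eventually_analyticAt.and (hS.continuousAt.eventually_ne hS0))
  obtain ⟨H₀, hH₀⟩ := DifferentiableOn.isExactOn_ball (c := (0 : ℂ)) (r := ρ)
    (f := fun u => -u ^ m / S u)
    (fun u hu => (hball u hu).1.differentiableAt.differentiableWithinAt)
  -- In `u = 1/z` the differential is `-u^m / S(u) du` with `S` the reversed polynomial. Its
  -- primitive vanishing at `0` has a zero of order exactly `m + 1`, and `ζ` is to be an `(m+1)`-st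
  -- root of it.
  set H : ℂ → ℂ := fun u => H₀ u - H₀ 0 with hH
  have hHd : ∀ u ∈ Metric.ball (0 : ℂ) ρ, HasDerivAt H (-u ^ m / S u) u := fun u hu =>
    (hH₀ u hu).sub_const _
  have h0 : (0 : ℂ) ∈ Metric.ball (0 : ℂ) ρ := Metric.mem_ball_self hρ
  have hHan : AnalyticAt ℂ H 0 :=
    DifferentiableOn.analyticAt (s := Metric.ball (0 : ℂ) ρ)
      (fun u hu => (hHd u hu).differentiableAt.differentiableWithinAt)
      (Metric.isOpen_ball.mem_nhds h0)
  have hder : deriv H =ᶠ[𝓝 0] fun u => u ^ m • (-(S u)⁻¹) := by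
    filter_upwards [Metric.isOpen_ball.mem_nhds h0] with u hu
    rw [(hHd u hu).deriv]
    simp [div_eq_mul_inv]
  have hord : analyticOrderAt (deriv H) 0 = m := by
    rw [(hHan.deriv).analyticOrderAt_eq_natCast]
    refine ⟨fun u => -(S u)⁻¹, (hS.inv hS0).neg, by simpa using hS0, ?_⟩
    filter_upwards [hder] with u hu
    simpa using hu
  have hH0 : H 0 = 0 := by simp [hH]
  have hord' : analyticOrderAt H 0 = (m + 1 : ℕ) := by
    have := hHan.analyticOrderAt_deriv_add_one
    rw [hord, hH0] at this
    simpa using this.symm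
  obtain ⟨a, ha, ha0, haH⟩ := (hHan.analyticOrderAt_eq_natCast).1 hord'
  obtain ⟨κ, hκ⟩ := IsAlgClosed.exists_pow_nat_eq (a 0) (Nat.succ_pos m)
  have hκ0 : κ ≠ 0 := by
    rintro rfl
    exact ha0 (by rw [← hκ]; simp)
  -- Normalizing to `b 0 = 1` makes the principal `(m+1)`-st root analytic near `0`; the factor `κ`
  -- supplies a root of `a 0`.
  set b : ℂ → ℂ := fun u => a u / a 0
  have hb : AnalyticAt ℂ b 0 := ha.div_const
  have hb0 : b 0 = 1 := div_self ha0
  set c : ℂ → ℂ := fun u => b u ^ ((m + 1 : ℂ)⁻¹) with hc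
  have hcan : AnalyticAt ℂ c 0 :=
    hb.cpow analyticAt_const (by rw [hb0]; exact Complex.one_mem_slitPlane)
  have hc0 : c 0 = 1 := by simp [hc, hb0]
  have hm1 : (m + 1 : ℂ) ≠ 0 := by exact_mod_cast Nat.succ_ne_zero m
  have hcpow : ∀ u, c u ^ (m + 1) = b u := by
    intro u
    have := Complex.cpow_nat_inv_pow (b u) (Nat.succ_ne_zero m)
    simpa [hc] using this
  set f : ℂ → ℂ := fun u => κ * u * c u with hf
  have hfan : AnalyticAt ℂ f 0 := (analyticAt_const.mul analyticAt_id).mul hcan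
  have hfd : HasDerivAt f κ 0 := by
    have := (((hasDerivAt_id (0 : ℂ)).const_mul κ).mul hcan.differentiableAt.hasDerivAt)
    refine this.congr_deriv ?_
    simp [hc0]
  have hfpow : ∀ᶠ u in 𝓝 (0 : ℂ), f u ^ (m + 1) = H u := by
    filter_upwards [haH] with u hu
    rw [hu, hf]
    simp only [mul_pow, hcpow, hκ, sub_zero, smul_eq_mul]
    simp only [b]
    field_simp
  have hgood : ∀ᶠ u in 𝓝 (0 : ℂ), AnalyticAt ℂ f u ∧ f u ^ (m + 1) = H u ∧ a u ≠ 0 ∧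
      u ∈ Metric.ball (0 : ℂ) ρ :=
    hfan.eventually_analyticAt.and (hfpow.and ((ha.continuousAt.eventually_ne ha0).and
      (Metric.isOpen_ball.mem_nhds h0)))
  obtain ⟨ρ', hρ', hball'⟩ := Metric.eventually_nhds_iff_ball.1 hgood
  have hstrict : HasStrictDerivAt f κ 0 := by
    have := hfan.hasStrictDerivAt
    rwa [hfd.deriv] at this
  have hs := hstrict.hasStrictFDerivAt_equiv hκ0
  refine ⟨(hs.toOpenPartialHomeomorph f).restrOpen (Metric.ball 0 ρ') Metric.isOpen_ball,
    ⟨hs.mem_toOpenPartialHomeomorph_source, Metric.mem_ball_self hρ'⟩, by simp [hf],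
    ⟨κ, hκ0, hfd⟩, ?_⟩
  rintro u ⟨-, hu⟩ hu0
  obtain ⟨h1, h2, h3, h4⟩ := hball' u hu
  change S u ≠ 0 ∧ f u ≠ 0 ∧ HasDerivAt f (-u ^ m / (S u * ((m + 1) * f u ^ m))) u
  have hcu : c u ≠ 0 := by
    intro h
    have := hcpow u
    rw [h, zero_pow (Nat.succ_ne_zero m)] at this
    exact (div_ne_zero h3 ha0) this.symm
  have hfu : f u ≠ 0 := mul_ne_zero (mul_ne_zero hκ0 hu0) hcu
  have hSu := (hball u h4).2
  refine ⟨hSu, hfu, ?_⟩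
  have hd := h1.differentiableAt.hasDerivAt
  have hd1 : HasDerivAt (fun u => f u ^ (m + 1)) (-u ^ m / S u) u := by
    refine (hHd u h4).congr_of_eventuallyEq ?_
    filter_upwards [Metric.isOpen_ball.mem_nhds hu] with x hx using (hball' x hx).2.1
  have hd2 := (hd.pow (m + 1)).unique hd1
  refine hd.congr_deriv ?_
  rw [eq_div_iff (mul_ne_zero hSu (mul_ne_zero hm1 (pow_ne_zero _ hfu)))]
  field_simp at hd2
  simp only [Nat.add_sub_cancel] at hd2
  push_cast at hd2
  linear_combination hd2

/-- The constant coefficient of the reversed polynomial is the leading coefficient of `P`, hence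
nonzero, so the root primitive exists in `u = 1/z`. `Z` is this root as a function of `z`, and `Y`
is its inverse. -/
theorem exists_infCoord (P : Polynomial ℂ) {m : ℕ} (hP : P.natDegree = m + 2) :
    Nonempty (InfCoord P m) := by
  have hP0 : P ≠ 0 := by rintro rfl; simp at hP
  have hS0 : P.reverse.eval 0 ≠ 0 := by
    rw [← Polynomial.coeff_zero_eq_eval_zero, Polynomial.coeff_zero_reverse]
    exact Polynomial.leadingCoeff_ne_zero.2 hP0
  obtain ⟨e, h0, he0, ⟨κ, hκ, hκd⟩, he⟩ := exists_root_primitive (S := fun u => P.reverse.eval u)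
    (P.reverse.differentiable.analyticAt 0) hS0 m
  have ht0 : (0 : ℂ) ∈ e.target := by
    have := e.map_source h0
    rwa [he0] at this
  have hs0 : e.symm 0 = 0 := by
    have := e.left_inv h0
    rwa [he0] at this
  obtain ⟨r, hr, hrb⟩ := Metric.isOpen_iff.1 e.open_target 0 ht0
  have hrev : ∀ u : ℂ, u ≠ 0 → P.reverse.eval u = u ^ (m + 2) * P.eval u⁻¹ := fun u hu => by
    rw [eval_inv_eq_reverse P hu, hP]
  have hm1 : (m + 1 : ℂ) ≠ 0 := by exact_mod_cast Nat.succ_ne_zero m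
  have hsymm_ne : ∀ ζ ∈ e.target, ζ ≠ 0 → e.symm ζ ≠ 0 := by
    intro ζ hζ hζ0 h
    apply hζ0
    rw [← e.right_inv hζ, h, he0]
  have hev : ∀ᶠ u in 𝓝 (0 : ℂ), u ∈ e.source ∧ ‖e u‖ < r := by
    refine (show ∀ᶠ u in 𝓝 (0 : ℂ), u ∈ e.source from e.open_source.mem_nhds h0).and ?_
    have : Tendsto (fun u => ‖e u‖) (𝓝 0) (𝓝 0) := by
      simpa [he0] using hκd.continuousAt.norm.tendsto
    exact this.eventually (gt_mem_nhds hr)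
  obtain ⟨η, hη, hηb⟩ := Metric.eventually_nhds_iff_ball.1 hev
  refine ⟨{ Y := fun ζ => (e.symm ζ)⁻¹, Z := fun z => e z⁻¹, r := r, R := η⁻¹, κ := κ⁻¹,
            r_pos := hr, κ_ne := inv_ne_zero hκ, deriv_Y := ?_, inj_Y := ?_, tendsto_Y := ?_,
            Z_spec := ?_, tendsto_Z := ?_ }⟩
  · intro ζ hζ hζr
    have ht : ζ ∈ e.target := hrb (by simpa using hζr)
    have hu := hsymm_ne ζ ht hζ
    obtain ⟨h1, h2, h3⟩ := he _ (e.map_target ht) hu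
    rw [e.right_inv ht] at h3
    rw [hrev _ hu] at h1 h3
    have hPe : P.eval (e.symm ζ)⁻¹ ≠ 0 := right_ne_zero_of_mul h1
    refine ⟨hPe, ?_⟩
    have hne : -(e.symm ζ) ^ m /
        (((e.symm ζ) ^ (m + 2) * P.eval (e.symm ζ)⁻¹) * ((m + 1) * ζ ^ m)) ≠ 0 :=
      div_ne_zero (neg_ne_zero.2 (pow_ne_zero _ hu))
        (mul_ne_zero h1 (mul_ne_zero hm1 (pow_ne_zero _ hζ)))
    have h4 := (e.hasDerivAt_symm ht hne h3).inv hu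
    refine h4.congr_deriv ?_
    field_simp
    ring
  · intro ζ ζ' h1 h2 h3 h4 h5
    have t1 : ζ ∈ e.target := hrb (by simpa using h3)
    have t2 : ζ' ∈ e.target := hrb (by simpa using h4)
    exact e.symm.injOn t1 t2 (inv_injective h5)
  · have h1 : HasDerivAt e.symm κ⁻¹ 0 := by
      refine e.hasDerivAt_symm ht0 hκ ?_
      rwa [hs0]
    have h2 := h1.tendsto_slope
    refine h2.congr fun ζ => ?_
    simp [slope_def_field, hs0]
  · intro z hz
    have hz0 : z ≠ 0 := by
      rintro rfl
      simp at hz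
      linarith [hη]
    have hzn : 0 < ‖z‖ := norm_pos_iff.2 hz0
    have hu : z⁻¹ ∈ Metric.ball (0 : ℂ) η := by
      rw [mem_ball_zero_iff, norm_inv]
      exact inv_lt_of_inv_lt₀ hη hz
    obtain ⟨h1, h2⟩ := hηb _ hu
    obtain ⟨h3, h4, h5⟩ := he _ h1 (inv_ne_zero hz0)
    refine ⟨h4, h2, by simp [e.left_inv h1], ?_⟩
    refine (h5.comp z (hasDerivAt_inv hz0)).congr_deriv ?_
    rw [hrev _ (inv_ne_zero hz0), inv_inv]
    rw [hrev _ (inv_ne_zero hz0), inv_inv] at h3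
    have hPz : P.eval z ≠ 0 := right_ne_zero_of_mul h3
    rw [pow_add, inv_pow, inv_pow]
    field_simp
  · have h1 : Tendsto e (𝓝 0) (𝓝 0) := by simpa [he0] using hκd.continuousAt.tendsto
    exact h1.comp tendsto_inv₀_cobounded

namespace InfCoord

variable {P : Polynomial ℂ} {m : ℕ}

/-- Rotating the coordinate by an `(m + 1)`-st root of unity. -/
noncomputable def rotate (D : InfCoord P m) (τ : ℂ) (hτ : τ ^ (m + 1) = 1) : InfCoord P m where
  Y ζ := D.Y (τ * ζ)
  Z z := τ⁻¹ * D.Z z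
  r := D.r
  R := D.R
  κ := D.κ * τ
  r_pos := D.r_pos
  κ_ne := mul_ne_zero D.κ_ne (by rintro rfl; simp at hτ)
  deriv_Y ζ hζ hr := by
    have hτ0 : τ ≠ 0 := by rintro rfl; simp at hτ
    have hn : ‖τ‖ = 1 := Complex.norm_eq_one_of_pow_eq_one hτ (Nat.succ_ne_zero m)
    obtain ⟨h1, h2⟩ := D.deriv_Y (τ * ζ) (mul_ne_zero hτ0 hζ) (by simpa [hn] using hr)
    refine ⟨h1, (h2.comp ζ ((hasDerivAt_id ζ).const_mul τ)).congr_deriv ?_⟩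
    rw [mul_pow]
    linear_combination ((m + 1) * ζ ^ m * P.eval (D.Y (τ * ζ))) * hτ
  inj_Y ζ ζ' h1 h2 h3 h4 h := by
    have hτ0 : τ ≠ 0 := by rintro rfl; simp at hτ
    have hn : ‖τ‖ = 1 := Complex.norm_eq_one_of_pow_eq_one hτ (Nat.succ_ne_zero m)
    exact mul_left_cancel₀ hτ0 (D.inj_Y _ _ (mul_ne_zero hτ0 h1) (mul_ne_zero hτ0 h2)
      (by simpa [hn] using h3) (by simpa [hn] using h4) h)
  tendsto_Y := by
    have hτ0 : τ ≠ 0 := by rintro rfl; simp at hτ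
    have h1 : Tendsto (fun ζ => τ * ζ) (𝓝[≠] 0) (𝓝[≠] 0) := by
      refine tendsto_nhdsWithin_iff.2 ⟨?_, ?_⟩
      · exact ((continuous_const_mul τ).tendsto' 0 0 (by simp)).mono_left nhdsWithin_le_nhds
      · filter_upwards [self_mem_nhdsWithin] with ζ hζ using mul_ne_zero hτ0 hζ
    refine ((D.tendsto_Y.comp h1).mul_const τ).congr fun ζ => ?_
    simp only [Function.comp]
    field_simp
  Z_spec z hz := by
    have hτ0 : τ ≠ 0 := by rintro rfl; simp at hτ
    have hn : ‖τ‖ = 1 := Complex.norm_eq_one_of_pow_eq_one hτ (Nat.succ_ne_zero m)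
    obtain ⟨h1, h2, h3, h4⟩ := D.Z_spec z hz
    refine ⟨mul_ne_zero (inv_ne_zero hτ0) h1, by simpa [hn] using h2,
      by rw [mul_inv_cancel_left₀ hτ0, h3], (h4.const_mul τ⁻¹).congr_deriv ?_⟩
    rw [mul_pow, inv_pow, ← mul_inv]
    congr 1
    have : τ ^ m ≠ 0 := pow_ne_zero _ hτ0
    field_simp
    linear_combination (P.eval z) * hτ
  tendsto_Z := by simpa using D.tendsto_Z.const_mul τ⁻¹

/-- A trajectory running into `∞` is, near its end, a straight segment in the coordinate `ζ`. -/
theorem exists_end (D : InfCoord P m) {z : ℝ → ℂ} {v : ℂ} {a b : ℝ} (hab : a < b)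
    (hz : ∀ t ∈ Set.Ioo a b, HasDerivAt z (v * P.eval (z t)) t)
    (hP : ∀ t ∈ Set.Ioo a b, P.eval (z t) ≠ 0)
    (hinf : Tendsto z (𝓝[<] b) (Bornology.cobounded ℂ)) :
    ∃ ξ : ℂ, ξ ^ (m + 1) = -v ∧
      ∀ᶠ t in 𝓝[<] b, z t = D.Y (ξ * (((b - t) ^ ((m + 1 : ℝ)⁻¹) : ℝ) : ℂ)) ∧
        ‖ξ * (((b - t) ^ ((m + 1 : ℝ)⁻¹) : ℝ) : ℂ)‖ < D.r := by
  have hm1 : (m + 1 : ℂ) ≠ 0 := by exact_mod_cast Nat.succ_ne_zero m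
  have hbig : ∀ᶠ t in 𝓝[<] b, D.R < ‖z t‖ :=
    (tendsto_norm_cobounded_atTop.comp hinf).eventually_gt_atTop D.R
  obtain ⟨c, hcb, hc⟩ := (mem_nhdsLT_iff_exists_Ioo_subset' hab).1
    (hbig.and (Ioo_mem_nhdsLT hab))
  have hcb : c < b := hcb
  -- Since `ζ^(m+1)` is a flat coordinate, `ζ^(m+1) - v t` is constant along the trajectory. The
  -- limit `ζ → 0` at `b` gives its value, hence `ζ^(m+1) = -v (b - t)`.
  set ζ : ℝ → ℂ := fun t => D.Z (z t) with hζ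
  have hζd : ∀ t ∈ Set.Ioo c b, HasDerivAt ζ (v / ((m + 1) * ζ t ^ m)) t := by
    intro t ht
    obtain ⟨h1, h2⟩ := hc ht
    obtain ⟨h3, -, -, h6⟩ := D.Z_spec _ h1
    refine (h6.scomp t (hz t h2)).congr_deriv ?_
    have := hP t h2
    simp only [smul_eq_mul, hζ]
    field_simp
  have hne : ∀ t ∈ Set.Ioo c b, ζ t ≠ 0 := fun t ht => (D.Z_spec _ (hc ht).1).1
  have hpow : ∀ t ∈ Set.Ioo c b, HasDerivAt (fun t : ℝ => ζ t ^ (m + 1) - v * t) 0 t := by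
    intro t ht
    have h1 := (hζd t ht).pow (m + 1)
    have h2 : HasDerivAt (fun t : ℝ => v * (t : ℂ)) v t := by
      simpa using (Complex.ofRealCLM.hasDerivAt (x := t)).const_mul v
    refine (h1.sub h2).congr_deriv ?_
    have := hne t ht
    push_cast
    field_simp
    simp
  have hlim : Tendsto ζ (𝓝[<] b) (𝓝 0) := D.tendsto_Z.comp hinf
  have hconst : ∀ t ∈ Set.Ioo c b, ζ t ^ (m + 1) - v * t = -(v * b) := by
    intro t ht
    have hcon : ∀ s ∈ Set.Ioo c b, ζ s ^ (m + 1) - v * s = ζ t ^ (m + 1) - v * t := fun s hs =>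
      isOpen_Ioo.is_const_of_deriv_eq_zero isPreconnected_Ioo
        (fun x hx => (hpow x hx).differentiableAt.differentiableWithinAt)
        (fun x hx => (hpow x hx).deriv) hs ht
    have h1 : Tendsto (fun s : ℝ => ζ s ^ (m + 1) - v * s) (𝓝[<] b) (𝓝 (0 ^ (m + 1) - v * b)) := by
      refine (hlim.pow (m + 1)).sub (Tendsto.const_mul v ?_)
      exact (Complex.continuous_ofReal.tendsto b).mono_left nhdsWithin_le_nhds
    have h2 : Tendsto (fun s : ℝ => ζ s ^ (m + 1) - v * s) (𝓝[<] b)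
        (𝓝 (ζ t ^ (m + 1) - v * t)) := by
      refine tendsto_const_nhds.congr' ?_
      filter_upwards [Ioo_mem_nhdsLT hcb] with s hs using (hcon s hs).symm
    rw [tendsto_nhds_unique h2 h1]
    simp
  have hroot : ∀ t : ℝ, t < b → (((b - t) ^ ((m + 1 : ℝ)⁻¹) : ℝ) : ℂ) ^ (m + 1) = ((b - t : ℝ) : ℂ) := by
    intro t ht
    rw [← Complex.ofReal_pow]
    congr 1
    have := Real.rpow_inv_natCast_pow (sub_nonneg.2 ht.le) (Nat.succ_ne_zero m)
    simpa using this
  have hpos : ∀ t : ℝ, t < b → (((b - t) ^ ((m + 1 : ℝ)⁻¹) : ℝ) : ℂ) ≠ 0 := by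
    intro t ht
    exact_mod_cast (Real.rpow_pos_of_pos (sub_pos.2 ht) _).ne'
  -- The quotient of `ζ` by the real root of `b - t` is continuous with constant `(m+1)`-st power
  -- `-v`, so it is constant: this is the direction `ξ`.
  set g : ℝ → ℂ := fun t => ζ t / (((b - t) ^ ((m + 1 : ℝ)⁻¹) : ℝ) : ℂ) with hg
  have hgc : ContinuousOn g (Set.Ioo c b) := by
    refine ContinuousOn.div (fun t ht => (hζd t ht).continuousAt.continuousWithinAt) ?_
      (fun t ht => hpos t ht.2)
    refine Complex.continuous_ofReal.comp_continuousOn ?_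
    refine ContinuousOn.rpow_const (by fun_prop) fun t ht => Or.inl (sub_ne_zero.2 ht.2.ne')
  have hgp : ∀ t ∈ Set.Ioo c b, g t ^ (m + 1) = -v := by
    intro t ht
    have h1 : ((b - t : ℝ) : ℂ) ≠ 0 := by exact_mod_cast (sub_pos.2 ht.2).ne'
    rw [hg]
    simp only [div_pow]
    rw [hroot t ht.2, div_eq_iff h1]
    push_cast
    linear_combination hconst t ht
  have hmid : (c + b) / 2 ∈ Set.Ioo c b := ⟨by linarith, by linarith⟩
  refine ⟨g ((c + b) / 2), hgp _ hmid, ?_⟩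
  filter_upwards [Ioo_mem_nhdsLT hcb] with t ht
  rw [eqOn_const_of_pow_eq isPreconnected_Ioo hgc (Nat.succ_ne_zero m) hgp hmid ht]
  have h1 : g t * (((b - t) ^ ((m + 1 : ℝ)⁻¹) : ℝ) : ℂ) = ζ t := by
    rw [hg]
    exact div_mul_cancel₀ _ (hpos t ht.2)
  obtain ⟨-, h4, h5, -⟩ := D.Z_spec _ (hc ht).1
  rw [h1]
  exact ⟨h5.symm, h4⟩

/-- A trajectory coming from `∞` is, near its start, a straight segment in the coordinate `ζ`. -/
theorem exists_start (D : InfCoord P m) {z : ℝ → ℂ} {v : ℂ} {a b : ℝ} (hab : a < b)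
    (hz : ∀ t ∈ Set.Ioo a b, HasDerivAt z (v * P.eval (z t)) t)
    (hP : ∀ t ∈ Set.Ioo a b, P.eval (z t) ≠ 0)
    (hinf : Tendsto z (𝓝[>] a) (Bornology.cobounded ℂ)) :
    ∃ ξ : ℂ, ξ ^ (m + 1) = v ∧
      ∀ᶠ t in 𝓝[>] a, z t = D.Y (ξ * (((t - a) ^ ((m + 1 : ℝ)⁻¹) : ℝ) : ℂ)) ∧
        ‖ξ * (((t - a) ^ ((m + 1 : ℝ)⁻¹) : ℝ) : ℂ)‖ < D.r := by
  have hneg : Tendsto (fun t : ℝ => -t) (𝓝[>] a) (𝓝[<] (-a)) := tendsto_neg_nhdsGT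
  have hneg' : Tendsto (fun t : ℝ => -t) (𝓝[<] (-a)) (𝓝[>] a) := tendsto_neg_nhdsLT_neg
  -- Reversing time turns a start into an end and `v` into `-v`.
  obtain ⟨ξ, hξ, hev⟩ := D.exists_end (z := fun t => z (-t)) (v := -v) (a := -b) (b := -a)
    (by linarith) (fun t ht => by
      have h1 : -t ∈ Set.Ioo a b := ⟨by linarith [ht.2], by linarith [ht.1]⟩
      refine ((hz _ h1).scomp t (hasDerivAt_neg t)).congr_deriv ?_
      simp) (fun t ht => hP _ ⟨by linarith [ht.2], by linarith [ht.1]⟩) (hinf.comp hneg')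
  refine ⟨ξ, by rw [hξ, neg_neg], ?_⟩
  filter_upwards [hneg.eventually hev] with t ht
  have : -a - -t = t - a := by ring
  rw [neg_neg, this] at ht
  exact ht

end InfCoord

/-- A thin neighbourhood of the segment is convex, so no connectedness of `U ∩ V` is needed to
continue the equality from `a` to `b`. -/
theorem IsChart.eq_of_segment {P : Polynomial ℂ} {U V : Set ℂ} {G₁ G₂ : ℂ → ℂ} (hU : IsOpen U)
    (hV : IsOpen V) (h₁ : IsChart P U G₁) (h₂ : IsChart P V G₂) {a b : ℂ}
    (hs₁ : segment ℝ a b ⊆ U) (hs₂ : segment ℝ a b ⊆ V) (he : G₁ a = G₂ a) : G₁ b = G₂ b := by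
  have hcomp : IsCompact (segment ℝ a b) := by
    rw [segment_eq_image]
    exact isCompact_Icc.image (by fun_prop)
  obtain ⟨δ, hδ, hsub⟩ := hcomp.exists_thickening_subset_open (hU.inter hV)
    (Set.subset_inter hs₁ hs₂)
  exact (h₁.mono (hsub.trans Set.inter_subset_left)).eqOn Metric.isOpen_thickening
    ((convex_segment _ _).thickening δ).isPreconnected
    (h₂.mono (hsub.trans Set.inter_subset_right))
    (Metric.self_subset_thickening hδ _ (left_mem_segment _ _ _)) he
    (Metric.self_subset_thickening hδ _ (right_mem_segment _ _ _))

/-- A chart on a star-shaped set is given by the straight trajectories from its centre. -/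
theorem IsChart.flow_eq_of_starConvex {P : Polynomial ℂ} {U : Set ℂ} {G : ℂ → ℂ} (hU : IsOpen U)
    (h : IsChart P U G) {a : ℂ} (hs : StarConvex ℝ a U) {x : ℂ} (hx : x ∈ U) :
    x - a ∈ flowDom P (G a) ∧ flow P (G a) (x - a) = G x := by
  have hseg := hs.segment_subset hx
  have hcomp : IsCompact (segment ℝ a x) := by
    rw [segment_eq_image]
    exact isCompact_Icc.image (by fun_prop)
  obtain ⟨δ, hδ, hsub⟩ := hcomp.exists_thickening_subset_open hU hseg
  have ha := Metric.self_subset_thickening hδ _ (left_mem_segment ℝ a x)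
  have hx' := Metric.self_subset_thickening hδ _ (right_mem_segment ℝ a x)
  set N := {w | w + a ∈ Metric.thickening δ (segment ℝ a x)} with hN
  have hNo : IsOpen N := Metric.isOpen_thickening.preimage (by fun_prop)
  have hNc : Convex ℝ N := by
    have := ((convex_segment (𝕜 := ℝ) a x).thickening δ).translate_preimage_right a
    simpa [hN, Set.preimage, add_comm] using this
  have hG : IsChart P N (fun w => G (w + a)) := (h.mono hsub).shift a
  have h0 : (0 : ℂ) ∈ N := by simpa [hN] using ha
  have hxN : x - a ∈ N := by simpa [hN] using hx'
  refine ⟨⟨N, _, hNo, hNc, h0, hxN, hG, by simp⟩, ?_⟩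
  rw [flow_eq hNo hNc h0 hG (by simp) hxN]
  simp

theorem starConvex_isPreconnected {S : Set ℂ} {a : ℂ} (h : StarConvex ℝ a S) :
    IsPreconnected S := by
  rcases S.eq_empty_or_nonempty with rfl | hne
  · exact isPreconnected_empty
  · exact (h.isPathConnected (h.mem hne)).isConnected.isPreconnected

/-! ### Flat models, horizontal directions and the cones at the zero -/

/-- The differential `dz / P` with zero `∞` of order `m`, the function `exp (2πi ∫ dz / P)`, and
the decomposition of `1 / P` into its residue terms and a derivative. -/
structure FlatModel (m : ℕ) where
  P : Polynomial ℂ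
  natDegree_P : P.natDegree = m + 2
  coord : InfCoord P m
  E : ℂ → ℂ
  E_ne : ∀ z, P.eval z ≠ 0 → E z ≠ 0
  deriv_E : ∀ z, P.eval z ≠ 0 → HasDerivAt E (2 * Real.pi * Complex.I * E z / P.eval z) z
  E_Y : ∀ ζ, ζ ≠ 0 → ‖ζ‖ < coord.r →
    E (coord.Y ζ) = Complex.exp (2 * Real.pi * Complex.I * ζ ^ (m + 1))
  q₀ : ℂ
  q₁ : ℂ
  q_ne : q₀ ≠ q₁
  P_q₀ : P.eval q₀ = 0
  P_q₁ : P.eval q₁ = 0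
  K : ℂ → ℂ
  deriv_K : ∀ z, P.eval z ≠ 0 →
    HasDerivAt K ((P.eval z)⁻¹ - (2 * Real.pi * Complex.I)⁻¹ * ((z - q₀)⁻¹ - (z - q₁)⁻¹)) z

/-- The sign `(-1) ^ n`. -/
noncomputable def sgn (n : ℕ) : ℝ := (-1) ^ n

theorem sgn_mul_self (n : ℕ) : sgn n * sgn n = 1 := by
  rw [sgn, ← mul_pow]; simp

theorem sgn_mul_self' (n : ℕ) : (sgn n : ℂ) * sgn n = 1 := by
  exact_mod_cast sgn_mul_self n

theorem sgn_ne_zero (n : ℕ) : sgn n ≠ 0 := left_ne_zero_of_mul_eq_one (sgn_mul_self n)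

theorem sgn_ne_zero' (n : ℕ) : (sgn n : ℂ) ≠ 0 := by exact_mod_cast sgn_ne_zero n

theorem sgn_succ (n : ℕ) : sgn (n + 1) = -sgn n := by simp [sgn, pow_succ]

theorem sgn_eq (n : ℕ) : sgn n = 1 ∨ sgn n = -1 := neg_one_pow_eq_or ℝ n

theorem norm_sgn (n : ℕ) : ‖(sgn n : ℂ)‖ = 1 := by
  rcases sgn_eq n with h | h <;> simp [h]

/-- The angle `π` of a half turn at the zero, as a rotation of the coordinate `ζ`. -/
noncomputable def omega (m : ℕ) : ℂ := Complex.exp (Real.pi * Complex.I / (m + 1))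

theorem omega_pow_succ (m : ℕ) : omega m ^ (m + 1) = -1 := by
  have hm1 : (m + 1 : ℂ) ≠ 0 := by exact_mod_cast Nat.succ_ne_zero m
  rw [omega, ← Complex.exp_nat_mul]
  push_cast
  rw [mul_div_cancel₀ _ hm1, Complex.exp_pi_mul_I]

theorem omega_pow_pow (m n : ℕ) : (omega m ^ n) ^ (m + 1) = sgn n := by
  rw [← pow_mul, mul_comm, pow_mul, omega_pow_succ, sgn]
  push_cast
  rfl

theorem norm_omega (m : ℕ) : ‖omega m‖ = 1 :=
  Complex.norm_eq_one_of_pow_eq_one (n := 2 * (m + 1))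
    (by rw [mul_comm, pow_mul, omega_pow_succ]; simp) (by simp)

theorem isPrimitiveRoot_omega (m : ℕ) : IsPrimitiveRoot (omega m) (2 * (m + 1)) := by
  have := Complex.isPrimitiveRoot_exp (2 * (m + 1)) (by simp)
  convert this using 1
  rw [omega]
  congr 1
  push_cast
  have hm1 : (m + 1 : ℂ) ≠ 0 := by exact_mod_cast Nat.succ_ne_zero m
  field_simp

/-- The horizontal directions are the `2(m+1)`-th roots of unity, and the parity of the exponent
records the orientation. -/
theorem exists_omega_pow (m : ℕ) {ξ : ℂ} {v : ℝ} (hv : v = 1 ∨ v = -1) (h : ξ ^ (m + 1) = v) :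
    ∃ n < 2 * (m + 1), ξ = omega m ^ n ∧ sgn n = v := by
  have h1 : ξ ^ (2 * (m + 1)) = 1 := by
    rw [mul_comm, pow_mul, h]
    rcases hv with rfl | rfl <;> simp
  have : NeZero (2 * (m + 1)) := ⟨by simp⟩
  obtain ⟨n, hn, rfl⟩ := (isPrimitiveRoot_omega m).eq_pow_of_pow_eq_one h1
  refine ⟨n, hn, rfl, ?_⟩
  rw [omega_pow_pow] at h
  exact_mod_cast h

namespace FlatModel

variable {m : ℕ} (D : FlatModel m)

/-- In a flat coordinate the logarithmic derivative of `E` is the constant `2πi`, so `E` measures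
displacements modulo integers. -/
theorem E_chart {U : Set ℂ} {G : ℂ → ℂ} (hU : IsOpen U) (hc : IsPreconnected U)
    (h : IsChart D.P U G) {w₀ w : ℂ} (hw₀ : w₀ ∈ U) (hw : w ∈ U) :
    D.E (G w) = D.E (G w₀) * Complex.exp (2 * Real.pi * Complex.I * (w - w₀)) := by
  have hd : ∀ w ∈ U,
      HasDerivAt (fun w => D.E (G w) * Complex.exp (-(2 * Real.pi * Complex.I * w))) 0 w := by
    intro w hw
    obtain ⟨h1, h2⟩ := h w hw
    have h3 := (D.deriv_E _ h1).comp w h2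
    have h4 := (((hasDerivAt_id w).const_mul (2 * Real.pi * Complex.I)).neg).cexp
    refine (h3.mul h4).congr_deriv ?_
    simp only [Function.comp, id, mul_one]
    field_simp
    ring
  have := hU.is_const_of_deriv_eq_zero hc
    (fun w hw => (hd w hw).differentiableAt.differentiableWithinAt)
    (fun w hw => (hd w hw).deriv) hw hw₀
  simp only [Complex.exp_neg] at this
  rw [mul_sub, Complex.exp_sub]
  have h1 := Complex.exp_ne_zero (2 * Real.pi * Complex.I * w)
  have h2 := Complex.exp_ne_zero (2 * Real.pi * Complex.I * w₀)
  field_simp at this ⊢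
  linear_combination this

theorem E_flow {z w : ℂ} (hz : D.P.eval z ≠ 0) (hw : w ∈ flowDom D.P z) :
    D.E (flow D.P z w) = D.E z * Complex.exp (2 * Real.pi * Complex.I * w) := by
  have := D.E_chart isOpen_flowDom (starConvex_isPreconnected starConvex_flowDom)
    isChart_flow (zero_mem_flowDom hz) hw
  rwa [flow_zero hz, sub_zero] at this

theorem tendsto_E : Tendsto D.E (Bornology.cobounded ℂ) (𝓝 1) := by
  have h1 : Tendsto (fun z => Complex.exp (2 * Real.pi * Complex.I * D.coord.Z z ^ (m + 1)))
      (Bornology.cobounded ℂ) (𝓝 1) := by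
    have hc : Continuous fun ζ : ℂ => Complex.exp (2 * Real.pi * Complex.I * ζ ^ (m + 1)) := by
      fun_prop
    have := (hc.tendsto 0).comp D.coord.tendsto_Z
    simpa [Function.comp_def] using this
  refine h1.congr' ?_
  filter_upwards [tendsto_norm_cobounded_atTop.eventually_gt_atTop D.coord.R] with z hz
  obtain ⟨h1, h2, h3, -⟩ := D.coord.Z_spec z hz
  rw [← D.E_Y _ h1 h2, h3]

theorem E_of_blowup {z w : ℂ} (hz : D.P.eval z ≠ 0) {t : ℝ} (ht : 0 < t)
    (hd : ∀ s ∈ Set.Ico 0 t, (s : ℂ) * w ∈ flowDom D.P z)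
    (hinf : Tendsto (fun s : ℝ => flow D.P z (s * w)) (𝓝[<] t) (Bornology.cobounded ℂ)) :
    D.E z * Complex.exp (2 * Real.pi * Complex.I * (t * w)) = 1 := by
  have h1 := D.tendsto_E.comp hinf
  have h2 : Tendsto (fun s : ℝ => D.E z * Complex.exp (2 * Real.pi * Complex.I * (s * w))) (𝓝[<] t)
      (𝓝 (D.E z * Complex.exp (2 * Real.pi * Complex.I * (t * w)))) := by
    have hc : Continuous fun s : ℝ => D.E z * Complex.exp (2 * Real.pi * Complex.I * (s * w)) := by
      fun_prop
    exact (hc.tendsto t).mono_left nhdsWithin_le_nhds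
  refine tendsto_nhds_unique h2 (h1.congr' ?_)
  filter_upwards [Ioo_mem_nhdsLT ht] with s hs
  exact D.E_flow hz (hd s ⟨hs.1.le, hs.2⟩)

/-- A trajectory that stops does so at the zero, where `E` tends to `1`. Excluding the value `1`
along the way therefore guarantees existence. -/
theorem mem_flowDom {z w : ℂ} (hz : D.P.eval z ≠ 0) (h : ∀ t : ℝ, 0 < t → t ≤ 1 →
    D.E z * Complex.exp (2 * Real.pi * Complex.I * (t * w)) ≠ 1) : w ∈ flowDom D.P z := by
  by_contra hw
  obtain ⟨t, h0, h1, h2, h3⟩ := exists_blowup hz hw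
  exact h t h0 h1 (D.E_of_blowup hz h0 h2 h3)

/-- The chart at the zero in the sector around the direction `ω ^ n`. -/
noncomputable def cone (n : ℕ) (x : ℂ) : ℂ :=
  D.coord.Y (omega m ^ n * (x * sgn n) ^ ((m + 1 : ℂ)⁻¹))

def coneDom (n : ℕ) : Set ℂ :=
  {x | x * sgn n ∈ Complex.slitPlane ∧ ‖x‖ < D.coord.r ^ (m + 1)}

theorem pow_cpow_inv (x : ℂ) : (x ^ ((m + 1 : ℂ)⁻¹)) ^ (m + 1) = x := by
  have := Complex.cpow_nat_inv_pow x (Nat.succ_ne_zero m)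
  simpa using this

theorem cone_arg_pow (n : ℕ) (x : ℂ) :
    (omega m ^ n * (x * sgn n) ^ ((m + 1 : ℂ)⁻¹)) ^ (m + 1) = x := by
  rw [mul_pow, omega_pow_pow, pow_cpow_inv]
  linear_combination x * sgn_mul_self' n

theorem norm_lt_of_pow {ζ x : ℂ} {r : ℝ} (hr : 0 < r) (h : ζ ^ (m + 1) = x)
    (hx : ‖x‖ < r ^ (m + 1)) : ‖ζ‖ < r := by
  rw [← h, norm_pow] at hx
  exact lt_of_pow_lt_pow_left₀ _ hr.le hx

theorem isOpen_coneDom (n : ℕ) : IsOpen (D.coneDom n) :=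
  (Complex.isOpen_slitPlane.preimage (f := fun x : ℂ => x * sgn n) (by fun_prop)).inter
    (isOpen_lt continuous_norm continuous_const)

theorem ne_zero_of_mem_coneDom {n : ℕ} {x : ℂ} (hx : x ∈ D.coneDom n) : x ≠ 0 := by
  rintro rfl
  exact Complex.slitPlane_ne_zero hx.1 (by simp)

/-- Since `d(ζ^(m+1)) = dz / P` and `ζ^(m+1) = x`, the coordinate `x` is flat. The factor `sgn n`
moves the cut of the principal root to the half-line opposite to the ray, and the power of `ω`
selects the sector. -/
theorem isChart_cone (n : ℕ) : IsChart D.P (D.coneDom n) (D.cone n) := by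
  intro x hx
  have hm1 : (m + 1 : ℂ) ≠ 0 := by exact_mod_cast Nat.succ_ne_zero m
  have hx0 := D.ne_zero_of_mem_coneDom hx
  have hpow := cone_arg_pow (m := m) n x
  set ζ := omega m ^ n * (x * sgn n) ^ ((m + 1 : ℂ)⁻¹) with hζ
  have hζ0 : ζ ≠ 0 := by
    intro h
    rw [h, zero_pow (Nat.succ_ne_zero m)] at hpow
    exact hx0 hpow.symm
  obtain ⟨h1, h2⟩ := D.coord.deriv_Y ζ hζ0 (norm_lt_of_pow D.coord.r_pos hpow hx.2)
  refine ⟨h1, ?_⟩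
  have h3 : HasDerivAt (fun x : ℂ => omega m ^ n * (x * sgn n) ^ ((m + 1 : ℂ)⁻¹))
      (ζ / ((m + 1) * x)) x := by
    have := ((((hasDerivAt_id x).mul_const (sgn n : ℂ)).cpow_const
      (c := (m + 1 : ℂ)⁻¹) hx.1).const_mul (omega m ^ n))
    refine this.congr_deriv ?_
    have hs := sgn_ne_zero' n
    simp only [id, one_mul]
    rw [Complex.cpow_sub _ _ (mul_ne_zero hx0 hs), Complex.cpow_one, hζ]
    field_simp
  refine (h2.comp x h3).congr_deriv ?_
  have : (m + 1 : ℂ) * ζ ^ m * D.P.eval (D.coord.Y ζ) * (ζ / ((m + 1) * x)) =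
      ζ ^ (m + 1) / x * D.P.eval (D.coord.Y ζ) := by
    field_simp
    ring
  rw [this, hpow, div_self hx0, one_mul]
  rfl

theorem starConvex_coneDom (n : ℕ) {ε : ℝ} (h0 : 0 < ε) (h1 : ε < D.coord.r ^ (m + 1)) :
    StarConvex ℝ ((ε : ℂ) * sgn n) (D.coneDom n) := by
  have hs := sgn_mul_self' n
  have e1 : StarConvex ℝ ((ε : ℂ) * sgn n) {x : ℂ | x * sgn n ∈ Complex.slitPlane} := by
    intro y hy a b ha hb hab
    have := Complex.starConvex_ofReal_slitPlane h0 hy ha hb hab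
    simp only [Complex.real_smul, Set.mem_ofPred_eq] at this ⊢
    convert this using 1
    linear_combination (a * ε : ℂ) * hs
  have e2 : StarConvex ℝ ((ε : ℂ) * sgn n) (Metric.ball (0 : ℂ) (D.coord.r ^ (m + 1))) := by
    refine (convex_ball _ _).starConvex ?_
    rw [mem_ball_zero_iff, norm_mul, norm_sgn, mul_one, Complex.norm_real,
      Real.norm_of_nonneg h0.le]
    exact h1
  have := e1.inter e2
  convert this using 1
  ext x
  simp [coneDom]

theorem E_cone {n : ℕ} {x : ℂ} (hx : x ∈ D.coneDom n) :
    D.E (D.cone n x) = Complex.exp (2 * Real.pi * Complex.I * x) := by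
  have hpow := cone_arg_pow (m := m) n x
  rw [cone, D.E_Y _ _ (norm_lt_of_pow D.coord.r_pos hpow hx.2), hpow]
  intro h
  rw [h, zero_pow (Nat.succ_ne_zero m)] at hpow
  exact D.ne_zero_of_mem_coneDom hx hpow.symm

theorem tendsto_Y : Tendsto D.coord.Y (𝓝[≠] 0) (Bornology.cobounded ℂ) := by
  have h1 : Tendsto (fun ζ => (D.coord.Y ζ)⁻¹) (𝓝[≠] 0) (𝓝[≠] 0) := by
    refine tendsto_nhdsWithin_iff.2 ⟨?_, ?_⟩
    · have := D.coord.tendsto_Y.mul (tendsto_id.mono_left (nhdsWithin_le_nhds (s := {0}ᶜ)))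
      rw [mul_zero] at this
      refine this.congr' ?_
      filter_upwards [self_mem_nhdsWithin] with ζ hζ
      exact div_mul_cancel₀ _ hζ
    · filter_upwards [D.coord.tendsto_Y.eventually_ne D.coord.κ_ne] with ζ hζ
      exact fun h => hζ (by rw [h, zero_div])
  have := tendsto_inv₀_nhdsNE_zero.comp h1
  simpa [Function.comp_def] using this

theorem tendsto_cone (n : ℕ) : Tendsto (D.cone n) (𝓝[≠] 0) (Bornology.cobounded ℂ) := by
  have hm1 : (m + 1 : ℂ) ≠ 0 := by exact_mod_cast Nat.succ_ne_zero m
  refine D.tendsto_Y.comp (tendsto_nhdsWithin_iff.2 ⟨?_, ?_⟩)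
  · have h1 : Tendsto (fun x : ℂ => ‖omega m ^ n * (x * sgn n) ^ ((m + 1 : ℂ)⁻¹)‖) (𝓝 0) (𝓝 0) := by
      have h2 : Continuous fun x : ℂ => ‖x‖ ^ ((m + 1 : ℝ)⁻¹) :=
        continuous_norm.rpow_const fun x => Or.inr (by positivity)
      have h3 := h2.tendsto 0
      rw [norm_zero, Real.zero_rpow (by positivity)] at h3
      refine h3.congr fun x => ?_
      rw [norm_mul, norm_pow, norm_omega, one_pow, one_mul]
      have : ((m + 1 : ℂ)⁻¹) = (((m + 1 : ℝ)⁻¹ : ℝ) : ℂ) := by push_cast; rfl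
      rw [this, Complex.norm_cpow_real, norm_mul, norm_sgn, mul_one]
    exact (tendsto_zero_iff_norm_tendsto_zero.2 h1).mono_left nhdsWithin_le_nhds
  · filter_upwards [self_mem_nhdsWithin] with x hx h
    have hpow := cone_arg_pow (m := m) n x
    rw [h, zero_pow (Nat.succ_ne_zero m)] at hpow
    exact hx hpow.symm

end FlatModel

/-- In the upper half-plane the principal arguments of `y` and `-y` differ by `π`. This makes the
cone charts in the directions `ω^n` and `ω^(n+1)` agree on the half-plane between them. -/
theorem cpow_eq_omega_mul {m : ℕ} {y : ℂ} (hy : 0 < y.im) :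
    y ^ ((m + 1 : ℂ)⁻¹) = omega m * (-y) ^ ((m + 1 : ℂ)⁻¹) := by
  have hy0 : y ≠ 0 := by rintro rfl; simp at hy
  have hlog : Complex.log y = Complex.log (-y) + Real.pi * Complex.I := by
    rw [Complex.log, Complex.log, norm_neg, Complex.arg_neg_eq_arg_sub_pi_of_im_pos hy]
    push_cast
    ring
  rw [Complex.cpow_def_of_ne_zero hy0, Complex.cpow_def_of_ne_zero (neg_ne_zero.2 hy0), hlog,
    omega, ← Complex.exp_add]
  congr 1
  ring

theorem re_mul_sgn (x : ℂ) (n : ℕ) : (x * sgn n).re = x.re * sgn n := by simp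

theorem im_mul_sgn (x : ℂ) (n : ℕ) : (x * sgn n).im = x.im * sgn n := by simp

/-- The plane without the real half-line opposite to the direction `sgn n` and without the points
at distance at least `T` in that direction. -/
def strip (n : ℕ) (T : ℝ) : Set ℂ := {x | x.im ≠ 0 ∨ (0 < x.re * sgn n ∧ x.re * sgn n < T)}

theorem isOpen_strip (n : ℕ) (T : ℝ) : IsOpen (strip n T) := by
  refine (isOpen_ne_fun Complex.continuous_im continuous_const).union ?_
  exact (isOpen_lt continuous_const (Complex.continuous_re.mul_const _)).inter
    (isOpen_lt (Complex.continuous_re.mul_const _) continuous_const)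

theorem ofReal_mul_sgn_mem_strip {n : ℕ} {T t : ℝ} (h0 : 0 < t) (h1 : t < T) :
    (t : ℂ) * sgn n ∈ strip n T := by
  right
  have : ((t : ℂ) * sgn n).re * sgn n = t := by
    simp [mul_assoc, sgn_mul_self]
  rw [this]
  exact ⟨h0, h1⟩

theorem starConvex_strip (n : ℕ) (T : ℝ) {t : ℝ} (h0 : 0 < t) (h1 : t < T) :
    StarConvex ℝ ((t : ℂ) * sgn n) (strip n T) := by
  intro y hy a b ha hb hab
  have hs := sgn_mul_self n
  rcases hb.eq_or_lt with rfl | hb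
  · have : a = 1 := by linarith
    subst this
    simpa using ofReal_mul_sgn_mem_strip h0 h1
  by_cases hy0 : y.im = 0
  · right
    obtain h | ⟨h2, h3⟩ := hy
    · exact absurd hy0 h
    have : (a • ((t : ℂ) * sgn n) + b • y).re * sgn n = a * t + b * (y.re * sgn n) := by
      simp
      linear_combination (a * t) * hs
    rw [this]
    constructor
    · have := mul_pos hb h2
      have := mul_nonneg ha h0.le
      linarith
    · have h4 : b * (y.re * sgn n) < b * T := by gcongr
      have h5 : a * t ≤ a * T := by gcongr
      calc _ < a * T + b * T := by linarith
        _ = T := by rw [← add_mul, hab, one_mul]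
  · left
    simp [hb.ne', hy0]

/-! ### Rays leaving the zero -/

namespace FlatModel

variable {m : ℕ} (D : FlatModel m)

/-- The bound by `r^(m+1)` places the base points inside the cones. The bound by `1` places them on
every saddle connection before its other end, since lengths are positive integers. -/
noncomputable def eps : ℝ := (min (D.coord.r / 2) (1 / 2)) ^ (m + 1)

theorem eps_pos : 0 < D.eps := by
  have := D.coord.r_pos
  exact pow_pos (lt_min (by linarith) (by norm_num)) _

theorem eps_lt_one : D.eps < 1 := by
  have := D.coord.r_pos
  refine pow_lt_one₀ (le_min (by linarith) (by norm_num)) ?_ (Nat.succ_ne_zero m)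
  exact (min_le_right _ _).trans_lt (by norm_num)

theorem eps_lt : D.eps < D.coord.r ^ (m + 1) := by
  have := D.coord.r_pos
  refine pow_lt_pow_left₀ ?_ (le_min (by linarith) (by norm_num)) (Nat.succ_ne_zero m)
  exact (min_le_left _ _).trans_lt (by linarith)

noncomputable def base (n : ℕ) : ℂ := D.cone n (D.eps * sgn n)

/-- The chart spanned by the straight rays leaving the zero around the direction `ω ^ n`. -/
noncomputable def ray (n : ℕ) (x : ℂ) : ℂ := flow D.P (D.base n) (x - D.eps * sgn n)

def rayDom (n : ℕ) : Set ℂ := {x | x - D.eps * sgn n ∈ flowDom D.P (D.base n)}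

theorem isOpen_rayDom (n : ℕ) : IsOpen (D.rayDom n) :=
  isOpen_flowDom.preimage (by fun_prop)

theorem isChart_ray (n : ℕ) : IsChart D.P (D.rayDom n) (D.ray n) := by
  have := (isChart_flow (P := D.P) (z := D.base n)).shift (-(D.eps * sgn n))
  exact this

theorem starConvex_rayDom (n : ℕ) : StarConvex ℝ ((D.eps : ℂ) * sgn n) (D.rayDom n) := by
  intro y hy a b ha hb hab
  have h := starConvex_flowDom (P := D.P) (z := D.base n) hy ha hb hab
  change _ ∈ flowDom _ _
  convert h using 1
  have hab' : (a : ℂ) + b = 1 := by exact_mod_cast hab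
  simp only [smul_zero, zero_add, Complex.real_smul]
  linear_combination ((D.eps : ℂ) * sgn n) * hab'

theorem eps_mem_coneDom (n : ℕ) : (D.eps : ℂ) * sgn n ∈ D.coneDom n :=
  (D.starConvex_coneDom n D.eps_pos D.eps_lt).mem
    ⟨(D.eps : ℂ) * sgn n, by
      constructor
      · rw [mul_assoc, sgn_mul_self', mul_one]
        exact Complex.ofReal_mem_slitPlane.2 D.eps_pos
      · rw [norm_mul, norm_sgn, mul_one, Complex.norm_real, Real.norm_of_nonneg D.eps_pos.le]
        exact D.eps_lt⟩

theorem coneDom_subset (n : ℕ) : D.coneDom n ⊆ D.rayDom n := fun _ hx =>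
  ((D.isChart_cone n).flow_eq_of_starConvex (D.isOpen_coneDom n)
    (D.starConvex_coneDom n D.eps_pos D.eps_lt) hx).1

theorem ray_eq_cone {n : ℕ} {x : ℂ} (hx : x ∈ D.coneDom n) : D.ray n x = D.cone n x :=
  ((D.isChart_cone n).flow_eq_of_starConvex (D.isOpen_coneDom n)
    (D.starConvex_coneDom n D.eps_pos D.eps_lt) hx).2

theorem P_base (n : ℕ) : D.P.eval (D.base n) ≠ 0 :=
  (D.isChart_cone n _ (D.eps_mem_coneDom n)).1

theorem E_base (n : ℕ) :
    D.E (D.base n) = Complex.exp (2 * Real.pi * Complex.I * (D.eps * sgn n)) :=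
  D.E_cone (D.eps_mem_coneDom n)

theorem E_ray {n : ℕ} {x : ℂ} (hx : x ∈ D.rayDom n) :
    D.E (D.ray n x) = Complex.exp (2 * Real.pi * Complex.I * x) := by
  rw [ray, D.E_flow (D.P_base n) hx, D.E_base, ← Complex.exp_add]
  congr 1
  ring

theorem norm_exp_two_pi_mul (x : ℂ) :
    ‖Complex.exp (2 * Real.pi * Complex.I * x)‖ = Real.exp (-(2 * Real.pi * x.im)) := by
  rw [Complex.norm_exp]
  congr 1
  simp

/-- On the way from the base point to `x` the modulus of `E` is never `1`, because the imaginary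
part of the flat coordinate is a positive multiple of `x.im`. So the zero is not met. -/
theorem mem_rayDom_of_im_ne {n : ℕ} {x : ℂ} (hx : x.im ≠ 0) : x ∈ D.rayDom n := by
  refine D.mem_flowDom (D.P_base n) fun t h0 h1 h => ?_
  rw [E_base, ← Complex.exp_add, ← mul_add] at h
  have h2 := norm_exp_two_pi_mul (D.eps * sgn n + t * (x - D.eps * sgn n))
  rw [h, norm_one, eq_comm, Real.exp_eq_one_iff] at h2
  simp [Real.pi_ne_zero, h0.ne', hx] at h2

/-- The half-plane to the left of ray `n` lies to the right of ray `n + 1`. Both charts exist on it,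
and they agree at a point near the zero, where the two cones coincide. -/
theorem ray_succ {n : ℕ} {x : ℂ} (hx : 0 < x.im * sgn n) : D.ray n x = D.ray (n + 1) x := by
  have hs := sgn_mul_self n
  set U : Set ℂ := {x | 0 < x.im * sgn n} with hU
  have hUo : IsOpen U := isOpen_lt continuous_const (by fun_prop)
  have hUc : Convex ℝ U := by
    intro y hy z hz a b ha hb hab
    simp only [hU, Set.mem_ofPred_eq] at *
    have : (a • y + b • z).im * sgn n = a * (y.im * sgn n) + b * (z.im * sgn n) := by
      simp; ring
    rw [this]
    rcases ha.eq_or_lt with rfl | ha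
    · have : b = 1 := by linarith
      subst this; simpa using hz
    · have := mul_pos ha hy
      have := mul_nonneg hb hz.le
      linarith
  have hne : ∀ y ∈ U, y.im ≠ 0 := fun y hy h => by
    simp [hU, h] at hy
  set y : ℂ := D.eps * sgn n * Complex.I with hy
  have hyim : y.im = D.eps * sgn n := by simp [hy]
  have hyU : y ∈ U := by
    simp only [hU, Set.mem_ofPred_eq, hyim, mul_assoc, hs, mul_one]
    exact D.eps_pos
  have hcone : ∀ k, y ∈ D.coneDom k := by
    intro k
    refine ⟨Complex.mem_slitPlane_iff.2 (Or.inr ?_), ?_⟩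
    · rw [im_mul_sgn, hyim]
      exact mul_ne_zero (mul_ne_zero D.eps_pos.ne' (sgn_ne_zero _)) (sgn_ne_zero _)
    · rw [hy, norm_mul, norm_mul, norm_sgn, Complex.norm_I, mul_one, mul_one, Complex.norm_real,
        Real.norm_of_nonneg D.eps_pos.le]
      exact D.eps_lt
  refine ((D.isChart_ray n).mono fun y hy => D.mem_rayDom_of_im_ne (hne y hy)).eqOn hUo
    hUc.isPreconnected ((D.isChart_ray (n + 1)).mono fun y hy =>
      D.mem_rayDom_of_im_ne (hne y hy)) hyU ?_ hx
  rw [D.ray_eq_cone (hcone n), D.ray_eq_cone (hcone (n + 1)), cone, cone, sgn_succ]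
  have h1 : 0 < (y * sgn n).im := by rw [im_mul_sgn]; exact hyU
  rw [cpow_eq_omega_mul h1, pow_succ]
  push_cast
  rw [mul_neg, mul_assoc (omega m ^ n)]

/-- The ray in direction `ω ^ n` never returns to the zero. -/
def Infinite (n : ℕ) : Prop := ∀ t : ℝ, 0 < t → (t : ℂ) * sgn n ∈ D.rayDom n

theorem ofReal_mul_sgn_mem_coneDom (n : ℕ) {t : ℝ} (h0 : 0 < t) (h1 : t < D.coord.r ^ (m + 1)) :
    (t : ℂ) * sgn n ∈ D.coneDom n := by
  constructor
  · rw [mul_assoc, sgn_mul_self', mul_one]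
    exact Complex.ofReal_mem_slitPlane.2 h0
  · rwa [norm_mul, norm_sgn, mul_one, Complex.norm_real, Real.norm_of_nonneg h0.le]

theorem cone_ofReal_mul_sgn (n : ℕ) {t : ℝ} (h0 : 0 < t) :
    D.cone n (t * sgn n) = D.coord.Y (omega m ^ n * ((t ^ ((m + 1 : ℝ)⁻¹) : ℝ) : ℂ)) := by
  rw [cone, mul_assoc, sgn_mul_self', mul_one, Complex.ofReal_cpow h0.le]
  push_cast
  rfl

theorem hasDerivAt_ray_real {n : ℕ} {t : ℝ} (h : (t : ℂ) * sgn n ∈ D.rayDom n) :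
    HasDerivAt (fun t : ℝ => D.ray n (t * sgn n))
      (sgn n * D.P.eval (D.ray n (t * sgn n))) t := by
  have h1 : HasDerivAt (fun s : ℝ => (s : ℂ) * sgn n) (sgn n) t := by
    simpa using (Complex.ofRealCLM.hasDerivAt (x := t)).mul_const (sgn n : ℂ)
  have h2 := ((D.isChart_ray n) _ h).2.scomp t h1
  simpa [Function.comp_def] using h2

/-- The blow-up of trajectories, applied from the base point and reparametrized by the distance to
the zero; the initial piece of length `eps` lies in the cone. -/
theorem exists_ray_blowup {n : ℕ} {T₀ : ℝ} (h0 : 0 < T₀) (h : (T₀ : ℂ) * sgn n ∉ D.rayDom n) :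
    ∃ T, 0 < T ∧ T ≤ T₀ ∧ (∀ t ∈ Set.Ioo 0 T, (t : ℂ) * sgn n ∈ D.rayDom n) ∧
      Tendsto (fun t : ℝ => D.ray n (t * sgn n)) (𝓝[<] T) (Bornology.cobounded ℂ) := by
  have hlt : D.eps < T₀ := by
    by_contra hle
    exact h (D.coneDom_subset n (D.ofReal_mul_sgn_mem_coneDom n h0
      ((not_lt.1 hle).trans_lt D.eps_lt)))
  obtain ⟨s, hs0, hs1, hd, hinf⟩ := exists_blowup (D.P_base n) h
  have key : ∀ t : ℝ, (((t - D.eps) / (T₀ - D.eps) : ℝ) : ℂ) * (T₀ * sgn n - D.eps * sgn n) =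
      t * sgn n - D.eps * sgn n := by
    intro t
    have : ((T₀ : ℂ) - D.eps) ≠ 0 := by exact_mod_cast (sub_pos.2 hlt).ne'
    push_cast
    field_simp
  have hpos : 0 < T₀ - D.eps := sub_pos.2 hlt
  have he := D.eps_pos
  set T := D.eps + s * (T₀ - D.eps) with hT
  have hTs : (T - D.eps) / (T₀ - D.eps) = s := by
    rw [hT]; field_simp; ring
  have hsp := mul_pos hs0 hpos
  refine ⟨T, by linarith, by nlinarith, ?_, ?_⟩
  · intro t ht
    rcases lt_or_ge t D.eps with hte | hte
    · exact D.coneDom_subset n (D.ofReal_mul_sgn_mem_coneDom n ht.1 (hte.trans D.eps_lt))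
    · have := hd ((t - D.eps) / (T₀ - D.eps)) ⟨div_nonneg (by linarith) hpos.le, by
        rw [div_lt_iff₀ hpos]; linarith [ht.2]⟩
      rw [key] at this
      exact this
  · have h1 : Tendsto (fun t : ℝ => (t - D.eps) / (T₀ - D.eps)) (𝓝[<] T) (𝓝[<] s) := by
      refine tendsto_nhdsWithin_iff.2 ⟨?_, ?_⟩
      · have hc : Continuous fun t : ℝ => (t - D.eps) / (T₀ - D.eps) := by fun_prop
        have := hc.tendsto T
        rw [hTs] at this
        exact this.mono_left nhdsWithin_le_nhds
      · filter_upwards [self_mem_nhdsWithin] with t ht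
        change _ < s
        rw [← hTs]
        have : t < T := ht
        gcongr
    refine (hinf.comp h1).congr fun t => ?_
    simp only [Function.comp, key]
    rfl

theorem not_tendsto_cobounded_of_mem {n : ℕ} {T : ℝ} (h : (T : ℂ) * sgn n ∈ D.rayDom n) :
    ¬ Tendsto (fun t : ℝ => D.ray n (t * sgn n)) (𝓝[<] T) (Bornology.cobounded ℂ) := by
  intro hinf
  have h1 := (D.hasDerivAt_ray_real h).continuousAt.tendsto.mono_left
    (nhdsWithin_le_nhds (s := Set.Iio T))
  exact (h1.not_tendsto (Metric.disjoint_nhds_cobounded _)) hinf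

/-! ### Saddle connections as gluings of two rays -/

/-- The ray in direction `ω ^ n` is a saddle connection of length `T`, returning to the zero from
the direction `ω ^ n'`. -/
structure Glue (n n' T : ℕ) : Prop where
  pos : 0 < T
  sgn_eq : sgn n' = -sgn n
  dom : strip n T ⊆ D.rayDom n
  dom' : strip n' T ⊆ D.rayDom n'
  notMem : (T : ℂ) * sgn n ∉ D.rayDom n
  ray_eq : ∀ x ∈ strip n' T, D.ray n (x + T * sgn n) = D.ray n' x

theorem natCast_mul_sgn_add {n n' T : ℕ} (hs : sgn n' = -sgn n) {x : ℂ} (hx : x ∈ strip n' T) :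
    x + T * sgn n ∈ strip n T := by
  have h := sgn_mul_self n
  rcases hx with hx | ⟨h1, h2⟩
  · left; simpa using hx
  · right
    rw [hs] at h1 h2
    have : (x + T * sgn n).re * sgn n = x.re * sgn n + T := by
      simp; linear_combination (T : ℝ) * h
    rw [this]
    constructor <;> linarith

/-- A trajectory of `P` which starts at `z` and runs into the zero. -/
theorem exists_glue_of_blowup {n : ℕ} {T : ℝ} (hT : 0 < T)
    (hd : ∀ t ∈ Set.Ioo 0 T, (t : ℂ) * sgn n ∈ D.rayDom n)
    (hinf : Tendsto (fun t : ℝ => D.ray n (t * sgn n)) (𝓝[<] T) (Bornology.cobounded ℂ)) :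
    ∃ n' < 2 * (m + 1), ∃ k : ℕ, T = k ∧ D.Glue n n' k := by
  have hss := sgn_mul_self' n
  -- the length is an integer
  have hexp : Complex.exp (2 * Real.pi * Complex.I * (T * sgn n)) = 1 := by
    have h1 := D.tendsto_E.comp hinf
    have hc : Continuous fun t : ℝ => Complex.exp (2 * Real.pi * Complex.I * (t * sgn n)) := by
      fun_prop
    refine tendsto_nhds_unique ((hc.tendsto T).mono_left nhdsWithin_le_nhds) (h1.congr' ?_)
    filter_upwards [Ioo_mem_nhdsLT hT] with t ht using D.E_ray (hd t ht)
  obtain ⟨k, hk⟩ := Complex.exp_eq_one_iff.1 hexp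
  have hk' : T * sgn n = k := by
    have h2 : (2 * Real.pi * Complex.I : ℂ) ≠ 0 := Complex.two_pi_I_ne_zero
    have h3 : (T * sgn n : ℂ) = k := mul_left_cancel₀ h2 (by linear_combination hk)
    exact_mod_cast h3
  have hTint : ∃ k : ℕ, T = k := by
    rcases sgn_eq n with h | h
    · refine ⟨k.toNat, ?_⟩
      rw [h, mul_one] at hk'
      have : (0 : ℤ) ≤ k := by exact_mod_cast (hk' ▸ hT).le
      rw [hk']
      exact_mod_cast (Int.toNat_of_nonneg this).symm
    · refine ⟨(-k).toNat, ?_⟩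
      rw [h] at hk'
      have hk2 : T = ((-k : ℤ) : ℝ) := by push_cast; linarith
      have : (0 : ℤ) ≤ -k := by exact_mod_cast (hk2 ▸ hT).le
      rw [hk2]
      exact_mod_cast (Int.toNat_of_nonneg this).symm
  obtain ⟨T, rfl⟩ := hTint
  have hTpos : 0 < T := by exact_mod_cast hT
  have hT1 : (1 : ℝ) ≤ T := by exact_mod_cast hTpos
  -- the direction in which it returns
  obtain ⟨ξ, hξ, hev⟩ := D.coord.exists_end (v := sgn n) hT
    (fun t ht => D.hasDerivAt_ray_real (hd t ht))
    (fun t ht => (D.isChart_ray n _ (hd t ht)).1) hinf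
  obtain ⟨n', hn', rfl, hsn⟩ := exists_omega_pow m (v := -sgn n)
    (by rcases sgn_eq n with h | h <;> simp [h]) (by rw [hξ]; push_cast; rfl)
  have hdom : strip n T ⊆ D.rayDom n := by
    rintro x (hx | ⟨h1, h2⟩)
    · exact D.mem_rayDom_of_im_ne hx
    · by_cases hx : x.im = 0
      · have : x = ((x.re * sgn n : ℝ) : ℂ) * sgn n := by
          apply Complex.ext
          · simp [mul_assoc, sgn_mul_self]
          · simp [hx]
        rw [this]
        exact hd _ ⟨h1, h2⟩
      · exact D.mem_rayDom_of_im_ne hx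
  -- The same chart with its origin moved to the far end; it is to be identified with the chart of
  -- the returning ray `n'`.
  set G : ℂ → ℂ := fun x => D.ray n (x + T * sgn n) with hG
  have hGc : IsChart D.P (strip n' T) G :=
    ((D.isChart_ray n).shift (T * sgn n)).mono fun x hx => hdom (natCast_mul_sgn_add hsn hx)
  have hr : 0 < D.coord.r ^ (m + 1) := pow_pos D.coord.r_pos _
  obtain ⟨t, ⟨ht1, ht3⟩, ht2⟩ := (hev.and (Ioo_mem_nhdsLT (show max 0 ((T : ℝ) -
    D.coord.r ^ (m + 1)) < T from max_lt hT (by linarith)))).exists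
  have hts : (0 : ℝ) < T - t := by linarith [ht2.2]
  have htr : T - t < D.coord.r ^ (m + 1) := by
    have := (le_max_right 0 ((T : ℝ) - D.coord.r ^ (m + 1))).trans_lt ht2.1
    linarith
  have ht0 : 0 < t := (le_max_left _ _).trans_lt ht2.1
  have hagree : G (((T - t : ℝ) : ℂ) * sgn n') = D.cone n' (((T - t : ℝ) : ℂ) * sgn n') := by
    rw [D.cone_ofReal_mul_sgn n' hts, ← ht1, hsn]
    change D.ray n _ = _
    congr 1
    push_cast
    ring
  -- Near the far end `G` is the cone of direction `ω^n'`. The strip and the cone domain are both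
  -- star-shaped about the point at distance `eps`, so the agreement reaches that point, from which
  -- the flow then gives the whole strip.
  have hGε : G (D.eps * sgn n') = D.base n' := by
    have hpre : IsPreconnected (strip n' T ∩ D.coneDom n') :=
      starConvex_isPreconnected ((starConvex_strip n' T D.eps_pos
        (D.eps_lt_one.trans_le hT1)).inter (D.starConvex_coneDom n' D.eps_pos D.eps_lt))
    refine (hGc.mono Set.inter_subset_left).eqOn ((isOpen_strip n' T).inter
      (D.isOpen_coneDom n')) hpre ((D.isChart_cone n').mono Set.inter_subset_right)
      ⟨ofReal_mul_sgn_mem_strip hts (by linarith), D.ofReal_mul_sgn_mem_coneDom n' hts htr⟩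
      hagree ⟨ofReal_mul_sgn_mem_strip D.eps_pos (D.eps_lt_one.trans_le hT1),
        D.eps_mem_coneDom n'⟩
  have hflow := fun x (hx : x ∈ strip n' T) => hGc.flow_eq_of_starConvex (isOpen_strip n' T)
    (starConvex_strip n' T D.eps_pos (D.eps_lt_one.trans_le hT1)) hx
  rw [hGε] at hflow
  refine ⟨n', hn', T, rfl, hTpos, hsn, hdom, fun x hx => (hflow x hx).1, ?_,
    fun x hx => (hflow x hx).2.symm⟩
  intro hmem
  exact D.not_tendsto_cobounded_of_mem (T := (T : ℝ)) (by exact_mod_cast hmem) hinf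

variable {D}

theorem Glue.not_infinite {n n' T : ℕ} (h : D.Glue n n' T) : ¬ D.Infinite n := fun hi =>
  h.notMem (by exact_mod_cast hi T (by exact_mod_cast h.pos))

/-- The gluing identity inverts by translation. That ray `n'` really stops at length `T` holds
because its points there are points of ray `n` approaching the zero. -/
theorem Glue.symm {n n' T : ℕ} (h : D.Glue n n' T) : D.Glue n' n T := by
  have hs : sgn n = -sgn n' := by rw [h.sgn_eq, neg_neg]
  have heq : ∀ x ∈ strip n T, D.ray n' (x + T * sgn n') = D.ray n x := by
    intro x hx
    rw [← h.ray_eq _ (natCast_mul_sgn_add hs hx), h.sgn_eq]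
    congr 1
    push_cast
    ring
  refine ⟨h.pos, hs, h.dom', h.dom, ?_, heq⟩
  intro hmem
  refine D.not_tendsto_cobounded_of_mem (n := n') (T := T) (by exact_mod_cast hmem) ?_
  have hlim : Tendsto (fun t : ℝ => ((T - t : ℝ) : ℂ) * sgn n) (𝓝[<] (T : ℝ)) (𝓝[≠] 0) := by
    refine tendsto_nhdsWithin_iff.2 ⟨?_, ?_⟩
    · have hc : Continuous fun t : ℝ => ((T - t : ℝ) : ℂ) * sgn n := by fun_prop
      have := hc.tendsto T
      simp only [sub_self, Complex.ofReal_zero, zero_mul] at this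
      exact this.mono_left nhdsWithin_le_nhds
    · filter_upwards [self_mem_nhdsWithin] with t ht
      have : t < T := ht
      exact mul_ne_zero (by exact_mod_cast (sub_pos.2 this).ne') (sgn_ne_zero' n)
  refine ((D.tendsto_cone n).comp hlim).congr' ?_
  have hr : 0 < D.coord.r ^ (m + 1) := pow_pos D.coord.r_pos _
  have hT : (0 : ℝ) < T := by exact_mod_cast h.pos
  filter_upwards [Ioo_mem_nhdsLT (show max 0 ((T : ℝ) - D.coord.r ^ (m + 1)) < T from
    max_lt hT (by linarith))] with t ht
  have h1 : (0 : ℝ) < T - t := by linarith [ht.2]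
  have h2 : T - t < D.coord.r ^ (m + 1) := by
    have := (le_max_right 0 ((T : ℝ) - D.coord.r ^ (m + 1))).trans_lt ht.1
    linarith
  have h3 : 0 < t := (le_max_left _ _).trans_lt ht.1
  simp only [Function.comp]
  rw [← D.ray_eq_cone (D.ofReal_mul_sgn_mem_coneDom n h1 h2),
    ← heq _ (ofReal_mul_sgn_mem_strip h1 (by linarith)), h.sgn_eq]
  congr 1
  push_cast
  ring

end FlatModel

/-! ### Every regular point is visible from the zero -/

theorem ofReal_mul_cpow {a : ℝ} (ha : 0 < a) {x : ℂ} (hx : x ≠ 0) (c : ℂ) :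
    ((a : ℂ) * x) ^ c = (a : ℂ) ^ c * x ^ c := by
  have ha' : (a : ℂ) ≠ 0 := by exact_mod_cast ha.ne'
  rw [Complex.cpow_def_of_ne_zero (mul_ne_zero ha' hx), Complex.cpow_def_of_ne_zero ha',
    Complex.cpow_def_of_ne_zero hx, Complex.log_ofReal_mul ha hx, ← Complex.exp_add,
    ← Complex.ofReal_log ha.le]
  ring_nf

theorem isPreconnected_eval_ne_zero {P : Polynomial ℂ} (hP : P ≠ 0) :
    IsPreconnected {z : ℂ | P.eval z ≠ 0} := by
  have hfin : {z : ℂ | P.eval z = 0}.Finite := Polynomial.finite_setOfPred_isRoot hP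
  have := hfin.countable.isConnected_compl_of_one_lt_rank (E := ℂ)
    (by rw [Complex.rank_real_complex]; norm_num)
  exact this.isPreconnected

theorem IsChart.map_nhds {P : Polynomial ℂ} {U : Set ℂ} {G : ℂ → ℂ} (h : IsChart P U G)
    (hU : IsOpen U) {w : ℂ} (hw : w ∈ U) : map G (𝓝 w) = 𝓝 (G w) := by
  have h1 := (h.differentiableOn.analyticAt (hU.mem_nhds hw)).hasStrictDerivAt
  rw [(h w hw).2.deriv] at h1
  exact h1.map_nhds_eq (h w hw).1

/-- A chart defined on all of `ℂ` reaches every point where `P ≠ 0`. -/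
theorem IsChart.mem_range {P : Polynomial ℂ} {G : ℂ → ℂ} (h : IsChart P Set.univ G) {x : ℂ}
    (hx : P.eval x ≠ 0) : x ∈ Set.range G := by
  have hP : P ≠ 0 := by rintro rfl; simp at hx
  -- Membership in the range is locally constant: one hit in a chart ball makes a translate of `G`
  -- agree with the local chart on the entire ball. The complement of the roots is connected, which
  -- gives surjectivity.
  have key : ∀ y, P.eval y ≠ 0 → ∀ᶠ y' in 𝓝 y, y' ∈ Set.range G ↔ y ∈ Set.range G := by
    intro y hy
    obtain ⟨r, hr, hunif⟩ := exists_uniform_chart P hy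
    obtain ⟨H, hH, hH0⟩ := hunif.self_of_nhds 0
    have hmap := hH.map_nhds Metric.isOpen_ball (Metric.mem_ball_self hr)
    rw [hH0] at hmap
    rw [← hmap, eventually_map]
    filter_upwards [Metric.ball_mem_nhds (0 : ℂ) hr] with δ hδ
    have heq : ∀ w, (∃ δ' ∈ Metric.ball (0 : ℂ) r, G (w + δ') = H δ') →
        ∀ δ' ∈ Metric.ball (0 : ℂ) r, G (w + δ') = H δ' := by
      rintro w ⟨δ', hδ', he⟩ δ'' hδ''
      have h1 : IsChart P (Metric.ball (0 : ℂ) r) (fun δ => G (w + δ)) := by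
        have := (h.shift w).mono (Set.subset_univ (Metric.ball (0 : ℂ) r))
        simpa [add_comm] using this
      exact h1.eqOn Metric.isOpen_ball (convex_ball _ _).isPreconnected hH hδ' he hδ''
    constructor
    · rintro ⟨w, hw⟩
      have := heq (w - δ) ⟨δ, hδ, by simpa using hw⟩ 0 (Metric.mem_ball_self hr)
      exact ⟨_, this.trans hH0⟩
    · rintro ⟨w, hw⟩
      have := heq w ⟨0, Metric.mem_ball_self hr, by simpa [hH0] using hw⟩ δ hδ
      exact ⟨_, this⟩
  have hopen : IsOpen {z : ℂ | P.eval z ≠ 0} := isOpen_ne_fun P.continuous continuous_const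
  set u : Set ℂ := {z | P.eval z ≠ 0 ∧ z ∈ Set.range G} with hu
  set v : Set ℂ := {z | P.eval z ≠ 0 ∧ z ∉ Set.range G} with hv
  have huo : IsOpen u := isOpen_iff_mem_nhds.2 fun y hy => by
    filter_upwards [key y hy.1, hopen.mem_nhds hy.1] with y' h1 h2 using ⟨h2, h1.2 hy.2⟩
  have hvo : IsOpen v := isOpen_iff_mem_nhds.2 fun y hy => by
    filter_upwards [key y hy.1, hopen.mem_nhds hy.1] with y' h1 h2
      using ⟨h2, fun h3 => hy.2 (h1.1 h3)⟩
  rcases (isPreconnected_iff_subset_of_disjoint.1 (isPreconnected_eval_ne_zero hP)) u v huo hvo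
    (fun z hz => by by_cases hzr : z ∈ Set.range G; exacts [Or.inl ⟨hz, hzr⟩, Or.inr ⟨hz, hzr⟩])
    (by ext z; simp only [Set.mem_inter_iff, Set.mem_empty_iff_false, iff_false]
        rintro ⟨-, h1, h2⟩; exact h2.2 h1.2) with h1 | h1
  · exact (h1 hx).2
  · exact absurd ⟨0, rfl⟩ (h1 (h 0 trivial).1).2

namespace FlatModel

variable {m : ℕ} (D : FlatModel m)

/-- An entire chart reaches every regular point, in particular `base 0`. Recentred there it would
extend the ray `0` continuously to the apex, where that ray tends to `∞`. -/
theorem flowDom_ne_univ (z : ℂ) : flowDom D.P z ≠ Set.univ := by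
  intro huniv
  have hG : IsChart D.P Set.univ (flow D.P z) := huniv ▸ isChart_flow
  obtain ⟨w₁, hw₁⟩ := hG.mem_range (D.P_base 0)
  have hG' : IsChart D.P Set.univ (fun w => flow D.P z (w + w₁)) := hG.shift w₁
  have hflow := flow_eq isOpen_univ convex_univ (Set.mem_univ 0) hG' (by simpa using hw₁)
  have hdom : D.rayDom 0 = Set.univ := Set.eq_univ_of_forall fun x =>
    ⟨Set.univ, _, isOpen_univ, convex_univ, trivial, trivial, hG', by simpa using hw₁⟩
  have hcont : ContinuousAt (D.ray 0) 0 :=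
    (D.isChart_ray 0 0 (hdom ▸ trivial)).2.continuousAt
  have hlim : Tendsto (fun t : ℝ => (t : ℂ) * sgn 0) (𝓝[>] 0) (𝓝[≠] 0) := by
    refine tendsto_nhdsWithin_iff.2 ⟨?_, ?_⟩
    · have hc : Continuous fun t : ℝ => (t : ℂ) * sgn 0 := by fun_prop
      have := hc.tendsto 0
      simp only [Complex.ofReal_zero, zero_mul] at this
      exact this.mono_left nhdsWithin_le_nhds
    · filter_upwards [self_mem_nhdsWithin] with t ht
      have : 0 < t := ht
      exact mul_ne_zero (by exact_mod_cast this.ne') (sgn_ne_zero' 0)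
  have h1 := (D.tendsto_cone 0).comp hlim
  have h2 := hcont.tendsto.comp (hlim.mono_right nhdsWithin_le_nhds)
  refine (h2.not_tendsto (Metric.disjoint_nhds_cobounded _)) (h1.congr' ?_)
  filter_upwards [Ioo_mem_nhdsGT (pow_pos D.coord.r_pos (m + 1))] with t ht
  exact (D.ray_eq_cone (D.ofReal_mul_sgn_mem_coneDom 0 ht.1 ht.2)).symm

/-- Every point is reached from the zero along a straight ray. -/
theorem exists_ray_eq {z : ℂ} (hz : D.P.eval z ≠ 0) :
    ∃ n < 2 * (m + 1), ∃ x ∈ D.rayDom n, (x.im ≠ 0 ∨ 0 < x.re * sgn n) ∧ D.ray n x = z := by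
  -- Some trajectory from `z` must break off, hence runs into the zero. Followed backwards it
  -- becomes a ray from the zero to `z`.
  obtain ⟨w, hw⟩ := (Set.ne_univ_iff_exists_notMem _).1 (D.flowDom_ne_univ z)
  obtain ⟨t, ht0, ht1, hd, hinf⟩ := exists_blowup hz hw
  obtain ⟨ξ, hξ, hev⟩ := D.coord.exists_end (v := w) ht0
    (fun s hs => hasDerivAt_flow_ray (hd s ⟨hs.1.le, hs.2⟩))
    (fun s hs => (isChart_flow _ (hd s ⟨hs.1.le, hs.2⟩)).1) hinf
  have hw0 : w ≠ 0 := by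
    rintro rfl
    exact hw (zero_mem_flowDom hz)
  -- The direction `-w` in which the zero is left lies in a cone around a horizontal direction of
  -- orientation `v`; one of the two orientations always avoids the cut.
  obtain ⟨v, hv, hvs⟩ : ∃ v : ℝ, (v = 1 ∨ v = -1) ∧ -w * v ∈ Complex.slitPlane := by
    by_cases h : -w ∈ Complex.slitPlane
    · exact ⟨1, Or.inl rfl, by simpa using h⟩
    · refine ⟨-1, Or.inr rfl, ?_⟩
      rw [Complex.mem_slitPlane_iff] at h ⊢
      push Not at h
      left
      have : (-w).re ≠ 0 := fun h0 => hw0 (neg_eq_zero.1 (Complex.ext h0 h.2))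
      have := lt_of_le_of_ne h.1 this
      simp at this ⊢
      linarith
  have hv2 : (v : ℂ) * v = 1 := by rcases hv with rfl | rfl <;> simp
  have hv0 : (v : ℂ) ≠ 0 := left_ne_zero_of_mul_eq_one hv2
  have hvw : -w * v ≠ 0 := Complex.slitPlane_ne_zero hvs
  have hcp0 : (-w * v) ^ ((m + 1 : ℂ)⁻¹) ≠ 0 := by
    intro h
    have := pow_cpow_inv (m := m) (-w * v)
    rw [h, zero_pow (Nat.succ_ne_zero m)] at this
    exact hvw this.symm
  obtain ⟨n, hn, hξn, hsn⟩ := exists_omega_pow m (ξ := ξ / (-w * v) ^ ((m + 1 : ℂ)⁻¹)) hv (by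
    rw [div_pow, hξ, pow_cpow_inv]
    field_simp
    rw [sq, hv2])
  -- the trajectory, seen from the zero
  set S : Set ℂ := {x | x + t * w ∈ flowDom D.P z} with hS
  have hSo : IsOpen S := isOpen_flowDom.preimage (by fun_prop)
  have hGc : IsChart D.P S (fun x => flow D.P z (x + t * w)) := isChart_flow.shift _
  have hcone : ∀ᶠ s : ℝ in 𝓝[<] t, ((t - s : ℝ) : ℂ) * -w ∈ D.coneDom n ∧
      flow D.P z (((t - s : ℝ) : ℂ) * -w + t * w) = D.ray n (((t - s : ℝ) : ℂ) * -w) := by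
    have hsmall : ∀ᶠ s : ℝ in 𝓝[<] t, ‖((t - s : ℝ) : ℂ) * -w‖ < D.coord.r ^ (m + 1) := by
      have hc : Continuous fun s : ℝ => ‖((t - s : ℝ) : ℂ) * -w‖ := by fun_prop
      have := (hc.tendsto t).mono_left (nhdsWithin_le_nhds (s := Set.Iio t))
      rw [sub_self, Complex.ofReal_zero, zero_mul, norm_zero] at this
      exact this.eventually (gt_mem_nhds (pow_pos D.coord.r_pos _))
    filter_upwards [hev, hsmall, self_mem_nhdsWithin] with s h1 h2 h3
    have h3 : 0 < t - s := sub_pos.2 h3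
    have hmul : ((t - s : ℝ) : ℂ) * -w * sgn n = ((t - s : ℝ) : ℂ) * (-w * v) := by
      rw [hsn]; ring
    have hmem : ((t - s : ℝ) : ℂ) * -w ∈ D.coneDom n := by
      refine ⟨?_, h2⟩
      rw [hmul]
      rw [Complex.mem_slitPlane_iff] at hvs ⊢
      rw [Complex.re_ofReal_mul, Complex.im_ofReal_mul]
      rcases hvs with h | h
      · exact Or.inl (mul_pos h3 h)
      · exact Or.inr (mul_ne_zero h3.ne' h)
    refine ⟨hmem, ?_⟩
    rw [D.ray_eq_cone hmem, cone, hmul, ofReal_mul_cpow h3 (Complex.slitPlane_ne_zero hvs)]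
    have e1 : ((t - s : ℝ) : ℂ) * -w + t * w = s * w := by push_cast; ring
    rw [e1, h1.1]
    congr 1
    rw [← hξn, Complex.ofReal_cpow h3.le]
    push_cast
    field_simp
  have hseg : ∀ s : ℝ, 0 ≤ s → s < t → segment ℝ (((t - s : ℝ) : ℂ) * -w) ((t : ℂ) * -w) ⊆ S := by
    intro s hs0 hst x hx
    rw [segment_eq_image] at hx
    obtain ⟨θ, ⟨hθ0, hθ1⟩, rfl⟩ := hx
    have := hd ((1 - θ) * s) ⟨by nlinarith, by nlinarith⟩
    simp only [hS, Set.mem_ofPred_eq]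
    convert this using 1
    simp
    ring
  obtain ⟨s, ⟨hs1, hs2⟩, hs3⟩ := (hcone.and (Ioo_mem_nhdsLT ht0)).exists
  have hend : flow D.P z ((t : ℂ) * -w + t * w) = z := by
    have : (t : ℂ) * -w + t * w = 0 := by ring
    rw [this, flow_zero hz]
  have hside : ((t : ℂ) * -w).im ≠ 0 ∨ 0 < ((t : ℂ) * -w).re * sgn n := by
    rw [hsn]
    rw [Complex.mem_slitPlane_iff] at hvs
    rw [Complex.re_ofReal_mul, Complex.im_ofReal_mul]
    simp only [Complex.re_mul_ofReal, Complex.im_mul_ofReal] at hvs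
    rcases hvs with h | h
    · right
      rw [mul_assoc]
      exact mul_pos ht0 h
    · left
      exact mul_ne_zero ht0.ne' (left_ne_zero_of_mul h)
  have hfinal : segment ℝ (((t - s : ℝ) : ℂ) * -w) ((t : ℂ) * -w) ⊆ D.rayDom n →
      D.ray n ((t : ℂ) * -w) = z := by
    intro hsub
    rw [← hend]
    exact (hGc.eq_of_segment hSo (D.isOpen_rayDom n) (D.isChart_ray n)
      (hseg s hs3.1.le hs3.2) hsub hs2).symm
  have hts : 0 < t - s := by linarith [hs3.2]
  have hmem : segment ℝ (((t - s : ℝ) : ℂ) * -w) ((t : ℂ) * -w) ⊆ D.rayDom n := by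
    by_cases him : w.im = 0
    · -- the horizontal case
      have hpos : 0 < -w.re * sgn n := by
        rcases hside with h | h
        · simp [him] at h
        · rw [Complex.re_ofReal_mul, mul_assoc] at h
          simpa using (mul_pos_iff_of_pos_left ht0).1 h
      set a := -w.re * sgn n with ha
      have hwa : -w = (a : ℂ) * sgn n := by
        have := sgn_mul_self n
        apply Complex.ext
        · simp [ha, mul_assoc, this]
        · simp [him]
      have hconv : ∀ s : ℝ, (s : ℂ) * -w = ((s * a : ℝ) : ℂ) * sgn n := by
        intro s; rw [hwa]; push_cast; ring
      -- In the horizontal case the ray must not meet the zero before it reaches `z`. If it did at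
      -- distance `T`, it would blow up there, while it agrees with the reversed trajectory, which
      -- is continuous at that point.
      have hrays : ∀ τ : ℝ, 0 < τ → τ ≤ t → (τ : ℂ) * -w ∈ D.rayDom n := by
        intro τ hτ0 hτ1
        rw [hconv]
        by_contra hnot
        obtain ⟨T, hT0, hT1, hTd, hTinf⟩ := D.exists_ray_blowup (mul_pos hτ0 hpos) hnot
        have hTa : T = T / a * a := by field_simp
        have hTat : T / a ≤ t := by rw [div_le_iff₀ hpos]; nlinarith
        have hTS : ((T / a : ℝ) : ℂ) * -w ∈ S := by
          have := hd (t - T / a) ⟨by linarith, by linarith [div_pos hT0 hpos]⟩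
          simp only [hS, Set.mem_ofPred_eq]
          convert this using 1
          push_cast
          ring
        have hagree : ∀ τ' ∈ Set.Ioo 0 T,
            flow D.P z ((τ' : ℂ) * sgn n + t * w) = D.ray n (τ' * sgn n) := by
          intro τ' hτ'
          obtain ⟨s', ⟨hs1', hs2'⟩, hs3'⟩ := (hcone.and (Ioo_mem_nhdsLT
            (show max 0 (t - τ' / a) < t from
              max_lt ht0 (by linarith [div_pos hτ'.1 hpos])))).exists
          have hs'0 : 0 < s' := (le_max_left _ _).trans_lt hs3'.1
          have hs't : s' < t := hs3'.2
          have hs'a : (t - s') * a < τ' := by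
            have := (le_max_right 0 (t - τ' / a)).trans_lt hs3'.1
            rw [← lt_div_iff₀ hpos]; linarith
          rw [hconv] at hs2'
          refine hGc.eq_of_segment hSo (D.isOpen_rayDom n) (D.isChart_ray n) ?_ ?_ hs2'
          · have hsub := hseg s' hs'0.le hs't
            refine fun x hx => hsub ?_
            rw [hconv, hconv]
            rw [segment_eq_image] at hx
            obtain ⟨θ, ⟨hθ0, hθ1⟩, rfl⟩ := hx
            have h1 : τ' ≤ t * a := hτ'.2.le.trans (by rw [hTa]; gcongr)
            have h2 : (t - s') * a < t * a := by nlinarith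
            refine ⟨1 - θ * (τ' - (t - s') * a) / (t * a - (t - s') * a),
              θ * (τ' - (t - s') * a) / (t * a - (t - s') * a), ?_, ?_, by ring, ?_⟩
            · rw [sub_nonneg, div_le_one (by linarith)]
              nlinarith
            · exact div_nonneg (by nlinarith) (by linarith)
            · have h3 : ((t : ℂ) * a - (t - s') * a) ≠ 0 := by
                exact_mod_cast (sub_pos.2 h2).ne'
              simp only [Complex.real_smul]
              have hlam : (θ : ℂ) * (τ' - (t - s') * a) / (t * a - (t - s') * a) *
                  (t * a - (t - s') * a) = θ * (τ' - (t - s') * a) := div_mul_cancel₀ _ h3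
              push_cast
              linear_combination (sgn n : ℂ) * hlam
          · intro x hx
            rw [segment_eq_image] at hx
            obtain ⟨θ, ⟨hθ0, hθ1⟩, rfl⟩ := hx
            have h1 : 0 < (t - s') * a := mul_pos (by linarith) hpos
            have := hTd ((1 - θ) * ((t - s') * a) + θ * τ') ⟨by
              rcases hθ0.eq_or_lt with rfl | h
              · simpa using h1
              · have := mul_pos h hτ'.1
                have := mul_nonneg (sub_nonneg.2 hθ1) h1.le
                linarith, by
              have h2 : (t - s') * a < T := hs'a.trans hτ'.2
              rcases hθ0.eq_or_lt with rfl | h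
              · simpa using h2
              · have := mul_lt_mul_of_pos_left hτ'.2 h
                have := mul_le_mul_of_nonneg_left h2.le (sub_nonneg.2 hθ1)
                linarith⟩
            convert this using 1
            simp only [Complex.real_smul]
            push_cast
            ring
        have hTS' : (T : ℂ) * sgn n ∈ S := by
          rw [hconv, ← hTa] at hTS
          exact hTS
        have hcont : ContinuousAt (fun x => flow D.P z (x + t * w)) ((T : ℂ) * sgn n) :=
          (hGc _ hTS').2.continuousAt
        have hc : Continuous fun τ : ℝ => (τ : ℂ) * sgn n := by fun_prop
        have hl := hcont.tendsto.comp ((hc.tendsto T).mono_left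
          (nhdsWithin_le_nhds (s := Set.Iio T)))
        refine (hl.not_tendsto (Metric.disjoint_nhds_cobounded _)) (hTinf.congr' ?_)
        filter_upwards [Ioo_mem_nhdsLT hT0] with τ' hτ'
        exact (hagree τ' hτ').symm
      intro x hx
      rw [segment_eq_image] at hx
      obtain ⟨θ, ⟨hθ0, hθ1⟩, rfl⟩ := hx
      have := hrays ((1 - θ) * (t - s) + θ * t) (by nlinarith) (by nlinarith [hs3.1])
      convert this using 1
      simp only [Complex.real_smul]
      push_cast
      ring
    · intro x hx
      refine D.mem_rayDom_of_im_ne ?_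
      rw [segment_eq_image] at hx
      obtain ⟨θ, ⟨hθ0, hθ1⟩, rfl⟩ := hx
      have h1 : (1 - θ) * (t - s) + θ * t ≠ 0 := by
        have : 0 < (1 - θ) * (t - s) + θ * t := by nlinarith
        exact this.ne'
      have h2 : ((1 - θ) • (((t - s : ℝ) : ℂ) * -w) + θ • ((t : ℂ) * -w)).im =
          -(((1 - θ) * (t - s) + θ * t) * w.im) := by
        simp
        ring
      rw [h2]
      exact neg_ne_zero.2 (mul_ne_zero h1 him)
  exact ⟨n, hn, (t : ℂ) * -w, hmem (right_mem_segment _ _ _), hside, hfinal hmem⟩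

end FlatModel

/-! ### Petals of the poles of higher order -/

/-- The cofactor `S` in `P = (z - p) ^ d * S`, where `d` is the multiplicity of `p`. -/
noncomputable def rootCofactor (P : Polynomial ℂ) (p : ℂ) : Polynomial ℂ :=
  P /ₘ (Polynomial.X - Polynomial.C p) ^ P.rootMultiplicity p

/-- The coordinate `(z - p) ^ (1 - d)` at a zero `p` of order `d` of `P`, normalized so that its
derivative with respect to `dz / P` tends to `v = ±1` at `p`. -/
noncomputable def petalCoord (P : Polynomial ℂ) (p : ℂ) (v : ℝ) (z : ℂ) : ℂ :=
  ((z - p) ^ (P.rootMultiplicity p - 1))⁻¹ /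
    (-((P.rootMultiplicity p - 1 : ℕ) : ℂ) * (rootCofactor P p).eval p * v)

theorem eval_rootCofactor_ne_zero {P : Polynomial ℂ} (hP : P ≠ 0) (p : ℂ) :
    (rootCofactor P p).eval p ≠ 0 :=
  Polynomial.eval_divByMonic_pow_rootMultiplicity_ne_zero p hP

theorem eval_eq_pow_mul_rootCofactor (P : Polynomial ℂ) (p z : ℂ) :
    P.eval z = (z - p) ^ P.rootMultiplicity p * (rootCofactor P p).eval z := by
  conv_lhs => rw [← Polynomial.pow_mul_divByMonic_rootMultiplicity_eq P p]
  simp [rootCofactor]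

section Petal

variable {P : Polynomial ℂ} {p : ℂ} {v : ℝ}

theorem petalRate_ne_zero (hP : P ≠ 0) (hd : 2 ≤ P.rootMultiplicity p) (hv : v = 1 ∨ v = -1) :
    -((P.rootMultiplicity p - 1 : ℕ) : ℂ) * (rootCofactor P p).eval p * v ≠ 0 := by
  have h1 : ((P.rootMultiplicity p - 1 : ℕ) : ℂ) ≠ 0 := by
    exact_mod_cast (by omega : P.rootMultiplicity p - 1 ≠ 0)
  have h2 : (v : ℂ) ≠ 0 := by rcases hv with rfl | rfl <;> simp
  exact mul_ne_zero (mul_ne_zero (neg_ne_zero.2 h1) (eval_rootCofactor_ne_zero hP p)) h2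

/-- The powers of `z - p` cancel and leave a quotient tending to `1/v = v`. So near the pole the
petal coordinate is almost `v` times the flat coordinate. -/
theorem hasDerivAt_petalCoord (hP : P ≠ 0) (hd : 2 ≤ P.rootMultiplicity p)
    (hv : v = 1 ∨ v = -1) {G : ℂ → ℂ} {w : ℂ} (hne : G w ≠ p)
    (hG : HasDerivAt G (P.eval (G w)) w) :
    HasDerivAt (fun w => petalCoord P p v (G w))
      ((rootCofactor P p).eval (G w) / (rootCofactor P p).eval p / v) w := by
  have hne' : G w - p ≠ 0 := sub_ne_zero.2 hne
  have hS := eval_rootCofactor_ne_zero hP p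
  have hv0 : (v : ℂ) ≠ 0 := by rcases hv with rfl | rfl <;> simp
  obtain ⟨e, he⟩ : ∃ e, P.rootMultiplicity p = e + 2 := ⟨_, (Nat.sub_add_cancel hd).symm⟩
  have h1 := ((((hG.sub_const p).fun_pow (e + 1)).fun_inv (pow_ne_zero _ hne'))).div_const
    (-((e + 1 : ℕ) : ℂ) * (rootCofactor P p).eval p * v)
  have he1 : (e : ℂ) + 1 ≠ 0 := by exact_mod_cast Nat.succ_ne_zero e
  simp only [petalCoord, he, show e + 2 - 1 = e + 1 by omega]
  refine h1.congr_deriv ?_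
  rw [eval_eq_pow_mul_rootCofactor P p, he]
  push_cast
  field_simp
  ring

/-- A large petal coordinate forces `z` close to `p`, where the derivative of the petal coordinate
is within `1/8` of `v` by continuity. -/
theorem exists_petalCoord_bound (hP : P ≠ 0) (hd : 2 ≤ P.rootMultiplicity p)
    (hv : v = 1 ∨ v = -1) {r : ℝ} (hr : 0 < r) :
    ∃ M > 0, ∀ z, z ≠ p → M ≤ ‖petalCoord P p v z‖ →
      ‖z - p‖ < r ∧ ‖(rootCofactor P p).eval z / (rootCofactor P p).eval p / v - v‖ ≤ 1 / 8 := by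
  have hS := eval_rootCofactor_ne_zero hP p
  have hc0 := petalRate_ne_zero hP hd hv
  set c := -((P.rootMultiplicity p - 1 : ℕ) : ℂ) * (rootCofactor P p).eval p * v with hc
  have hc0' : 0 < ‖c‖ := norm_pos_iff.2 hc0
  have hcont : Continuous fun z => (rootCofactor P p).eval z / (rootCofactor P p).eval p :=
    (rootCofactor P p).continuous.div_const _
  have hev := Metric.continuous_iff.1 hcont p (1 / 8) (by norm_num)
  obtain ⟨δ, hδ, hball⟩ := hev
  have hmin : 0 < min δ r := lt_min hδ hr
  refine ⟨2 / ((min δ r) ^ (P.rootMultiplicity p - 1) * ‖c‖), by positivity, fun z hz hM => ?_⟩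
  have hz0 : 0 < ‖z - p‖ := norm_pos_iff.2 (sub_ne_zero.2 hz)
  have hlt : ‖z - p‖ < min δ r := by
    rw [petalCoord, ← hc, norm_div, norm_inv, norm_pow, le_div_iff₀ hc0'] at hM
    have h1 : 2 / ((min δ r) ^ (P.rootMultiplicity p - 1) * ‖c‖) * ‖c‖ =
        2 * ((min δ r) ^ (P.rootMultiplicity p - 1))⁻¹ := by field_simp
    rw [h1] at hM
    have h2 : ((min δ r) ^ (P.rootMultiplicity p - 1))⁻¹ <
        (‖z - p‖ ^ (P.rootMultiplicity p - 1))⁻¹ := by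
      have : 0 < ((min δ r) ^ (P.rootMultiplicity p - 1))⁻¹ := by positivity
      linarith
    exact lt_of_pow_lt_pow_left₀ _ hmin.le ((inv_lt_inv₀ (by positivity) (by positivity)).1 h2)
  refine ⟨hlt.trans_le (min_le_right _ _), ?_⟩
  have h3 := hball z (by rw [dist_eq_norm]; exact hlt.trans_le (min_le_left _ _))
  rw [div_self hS, dist_eq_norm] at h3
  rcases hv with rfl | rfl
  · simpa using h3.le
  · have : (rootCofactor P p).eval z / (rootCofactor P p).eval p / ((-1 : ℝ) : ℂ) - ((-1 : ℝ) : ℂ) =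
        -((rootCofactor P p).eval z / (rootCofactor P p).eval p - 1) := by
      push_cast; ring
    rw [this, norm_neg]
    exact h3.le

/-- The sector of opening angle `3π / 2` around the direction `v`. -/
def sector (v : ℝ) : Set ℂ := {w | 0 ≤ w.re * v + |w.im|}

theorem smul_mem_sector {w : ℂ} (hw : w ∈ sector v) {t : ℝ} (ht : 0 ≤ t) :
    (t : ℂ) * w ∈ sector v := by
  simp only [sector, Set.mem_ofPred_eq, Complex.re_ofReal_mul, Complex.im_ofReal_mul, abs_mul,
    abs_of_nonneg ht] at *
  nlinarith

/-- Elements of the sector make an angle of at least `π/4` with `-v`, so `R + v w` stays at distance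
at least `1/√2` times `R` and `‖w‖` from the origin. -/
theorem sq_le_of_mem_sector (hv : v = 1 ∨ v = -1) {w : ℂ} (hw : w ∈ sector v) {R : ℝ}
    (hR : 0 < R) : ‖w‖ ^ 2 ≤ 2 * ‖(R : ℂ) + v * w‖ ^ 2 ∧ R ^ 2 ≤ 2 * ‖(R : ℂ) + v * w‖ ^ 2 := by
  have hv2 : v * v = 1 := by rcases hv with rfl | rfl <;> norm_num
  have e1 : ‖w‖ ^ 2 = w.re ^ 2 + w.im ^ 2 := by
    rw [← Complex.normSq_eq_norm_sq, Complex.normSq_apply]; ring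
  have e2 : ‖(R : ℂ) + v * w‖ ^ 2 = (R + v * w.re) ^ 2 + w.im ^ 2 := by
    rw [← Complex.normSq_eq_norm_sq, Complex.normSq_apply]
    simp
    linear_combination (w.im ^ 2) * hv2
  simp only [sector, Set.mem_ofPred_eq] at hw
  have e3 : w.re ^ 2 = (w.re * v) ^ 2 := by linear_combination -(w.re ^ 2) * hv2
  have e4 : w.im ^ 2 = |w.im| ^ 2 := (sq_abs _).symm
  rw [e1, e2, e3, e4]
  have h0 := abs_nonneg w.im
  set a := w.re * v with ha
  rw [show v * w.re = a by rw [ha]; ring]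
  set b := |w.im|
  rcases le_total 0 a with h | h
  · constructor <;> nlinarith [mul_nonneg hR.le h]
  · constructor
    · nlinarith [sq_nonneg (2 * R + 2 * a)]
    · nlinarith [sq_nonneg (R + 2 * a)]

theorem norm_petalCoord_ge (hv : v = 1 ∨ v = -1) {w : ℂ} (hw : w ∈ sector v) {R : ℝ}
    (hR : 0 < R) {g : ℂ} (hg : ‖g - (R + v * w)‖ ≤ ‖w‖ / 4) : R / 5 ≤ ‖g‖ ∧ ‖w‖ / 5 ≤ ‖g‖ := by
  obtain ⟨h1, h2⟩ := sq_le_of_mem_sector hv hw hR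
  have h3 : ‖(R : ℂ) + v * w‖ ≤ ‖g‖ + ‖w‖ / 4 := by
    have := norm_sub_norm_le ((R : ℂ) + v * w) g
    rw [norm_sub_rev] at this
    linarith
  set N := ‖(R : ℂ) + v * w‖
  have hN : 0 ≤ N := norm_nonneg _
  have h4 : ‖w‖ ≤ 3 / 2 * N := by
    have := norm_nonneg w
    nlinarith
  have h5 : R ≤ 3 / 2 * N := by nlinarith
  constructor <;> linarith

theorem petalCoord_mem_slitPlane (hv : v = 1 ∨ v = -1) {w : ℂ} (hw : w ∈ sector v) {R : ℝ}
    (hR : 0 < R) {g : ℂ} (hg : ‖g - (R + v * w)‖ ≤ ‖w‖ / 4) : g ∈ Complex.slitPlane := by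
  have hv2 : v * v = 1 := by rcases hv with rfl | rfl <;> norm_num
  have h1 := (Complex.abs_re_le_norm _).trans hg
  have h2 := (Complex.abs_im_le_norm _).trans hg
  simp at h1 h2
  rw [Complex.mem_slitPlane_iff]
  by_contra! hcon
  obtain ⟨hre, him⟩ := hcon
  rw [him] at h2
  have h3 : |w.im| ≤ ‖w‖ / 4 := by
    have : |0 - v * w.im| = |w.im| := by
      rw [zero_sub, abs_neg, abs_mul]
      rcases hv with rfl | rfl <;> simp
    rwa [this] at h2
  have h4 : ‖w‖ ^ 2 = (v * w.re) ^ 2 + |w.im| ^ 2 := by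
    rw [← Complex.normSq_eq_norm_sq, Complex.normSq_apply, sq_abs]
    linear_combination -(w.re ^ 2) * hv2
  have h5 := (abs_le.1 h1).1
  have h6 : R + v * w.re ≤ ‖w‖ / 4 := by linarith
  simp only [sector, Set.mem_ofPred_eq] at hw
  have h7 : -|w.im| ≤ v * w.re := by linarith
  have h8 : (v * w.re) ^ 2 ≤ (‖w‖ / 4) ^ 2 := sq_le_sq' (by linarith) (by linarith)
  have h9 : |w.im| ^ 2 ≤ (‖w‖ / 4) ^ 2 := pow_le_pow_left₀ (abs_nonneg _) h3 2
  have h10 : ‖w‖ = 0 := by nlinarith [sq_nonneg ‖w‖, norm_nonneg w]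
  rw [h10] at h3 h6 h8
  nlinarith [abs_nonneg w.im]

/-- Straight trajectories starting deep in a petal of the pole `p` do not leave the sector around
the direction of the petal. -/
theorem flow_petal (hP : P ≠ 0) (hd : 2 ≤ P.rootMultiplicity p) (hv : v = 1 ∨ v = -1) {r M : ℝ}
    (hM : ∀ z, z ≠ p → M ≤ ‖petalCoord P p v z‖ →
      ‖z - p‖ < r ∧ ‖(rootCofactor P p).eval z / (rootCofactor P p).eval p / v - v‖ ≤ 1 / 8)
    {R : ℝ} (hR0 : 0 < R) (hR : 5 * M ≤ R) {z₁ : ℂ} (hz₁ : P.eval z₁ ≠ 0)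
    (hg : petalCoord P p v z₁ = R) {w : ℂ} (hw : w ∈ sector v) :
    w ∈ flowDom P z₁ ∧ ‖petalCoord P p v (flow P z₁ w) - (R + v * w)‖ ≤ ‖w‖ / 4 := by
  have hp : P.eval p = 0 := by
    have := (Polynomial.rootMultiplicity_pos hP).1 (by omega : 0 < P.rootMultiplicity p)
    exact this
  rcases eq_or_ne w 0 with rfl | hw0
  · refine ⟨zero_mem_flowDom hz₁, ?_⟩
    rw [flow_zero hz₁, hg]; simp
  have hwn : 0 < ‖w‖ := norm_pos_iff.2 hw0
  have hne : ∀ {t : ℝ}, (t : ℂ) * w ∈ flowDom P z₁ → flow P z₁ (t * w) ≠ p := fun h1 h2 =>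
    (isChart_flow _ h1).1 (by rw [h2, hp])
  -- A barrier argument. When the error reaches `‖w‖ t / 4`, the petal coordinate is still at least
  -- `R / 5 ≥ M`, so the error grows at rate at most `‖w‖ / 8`.
  have hb : ∀ T : ℝ, 0 ≤ T → (T : ℂ) * w ∈ flowDom P z₁ →
      ‖petalCoord P p v (flow P z₁ (T * w)) - (R + v * (T * w))‖ ≤ ‖w‖ / 4 * T := by
    intro T hT0 hT
    have hdom : ∀ t ∈ Set.Icc 0 T, (t : ℂ) * w ∈ flowDom P z₁ := by
      intro t ht
      rcases hT0.eq_or_lt with h | h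
      · obtain rfl : t = T := le_antisymm ht.2 (h ▸ ht.1)
        exact hT
      · have := smul_mem_flowDom hT (s := t / T)
          ⟨div_nonneg ht.1 h.le, (div_le_one h).2 ht.2⟩
        convert this using 1
        rw [← mul_assoc]
        congr 1
        have : (T : ℂ) ≠ 0 := by exact_mod_cast h.ne'
        push_cast
        field_simp
    have hder : ∀ t ∈ Set.Icc 0 T,
        HasDerivAt (fun t : ℝ => petalCoord P p v (flow P z₁ (t * w)) - (R + v * (t * w)))
          (w * ((rootCofactor P p).eval (flow P z₁ (t * w)) / (rootCofactor P p).eval p / v - v))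
          t := by
      intro t ht
      have h1 : HasDerivAt (fun s : ℝ => (s : ℂ) * w) w t := by
        simpa using (Complex.ofRealCLM.hasDerivAt (x := t)).mul_const w
      have h2 := (hasDerivAt_petalCoord hP hd hv (hne (hdom t ht))
        (isChart_flow _ (hdom t ht)).2).scomp t h1
      have h3 := h2.sub ((h1.const_mul (v : ℂ)).const_add (R : ℂ))
      refine h3.congr_deriv ?_
      simp only [smul_eq_mul]
      ring
    refine image_norm_le_of_norm_deriv_right_lt_deriv_boundary' (a := 0) (b := T)
      (B := fun t => ‖w‖ / 4 * t) (B' := fun _ => ‖w‖ / 4)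
      (f := fun t : ℝ => petalCoord P p v (flow P z₁ (t * w)) - (R + v * (t * w)))
      (fun t ht => (hder t ht).continuousAt.continuousWithinAt)
      (fun t ht => (hder t ⟨ht.1, ht.2.le⟩).hasDerivWithinAt) ?_
      (by fun_prop) (fun t _ => ?_) (fun t ht heq => ?_) ⟨hT0, le_rfl⟩
    · simp [flow_zero hz₁, hg]
    · simpa using ((hasDerivAt_id t).const_mul (‖w‖ / 4)).hasDerivWithinAt
    · have h1 : M ≤ ‖petalCoord P p v (flow P z₁ (t * w))‖ := by
        have := (norm_petalCoord_ge hv (smul_mem_sector hw ht.1) hR0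
          (g := petalCoord P p v (flow P z₁ (t * w))) (by
            rw [heq, norm_mul, Complex.norm_real, Real.norm_of_nonneg ht.1]; linarith)).1
        linarith
      have h2 := (hM _ (hne (hdom t ⟨ht.1, ht.2.le⟩)) h1).2
      rw [norm_mul]
      nlinarith
  -- The estimate confines the trajectory to the ball of radius `r` around `p`, which is
  -- incompatible with a blow-up.
  have hdom : w ∈ flowDom P z₁ := by
    by_contra hnot
    obtain ⟨T, hT0, hT1, hd', hinf⟩ := exists_blowup hz₁ hnot
    have hbd : ∀ᶠ s : ℝ in 𝓝[<] T, ‖flow P z₁ (s * w)‖ ≤ ‖p‖ + r := by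
      filter_upwards [Ioo_mem_nhdsLT hT0] with s hs
      have h0 := hd' s ⟨hs.1.le, hs.2⟩
      have h1 := (norm_petalCoord_ge hv (smul_mem_sector hw hs.1.le) hR0
          (g := petalCoord P p v (flow P z₁ (s * w))) (by
            rw [norm_mul, Complex.norm_real, Real.norm_of_nonneg hs.1.le]
            linarith [hb s hs.1.le h0])).1
      have h2 := (hM _ (hne h0) (by linarith)).1
      have := norm_sub_norm_le (flow P z₁ (s * w)) p
      linarith
    have h3 := (tendsto_norm_cobounded_atTop.comp hinf).eventually (eventually_gt_atTop (‖p‖ + r))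
    obtain ⟨s, h4, h5⟩ := (hbd.and h3).exists
    exact absurd h5 (not_lt.2 h4)
  refine ⟨hdom, ?_⟩
  have := hb 1 zero_le_one (by simpa using hdom)
  simpa using this

end Petal

theorem starConvex_sector (v : ℝ) : StarConvex ℝ 0 (sector v) := by
  rw [starConvex_zero_iff]
  intro w hw t h0 _
  simpa using smul_mem_sector hw h0

theorem exists_root_separation {P : Polynomial ℂ} (hP : P ≠ 0) (p : ℂ) :
    ∃ r > 0, ∀ q, P.eval q = 0 → q ≠ p → r ≤ ‖p - q‖ := by
  have hfin : ({q | P.IsRoot q} \ {p}).Finite :=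
    (Polynomial.finite_setOfPred_isRoot hP).subset Set.sdiff_subset
  obtain ⟨r, hr, hball⟩ := Metric.isOpen_iff.1 hfin.isClosed.isOpen_compl p (by simp)
  refine ⟨r, hr, fun q hq hqp => ?_⟩
  by_contra! hlt
  exact hball (show q ∈ Metric.ball p r by rwa [mem_ball_iff_norm']) ⟨hq, hqp⟩

/-- A sector of opening angle `3π / 2` around the ray in direction `sgn n`, with apex at distance
`A` from the origin. -/
def wedge (n : ℕ) (A : ℝ) : Set ℂ := {x | A < x.re * sgn n + |x.im|}

theorem isOpen_wedge (n : ℕ) (A : ℝ) : IsOpen (wedge n A) :=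
  isOpen_lt continuous_const
    ((Complex.continuous_re.mul_const _).add Complex.continuous_im.abs)

theorem ofReal_mul_sgn_mem_wedge {n : ℕ} {A t : ℝ} (h : A < t) : (t : ℂ) * sgn n ∈ wedge n A := by
  have : ((t : ℂ) * sgn n).re * sgn n = t := by simp [mul_assoc, sgn_mul_self]
  simp only [wedge, Set.mem_ofPred_eq, this]
  simpa using h

theorem starConvex_wedge (n : ℕ) {A t : ℝ} (h : A < t) :
    StarConvex ℝ ((t : ℂ) * sgn n) (wedge n A) := by
  intro y hy a b ha hb hab
  simp only [wedge, Set.mem_ofPred_eq] at *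
  have e1 : (a • ((t : ℂ) * sgn n) + b • y).re * sgn n = a * t + b * (y.re * sgn n) := by
    have := sgn_mul_self n
    simp
    linear_combination (a * t) * this
  have e2 : |(a • ((t : ℂ) * sgn n) + b • y).im| = b * |y.im| := by
    simp [abs_mul, abs_of_nonneg hb]
  rw [e1, e2]
  obtain rfl : a = 1 - b := by linarith
  rcases hb.eq_or_lt with rfl | hb
  · simpa using h
  · nlinarith

theorem isPreconnected_wedge (n : ℕ) (A : ℝ) : IsPreconnected (wedge n A) :=
  starConvex_isPreconnected (starConvex_wedge n (lt_add_one A))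

namespace FlatModel

variable {m : ℕ} (D : FlatModel m)

theorem P_ne_zero : D.P ≠ 0 := by
  intro h
  have := D.natDegree_P
  simp [h] at this

theorem ofReal_mul_sgn_mem_rayDom {n : ℕ} {t s : ℝ} (hs : 0 < s) (hst : s ≤ t)
    (ht : (t : ℂ) * sgn n ∈ D.rayDom n) : (s : ℂ) * sgn n ∈ D.rayDom n := by
  rcases lt_or_ge s (D.coord.r ^ (m + 1)) with h | h
  · exact D.coneDom_subset n (D.ofReal_mul_sgn_mem_coneDom n hs h)
  · have h1 : D.eps < s := D.eps_lt.trans_le h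
    have h2 : 0 < t - D.eps := by linarith
    have := (D.starConvex_rayDom n) ht (a := (t - s) / (t - D.eps)) (b := (s - D.eps) / (t - D.eps))
      (div_nonneg (by linarith) h2.le) (div_nonneg (by linarith) h2.le) (by field_simp; ring)
    convert this using 1
    have h3 : (t : ℂ) - D.eps ≠ 0 := by exact_mod_cast h2.ne'
    simp only [Complex.real_smul]
    push_cast
    field_simp
    ring

/-- The infinite ray `n` converges to the pole `p`, inside the petal given by the branch `ρ` of the
root of the petal coordinate. -/
structure Petal (n : ℕ) (p ρ : ℂ) : Prop where
  two_le : 2 ≤ D.P.rootMultiplicity p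
  exists_wedge : ∃ A > 0, ∃ C, ∀ x ∈ wedge n A, x ∈ D.rayDom n ∧
    petalCoord D.P p (sgn n) (D.ray n x) ∈ Complex.slitPlane ∧
    ‖petalCoord D.P p (sgn n) (D.ray n x) - sgn n * x‖ ≤ ‖x‖ / 4 + C ∧
    (∀ q, D.P.eval q = 0 → q ≠ p → ‖D.ray n x - p‖ < ‖p - q‖) ∧
    (D.ray n x - p)⁻¹ = ρ * petalCoord D.P p (sgn n) (D.ray n x) ^
      (((D.P.rootMultiplicity p - 1 : ℕ) : ℂ)⁻¹)

theorem tendsto_ray_zero (n : ℕ) :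
    Tendsto (fun t : ℝ => D.ray n (t * sgn n)) (𝓝[>] 0) (Bornology.cobounded ℂ) := by
  have h1 : Tendsto (fun t : ℝ => (t : ℂ) * sgn n) (𝓝[>] 0) (𝓝[≠] 0) := by
    refine tendsto_nhdsWithin_iff.2 ⟨?_, ?_⟩
    · have hc : Continuous fun t : ℝ => (t : ℂ) * sgn n := by fun_prop
      have := (hc.tendsto 0).mono_left (nhdsWithin_le_nhds (s := Set.Ioi 0))
      simpa using this
    · filter_upwards [self_mem_nhdsWithin] with t ht
      exact mul_ne_zero (by exact_mod_cast ht.ne') (sgn_ne_zero' n)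
  refine ((D.tendsto_cone n).comp h1).congr' ?_
  filter_upwards [Ioo_mem_nhdsGT (pow_pos D.coord.r_pos (m + 1))] with t ht
  exact (D.ray_eq_cone (D.ofReal_mul_sgn_mem_coneDom n ht.1 ht.2)).symm

/-- Every petal of a pole contains an infinite ray. -/
theorem exists_petal {p ρ : ℂ} {v : ℝ} (hd : 2 ≤ D.P.rootMultiplicity p) (hv : v = 1 ∨ v = -1)
    (hρ : ρ ^ (D.P.rootMultiplicity p - 1) =
      -((D.P.rootMultiplicity p - 1 : ℕ) : ℂ) * (rootCofactor D.P p).eval p * v) :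
    ∃ n < 2 * (m + 1), sgn n = v ∧ D.Infinite n ∧ D.Petal n p ρ := by
  have hP := D.P_ne_zero
  have hc0 := petalRate_ne_zero hP hd hv
  set e := D.P.rootMultiplicity p - 1 with he
  have he0 : e ≠ 0 := by omega
  have hρ0 : ρ ≠ 0 := by
    rintro rfl
    rw [zero_pow he0] at hρ
    exact hc0 hρ.symm
  obtain ⟨r, hr, hsep⟩ := exists_root_separation hP p
  obtain ⟨M, hM0, hM⟩ := exists_petalCoord_bound hP hd hv hr
  set R := 5 * M with hR
  have hR0 : 0 < R := by positivity
  have hRpow : ((R : ℂ) ^ ((e : ℂ)⁻¹)) ^ e = R := Complex.cpow_nat_inv_pow _ he0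
  have hRpow0 : (R : ℂ) ^ ((e : ℂ)⁻¹) ≠ 0 := by
    intro h
    rw [h, zero_pow he0] at hRpow
    exact hR0.ne' (by exact_mod_cast hRpow.symm)
  -- A point deep in the petal: its petal coordinate is the real number `R`, and `(z₁ - p)⁻¹` lies
  -- on the branch given by `ρ`.
  set z₁ := p + (ρ * (R : ℂ) ^ ((e : ℂ)⁻¹))⁻¹ with hz₁
  have hz₁p : (z₁ - p)⁻¹ = ρ * (R : ℂ) ^ ((e : ℂ)⁻¹) := by rw [hz₁]; simp
  have hne₁ : z₁ ≠ p := by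
    intro h
    rw [h, sub_self, inv_zero] at hz₁p
    exact mul_ne_zero hρ0 hRpow0 hz₁p.symm
  have hg₁ : petalCoord D.P p v z₁ = R := by
    rw [petalCoord, ← he, ← inv_pow, hz₁p, mul_pow, hρ, hRpow]
    exact mul_div_cancel_left₀ _ hc0
  have hPne : ∀ z, z ≠ p → ‖z - p‖ < r → D.P.eval z ≠ 0 := by
    intro z h1 h2 h3
    have := hsep z h3 h1
    rw [norm_sub_rev] at this
    linarith
  have hPz₁ : D.P.eval z₁ ≠ 0 := hPne z₁ hne₁ (hM z₁ hne₁ (by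
    rw [hg₁, Complex.norm_real, Real.norm_of_nonneg hR0.le]; linarith)).1
  have hflow := fun w hw => flow_petal hP hd hv hM hR0 le_rfl hPz₁ hg₁ (w := w) hw
  have hp : D.P.eval p = 0 := by
    have := (Polynomial.rootMultiplicity_pos hP).1 (by omega : 0 < D.P.rootMultiplicity p)
    exact this
  have hnep : ∀ w ∈ sector v, flow D.P z₁ w ≠ p := fun w hw h =>
    (isChart_flow _ (hflow w hw).1).1 (by rw [h, hp])
  have hnear : ∀ w ∈ sector v, ‖flow D.P z₁ w - p‖ < r := fun w hw =>
    (hM _ (hnep w hw) (by linarith [(norm_petalCoord_ge hv hw hR0 (hflow w hw).2).1])).1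
  have hslit : ∀ w ∈ sector v, petalCoord D.P p v (flow D.P z₁ w) ∈ Complex.slitPlane :=
    fun w hw => petalCoord_mem_slitPlane hv hw hR0 (hflow w hw).2
  have hflowc : ContinuousOn (flow D.P z₁) (sector v) := fun w hw =>
    (isChart_flow _ (hflow w hw).1).2.continuousAt.continuousWithinAt
  have hgc : ContinuousOn (fun w => petalCoord D.P p v (flow D.P z₁ w)) (sector v) := by
    refine ContinuousOn.div_const (ContinuousOn.inv₀ ((hflowc.sub continuousOn_const).pow _) ?_) _
    intro w hw
    exact pow_ne_zero _ (sub_ne_zero.2 (hnep w hw))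
  have hcpow0 : ∀ w ∈ sector v,
      petalCoord D.P p v (flow D.P z₁ w) ^ ((e : ℂ)⁻¹) ≠ 0 := fun w hw h => by
    rw [Complex.cpow_eq_zero_iff] at h
    exact Complex.slitPlane_ne_zero (hslit w hw) h.1
  have h0sec : (0 : ℂ) ∈ sector v := by simp [sector]
  -- the branch of the root is constant
  have hbranch : ∀ w ∈ sector v, (flow D.P z₁ w - p)⁻¹ =
      ρ * petalCoord D.P p v (flow D.P z₁ w) ^ ((e : ℂ)⁻¹) := by
    intro w hw
    have hconst := eqOn_const_of_pow_eq (starConvex_isPreconnected (starConvex_sector v))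
      (g := fun w => (flow D.P z₁ w - p)⁻¹ / petalCoord D.P p v (flow D.P z₁ w) ^ ((e : ℂ)⁻¹))
      (ContinuousOn.div (ContinuousOn.inv₀ (hflowc.sub continuousOn_const)
        fun w hw => sub_ne_zero.2 (hnep w hw))
        (hgc.cpow continuousOn_const hslit) hcpow0) he0
      (c := -(e : ℂ) * (rootCofactor D.P p).eval p * v) (fun w hw => by
        rw [div_pow, Complex.cpow_nat_inv_pow _ he0, inv_pow]
        have h1 : petalCoord D.P p v (flow D.P z₁ w) ≠ 0 := Complex.slitPlane_ne_zero (hslit w hw)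
        rw [div_eq_iff h1, petalCoord, ← he, mul_div_cancel₀ _ hc0]) hw h0sec
    simp only [flow_zero hPz₁, hg₁, hz₁p] at hconst
    rw [mul_div_cancel_right₀ _ hRpow0, div_eq_iff (hcpow0 w hw)] at hconst
    exact hconst
  -- a point of the petal on a ray
  set τ : ℝ := Real.log ‖D.E z₁‖ / (2 * Real.pi) with hτ
  set w₀ : ℂ := τ * Complex.I with hw₀
  have hw₀re : w₀.re = 0 := by simp [hw₀]
  have hw₀im : w₀.im = τ := by simp [hw₀]
  have hw₀s : w₀ ∈ sector v := by simp [sector, hw₀re]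
  -- The vertical displacement `τ` brings `|E|` to `1`, the level of the zero. The ray that reaches
  -- this point is therefore horizontal.
  have hE₀ : ‖D.E (flow D.P z₁ w₀)‖ = 1 := by
    rw [D.E_flow hPz₁ (hflow w₀ hw₀s).1, norm_mul, norm_exp_two_pi_mul, hw₀im, hτ,
      mul_div_cancel₀ _ (by positivity), Real.exp_neg, Real.exp_log]
    · exact mul_inv_cancel₀ (norm_ne_zero_iff.2 (D.E_ne _ hPz₁))
    · exact norm_pos_iff.2 (D.E_ne _ hPz₁)
  obtain ⟨n, hn, x₀, hx₀, hx₀', hx₀z⟩ := D.exists_ray_eq (isChart_flow _ (hflow w₀ hw₀s).1).1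
  have hx₀im : x₀.im = 0 := by
    rw [← hx₀z, D.E_ray hx₀, norm_exp_two_pi_mul, Real.exp_eq_one_iff] at hE₀
    have := Real.pi_pos
    nlinarith
  have hx₀re : 0 < x₀.re * sgn n := hx₀'.resolve_left (fun h => h hx₀im)
  set t₀ := x₀.re * sgn n with ht₀
  have hss := sgn_mul_self n
  have hss' := sgn_mul_self' n
  have hx₀t : x₀ = t₀ * sgn n := by
    apply Complex.ext
    · simp [ht₀, mul_assoc, hss]
    · simp [hx₀im]
  have hshift : IsChart D.P {x | x + (w₀ - x₀) ∈ flowDom D.P z₁}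
      (fun x => flow D.P z₁ (x + (w₀ - x₀))) := isChart_flow.shift _
  have hshiftO : IsOpen {x | x + (w₀ - x₀) ∈ flowDom D.P z₁} :=
    isOpen_flowDom.preimage (by fun_prop)
  have hstart : D.ray n (t₀ * sgn n) = flow D.P z₁ (t₀ * sgn n + (w₀ - x₀)) := by
    rw [← hx₀t, hx₀z]
    congr 1
    ring
  have hsegment : ∀ a b : ℝ, segment ℝ ((a : ℂ) * sgn n) ((b : ℂ) * sgn n) ⊆
      (fun s : ℝ => (s : ℂ) * sgn n) '' Set.uIcc a b := by
    intro a b y hy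
    rw [← segment_eq_uIcc, segment_eq_image]
    rw [segment_eq_image] at hy
    obtain ⟨θ, hθ, rfl⟩ := hy
    refine ⟨_, ⟨θ, hθ, rfl⟩, ?_⟩
    simp only [Complex.real_smul, smul_eq_mul]
    push_cast
    ring
  have hsec : ∀ t : ℝ, 0 ≤ (t - t₀) * (sgn n * v) →
      (t : ℂ) * sgn n + (w₀ - x₀) ∈ sector v := by
    intro t ht
    have e1 : ((t : ℂ) * sgn n + (w₀ - x₀)).re = (t - t₀) * sgn n := by
      rw [hx₀t]
      simp [hw₀re]
      ring
    simp only [sector, Set.mem_ofPred_eq, e1]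
    have := abs_nonneg ((t : ℂ) * sgn n + (w₀ - x₀)).im
    nlinarith
  have hagree : ∀ t : ℝ, (∀ s ∈ Set.uIcc t₀ t, (s : ℂ) * sgn n ∈ D.rayDom n) →
      0 ≤ (t - t₀) * (sgn n * v) →
      D.ray n (t * sgn n) = flow D.P z₁ (t * sgn n + (w₀ - x₀)) := by
    intro t ht htv
    refine (D.isChart_ray n).eq_of_segment (D.isOpen_rayDom n) hshiftO hshift ?_ ?_ hstart
    · intro y hy
      obtain ⟨s, hs, rfl⟩ := hsegment _ _ hy
      exact ht s hs
    · intro y hy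
      obtain ⟨s, hs, rfl⟩ := hsegment _ _ hy
      refine (hflow _ (hsec s ?_)).1
      rcases Set.mem_uIcc.1 hs with ⟨h1, h2⟩ | ⟨h1, h2⟩
      · rcases (sub_nonneg.2 (h1.trans h2)).eq_or_lt with h | h
        · obtain rfl : s = t₀ := by linarith
          simp
        · have := (mul_nonneg_iff_of_pos_left h).1 htv
          exact mul_nonneg (by linarith) this
      · rcases (sub_nonneg.2 (h1.trans h2)).eq_or_lt with h | h
        · obtain rfl : s = t₀ := by linarith
          simp
        · have : sgn n * v ≤ 0 := by
            by_contra! hpos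
            nlinarith
          exact mul_nonneg_of_nonpos_of_nonpos (by linarith) this
  have hbdd : ∀ {l : Filter ℝ} [l.NeBot], (∀ᶠ t : ℝ in l, D.ray n (t * sgn n) =
      flow D.P z₁ (t * sgn n + (w₀ - x₀)) ∧ 0 ≤ (t - t₀) * (sgn n * v)) →
      ¬ Tendsto (fun t : ℝ => D.ray n (t * sgn n)) l (Bornology.cobounded ℂ) := by
    intro l _ hl hinf
    have h3 := (tendsto_norm_cobounded_atTop.comp hinf).eventually (eventually_gt_atTop (‖p‖ + r))
    obtain ⟨t, ⟨h4, h5⟩, h6⟩ := (hl.and h3).exists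
    have h7 := hnear _ (hsec t h5)
    rw [← h4] at h7
    have := norm_sub_norm_le (D.ray n (t * sgn n)) p
    simp only [Function.comp] at h6
    linarith
  have hx₀D : (t₀ : ℂ) * sgn n ∈ D.rayDom n := hx₀t ▸ hx₀
  -- With the opposite orientation, going back along the ray would mean moving in direction `v`. The
  -- path would stay in the sector, bounded near `p`, all the way to the zero, which lies at `∞`.
  have hsgn : sgn n = v := by
    by_contra hne
    have hneg : sgn n * v = -1 := by
      rcases sgn_eq n with h | h <;> rcases hv with h' | h' <;> rw [h, h'] at hne ⊢ <;> norm_num at *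
    refine hbdd ?_ (D.tendsto_ray_zero n)
    filter_upwards [Ioo_mem_nhdsGT hx₀re] with t ht
    have h1 : 0 ≤ (t - t₀) * (sgn n * v) := by
      rw [hneg]; linarith [ht.2]
    refine ⟨hagree t (fun s hs => ?_) h1, h1⟩
    rw [Set.uIcc_of_ge ht.2.le] at hs
    exact D.ofReal_mul_sgn_mem_rayDom (ht.1.trans_le hs.1) hs.2 hx₀D
  have hsv : sgn n * v = 1 := by rw [← hsgn, hss]
  -- Beyond `t₀` the ray moves within the sector, hence stays near `p` and cannot return to the
  -- zero.
  have hinf : D.Infinite n := by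
    intro T₀ hT₀
    by_contra hnot
    obtain ⟨T, hT0, hT1, hTd, hTinf⟩ := D.exists_ray_blowup hT₀ hnot
    have hlt : t₀ < T := by
      by_contra! hle
      exact D.not_tendsto_cobounded_of_mem (D.ofReal_mul_sgn_mem_rayDom hT0 hle hx₀D) hTinf
    refine hbdd ?_ hTinf
    filter_upwards [Ioo_mem_nhdsLT hlt] with t ht
    have h1 : 0 ≤ (t - t₀) * (sgn n * v) := by
      rw [hsv]; linarith [ht.1]
    refine ⟨hagree t (fun s hs => ?_) h1, h1⟩
    rw [Set.uIcc_of_le ht.1.le] at hs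
    exact hTd s ⟨hx₀re.trans_le hs.1, hs.2.trans_lt ht.2⟩
  subst hsgn
  have hA0 : 0 < t₀ + |τ| := by positivity
  have hwsec : ∀ x ∈ wedge n (t₀ + |τ|), x + (w₀ - x₀) ∈ sector (sgn n) := by
    intro x hx
    simp only [wedge, sector, Set.mem_ofPred_eq] at *
    have e1 : (x + (w₀ - x₀)).re * sgn n = x.re * sgn n - t₀ := by
      rw [ht₀]; simp [hw₀re]; ring
    have e2 : (x + (w₀ - x₀)).im = x.im + τ := by simp [hw₀im, hx₀im]
    rw [e1, e2]
    have : |x.im| ≤ |x.im + τ| + |τ| := by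
      have := abs_sub (x.im + τ) τ
      simpa using this
    linarith
  have hwdom : wedge n (t₀ + |τ|) ⊆ D.rayDom n := by
    intro x hx
    by_cases him : x.im = 0
    · simp only [wedge, Set.mem_ofPred_eq, him, abs_zero, add_zero] at hx
      have := hinf _ (hA0.trans hx)
      convert this using 1
      apply Complex.ext
      · simp [mul_assoc, hss]
      · simp [him]
    · exact D.mem_rayDom_of_im_ne him
  have hwmem : ((t₀ + |τ| + 1 : ℝ) : ℂ) * sgn n ∈ wedge n (t₀ + |τ|) :=
    ofReal_mul_sgn_mem_wedge (lt_add_one _)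
  have heq : Set.EqOn (D.ray n) (fun x => flow D.P z₁ (x + (w₀ - x₀))) (wedge n (t₀ + |τ|)) := by
    refine ((D.isChart_ray n).mono hwdom).eqOn (isOpen_wedge _ _) (isPreconnected_wedge _ _)
      (hshift.mono fun x hx => (hflow _ (hwsec x hx)).1) hwmem ?_
    refine hagree _ (fun s hs => hinf s ?_) ?_
    · rw [Set.uIcc_of_le (by linarith [abs_nonneg τ])] at hs
      exact hx₀re.trans_le hs.1
    · rw [hsv]; linarith [abs_nonneg τ]
  refine ⟨n, hn, rfl, hinf, hd, t₀ + |τ|, hA0, R + 2 * ‖w₀ - x₀‖, fun x hx => ?_⟩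
  rw [heq hx]
  refine ⟨hwdom hx, hslit _ (hwsec x hx), ?_, fun q hq hqp =>
    (hnear _ (hwsec x hx)).trans_le (hsep q hq hqp), hbranch _ (hwsec x hx)⟩
  have h1 := (hflow _ (hwsec x hx)).2
  have h2 : petalCoord D.P p (sgn n) (flow D.P z₁ (x + (w₀ - x₀))) - sgn n * x =
      (petalCoord D.P p (sgn n) (flow D.P z₁ (x + (w₀ - x₀))) -
        (R + sgn n * (x + (w₀ - x₀)))) + (R + sgn n * (w₀ - x₀)) := by ring
  rw [h2]
  have h3 := norm_add_le (petalCoord D.P p (sgn n) (flow D.P z₁ (x + (w₀ - x₀))) -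
        (R + sgn n * (x + (w₀ - x₀)))) ((R : ℂ) + sgn n * (w₀ - x₀))
  have h4 := norm_add_le (R : ℂ) (sgn n * (w₀ - x₀))
  rw [norm_mul, norm_sgn, one_mul, Complex.norm_real, Real.norm_of_nonneg hR0.le] at h4
  have h5 := norm_add_le x (w₀ - x₀)
  have h6 := norm_nonneg (w₀ - x₀)
  linarith

end FlatModel

/-! ### Counting horizontal rays against petals -/

theorem sgn_eq_iff {n n' : ℕ} : sgn n = sgn n' ↔ n % 2 = n' % 2 := by
  rcases Nat.even_or_odd n with h | h <;> rcases Nat.even_or_odd n' with h' | h' <;>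
    simp only [sgn, h.neg_one_pow, h'.neg_one_pow] <;> norm_num <;>
    simp only [Nat.even_iff, Nat.odd_iff] at h h' <;> omega

theorem card_filter_sgn_le (m : ℕ) (v : ℝ) :
    ((Finset.range (2 * (m + 1))).filter (fun n => sgn n = v)).card ≤ m + 1 := by
  refine (Finset.card_le_card_of_injOn (t := Finset.range (m + 1)) (fun n => n / 2)
    (fun n hn => ?_) (fun n hn n' hn' h => ?_)).trans_eq (Finset.card_range _)
  · simp only [Finset.coe_filter, Finset.mem_range, Set.mem_ofPred_eq] at hn
    simp only [Finset.coe_range, Set.mem_Iio]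
    omega
  · simp only [Finset.coe_filter, Finset.mem_range, Set.mem_ofPred_eq] at hn hn' h
    have := sgn_eq_iff.1 (hn.2.trans hn'.2.symm)
    omega

/-- The case `e = 0`, where there are no roots by convention, expresses that a simple pole has no
petals. -/
theorem card_toFinset_nthRoots {e : ℕ} {a : ℂ} (ha : e ≠ 0 → a ≠ 0) :
    (Polynomial.nthRoots e a).toFinset.card = e := by
  rcases Nat.eq_zero_or_pos e with rfl | he
  · simp
  · obtain ⟨α, hα⟩ := IsAlgClosed.exists_pow_nat_eq a he
    have hζ := Complex.isPrimitiveRoot_exp e he.ne'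
    rw [Multiset.toFinset_card_of_nodup (hζ.nthRoots_nodup (ha he.ne')), hζ.card_nthRoots, if_pos ⟨α, hα⟩]

namespace FlatModel

variable {m : ℕ} {D : FlatModel m}

theorem Petal.tendsto_petalCoord {n : ℕ} {p ρ : ℂ} (h : D.Petal n p ρ) :
    Tendsto (fun t : ℝ => ‖petalCoord D.P p (sgn n) (D.ray n (t * sgn n))‖) atTop atTop := by
  obtain ⟨A, hA, C, hw⟩ := h.exists_wedge
  have h1 : Tendsto (fun t : ℝ => 3 / 4 * t - C) atTop atTop :=
    tendsto_atTop_add_const_right _ _ (tendsto_id.const_mul_atTop (by norm_num))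
  refine tendsto_atTop_mono' _ ?_ h1
  filter_upwards [eventually_gt_atTop A] with t ht
  have h2 := (hw _ (ofReal_mul_sgn_mem_wedge (n := n) ht)).2.2.1
  have h3 : (sgn n : ℂ) * (t * sgn n) = t := by linear_combination (t : ℂ) * sgn_mul_self' n
  rw [h3, norm_mul, norm_sgn, mul_one, Complex.norm_real,
    Real.norm_of_nonneg (hA.trans ht).le] at h2
  have h4 := norm_sub_norm_le (t : ℂ) (petalCoord D.P p (sgn n) (D.ray n (t * sgn n)))
  rw [norm_sub_rev, Complex.norm_real, Real.norm_of_nonneg (hA.trans ht).le] at h4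
  linarith

theorem Petal.tendsto {n : ℕ} {p ρ : ℂ} (h : D.Petal n p ρ) :
    Tendsto (fun t : ℝ => D.ray n (t * sgn n)) atTop (𝓝 p) := by
  obtain ⟨A, hA, C, hw⟩ := h.exists_wedge
  rw [Metric.tendsto_nhds]
  intro r hr
  obtain ⟨M, hM0, hM⟩ := exists_petalCoord_bound D.P_ne_zero h.two_le (sgn_eq n) hr
  filter_upwards [h.tendsto_petalCoord.eventually_ge_atTop M, eventually_gt_atTop A] with t h1 h2
  rw [dist_eq_norm]
  refine (hM _ ?_ h1).1
  intro hp
  have h3 := D.isChart_ray n _ (hw _ (ofReal_mul_sgn_mem_wedge (n := n) h2)).1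
  rw [hp] at h3
  exact h3.1 ((Polynomial.rootMultiplicity_pos D.P_ne_zero).1
    (by have := h.two_le; omega : 0 < D.P.rootMultiplicity p))

theorem Petal.unique {n : ℕ} {p ρ p' ρ' : ℂ} (h : D.Petal n p ρ) (h' : D.Petal n p' ρ') :
    p = p' ∧ ρ = ρ' := by
  obtain rfl := tendsto_nhds_unique h.tendsto h'.tendsto
  refine ⟨rfl, ?_⟩
  obtain ⟨A, hA, C, hw⟩ := h.exists_wedge
  obtain ⟨A', hA', C', hw'⟩ := h'.exists_wedge
  set t := max A A' + 1
  have h1 := hw _ (ofReal_mul_sgn_mem_wedge (n := n) (t := t)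
    (by have := le_max_left A A'; simp only [t]; linarith))
  have h2 := hw' _ (ofReal_mul_sgn_mem_wedge (n := n) (t := t)
    (by have := le_max_right A A'; simp only [t]; linarith))
  have h3 := h1.2.2.2.2.symm.trans h2.2.2.2.2
  refine mul_right_cancel₀ (fun h0 => ?_) h3
  rw [Complex.cpow_eq_zero_iff] at h0
  exact Complex.slitPlane_ne_zero h1.2.1 h0.1

/-- If there are enough finite rays, all other rays are infinite and end in petals. -/
theorem petal_of_card (D : FlatModel m) {v : ℝ} (hv : v = 1 ∨ v = -1) {F : Finset ℕ}
    (hF : ∀ n ∈ F, n < 2 * (m + 1) ∧ sgn n = v ∧ ¬ D.Infinite n)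
    (hcard : D.P.roots.toFinset.card ≤ F.card + 1) {n : ℕ} (hn : n < 2 * (m + 1))
    (hnv : sgn n = v) (hnF : n ∉ F) : D.Infinite n ∧ ∃ p ρ, D.Petal n p ρ := by
  classical
  set a : ℂ → ℂ := fun p =>
    -((D.P.rootMultiplicity p - 1 : ℕ) : ℂ) * (rootCofactor D.P p).eval p * v with ha
  -- The petals of orientation `v`: a pole of order `d` together with one of the `d - 1` branches of
  -- the root. Their number is `m + 2` minus the number of poles.
  set S : Finset (Σ _ : ℂ, ℂ) := D.P.roots.toFinset.sigma fun p =>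
    (Polynomial.nthRoots (D.P.rootMultiplicity p - 1) (a p)).toFinset with hS
  have hScard : S.card + D.P.roots.toFinset.card = m + 2 := by
    rw [hS, Finset.card_sigma]
    have h1 : ∀ p ∈ D.P.roots.toFinset,
        (Polynomial.nthRoots (D.P.rootMultiplicity p - 1) (a p)).toFinset.card =
          D.P.rootMultiplicity p - 1 := fun p _ => card_toFinset_nthRoots fun h =>
      petalRate_ne_zero D.P_ne_zero (by omega) hv
    rw [Finset.sum_congr rfl h1, Finset.card_eq_sum_ones, ← Finset.sum_add_distrib]
    have h2 : ∀ p ∈ D.P.roots.toFinset,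
        D.P.rootMultiplicity p - 1 + 1 = D.P.roots.count p := fun p hp => by
      rw [Polynomial.count_roots]
      have : 0 < D.P.rootMultiplicity p :=
        (Polynomial.rootMultiplicity_pos D.P_ne_zero).2
          (Polynomial.isRoot_of_mem_roots (Multiset.mem_toFinset.1 hp))
      omega
    rw [Finset.sum_congr rfl h2, Multiset.toFinset_sum_count_eq,
      IsAlgClosed.card_roots_eq_natDegree, D.natDegree_P]
  have hex : ∀ x ∈ S, ∃ n < 2 * (m + 1), sgn n = v ∧ D.Infinite n ∧ D.Petal n x.1 x.2 := by
    intro x hx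
    rw [hS, Finset.mem_sigma, Multiset.mem_toFinset (a := x.2)] at hx
    have hpos : 0 < D.P.rootMultiplicity x.1 - 1 := by
      by_contra h0
      rw [Nat.eq_zero_of_not_pos h0] at hx
      simp at hx
    exact D.exists_petal (by omega) hv ((Polynomial.mem_nthRoots hpos).1 hx.2)
  choose! f hf1 hf2 hf3 hf4 using hex
  have hinj : Set.InjOn f S := by
    intro x hx y hy hxy
    have h1 := hf4 y hy
    rw [← hxy] at h1
    obtain ⟨h2, h3⟩ := (hf4 x hx).unique h1
    exact Sigma.ext h2 (heq_of_eq h3)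
  set N := (Finset.range (2 * (m + 1))).filter (fun n => sgn n = v) with hN
  have hsub : F ∪ S.image f ⊆ N := by
    intro k hk
    rw [hN, Finset.mem_filter, Finset.mem_range]
    rcases Finset.mem_union.1 hk with hk | hk
    · exact ⟨(hF k hk).1, (hF k hk).2.1⟩
    · obtain ⟨x, hx, rfl⟩ := Finset.mem_image.1 hk
      exact ⟨hf1 x hx, hf2 x hx⟩
  have hdisj : Disjoint F (S.image f) := by
    rw [Finset.disjoint_left]
    intro k hk hk'
    obtain ⟨x, hx, rfl⟩ := Finset.mem_image.1 hk'
    exact (hF _ hk).2.2 (hf3 x hx)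
  -- Different petals have different rays, and finite rays are not infinite. The two disjoint
  -- families have at least `m + 1` members together, which is all there is room for.
  have heq : F ∪ S.image f = N := by
    refine Finset.eq_of_subset_of_card_le hsub ?_
    rw [Finset.card_union_of_disjoint hdisj, Finset.card_image_of_injOn hinj]
    have := card_filter_sgn_le m v
    rw [← hN] at this
    omega
  have hnN : n ∈ F ∪ S.image f := by
    rw [heq, hN, Finset.mem_filter, Finset.mem_range]
    exact ⟨hn, hnv⟩
  rcases Finset.mem_union.1 hnN with h | h
  · exact absurd h hnF
  · obtain ⟨x, hx, rfl⟩ := Finset.mem_image.1 h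
    exact ⟨hf3 x hx, x.1, x.2, hf4 x hx⟩

end FlatModel

/-! ### The residue read off from the rays inside a loop -/

theorem log_eq_log_neg_add {y : ℂ} (hy : 0 < y.im) :
    Complex.log y = Complex.log (-y) + Real.pi * Complex.I := by
  rw [Complex.log, Complex.log, norm_neg, Complex.arg_neg_eq_arg_sub_pi_of_im_pos hy]
  push_cast
  ring

theorem petalCoord_neg (P : Polynomial ℂ) (p : ℂ) (v : ℝ) (z : ℂ) :
    petalCoord P p (-v) z = -petalCoord P p v z := by
  simp only [petalCoord]
  push_cast
  rw [mul_neg, div_neg]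

namespace FlatModel

variable {m : ℕ} {D : FlatModel m}

theorem Petal.exists_near {n : ℕ} {p ρ : ℂ} (h : D.Petal n p ρ) :
    ∃ A > 0, ∀ r > 0, ∃ B, ∀ x ∈ wedge n A, B ≤ ‖x‖ → ‖D.ray n x - p‖ < r := by
  obtain ⟨A, hA, C, hw⟩ := h.exists_wedge
  refine ⟨A, hA, fun r hr => ?_⟩
  obtain ⟨M, hM0, hM⟩ := exists_petalCoord_bound D.P_ne_zero h.two_le (sgn_eq n) hr
  refine ⟨2 * (M + C), fun x hx hB => ?_⟩
  obtain ⟨h1, h2, h3, -⟩ := hw x hx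
  refine (hM _ (fun hp => ?_) ?_).1
  · have h3 := D.isChart_ray n _ h1
    rw [hp] at h3
    exact h3.1 ((Polynomial.rootMultiplicity_pos D.P_ne_zero).1
      (by have := h.two_le; omega : 0 < D.P.rootMultiplicity p))
  · have h4 := norm_sub_norm_le ((sgn n : ℂ) * x) (petalCoord D.P p (sgn n) (D.ray n x))
    rw [norm_sub_rev, norm_mul, norm_sgn, one_mul] at h4
    have := norm_nonneg x
    linarith

/-- A vertical path going up on the left of the ray `n`. -/
theorem norm_vertical (n : ℕ) {τ : ℝ} (hτ : 0 ≤ τ) : ‖(τ : ℂ) * Complex.I * sgn n‖ = τ := by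
  rw [norm_mul, norm_sgn]
  simp [abs_of_nonneg hτ]

theorem im_vertical (n : ℕ) (τ : ℝ) : ((τ : ℂ) * Complex.I * sgn n).im = τ * sgn n := by simp

theorem abs_sgn (n : ℕ) : |sgn n| = 1 := by
  rcases sgn_eq n with h | h <;> simp [h]

theorem vertical_add_mem_wedge (n n' : ℕ) (s A : ℝ) {τ : ℝ} (h0 : 0 ≤ τ) (h : A + |s| < τ) :
    (τ : ℂ) * Complex.I * sgn n + s ∈ wedge n' A := by
  have h1 : ((τ : ℂ) * Complex.I * sgn n + s).re = s := by simp
  have h2 : |((τ : ℂ) * Complex.I * sgn n + s).im| = τ := by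
    simp [abs_mul, abs_sgn, abs_of_nonneg h0]
  have h3 : -|s| ≤ s * sgn n' := by
    have := neg_abs_le (s * sgn n')
    rwa [abs_mul, abs_sgn, mul_one] at this
  simp only [wedge, Set.mem_ofPred_eq, h1, h2]
  linarith

/-- Wedges open by more than a half-turn, so far up in the common half-plane lie points close to
both poles. The translation `s` permits the same conclusion across a saddle connection. -/
theorem Petal.eq_of_adjacent {n n' : ℕ} {p ρ p' ρ' : ℂ} (h : D.Petal n p ρ)
    (h' : D.Petal n' p' ρ') {s : ℝ}
    (heq : ∀ x : ℂ, 0 < x.im * sgn n → D.ray n x = D.ray n' (x + s)) : p = p' := by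
  obtain ⟨A, hA, hw⟩ := h.exists_near
  obtain ⟨A', hA', hw'⟩ := h'.exists_near
  by_contra hne
  have hr : 0 < ‖p - p'‖ / 2 := half_pos (norm_pos_iff.2 (sub_ne_zero.2 hne))
  obtain ⟨B, hB⟩ := hw _ hr
  obtain ⟨B', hB'⟩ := hw' _ hr
  set τ := A + A' + |s| + |B| + |B'| + 1 with hτ
  have h1 := le_abs_self B
  have h2 := le_abs_self B'
  have h3 := abs_nonneg s
  have h4 := abs_nonneg B
  have h5 := abs_nonneg B'
  have hτ0 : 0 < τ := by linarith
  have e1 := hB (τ * Complex.I * sgn n) (by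
    simpa using vertical_add_mem_wedge n n 0 A hτ0.le (by rw [abs_zero]; linarith))
    (by rw [norm_vertical n hτ0.le]; linarith)
  have e2 := hB' (τ * Complex.I * sgn n + s)
    (vertical_add_mem_wedge n n' s A' hτ0.le (by linarith)) (by
      have := norm_sub_norm_le ((τ : ℂ) * Complex.I * sgn n) (-(s : ℂ))
      rw [norm_vertical n hτ0.le, norm_neg, Complex.norm_real, Real.norm_eq_abs, sub_neg_eq_add]
        at this
      linarith)
  rw [heq _ (by rw [im_vertical, mul_assoc, sgn_mul_self]; linarith)] at e1
  have e3 := norm_sub_le (D.ray n' (τ * Complex.I * sgn n + s) - p')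
    (D.ray n' (τ * Complex.I * sgn n + s) - p)
  rw [sub_sub_sub_cancel_left] at e3
  linarith

open Classical in
/-- A branch of `log (z - q)` along the ray `n`, ending in a petal of `p`. -/
noncomputable def petalLog (D : FlatModel m) (n : ℕ) (p q x : ℂ) : ℂ :=
  if p = q then -Complex.log (petalCoord D.P p (sgn n) (D.ray n x)) /
    (D.P.rootMultiplicity p - 1 : ℕ)
  else Complex.log ((D.ray n x - q) / (p - q))

/-- At the pole itself the petal coordinate is a constant times `(z - p)^(1-d)`, so its logarithm
divided by `1 - d` differentiates like `log (z - p)`. For another pole `q`, the disc about `p`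
containing the petal misses `q`, and `(z - q)/(p - q)` stays within distance `1` of `1`. -/
theorem hasDerivAt_petalLog {n : ℕ} {p q x : ℂ} (hd : 2 ≤ D.P.rootMultiplicity p)
    (hq : D.P.eval q = 0) (hx : x ∈ D.rayDom n)
    (hs : petalCoord D.P p (sgn n) (D.ray n x) ∈ Complex.slitPlane)
    (hnear : q ≠ p → ‖D.ray n x - p‖ < ‖p - q‖) :
    HasDerivAt (D.petalLog n p q) (D.P.eval (D.ray n x) / (D.ray n x - q)) x := by
  obtain ⟨hP, hder⟩ := D.isChart_ray n x hx
  by_cases hpq : p = q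
  · subst hpq
    have hne : D.ray n x ≠ p := fun h => hP (by rw [h, hq])
    have h1 := hasDerivAt_petalCoord D.P_ne_zero hd (sgn_eq n) hne hder
    have h2 := (h1.clog hs).neg.div_const ((D.P.rootMultiplicity p - 1 : ℕ) : ℂ)
    have heq : D.petalLog n p p = fun x =>
        (-fun w => Complex.log (petalCoord D.P p (sgn n) (D.ray n w))) x /
          ((D.P.rootMultiplicity p - 1 : ℕ) : ℂ) := by
      funext x
      simp [petalLog]
    rw [heq]
    refine h2.congr_deriv ?_
    obtain ⟨e, he⟩ : ∃ e, D.P.rootMultiplicity p = e + 2 := ⟨_, (Nat.sub_add_cancel hd).symm⟩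
    have hS := eval_rootCofactor_ne_zero D.P_ne_zero p
    have hv := sgn_ne_zero' n
    have hne' := sub_ne_zero.2 hne
    have he1 : (e : ℂ) + 1 ≠ 0 := by exact_mod_cast Nat.succ_ne_zero e
    have hS' : (rootCofactor D.P p).eval (D.ray n x) ≠ 0 := by
      intro h
      rw [eval_eq_pow_mul_rootCofactor D.P p, h, mul_zero] at hP
      exact hP rfl
    rw [eval_eq_pow_mul_rootCofactor D.P p, petalCoord, he, show e + 2 - 1 = e + 1 by omega]
    push_cast
    field_simp
    ring
  · have hpq' : p - q ≠ 0 := sub_ne_zero.2 hpq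
    have hne : D.ray n x - q ≠ 0 := sub_ne_zero.2 fun h => hP (by rw [h, hq])
    have hslit : (D.ray n x - q) / (p - q) ∈ Complex.slitPlane := by
      suffices h : ‖(D.ray n x - q) / (p - q) - 1‖ < 1 by
        simpa using Complex.mem_slitPlane_of_norm_lt_one h
      have : (D.ray n x - q) / (p - q) - 1 = (D.ray n x - p) / (p - q) := by
        field_simp; ring
      rw [this, norm_div, div_lt_one (norm_pos_iff.2 hpq')]
      exact hnear (Ne.symm hpq)
    have h1 := ((hder.sub_const q).div_const (p - q)).clog hslit
    have heq : D.petalLog n p q = fun x => Complex.log ((D.ray n x - q) / (p - q)) := by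
      funext x
      simp [petalLog, hpq]
    rw [heq]
    refine h1.congr_deriv ?_
    field_simp

/-- The integration constant of the flat coordinate at the end of a petal. -/
def PetalConst (D : FlatModel m) (n : ℕ) (p c : ℂ) : Prop :=
  ∃ A > 0, ∃ C, ∀ x ∈ wedge n A,
    ‖petalCoord D.P p (sgn n) (D.ray n x) - sgn n * x‖ ≤ ‖x‖ / 4 + C ∧
    x - D.K (D.ray n x) - (2 * Real.pi * Complex.I)⁻¹ *
      (D.petalLog n p D.q₀ x - D.petalLog n p D.q₁ x) = c

theorem Petal.exists_petalConst {n : ℕ} {p ρ : ℂ} (h : D.Petal n p ρ) :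
    ∃ c, D.PetalConst n p c := by
  obtain ⟨A, hA, C, hw⟩ := h.exists_wedge
  set Φ : ℂ → ℂ := fun x => x - D.K (D.ray n x) - (2 * Real.pi * Complex.I)⁻¹ *
      (D.petalLog n p D.q₀ x - D.petalLog n p D.q₁ x) with hΦ
  have hder : ∀ x ∈ wedge n A, HasDerivAt Φ 0 x := by
    intro x hx
    obtain ⟨h1, h2, h3, h4, h5⟩ := hw x hx
    obtain ⟨hP, hd⟩ := D.isChart_ray n x h1
    have hk := (D.deriv_K _ hP).comp x hd
    have hl₀ := hasDerivAt_petalLog h.two_le D.P_q₀ h1 h2 (h4 _ D.P_q₀)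
    have hl₁ := hasDerivAt_petalLog h.two_le D.P_q₁ h1 h2 (h4 _ D.P_q₁)
    have := ((hasDerivAt_id x).sub hk).sub ((hl₀.sub hl₁).const_mul (2 * Real.pi * Complex.I)⁻¹)
    refine this.congr_deriv ?_
    have e1 : (D.P.eval (D.ray n x))⁻¹ * D.P.eval (D.ray n x) = 1 := inv_mul_cancel₀ hP
    linear_combination -e1
  refine ⟨Φ (((A + 1 : ℝ) : ℂ) * sgn n), A, hA, C, fun x hx => ⟨(hw x hx).2.2.1, ?_⟩⟩
  exact (isOpen_wedge n A).is_const_of_deriv_eq_zero (isPreconnected_wedge n A)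
    (fun y hy => (hder y hy).differentiableAt.differentiableWithinAt)
    (fun y hy => (hder y hy).deriv) hx (ofReal_mul_sgn_mem_wedge (lt_add_one A))

-- In the next petal the normalized coordinate changes sign, so its principal logarithm jumps by
-- `πi`. Only the logarithm at `p` itself is affected, and division by `d - 1` and by `2πi` leaves
-- the jump `1 / (2(d - 1))`.
open Classical in
theorem PetalConst.adjacent {n n' : ℕ} {p c c' : ℂ} (h : D.PetalConst n p c)
    (h' : D.PetalConst n' p c') (hs : sgn n' = -sgn n) {s : ℝ}
    (heq : ∀ x : ℂ, 0 < x.im * sgn n → D.ray n x = D.ray n' (x + s)) :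
    c = c' - s + ((if p = D.q₀ then 1 else 0) - (if p = D.q₁ then 1 else 0)) /
      (2 * (D.P.rootMultiplicity p - 1 : ℕ)) := by
  obtain ⟨A, hA, C, hw⟩ := h
  obtain ⟨A', hA', C', hw'⟩ := h'
  set τ := A + A' + |s| + 4 * |C| + 1 with hτ
  have h1 := le_abs_self C
  have h3 := abs_nonneg s
  have h4 := abs_nonneg C
  have hτ0 : 0 < τ := by linarith
  obtain ⟨e1, e2⟩ := hw (τ * Complex.I * sgn n) (by
    simpa using vertical_add_mem_wedge n n 0 A hτ0.le (by rw [abs_zero]; linarith))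
  obtain ⟨-, e4⟩ := hw' (τ * Complex.I * sgn n + s)
    (vertical_add_mem_wedge n n' s A' hτ0.le (by linarith))
  have e5 := heq (τ * Complex.I * sgn n)
    (by rw [im_vertical, mul_assoc, sgn_mul_self]; linarith)
  have him : 0 < (petalCoord D.P p (sgn n) (D.ray n (τ * Complex.I * sgn n))).im := by
    have e6 : (sgn n : ℂ) * (τ * Complex.I * sgn n) = τ * Complex.I := by
      linear_combination (τ : ℂ) * Complex.I * sgn_mul_self' n
    rw [e6, norm_vertical n hτ0.le] at e1
    have e7 := (abs_le.1 ((Complex.abs_im_le_norm _).trans e1)).1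
    simp at e7
    linarith
  have hlog : ∀ q, D.petalLog n p q (τ * Complex.I * sgn n) =
      D.petalLog n' p q (τ * Complex.I * sgn n + s) -
        (if p = q then 1 else 0) * (Real.pi * Complex.I / (D.P.rootMultiplicity p - 1 : ℕ)) := by
    intro q
    simp only [petalLog]
    split_ifs with hpq
    · rw [log_eq_log_neg_add him, ← petalCoord_neg, ← hs, e5]
      ring
    · rw [e5]; ring
  rw [hlog, hlog, e5] at e2
  have hpi : (Real.pi : ℂ) ≠ 0 := by exact_mod_cast Real.pi_ne_zero
  have e8 : (2 * Real.pi * Complex.I)⁻¹ * (Real.pi * Complex.I / (D.P.rootMultiplicity p - 1 : ℕ)) =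
      1 / (2 * (D.P.rootMultiplicity p - 1 : ℕ)) := by
    rw [mul_inv, mul_inv, div_eq_mul_inv, one_div, mul_inv]
    field_simp
  rw [← e2, ← e4]
  linear_combination ((if p = D.q₀ then 1 else 0) - (if p = D.q₁ then 1 else 0)) * e8

/-- The `2a` rays cut off by the loop converge to one pole `p`. Crossing the half-planes between
them and finally the one closed up by the loop changes the integration constant `2a` times by `δ /
(2e)`, where `e + 1` is the order of `p`; the total must be the holonomy `sgn n`. Hence `a δ = e sgn
n`, where `δ` is `1` at `q₀`, `-1` at `q₁` and `0` elsewhere. -/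
theorem rootMultiplicity_of_loop (D : FlatModel m) {n a : ℕ} (ha : 1 ≤ a)
    (hg : D.Glue n (n + 2 * a + 1) 1)
    (h : ∀ j, 1 ≤ j → j ≤ 2 * a → ∃ p ρ, D.Petal (n + j) p ρ) :
    (sgn n = 1 → D.P.rootMultiplicity D.q₀ = a + 1) ∧
      (sgn n = -1 → D.P.rootMultiplicity D.q₁ = a + 1) := by
  classical
  obtain ⟨p, ρ, h1⟩ := h 1 le_rfl (by omega)
  have hsucc : ∀ k (x : ℂ), 0 < x.im * sgn k → D.ray k x = D.ray (k + 1) (x + ((0 : ℝ) : ℂ)) :=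
    fun k x hx => by rw [D.ray_succ hx]; simp
  obtain ⟨c, hc⟩ := h1.exists_petalConst
  set δ : ℂ := (if p = D.q₀ then 1 else 0) - (if p = D.q₁ then 1 else 0) with hδ
  set e : ℕ := D.P.rootMultiplicity p - 1 with he
  -- Between consecutive rays there is no translation: the pole is the same, and the constant drops
  -- by `δ / (2e)`.
  have hchain : ∀ j, 1 ≤ j → j ≤ 2 * a → (∃ ρ, D.Petal (n + j) p ρ) ∧
      D.PetalConst (n + j) p (c - (j - 1) * (δ / (2 * e))) := by
    intro j hj
    induction j, hj using Nat.le_induction with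
    | base => intro _; exact ⟨⟨ρ, h1⟩, by simpa using hc⟩
    | succ j hj ih =>
      intro hj'
      obtain ⟨⟨ρj, hpj⟩, hcj⟩ := ih (by omega)
      obtain ⟨p', ρ', hp'⟩ := h (j + 1) (by omega) hj'
      obtain rfl := hpj.eq_of_adjacent hp' (hsucc _)
      refine ⟨⟨ρ', hp'⟩, ?_⟩
      obtain ⟨c', hc'⟩ := hp'.exists_petalConst
      have h2 := hcj.adjacent hc' (sgn_succ _) (hsucc _)
      rw [← hδ, ← he] at h2
      convert hc' using 1
      push_cast at h2 ⊢
      linear_combination h2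
  obtain ⟨⟨ρ', hp⟩, hlast⟩ := hchain (2 * a) (by omega) le_rfl
  have hsn : sgn (n + 2 * a) = sgn n := sgn_eq_iff.2 (by omega)
  -- The half-plane after the last enclosed ray is bounded by the returning ray. Crossing to the
  -- departing ray along the saddle connection identifies it, up to translation by `sgn n`, with the
  -- half-plane before the first enclosed ray.
  have hclose : ∀ x : ℂ, 0 < x.im * sgn (n + 2 * a) →
      D.ray (n + 2 * a) x = D.ray (n + 1) (x + sgn n) := by
    intro x hx
    have hx0 : x.im ≠ 0 := fun h => by simp [h] at hx
    rw [D.ray_succ hx, ← hg.ray_eq x (Or.inl hx0)]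
    rw [hsn] at hx
    rw [D.ray_succ (by simpa using hx)]
    simp
  have hfin := hlast.adjacent hc (by rw [hsn, sgn_succ]) hclose
  rw [← hδ, ← he] at hfin
  have he0 : (e : ℂ) ≠ 0 := by
    have := hp.two_le
    exact_mod_cast (by omega : e ≠ 0)
  have hmain : (a : ℂ) * δ = e * sgn n := by
    push_cast at hfin
    field_simp at hfin
    linear_combination (-1 / 2) * hfin
  have hmult : D.P.rootMultiplicity p = e + 1 := by
    have := hp.two_le
    omega
  have hne := D.q_ne
  constructor
  · intro hs
    rw [hs] at hmain
    by_cases h0 : p = D.q₀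
    · have : p ≠ D.q₁ := h0 ▸ hne
      rw [hδ, if_pos h0, if_neg this] at hmain
      rw [← h0, hmult]
      have : (a : ℂ) = e := by simpa using hmain
      have : a = e := by exact_mod_cast this
      omega
    · exfalso
      rw [hδ, if_neg h0] at hmain
      by_cases h1 : p = D.q₁
      · rw [if_pos h1] at hmain
        have : (a : ℂ) + e = 0 := by push_cast at hmain; linear_combination -hmain
        have : a + e = 0 := by exact_mod_cast this
        omega
      · rw [if_neg h1] at hmain
        exact he0 (by simpa using hmain.symm)
  · intro hs
    rw [hs] at hmain
    by_cases h1 : p = D.q₁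
    · have : p ≠ D.q₀ := h1 ▸ hne.symm
      rw [hδ, if_pos h1, if_neg this] at hmain
      rw [← h1, hmult]
      have : (a : ℂ) = e := by push_cast at hmain; linear_combination -hmain
      have : a = e := by exact_mod_cast this
      omega
    · exfalso
      rw [hδ, if_neg h1] at hmain
      by_cases h0 : p = D.q₀
      · rw [if_pos h0] at hmain
        have : (a : ℂ) + e = 0 := by push_cast at hmain; linear_combination hmain
        have : a + e = 0 := by exact_mod_cast this
        omega
      · rw [if_neg h0] at hmain
        exact he0 (by simpa using hmain)

end FlatModel

/-! ### The combinatorics of the rays determines all identifications -/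

/-- The open half-plane on the side `s = ±1` of the real line. -/
def halfPlane (s : ℝ) : Set ℂ := {x | 0 < x.im * s}

theorem isOpen_halfPlane (s : ℝ) : IsOpen (halfPlane s) :=
  isOpen_lt continuous_const (Complex.continuous_im.mul_const _)

theorem convex_halfPlane (s : ℝ) : Convex ℝ (halfPlane s) := by
  intro y hy z hz a b ha hb hab
  simp only [halfPlane, Set.mem_ofPred_eq] at *
  have : (a • y + b • z).im * s = a * (y.im * s) + b * (z.im * s) := by simp; ring
  rw [this]
  rcases hb.eq_or_lt with rfl | hb
  · obtain rfl : a = 1 := by linarith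
    simpa using hy
  · have := mul_pos hb hz
    have := mul_nonneg ha hy.le
    linarith

theorem im_ne_zero_of_mem_halfPlane {s : ℝ} {x : ℂ} (hx : x ∈ halfPlane s) : x.im ≠ 0 := by
  intro h
  simp [halfPlane, h] at hx

theorem add_real_mem_halfPlane {s : ℝ} {x : ℂ} (hx : x ∈ halfPlane s) (k : ℝ) :
    x + k ∈ halfPlane s := by
  simpa [halfPlane] using hx

namespace FlatModel

variable {m : ℕ}

theorem ray_add_period (D : FlatModel m) (n : ℕ) : D.ray (n + 2 * (m + 1)) = D.ray n ∧
    D.rayDom (n + 2 * (m + 1)) = D.rayDom n ∧ sgn (n + 2 * (m + 1)) = sgn n := by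
  have h1 : sgn (n + 2 * (m + 1)) = sgn n := sgn_eq_iff.2 (by omega)
  have h2 : omega m ^ (n + 2 * (m + 1)) = omega m ^ n := by
    rw [pow_add, (isPrimitiveRoot_omega m).pow_eq_one, mul_one]
  have h3 : D.base (n + 2 * (m + 1)) = D.base n := by
    rw [base, base, cone, cone, h1, h2]
  refine ⟨?_, ?_, h1⟩
  · funext x
    rw [ray, ray, h3, h1]
  · rw [rayDom, rayDom, h3, h1]

theorem Glue.of_add_period {D : FlatModel m} {n n' T : ℕ} (h : D.Glue n n' T) :
    D.Glue (n + 2 * (m + 1)) n' T := by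
  obtain ⟨h1, h2, h3⟩ := D.ray_add_period n
  refine ⟨h.pos, h3 ▸ h.sgn_eq, ?_, h.dom', ?_, ?_⟩
  · rw [h2]
    have := h.dom
    simpa only [strip, h3] using this
  · rw [h2, h3]; exact h.notMem
  · rw [h1, h3]; exact h.ray_eq

/-- The two models have the same infinite rays, and the same pairs of finite rays form saddle
connections, all of length one. -/
def SameRays (D D' : FlatModel m) : Prop :=
  ∀ n, (D.Infinite n ∧ D'.Infinite n) ∨ ∃ n', D.Glue n n' 1 ∧ D'.Glue n n' 1

theorem sameRays_of_lt {D D' : FlatModel m} (h : ∀ n < 2 * (m + 1),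
    (D.Infinite n ∧ D'.Infinite n) ∨ ∃ n', D.Glue n n' 1 ∧ D'.Glue n n' 1) : D.SameRays D' := by
  intro n
  induction n using Nat.strong_induction_on with
  | _ n ih =>
    rcases lt_or_ge n (2 * (m + 1)) with hn | hn
    · exact h n hn
    · obtain ⟨l, rfl⟩ := Nat.exists_eq_add_of_le' hn
      rcases ih l (by omega) with ⟨h1, h2⟩ | ⟨n', h1, h2⟩
      · left
        constructor
        · intro t ht
          rw [(D.ray_add_period l).2.1, (D.ray_add_period l).2.2]
          exact h1 t ht
        · intro t ht
          rw [(D'.ray_add_period l).2.1, (D'.ray_add_period l).2.2]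
          exact h2 t ht
      · exact Or.inr ⟨n', h1.of_add_period, h2.of_add_period⟩

theorem SameRays.symm {D D' : FlatModel m} (h : D.SameRays D') : D'.SameRays D := fun n =>
  (h n).imp And.symm fun ⟨n', h1, h2⟩ => ⟨n', h2, h1⟩

/-- One of the two rays bounding a half-plane has a given orientation. -/
theorem exists_ray_eq_on_halfPlane (m l : ℕ) {s v : ℝ} (hs : s = 1 ∨ s = -1)
    (hv : v = 1 ∨ v = -1) : ∃ l', sgn l' = v ∧
      ∀ D : FlatModel m, ∀ x ∈ halfPlane s, D.ray l x = D.ray l' x := by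
  by_cases h : sgn l = v
  · exact ⟨l, h, fun D x _ => rfl⟩
  have hlv : sgn l = -v := by
    rcases sgn_eq l with h1 | h1 <;> rcases hv with h2 | h2 <;> rw [h1, h2] at h ⊢ <;> norm_num at *
  by_cases h' : sgn l = s
  · refine ⟨l + 1, by rw [sgn_succ, hlv, neg_neg], fun D x hx => D.ray_succ ?_⟩
    rw [h']; exact hx
  · have hsv : s = v := by
      rw [hlv] at h'
      rcases hs with h1 | h1 <;> rcases hv with h2 | h2 <;> rw [h1, h2] at h' ⊢ <;> norm_num at h'
    refine ⟨l + 2 * m + 1, ?_, fun D x hx => ?_⟩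
    · rw [sgn_succ, show sgn (l + 2 * m) = sgn l from sgn_eq_iff.2 (by omega), hlv, neg_neg]
    · rw [D.ray_succ (n := l + 2 * m + 1)]
      · exact (congrFun (D.ray_add_period l).1 x).symm
      · rw [sgn_succ, show sgn (l + 2 * m) = sgn l from sgn_eq_iff.2 (by omega), hlv, neg_neg,
          ← hsv]
        exact hx

theorem isChart_halfPlane (D : FlatModel m) (n : ℕ) (s k : ℝ) :
    IsChart D.P (halfPlane s) (fun x => D.ray n (x + k)) :=
  ((D.isChart_ray n).shift (k : ℂ)).mono fun _ hx =>
    D.mem_rayDom_of_im_ne (im_ne_zero_of_mem_halfPlane (add_real_mem_halfPlane hx k))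

theorem eqOn_halfPlane (D : FlatModel m) {n l : ℕ} {s k : ℝ} {x₀ : ℂ} (hx₀ : x₀ ∈ halfPlane s)
    (h : D.ray n x₀ = D.ray l (x₀ + k)) : ∀ x ∈ halfPlane s, D.ray n x = D.ray l (x + k) := by
  have h1 : IsChart D.P (halfPlane s) (D.ray n) := by simpa using D.isChart_halfPlane n s 0
  exact h1.eqOn (isOpen_halfPlane s) (convex_halfPlane s).isPreconnected
    (D.isChart_halfPlane l s k) hx₀ h

theorem tendsto_ray_vertical (D : FlatModel m) (n : ℕ) {s : ℝ} (hs : s ≠ 0) :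
    Tendsto (fun ε : ℝ => D.ray n ((ε * s : ℝ) * Complex.I)) (𝓝[>] 0) (Bornology.cobounded ℂ) := by
  have hc : Continuous fun ε : ℝ => ((ε * s : ℝ) : ℂ) * Complex.I := by fun_prop
  have h0 := (hc.tendsto 0).mono_left (nhdsWithin_le_nhds (s := Set.Ioi 0))
  simp only [zero_mul, Complex.ofReal_zero] at h0
  have h1 : Tendsto (fun ε : ℝ => ((ε * s : ℝ) : ℂ) * Complex.I) (𝓝[>] 0) (𝓝[≠] 0) := by
    refine tendsto_nhdsWithin_iff.2 ⟨h0, ?_⟩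
    filter_upwards [self_mem_nhdsWithin] with ε hε
    exact mul_ne_zero (by exact_mod_cast mul_ne_zero hε.ne' hs) Complex.I_ne_zero
  refine ((D.tendsto_cone n).comp h1).congr' ?_
  filter_upwards [h0.eventually (Metric.ball_mem_nhds _ (pow_pos D.coord.r_pos (m + 1))),
    self_mem_nhdsWithin] with ε h2 h3
  refine (D.ray_eq_cone ⟨?_, by simpa using h2⟩).symm
  rw [Complex.mem_slitPlane_iff]
  right
  have h4 : ε ≠ 0 := (Set.mem_Ioi.1 h3).ne'
  simp [h4, hs, sgn_ne_zero]

/-- Induction on `|k|`. For `k = 0` the points have the same coordinate `ζ` at the zero, a condition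
independent of the model. For `k ≠ 0` the apex of chart `n` corresponds to the point `k` on the
boundary of chart `l`. Thus the boundary ray towards `k` cannot be infinite, or its chart would be
continuous there. It is a saddle connection of length one in both models, and crossing it brings `k`
one step closer to `0`. -/
theorem ray_eq_of_ray_eq {D D' : FlatModel m} (h : D.SameRays D') {s : ℝ}
    (hs : s = 1 ∨ s = -1) {n : ℕ} (N : ℕ) : ∀ (l : ℕ) (k : ℤ), k.natAbs = N →
    (∀ x ∈ halfPlane s, D.ray n x = D.ray l (x + ((k : ℝ) : ℂ))) →
    ∀ x ∈ halfPlane s, D'.ray n x = D'.ray l (x + ((k : ℝ) : ℂ)) := by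
  have hs0 : s ≠ 0 := by rcases hs with rfl | rfl <;> norm_num
  have hss : s * s = 1 := by rcases hs with rfl | rfl <;> norm_num
  have hvert : ∀ ε : ℝ, 0 < ε → ((ε * s : ℝ) : ℂ) * Complex.I ∈ halfPlane s := by
    intro ε hε
    simp [halfPlane, mul_assoc, hss, hε]
  induction N with
  | zero =>
    intro l k hk hD
    obtain rfl : k = 0 := Int.natAbs_eq_zero.1 hk
    set R := min (D.coord.r ^ (m + 1)) (D'.coord.r ^ (m + 1)) with hR
    have hR0 : 0 < R := lt_min (pow_pos D.coord.r_pos _) (pow_pos D'.coord.r_pos _)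
    set x₀ : ℂ := ((R / 2 * s : ℝ) : ℂ) * Complex.I with hx₀
    have hmem := hvert (R / 2) (half_pos hR0)
    rw [← hx₀] at hmem
    have hnorm : ‖x₀‖ < R := by
      have h1 : |s| = 1 := by rcases hs with rfl | rfl <;> simp
      rw [hx₀, norm_mul, Complex.norm_I, mul_one, Complex.norm_real, Real.norm_eq_abs, abs_mul, h1,
        mul_one, abs_of_pos (half_pos hR0)]
      linarith
    have hslit : ∀ n, x₀ * sgn n ∈ Complex.slitPlane := by
      intro n
      rw [Complex.mem_slitPlane_iff]
      right
      rw [im_mul_sgn]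
      exact mul_ne_zero (im_ne_zero_of_mem_halfPlane hmem) (sgn_ne_zero n)
    have hc : ∀ n, x₀ ∈ D.coneDom n := fun n => ⟨hslit n, hnorm.trans_le (min_le_left _ _)⟩
    have hc' : ∀ n, x₀ ∈ D'.coneDom n := fun n => ⟨hslit n, hnorm.trans_le (min_le_right _ _)⟩
    refine D'.eqOn_halfPlane hmem ?_
    have h1 := hD x₀ hmem
    simp only [Int.cast_zero, Complex.ofReal_zero, add_zero] at h1 ⊢
    rw [D.ray_eq_cone (hc n), D.ray_eq_cone (hc l), cone, cone] at h1
    have hne : ∀ n, omega m ^ n * (x₀ * sgn n) ^ ((m + 1 : ℂ)⁻¹) ≠ 0 := by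
      intro n h0
      have := cone_arg_pow (m := m) n x₀
      rw [h0, zero_pow (Nat.succ_ne_zero m)] at this
      exact D.ne_zero_of_mem_coneDom (hc n) this.symm
    have h2 := D.coord.inj_Y _ _ (hne n) (hne l)
      (norm_lt_of_pow D.coord.r_pos (cone_arg_pow n x₀) (hc n).2)
      (norm_lt_of_pow D.coord.r_pos (cone_arg_pow l x₀) (hc l).2) h1
    rw [D'.ray_eq_cone (hc' n), D'.ray_eq_cone (hc' l), cone, cone, h2]
  | succ N ih =>
    intro l k hk hD
    obtain ⟨v, hv, hkv⟩ : ∃ v : ℤ, (v = 1 ∨ v = -1) ∧ k = v * (N + 1) := by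
      rcases Int.natAbs_eq k with h1 | h1
      · exact ⟨1, Or.inl rfl, by rw [h1, hk]; push_cast; ring⟩
      · exact ⟨-1, Or.inr rfl, by rw [h1, hk]; push_cast; ring⟩
    obtain ⟨l', hl', hll'⟩ := exists_ray_eq_on_halfPlane m l hs (v := (v : ℝ))
      (by rcases hv with rfl | rfl <;> simp)
    rcases h l' with ⟨hinf, -⟩ | ⟨l'', hg, hg'⟩
    · exfalso
      have hk1 : ((k : ℝ) : ℂ) = ((N + 1 : ℝ) : ℂ) * sgn l' := by
        rw [hl', hkv]; push_cast; ring
      have hmem := hinf (N + 1) (by positivity)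
      rw [← hk1] at hmem
      have hcont := (D.isChart_ray l' _ hmem).2.continuousAt.tendsto
      have hc : Continuous fun ε : ℝ => ((ε * s : ℝ) : ℂ) * Complex.I + ((k : ℝ) : ℂ) := by fun_prop
      have h0 := (hc.tendsto 0).mono_left (nhdsWithin_le_nhds (s := Set.Ioi 0))
      simp only [zero_mul, Complex.ofReal_zero, zero_add] at h0
      have h1 := hcont.comp h0
      refine h1.not_tendsto (Metric.disjoint_nhds_cobounded _) ?_
      refine (D.tendsto_ray_vertical n hs0).congr' ?_
      filter_upwards [self_mem_nhdsWithin] with ε hε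
      rw [hD _ (hvert ε hε), hll' D _ (add_real_mem_halfPlane (hvert ε hε) _)]
      rfl
    · have hshift : ∀ D : FlatModel m, D.Glue l' l'' 1 → ∀ x ∈ halfPlane s,
          D.ray l (x + ((k : ℝ) : ℂ)) = D.ray l'' (x + (((k - v : ℤ) : ℝ) : ℂ)) := by
        intro D hg x hx
        rw [hll' D _ (add_real_mem_halfPlane hx _), ← hg.ray_eq _ (Or.inl
          (im_ne_zero_of_mem_halfPlane (add_real_mem_halfPlane hx _))), hl']
        congr 1
        push_cast
        ring
      have h1 := ih l'' (k - v) (by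
        rw [hkv]
        rcases hv with rfl | rfl <;> omega) (fun x hx => by rw [hD x hx, hshift D hg x hx])
      intro x hx
      rw [h1 x hx, hshift D' hg' x hx]

/-- The part of the domain of a ray that is visible from the zero. -/
def visDom (D : FlatModel m) (n : ℕ) : Set ℂ :=
  {x | x ∈ D.rayDom n ∧ (x.im ≠ 0 ∨ 0 < x.re * sgn n)}

theorem SameRays.visDom_subset {D D' : FlatModel m} (h : D.SameRays D') (n : ℕ) :
    D.visDom n ⊆ D'.visDom n := by
  rintro x ⟨hx, hx'⟩
  refine ⟨?_, hx'⟩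
  by_cases him : x.im = 0
  · have hre := hx'.resolve_left (fun h => h him)
    have hxt : x = ((x.re * sgn n : ℝ) : ℂ) * sgn n := by
      apply Complex.ext
      · simp [mul_assoc, sgn_mul_self]
      · simp [him]
    rcases h n with ⟨-, h'⟩ | ⟨n', hg, hg'⟩
    · rw [hxt]; exact h' _ hre
    · refine hg'.dom (Or.inr ⟨hre, ?_⟩)
      by_contra! hle
      refine hg.notMem ?_
      rw [hxt] at hx
      exact_mod_cast D.ofReal_mul_sgn_mem_rayDom (by simp) hle hx
  · exact D'.mem_rayDom_of_im_ne him

/-- Equal values of `E` force the two flat coordinates to differ by an integer. The coincidence then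
extends to a half-plane, where it is transported to the other model. -/
theorem SameRays.ray_eq {D D' : FlatModel m} (h : D.SameRays D') {n l : ℕ} {x y : ℂ}
    (hx : x ∈ D.visDom n) (hy : y ∈ D.visDom l) (heq : D.ray n x = D.ray l y) :
    D'.ray n x = D'.ray l y := by
  have hE : Complex.exp (2 * Real.pi * Complex.I * y) =
      Complex.exp (2 * Real.pi * Complex.I * x) := by
    rw [← D.E_ray hx.1, ← D.E_ray hy.1, heq]
  obtain ⟨k, hk⟩ := Complex.exp_eq_exp_iff_exists_int.1 hE
  have hyx : y = x + ((k : ℝ) : ℂ) := by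
    have h0 := Complex.two_pi_I_ne_zero
    refine mul_left_cancel₀ h0 ?_
    rw [hk]; push_cast; ring
  subst hyx
  by_cases him : x.im = 0
  · -- both points are real: approach them from above
    have h1 : D.ray n =ᶠ[𝓝 x] fun x => D.ray l (x + ((k : ℝ) : ℂ)) := by
      have ho : IsOpen (D.rayDom n ∩ {x | x + ((k : ℝ) : ℂ) ∈ D.rayDom l}) :=
        (D.isOpen_rayDom n).inter ((D.isOpen_rayDom l).preimage (by fun_prop))
      exact ((D.isChart_ray n).mono Set.inter_subset_left).eventuallyEq ho
        (((D.isChart_ray l).shift _).mono Set.inter_subset_right) ⟨hx.1, hy.1⟩ heq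
    have hfreq : (𝓝 x ⊓ 𝓟 (halfPlane 1)).NeBot := by
      rw [← nhdsWithin, ← mem_closure_iff_nhdsWithin_neBot]
      have hc : Continuous fun ε : ℝ => x + ε * Complex.I := by fun_prop
      have h0 := (hc.tendsto 0).mono_left (nhdsWithin_le_nhds (s := Set.Ioi 0))
      simp only [Complex.ofReal_zero, zero_mul, add_zero] at h0
      refine mem_closure_of_tendsto h0 ?_
      filter_upwards [self_mem_nhdsWithin] with ε hε
      simpa [halfPlane, him] using hε
    obtain ⟨x₀, h2, h3⟩ := ((h1.filter_mono inf_le_left).and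
      (show ∀ᶠ y in 𝓝 x ⊓ 𝓟 (halfPlane 1), y ∈ halfPlane 1 from
        mem_inf_of_right (mem_principal_self _))).exists
    have h4 := ray_eq_of_ray_eq h (Or.inl rfl) _ l k rfl (D.eqOn_halfPlane h3 h2)
    have hx' := h.visDom_subset n hx
    have hy' := h.visDom_subset l hy
    have c1 := (D'.isChart_ray n _ hx'.1).2.continuousAt.tendsto.mono_left
      (inf_le_left : 𝓝 x ⊓ 𝓟 (halfPlane 1) ≤ 𝓝 x)
    have c2 := ((D'.isChart_ray l).shift ((k : ℝ) : ℂ) x hy'.1).2.continuousAt.tendsto.mono_left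
      (inf_le_left : 𝓝 x ⊓ 𝓟 (halfPlane 1) ≤ 𝓝 x)
    refine tendsto_nhds_unique (c1.congr' ?_) c2
    exact mem_inf_of_right (mem_principal.2 fun y hy => h4 y hy)
  · obtain ⟨s, hs, hxs⟩ : ∃ s : ℝ, (s = 1 ∨ s = -1) ∧ x ∈ halfPlane s := by
      rcases lt_or_gt_of_ne him with h1 | h1
      · exact ⟨-1, Or.inr rfl, by simpa [halfPlane] using h1⟩
      · exact ⟨1, Or.inl rfl, by simpa [halfPlane] using h1⟩
    exact ray_eq_of_ray_eq h hs _ l k rfl (D.eqOn_halfPlane hxs heq) x hxs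

end FlatModel

/-! ### The map matching the rays is affine -/

namespace FlatModel

variable {m : ℕ}

theorem isOpen_visDom (D : FlatModel m) (n : ℕ) : IsOpen (D.visDom n) := by
  refine (D.isOpen_rayDom n).inter ?_
  exact (isOpen_ne_fun Complex.continuous_im continuous_const).union
    (isOpen_lt continuous_const (Complex.continuous_re.mul_const _))

theorem exists_visDom_ray_eq (D : FlatModel m) {z : ℂ} (hz : D.P.eval z ≠ 0) :
    ∃ n, ∃ x ∈ D.visDom n, D.ray n x = z := by
  obtain ⟨n, -, x, h1, h2, h3⟩ := D.exists_ray_eq hz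
  exact ⟨n, x, ⟨h1, h2⟩, h3⟩

open Classical in
/-- The map between the two spheres that matches the rays. -/
noncomputable def transfer (D D' : FlatModel m) (z : ℂ) : ℂ :=
  if h : D.P.eval z ≠ 0 then
    D'.ray (D.exists_visDom_ray_eq h).choose (D.exists_visDom_ray_eq h).choose_spec.choose
  else 0

variable {D D' : FlatModel m}

theorem transfer_ray (h : D.SameRays D') {n : ℕ} {x : ℂ} (hx : x ∈ D.visDom n) :
    D.transfer D' (D.ray n x) = D'.ray n x := by
  have hz := (D.isChart_ray n x hx.1).1
  rw [transfer, dif_pos hz]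
  obtain ⟨h1, h2⟩ := (D.exists_visDom_ray_eq hz).choose_spec.choose_spec
  exact h.ray_eq h1 hx h2

/-- Locally the map is a ray chart of `D'` after a local inverse of the corresponding chart of `D`.
-/
theorem hasDerivAt_transfer (h : D.SameRays D') {z : ℂ} (hz : D.P.eval z ≠ 0) :
    D'.P.eval (D.transfer D' z) ≠ 0 ∧
      HasDerivAt (D.transfer D') (D'.P.eval (D.transfer D' z) / D.P.eval z) z := by
  obtain ⟨n, x, hx, rfl⟩ := D.exists_visDom_ray_eq hz
  have hx' := h.visDom_subset n hx
  obtain ⟨hQ, hd'⟩ := D'.isChart_ray n x hx'.1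
  have hd := (D.isChart_ray n x hx.1).2
  have hstrict : HasStrictDerivAt (D.ray n) (D.P.eval (D.ray n x)) x := by
    have ha := (D.isChart_ray n).differentiableOn.analyticAt ((D.isOpen_rayDom n).mem_nhds hx.1)
    have := ha.hasStrictDerivAt
    rwa [hd.deriv] at this
  rw [transfer_ray h hx]
  refine ⟨hQ, ?_⟩
  set g := hstrict.localInverse (D.ray n) _ x hz with hg
  have hgd : HasDerivAt g (D.P.eval (D.ray n x))⁻¹ (D.ray n x) :=
    (hstrict.to_localInverse hz).hasDerivAt
  have hgx : g (D.ray n x) = x :=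
    HasStrictFDerivAt.localInverse_apply_image _
  have hright : ∀ᶠ y in 𝓝 (D.ray n x), D.ray n (g y) = y :=
    HasStrictFDerivAt.eventually_right_inverse _
  have hcomp : HasDerivAt (fun y => D'.ray n (g y))
      (D'.P.eval (D'.ray n x) * (D.P.eval (D.ray n x))⁻¹) (D.ray n x) := by
    rw [← hgx] at hd'
    have := hd'.comp (D.ray n x) hgd
    rwa [hgx] at this
  refine (hcomp.congr_of_eventuallyEq ?_).congr_deriv (div_eq_mul_inv _ _).symm
  have hmem : ∀ᶠ y in 𝓝 (D.ray n x), g y ∈ D.visDom n :=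
    hgd.continuousAt.eventually_mem (by rw [hgx]; exact (D.isOpen_visDom n).mem_nhds hx)
  filter_upwards [hright, hmem] with y h1 h2
  conv_lhs => rw [← h1]
  exact transfer_ray h h2

theorem transfer_transfer (h : D.SameRays D') {z : ℂ} (hz : D.P.eval z ≠ 0) :
    D'.transfer D (D.transfer D' z) = z := by
  obtain ⟨n, x, hx, rfl⟩ := D.exists_visDom_ray_eq hz
  rw [transfer_ray h hx, transfer_ray h.symm (h.visDom_subset n hx)]

/-- The index `n` depends on `ζ` alone. Hence the coordinates at the zero of two models are matched
by their rays. -/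
theorem exists_cone_eq (D : FlatModel m) {ζ : ℂ} (h0 : ζ ≠ 0) (hr : ‖ζ‖ < D.coord.r) :
    ∃ n, ζ ^ (m + 1) ∈ D.visDom n ∧ D.ray n (ζ ^ (m + 1)) = D.coord.Y ζ ∧
      ∀ D' : FlatModel m, ‖ζ‖ < D'.coord.r → D'.ray n (ζ ^ (m + 1)) = D'.coord.Y ζ := by
  set x := ζ ^ (m + 1) with hx
  have hx0 : x ≠ 0 := pow_ne_zero _ h0
  obtain ⟨v, hv, hvs⟩ : ∃ v : ℝ, (v = 1 ∨ v = -1) ∧ x * v ∈ Complex.slitPlane := by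
    by_cases h1 : x ∈ Complex.slitPlane
    · exact ⟨1, Or.inl rfl, by simpa using h1⟩
    · refine ⟨-1, Or.inr rfl, ?_⟩
      rw [Complex.mem_slitPlane_iff, not_or, not_not] at h1
      rw [Complex.mem_slitPlane_iff]
      left
      have h2 : x.re ≠ 0 := fun h => hx0 (Complex.ext h h1.2)
      simpa using lt_of_le_of_ne (not_lt.1 h1.1) h2
  have hv0 : (v : ℂ) ≠ 0 := by rcases hv with rfl | rfl <;> simp
  have hv2 : (v : ℂ) * v = 1 := by rcases hv with rfl | rfl <;> simp
  have hcp0 : (x * v) ^ ((m + 1 : ℂ)⁻¹) ≠ 0 := by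
    intro h
    have := pow_cpow_inv (m := m) (x * v)
    rw [h, zero_pow (Nat.succ_ne_zero m)] at this
    exact mul_ne_zero hx0 hv0 this.symm
  obtain ⟨n, -, hn, hsn⟩ := exists_omega_pow m (ξ := ζ / (x * v) ^ ((m + 1 : ℂ)⁻¹)) hv (by
    rw [div_pow, pow_cpow_inv, ← hx, div_eq_iff (mul_ne_zero hx0 hv0)]
    linear_combination -x * hv2)
  have hζ : omega m ^ n * (x * sgn n) ^ ((m + 1 : ℂ)⁻¹) = ζ := by
    rw [← hn, hsn, div_mul_cancel₀ _ hcp0]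
  have hcone : ∀ D : FlatModel m, ‖ζ‖ < D.coord.r → x ∈ D.coneDom n := fun D hD =>
    ⟨by rw [hsn]; exact hvs, by
      rw [hx, norm_pow]; exact pow_lt_pow_left₀ hD (norm_nonneg _) (Nat.succ_ne_zero m)⟩
  have hray : ∀ D : FlatModel m, ‖ζ‖ < D.coord.r → D.ray n x = D.coord.Y ζ := fun D hD => by
    rw [D.ray_eq_cone (hcone D hD), cone, hζ]
  refine ⟨n, ⟨D.coneDom_subset n (hcone D hr), ?_⟩, hray D hr, hray⟩
  have := (hcone D hr).1
  rw [Complex.mem_slitPlane_iff, re_mul_sgn, im_mul_sgn] at this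
  exact this.symm.imp left_ne_zero_of_mul id

theorem transfer_Y (h : D.SameRays D') {ζ : ℂ} (h0 : ζ ≠ 0) (hr : ‖ζ‖ < D.coord.r)
    (hr' : ‖ζ‖ < D'.coord.r) : D.transfer D' (D.coord.Y ζ) = D'.coord.Y ζ := by
  obtain ⟨n, h1, h2, h3⟩ := D.exists_cone_eq h0 hr
  rw [← h2, transfer_ray h h1, h3 D' hr']

/-- Both sides are parametrized by the same `ζ`, and `Y ζ` behaves like `1 / (κ ζ)` as `ζ → 0`. -/
theorem tendsto_transfer_div (h : D.SameRays D') :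
    Tendsto (fun z => D.transfer D' z / z) (Bornology.cobounded ℂ)
      (𝓝 (D.coord.κ / D'.coord.κ)) := by
  have hZ : ∀ᶠ z in Bornology.cobounded ℂ, D.coord.Z z ≠ 0 ∧ ‖D.coord.Z z‖ < D.coord.r ∧
      D.coord.Y (D.coord.Z z) = z := by
    filter_upwards [tendsto_norm_cobounded_atTop.eventually_gt_atTop D.coord.R] with z hz
    have := D.coord.Z_spec z hz
    exact ⟨this.1, this.2.1, this.2.2.1⟩
  have hlim : Tendsto D.coord.Z (Bornology.cobounded ℂ) (𝓝[≠] 0) :=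
    tendsto_nhdsWithin_iff.2 ⟨D.coord.tendsto_Z, hZ.mono fun z hz => hz.1⟩
  have hr' : ∀ᶠ z in Bornology.cobounded ℂ, ‖D.coord.Z z‖ < D'.coord.r := by
    have := D.coord.tendsto_Z.norm
    rw [norm_zero] at this
    exact this.eventually (gt_mem_nhds D'.coord.r_pos)
  have h1 := (D.coord.tendsto_Y.comp hlim).div (D'.coord.tendsto_Y.comp hlim) D'.coord.κ_ne
  refine h1.congr' ?_
  filter_upwards [hZ, hr'] with z ⟨h2, h3, h4⟩ h5
  have h6 := transfer_Y h h2 h3 h5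
  simp only [Function.comp, Pi.div_apply]
  rw [← h6, h4]
  rw [div_div_div_cancel_right₀ h2, div_eq_mul_inv, inv_inv, div_eq_mul_inv, mul_comm]

theorem tendsto_transfer (h : D.SameRays D') :
    Tendsto (D.transfer D') (Bornology.cobounded ℂ) (Bornology.cobounded ℂ) := by
  have h1 := (tendsto_transfer_div h).norm
  have hpos : 0 < ‖D.coord.κ / D'.coord.κ‖ :=
    norm_pos_iff.2 (div_ne_zero D.coord.κ_ne D'.coord.κ_ne)
  rw [← tendsto_norm_atTop_iff_cobounded]
  have h2 := h1.pos_mul_atTop hpos tendsto_norm_cobounded_atTop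
  refine h2.congr' ?_
  filter_upwards [tendsto_norm_cobounded_atTop.eventually_gt_atTop 0] with z hz
  rw [norm_div, div_mul_cancel₀ _ hz.ne']

/-- The inverse map tends to `∞` at `∞`, so points with large images cannot come from a bounded set.
This makes the poles removable singularities. -/
theorem exists_transfer_bound (h : D.SameRays D') (R : ℝ) :
    ∃ C, ∀ z, D.P.eval z ≠ 0 → ‖z‖ ≤ R → ‖D.transfer D' z‖ ≤ C := by
  have h1 := (tendsto_norm_cobounded_atTop.comp (tendsto_transfer h.symm)).eventually_gt_atTop R
  rw [← comap_norm_atTop, eventually_comap] at h1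
  obtain ⟨C, hC⟩ := h1.exists_forall_of_atTop
  refine ⟨C, fun z hz hzR => ?_⟩
  by_contra! hlt
  have := hC _ hlt.le _ rfl
  simp only [Function.comp, transfer_transfer h hz] at this
  linarith

-- The map extends over the poles to an entire function of linear growth. Its difference quotient at
-- `0` is entire with a finite limit at infinity, hence constant.
open Classical in
theorem exists_affine (h : D.SameRays D') : ∃ a b : ℂ, a ≠ 0 ∧
    ∀ z, D.P.eval z ≠ 0 → D.transfer D' z = a * z + b := by
  set Φ : ℂ → ℂ := fun z => if D.P.eval z = 0 then limUnder (𝓝[≠] z) (D.transfer D')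
    else D.transfer D' z with hΦ
  have hopen : IsOpen {z | D.P.eval z ≠ 0} := isOpen_ne_fun D.P.continuous continuous_const
  have hdiff : Differentiable ℂ Φ := by
    intro p
    by_cases hp : D.P.eval p = 0
    · obtain ⟨r, hr, hsep⟩ := exists_root_separation D.P_ne_zero p
      have hne : ∀ z ∈ Metric.ball p r \ {p}, D.P.eval z ≠ 0 := by
        rintro z ⟨h1, h2⟩ h3
        have := hsep z h3 h2
        rw [mem_ball_iff_norm'] at h1
        linarith
      obtain ⟨C, hC⟩ := exists_transfer_bound h (‖p‖ + r)
      have h1 := Complex.differentiableOn_update_limUnder_of_bddAbove (Metric.ball_mem_nhds p hr)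
        (f := D.transfer D')
        (fun z hz => (hasDerivAt_transfer h (hne z hz)).2.differentiableAt.differentiableWithinAt)
        ⟨C, by
          rintro _ ⟨z, hz, rfl⟩
          refine hC z (hne z hz) ?_
          have h2 := hz.1
          rw [mem_ball_iff_norm] at h2
          have := norm_sub_norm_le z p
          linarith⟩
      refine (h1.differentiableAt (Metric.ball_mem_nhds p hr)).congr_of_eventuallyEq ?_
      filter_upwards [Metric.ball_mem_nhds p hr] with z hz
      by_cases hzp : z = p
      · subst hzp
        simp [hΦ, hp]
      · simp [hΦ, hzp, hne z ⟨hz, hzp⟩]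
    · refine (hasDerivAt_transfer h hp).2.differentiableAt.congr_of_eventuallyEq ?_
      filter_upwards [hopen.mem_nhds hp] with z hz
      simp only [hΦ, if_neg (show ¬ D.P.eval z = 0 from hz)]
  have hlim : Tendsto (fun z => Φ z / z) (Bornology.cobounded ℂ)
      (𝓝 (D.coord.κ / D'.coord.κ)) := by
    refine (tendsto_transfer_div h).congr' ?_
    have hfin : {z | D.P.IsRoot z}.Finite := Polynomial.finite_setOfPred_isRoot D.P_ne_zero
    filter_upwards [Bornology.le_cofinite ℂ hfin.compl_mem_cofinite] with z hz
    simp only [hΦ, if_neg (show ¬ D.P.eval z = 0 from hz)]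
  have hlim' : Tendsto (dslope Φ 0) (cocompact ℂ) (𝓝 (D.coord.κ / D'.coord.κ)) := by
    rw [← Metric.cobounded_eq_cocompact]
    have h1 : Tendsto (fun z : ℂ => Φ 0 / z) (Bornology.cobounded ℂ) (𝓝 0) := by
      simpa [div_eq_mul_inv] using (tendsto_inv₀_cobounded (α := ℂ)).const_mul (Φ 0)
    have h2 := hlim.sub h1
    rw [sub_zero] at h2
    refine h2.congr' ?_
    filter_upwards [tendsto_norm_cobounded_atTop.eventually_gt_atTop 0] with z hz
    rw [dslope_of_ne _ (norm_pos_iff.1 hz), slope_def_field]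
    rw [sub_zero, sub_div]
  have hds : Differentiable ℂ (dslope Φ 0) := by
    rw [← differentiableOn_univ] at hdiff ⊢
    exact (Complex.differentiableOn_dslope univ_mem).2 hdiff
  refine ⟨D.coord.κ / D'.coord.κ, Φ 0, div_ne_zero D.coord.κ_ne D'.coord.κ_ne, fun z hz => ?_⟩
  have h1 := hds.apply_eq_of_tendsto_cocompact z hlim'
  have h2 := sub_smul_dslope Φ 0 z
  rw [h1, sub_zero, smul_eq_mul] at h2
  have h3 : Φ z = D.transfer D' z := by simp only [hΦ, if_neg hz]
  rw [← h3]
  linear_combination -h2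

/-- Models with the same rays agree up to an affine map. -/
theorem SameRays.exists_affine (h : D.SameRays D') : ∃ a b : ℂ, a ≠ 0 ∧
    (∀ z, D'.P.eval (a * z + b) = a * D.P.eval z) ∧
    (∀ n, ∀ x ∈ D.visDom n, D'.ray n x = a * D.ray n x + b) ∧
    a * D.q₀ + b = D'.q₀ ∧ a * D.q₁ + b = D'.q₁ := by
  obtain ⟨a, b, ha, hab⟩ := FlatModel.exists_affine h
  have hopen : IsOpen {z | D.P.eval z ≠ 0} := isOpen_ne_fun D.P.continuous continuous_const
  have hfin : {z | D.P.IsRoot z}.Finite := Polynomial.finite_setOfPred_isRoot D.P_ne_zero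
  -- Comparing the derivative `a` with the quotient of the two polynomials gives the identity at all
  -- but finitely many points.
  have hpoly : D'.P.comp (Polynomial.C a * Polynomial.X + Polynomial.C b) =
      Polynomial.C a * D.P := by
    refine Polynomial.eq_of_infinite_eval_eq _ _ (hfin.infinite_compl.mono fun z hz => ?_)
    have hz : D.P.eval z ≠ 0 := hz
    have h1 := (hasDerivAt_transfer h hz).2
    have h2 : HasDerivAt (D.transfer D') a z := by
      have h3 : HasDerivAt (fun z : ℂ => a * z + b) a z := by
        simpa using ((hasDerivAt_id z).const_mul a).add_const b
      refine h3.congr_of_eventuallyEq ?_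
      filter_upwards [hopen.mem_nhds hz] with y hy using hab y hy
    have h4 := h1.unique h2
    rw [hab z hz, div_eq_iff hz] at h4
    simpa using h4
  have heval : ∀ z, D'.P.eval (a * z + b) = a * D.P.eval z := fun z => by
    simpa using congrArg (Polynomial.eval z) hpoly
  have hray : ∀ n, ∀ x ∈ D.visDom n, D'.ray n x = a * D.ray n x + b := fun n x hx => by
    rw [← transfer_ray h hx, hab _ (D.isChart_ray n x hx.1).1]
  refine ⟨a, b, ha, heval, hray, ?_⟩
  -- compare the residues
  set p₀ := (D'.q₀ - b) / a with hp₀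
  set p₁ := (D'.q₁ - b) / a with hp₁
  have e0 : a * p₀ + b = D'.q₀ := by rw [hp₀]; field_simp; ring
  have e1 : a * p₁ + b = D'.q₁ := by rw [hp₁]; field_simp; ring
  have hPp₀ : D.P.eval p₀ = 0 := by
    have := heval p₀
    rw [e0, D'.P_q₀] at this
    exact (mul_eq_zero.1 this.symm).resolve_left ha
  have hPp₁ : D.P.eval p₁ = 0 := by
    have := heval p₁
    rw [e1, D'.P_q₁] at this
    exact (mul_eq_zero.1 this.symm).resolve_left ha
  have hpne : p₀ ≠ p₁ := fun h => D'.q_ne (by rw [← e0, ← e1, h])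
  have hprim : ∀ z, D.P.eval z ≠ 0 → HasDerivAt
      (fun z => 2 * Real.pi * Complex.I * (D'.K (a * z + b) - D.K z))
      ((z - D.q₀)⁻¹ - (z - D.q₁)⁻¹ - ((z - p₀)⁻¹ - (z - p₁)⁻¹)) z := by
    intro z hz
    have h3 : HasDerivAt (fun z : ℂ => a * z + b) a z := by
      simpa using ((hasDerivAt_id z).const_mul a).add_const b
    have h1 := (D'.deriv_K (a * z + b) (by rw [heval]; exact mul_ne_zero ha hz)).comp z h3
    refine ((h1.sub (D.deriv_K z hz)).const_mul (2 * Real.pi * Complex.I)).congr_deriv ?_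
    have f0 : a * z + b - D'.q₀ = a * (z - p₀) := by rw [← e0]; ring
    have f1 : a * z + b - D'.q₁ = a * (z - p₁) := by rw [← e1]; ring
    have h0 := Complex.two_pi_I_ne_zero
    have g0 : z - p₀ ≠ 0 := sub_ne_zero.2 fun h => hz (h ▸ hPp₀)
    have g1 : z - p₁ ≠ 0 := sub_ne_zero.2 fun h => hz (h ▸ hPp₁)
    have g2 : z - D.q₀ ≠ 0 := sub_ne_zero.2 fun h => hz (h ▸ D.P_q₀)
    have g3 : z - D.q₁ ≠ 0 := sub_ne_zero.2 fun h => hz (h ▸ D.P_q₁)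
    rw [f0, f1, heval, mul_inv a, mul_inv a, mul_inv a]
    have ha1 : a⁻¹ * a = 1 := inv_mul_cancel₀ ha
    have hI : (2 * Real.pi * Complex.I) * (2 * Real.pi * Complex.I)⁻¹ = 1 := mul_inv_cancel₀ h0
    generalize (2 * Real.pi * Complex.I : ℂ) = J at *
    linear_combination (J * (D.P.eval z)⁻¹ - J * J⁻¹ * ((z - p₀)⁻¹ - (z - p₁)⁻¹)) * ha1 +
      ((z - D.q₀)⁻¹ - (z - D.q₁)⁻¹ - ((z - p₀)⁻¹ - (z - p₁)⁻¹)) * hI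
  -- The difference of the two polar parts has a primitive, so its integral around a small circle
  -- about each root vanishes. This forces the preimages of the marked poles to be the marked poles.
  have hres : ∀ p, D.P.eval p = 0 →
      ((if D.q₀ = p then 1 else 0) - (if D.q₁ = p then 1 else 0) -
        ((if p₀ = p then 1 else 0) - (if p₁ = p then 1 else 0)) : ℂ) = 0 := by
    intro p hp
    obtain ⟨r, hr, hsep⟩ := exists_root_separation D.P_ne_zero p
    have hr2 : 0 < r / 2 := half_pos hr
    have hint : ∀ q, D.P.eval q = 0 → CircleIntegrable (fun z => (z - q)⁻¹) p (r / 2) ∧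
        (∮ z in C(p, r / 2), (z - q)⁻¹) = (if q = p then 1 else 0) * (2 * Real.pi * Complex.I) := by
      intro q hq
      by_cases hqp : q = p
      · subst hqp
        refine ⟨?_, ?_⟩
        · rw [circleIntegrable_sub_inv_iff]
          right
          rw [Metric.mem_sphere, dist_self]
          exact (abs_pos.2 hr2.ne').ne
        · rw [circleIntegral.integral_sub_center_inv _ hr2.ne']
          simp
      · have hnot : q ∉ Metric.closedBall p (r / 2) := by
          rw [mem_closedBall_iff_norm', not_le]
          exact (half_lt_self hr).trans_le (hsep q hq hqp)
        have hd : DifferentiableOn ℂ (fun z => (z - q)⁻¹) (Metric.closedBall p (r / 2)) := by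
          intro z hz
          refine DifferentiableAt.differentiableWithinAt ?_
          exact (differentiableAt_id.sub_const q).inv
            (sub_ne_zero.2 fun h => hnot (h ▸ hz))
        refine ⟨?_, ?_⟩
        · exact (hd.continuousOn.mono Metric.sphere_subset_closedBall).circleIntegrable hr2.le
        · rw [if_neg hqp, zero_mul]
          exact (hd.mono Metric.ball_subset_closedBall |> fun h =>
            DiffContOnCl.circleIntegral_eq_zero hr2.le
              ⟨h, by rw [closure_ball _ hr2.ne']; exact hd.continuousOn⟩)
    obtain ⟨i0, v0⟩ := hint _ D.P_q₀
    obtain ⟨i1, v1⟩ := hint _ D.P_q₁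
    obtain ⟨i2, v2⟩ := hint _ hPp₀
    obtain ⟨i3, v3⟩ := hint _ hPp₁
    have hzero := circleIntegral.integral_eq_zero_of_hasDerivWithinAt hr2.le
      (c := p) (fun z hz => (hprim z (fun h0 => by
        have hne : z ≠ p := by
          rintro rfl
          rw [Metric.mem_sphere, dist_self] at hz
          exact hr2.ne hz
        have := hsep z h0 hne
        rw [Metric.mem_sphere, dist_eq_norm, norm_sub_rev] at hz
        linarith)).hasDerivWithinAt)
    have s0 : (∮ z in C(p, r / 2), ((z - D.q₀)⁻¹ - (z - D.q₁)⁻¹ - ((z - p₀)⁻¹ - (z - p₁)⁻¹))) =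
        (∮ z in C(p, r / 2), ((z - D.q₀)⁻¹ - (z - D.q₁)⁻¹)) -
          ∮ z in C(p, r / 2), ((z - p₀)⁻¹ - (z - p₁)⁻¹) :=
      circleIntegral.integral_sub (i0.sub i1) (i2.sub i3)
    rw [s0, circleIntegral.integral_sub i0 i1, circleIntegral.integral_sub i2 i3, v0, v1, v2,
      v3] at hzero
    refine mul_right_cancel₀ Complex.two_pi_I_ne_zero ?_
    linear_combination hzero
  have hr0 := hres _ D.P_q₀
  have hr1 := hres _ D.P_q₁
  have hq := D.q_ne
  constructor
  · suffices p₀ = D.q₀ by rw [← this, e0]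
    by_contra hne
    rw [if_pos rfl, if_neg hq.symm, if_neg hne] at hr0
    split_ifs at hr0 <;> norm_num at hr0
  · suffices p₁ = D.q₁ by rw [← this, e1]
    by_contra hne
    rw [if_neg hq, if_pos rfl, if_neg hne] at hr1
    split_ifs at hr1 <;> norm_num at hr1

end FlatModel

/-! ### From angles to positions of the ends -/

theorem exists_int_of_flatTurn {m p q : ℕ} {θ : ℝ} (h : FlatTurn m (omega m ^ p) (omega m ^ q) θ) :
    ∃ N : ℤ, θ = Real.pi * (((q : ℤ) - p - 2 * (m + 1) * N : ℤ) : ℝ) := by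
  have hm1 : (m + 1 : ℂ) ≠ 0 := by exact_mod_cast Nat.succ_ne_zero m
  rw [FlatTurn, omega, ← Complex.exp_nat_mul, ← Complex.exp_nat_mul, ← Complex.exp_add,
    Complex.exp_eq_exp_iff_exists_int] at h
  obtain ⟨N, hN⟩ := h
  refine ⟨N, ?_⟩
  have h1 : (θ : ℂ) = ((Real.pi * (((q : ℤ) - p - 2 * (m + 1) * N : ℤ) : ℝ) : ℝ) : ℂ) := by
    push_cast at hN ⊢
    refine mul_left_cancel₀ Complex.I_ne_zero ?_
    field_simp at hN
    linear_combination -Complex.I * hN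
  exact_mod_cast h1

theorem modEq_of_flatTurn {m p q u : ℕ} (h : FlatTurn m (omega m ^ p) (omega m ^ q)
    (2 * Real.pi * (u + 1))) : q ≡ p + 2 * (u + 1) [MOD 2 * (m + 1)] := by
  obtain ⟨N, hN⟩ := exists_int_of_flatTurn h
  have h1 : (2 * (u + 1) : ℝ) = (((q : ℤ) - p - 2 * (m + 1) * N : ℤ) : ℝ) := by
    refine mul_left_cancel₀ Real.pi_ne_zero ?_
    rw [← hN]; ring
  have h2 : 2 * ((u : ℤ) + 1) = (q : ℤ) - p - 2 * (m + 1) * N := by exact_mod_cast h1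
  rw [← Int.natCast_modEq_iff, Int.modEq_iff_dvd]
  exact ⟨-N, by push_cast; linear_combination h2⟩

/-- One step of the exponent of `ω` is a flat angle `π`, and opposite orientations have exponents of
different parity, so the angle is an odd multiple of `π`. -/
theorem exists_nat_of_flatTurn {m p q : ℕ} {θ : ℝ} (hθ : 0 < θ) (hs : sgn q = -sgn p)
    (h : FlatTurn m (omega m ^ p) (omega m ^ q) θ) :
    ∃ a : ℕ, θ = Real.pi * (2 * a + 1) ∧ q ≡ p + (2 * a + 1) [MOD 2 * (m + 1)] := by
  obtain ⟨N, hN⟩ := exists_int_of_flatTurn h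
  set A : ℤ := (q : ℤ) - p - 2 * (m + 1) * N with hA
  have hpos : 0 < A := by
    have : 0 < (A : ℝ) := by
      rw [hN] at hθ
      exact (mul_pos_iff_of_pos_left Real.pi_pos).1 hθ
    exact_mod_cast this
  have hodd : q % 2 = (p + 1) % 2 := by
    rw [← sgn_succ] at hs
    exact sgn_eq_iff.1 hs
  obtain ⟨a, ha⟩ : ∃ a : ℕ, A = 2 * a + 1 := by
    refine ⟨(A / 2).toNat, ?_⟩
    have h1 : A % 2 = 1 := by
      have h2 : A = (q : ℤ) - p - 2 * ((m + 1) * N) := by rw [hA]; ring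
      generalize ((m : ℤ) + 1) * N = X at h2
      omega
    omega
  refine ⟨a, by rw [hN, ha]; push_cast; ring, ?_⟩
  rw [← Int.natCast_modEq_iff, Int.modEq_iff_dvd]
  exact ⟨-N, by push_cast; linear_combination hA - ha⟩

/-- The positions of the ends of the saddle connections around the zero. -/
theorem positions_of_modEq {k M A B : ℕ} {u w : ℕ → ℕ} {dep arr : Fin (k + 1) → ℕ}
    (hw : ∀ i < k, 0 < w i) (hA : 0 < A) (hB : 0 < B)
    (hsum : A + B + ∑ i ∈ Finset.range k, u i + ∑ i ∈ Finset.range k, w i = M)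
    (hdep : ∀ j, dep j < M) (harr : ∀ j, arr j < M) (h0 : dep 0 = 0)
    (harr0 : arr 0 ≡ A [MOD M])
    (hu' : ∀ i : Fin k, arr i.succ ≡ arr i.castSucc + u i [MOD M])
    (hw' : ∀ i : Fin k, dep i.castSucc ≡ dep i.succ + w i [MOD M]) (j : Fin (k + 1)) :
    arr j = A + ∑ i ∈ Finset.range j, u i ∧
      dep j + ∑ i ∈ Finset.range j, w i = if j = 0 then 0 else M := by
  have hle : ∀ (f : ℕ → ℕ) (j : Fin (k + 1)),
      ∑ i ∈ Finset.range j, f i ≤ ∑ i ∈ Finset.range k, f i := fun f j =>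
    Finset.sum_le_sum_of_subset (Finset.range_subset_range.2 (Nat.lt_succ_iff.1 j.2))
  constructor
  · have h1 : arr j ≡ A + ∑ i ∈ Finset.range j, u i [MOD M] := by
      induction j using Fin.induction with
      | zero => simpa using harr0
      | succ i ih =>
        refine (hu' i).trans ?_
        rw [Fin.val_succ, Finset.sum_range_succ, ← add_assoc]
        exact Nat.ModEq.add_right _ ih
    refine Nat.ModEq.eq_of_lt_of_lt h1 (harr j) ?_
    have := hle u j
    omega
  · have h1 : dep j + ∑ i ∈ Finset.range j, w i ≡ 0 [MOD M] := by
      induction j using Fin.induction with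
      | zero => simp [h0, Nat.ModEq.refl]
      | succ i ih =>
        rw [Fin.val_succ, Finset.sum_range_succ]
        have h2 := (hw' i).add_right (∑ i ∈ Finset.range i, w i)
        have h3 : dep i.succ + (∑ x ∈ Finset.range i, w x + w i) =
            dep i.succ + w i + ∑ x ∈ Finset.range i, w x := by ring
        rw [h3]
        exact h2.symm.trans ih
    split_ifs with hj
    · subst hj
      simp [h0]
    · have h2 := hle w j
      have h3 := hdep j
      have hj0 : 0 < (j : ℕ) := Nat.pos_of_ne_zero fun h => hj (Fin.ext h)
      have h4 : w 0 ≤ ∑ i ∈ Finset.range j, w i :=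
        Finset.single_le_sum (fun _ _ => Nat.zero_le _) (Finset.mem_range.2 hj0)
      have h5 := hw 0 (by have := j.2; omega)
      obtain ⟨c, hc⟩ := (Nat.modEq_zero_iff_dvd).1 h1
      have hM : 0 < M := by omega
      -- The sum is a positive multiple of `M`, and below `2M` because both `dep j` and the partial
      -- sum of the `w i` are below `M`.
      have hc1 : c = 1 := by
        have h6 : 0 < M * c := by omega
        have h7 : M * c < M * 2 := by omega
        have := Nat.pos_of_mul_pos_left h6
        have := lt_of_mul_lt_mul_left h7 (Nat.zero_le M)
        omega
      rw [hc, hc1, mul_one]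

/-! ### The block determines the rays -/

/-- The saddle connections of a model, given by the positions of their ends around the zero, with
the angles and poles prescribed by the block. -/
structure SaddleSystem (B : Block) (D : FlatModel B.zeroOrder) (dep arr : Fin (B.k + 1) → ℕ) :
    Prop where
  dep_lt : ∀ j, dep j < 2 * (B.zeroOrder + 1)
  arr_lt : ∀ j, arr j < 2 * (B.zeroOrder + 1)
  dep_zero : dep 0 = 0
  dep_injective : Function.Injective dep
  arr_injective : Function.Injective arr
  sgn_dep : ∀ j, sgn (dep j) = 1
  glue : ∀ j, D.Glue (dep j) (arr j) 1
  card_roots : D.P.roots.toFinset.card = B.k + 2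
  mult_first : D.P.rootMultiplicity D.q₀ = B.first.poleOrder
  mult_last : D.P.rootMultiplicity D.q₁ = B.last.poleOrder
  angles : ∃ α β : ℝ, 0 < α ∧ 0 < β ∧
    α + (∑ i, (2 * Real.pi * (B.c' i + 1) + 2 * Real.pi * (B.c'' i + 1))) + β
      = 2 * Real.pi * (B.zeroOrder + 1) ∧
    FlatTurn B.zeroOrder (omega B.zeroOrder ^ dep 0) (omega B.zeroOrder ^ arr 0) α ∧
    FlatTurn B.zeroOrder (omega B.zeroOrder ^ arr (Fin.last B.k))
      (omega B.zeroOrder ^ dep (Fin.last B.k)) β ∧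
    ∀ i : Fin B.k,
      FlatTurn B.zeroOrder (omega B.zeroOrder ^ arr i.castSucc) (omega B.zeroOrder ^ arr i.succ)
        (2 * Real.pi * (B.c' i + 1)) ∧
      FlatTurn B.zeroOrder (omega B.zeroOrder ^ dep i.succ) (omega B.zeroOrder ^ dep i.castSucc)
        (2 * Real.pi * (B.c'' i + 1))

namespace SaddleSystem

variable {B : Block} {D : FlatModel B.zeroOrder} {dep arr : Fin (B.k + 1) → ℕ}

theorem sgn_arr (h : SaddleSystem B D dep arr) (j : Fin (B.k + 1)) : sgn (arr j) = -1 := by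
  rw [(h.glue j).sgn_eq, h.sgn_dep]

/-- With `k + 2` poles and `k + 1` saddle connections of each orientation the count of rays against
petals is tight. -/
theorem petal_or_range (h : SaddleSystem B D dep arr) {n : ℕ} (hn : n < 2 * (B.zeroOrder + 1)) :
    (D.Infinite n ∧ ∃ p ρ, D.Petal n p ρ) ∨ n ∈ Set.range dep ∨ n ∈ Set.range arr := by
  classical
  by_contra! hcon
  obtain ⟨h1, h2, h3⟩ := hcon
  have hcard : ∀ f : Fin (B.k + 1) → ℕ, Function.Injective f →
      D.P.roots.toFinset.card ≤ (Finset.univ.image f).card + 1 := fun f hf => by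
    rw [h.card_roots, Finset.card_image_of_injective _ hf, Finset.card_univ, Fintype.card_fin]
  have hinf : ¬ (D.Infinite n ∧ ∃ p ρ, D.Petal n p ρ) := fun ⟨h4, p, ρ, h5⟩ => h1 h4 p ρ h5
  rcases sgn_eq n with hs | hs
  · refine hinf (D.petal_of_card (Or.inl rfl) (F := Finset.univ.image dep) (fun l hl => ?_)
      (hcard _ h.dep_injective) hn hs fun hmem => h2 ?_)
    · obtain ⟨j, -, rfl⟩ := Finset.mem_image.1 hl
      exact ⟨h.dep_lt j, h.sgn_dep j, (h.glue j).not_infinite⟩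
    · obtain ⟨j, -, rfl⟩ := Finset.mem_image.1 hmem
      exact ⟨j, rfl⟩
  · refine hinf (D.petal_of_card (Or.inr rfl) (F := Finset.univ.image arr) (fun l hl => ?_)
      (hcard _ h.arr_injective) hn hs fun hmem => h3 ?_)
    · obtain ⟨j, -, rfl⟩ := Finset.mem_image.1 hl
      exact ⟨h.arr_lt j, h.sgn_arr j, (h.glue j).symm.not_infinite⟩
    · obtain ⟨j, -, rfl⟩ := Finset.mem_image.1 hmem
      exact ⟨j, rfl⟩

/-- The positions of the saddle connections are determined by the block. -/
theorem positions (hB : B.IsTypeI ∨ B.IsTypeII ∨ B.IsTypeIII) (h : SaddleSystem B D dep arr) :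
    ∃ u w : ℕ → ℕ, (∀ i : Fin B.k, u i = 2 * (B.c' i + 1)) ∧ (∀ i : Fin B.k, w i = 2 * (B.c'' i + 1))
      ∧ ∀ j : Fin (B.k + 1), arr j = 2 * B.first.zeroOrder + 1 + ∑ i ∈ Finset.range j, u i ∧
      dep j + ∑ i ∈ Finset.range j, w i = if j = 0 then 0 else 2 * (B.zeroOrder + 1) := by
  obtain ⟨α, β, hα, hβ, htot, hfirst, hlast, hmid⟩ := h.angles
  obtain ⟨a, ha, ha'⟩ := exists_nat_of_flatTurn hα (by rw [h.sgn_arr, h.sgn_dep]) hfirst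
  obtain ⟨b, hb, -⟩ := exists_nat_of_flatTurn hβ (by rw [h.sgn_arr, h.sgn_dep]; norm_num) hlast
  set u : ℕ → ℕ := fun i => if hi : i < B.k then 2 * (B.c' ⟨i, hi⟩ + 1) else 0 with hu
  set w : ℕ → ℕ := fun i => if hi : i < B.k then 2 * (B.c'' ⟨i, hi⟩ + 1) else 0 with hw
  have hui : ∀ i : Fin B.k, u i = 2 * (B.c' i + 1) := fun i => by simp [hu]
  have hwi : ∀ i : Fin B.k, w i = 2 * (B.c'' i + 1) := fun i => by simp [hw]
  have hsum : (2 * a + 1) + (2 * b + 1) + ∑ i ∈ Finset.range B.k, u i +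
      ∑ i ∈ Finset.range B.k, w i = 2 * (B.zeroOrder + 1) := by
    rw [Finset.sum_range, Finset.sum_range]
    have h1 : ((2 * a + 1) + (∑ i, (2 * ((B.c' i : ℝ) + 1) + 2 * ((B.c'' i : ℝ) + 1))) +
        (2 * b + 1) : ℝ) = 2 * (B.zeroOrder + 1) := by
      refine mul_left_cancel₀ Real.pi_ne_zero ?_
      rw [mul_add, mul_add, ← ha, ← hb, Finset.mul_sum]
      refine Eq.trans ?_ (htot.trans (by ring))
      congr 2
      exact Finset.sum_congr rfl fun i _ => by ring
    have h2 : (2 * a + 1) + (∑ i, (2 * (B.c' i + 1) + 2 * (B.c'' i + 1))) +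
        (2 * b + 1) = 2 * (B.zeroOrder + 1) := by exact_mod_cast h1
    rw [Finset.sum_add_distrib] at h2
    simp only [hui, hwi]
    omega
  -- The total cone angle fixes only the sum of the two outer angles; the residue argument has to
  -- separate them.
  have hsum' : a + b = B.first.zeroOrder + B.last.zeroOrder := by
    rw [Finset.sum_range, Finset.sum_range] at hsum
    simp only [hui, hwi, ← Finset.mul_sum] at hsum
    have h3 : B.zeroOrder = (∑ i, (B.c' i + 1) + ∑ i, (B.c'' i + 1)) + B.first.zeroOrder +
        B.last.zeroOrder := by
      rw [Block.zeroOrder, ← Finset.sum_add_distrib]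
      congr 2
      exact Finset.sum_congr rfl fun i _ => by ring
    omega
  have hpos := positions_of_modEq (fun i hi => by simp [hw, hi])
    (Nat.succ_pos (2 * a)) (Nat.succ_pos (2 * b)) hsum h.dep_lt h.arr_lt h.dep_zero
    (by rw [h.dep_zero, zero_add] at ha'; exact ha')
    (fun i => by rw [hui]; exact modEq_of_flatTurn (hmid i).1)
    (fun i => by rw [hwi]; exact modEq_of_flatTurn (hmid i).2)
  have hle : ∀ (f : ℕ → ℕ) (j : Fin (B.k + 1)),
      ∑ i ∈ Finset.range j, f i ≤ ∑ i ∈ Finset.range B.k, f i := fun f j =>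
    Finset.sum_le_sum_of_subset (Finset.range_subset_range.2 (Nat.lt_succ_iff.1 j.2))
  -- The first loop encloses the positions `1, …, 2a`. No end of a saddle connection lies there, so
  -- all these rays end in petals.
  have hloop₀ : 1 ≤ a → a + 1 = B.first.poleOrder := by
    intro ha1
    have hg := h.glue 0
    have h0 := (hpos 0).1
    simp only [Fin.val_zero, Finset.range_zero, Finset.sum_empty, add_zero] at h0
    rw [h.dep_zero, h0] at hg
    rw [← h.mult_first]
    refine ((D.rootMultiplicity_of_loop ha1 (n := 0) (by simpa using hg) fun j hj1 hj2 => ?_).1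
      (by simp [sgn])).symm
    rw [zero_add]
    rcases h.petal_or_range (n := j) (by omega) with ⟨-, h1⟩ | ⟨l, h1⟩ | ⟨l, h1⟩
    · exact h1
    · exfalso
      have := (hpos l).2
      have h2 := hle w l
      split_ifs at this with hl
      · omega
      · omega
    · exfalso
      have := (hpos l).1
      omega
  have hloop₁ : 1 ≤ b → b + 1 = B.last.poleOrder := by
    intro hb1
    have hg := (h.glue (Fin.last B.k)).symm
    have h0 := (hpos (Fin.last B.k)).1
    have h1 := (hpos (Fin.last B.k)).2
    rw [Fin.val_last] at h0 h1
    -- For `k = 0` the departing end of the last loop has position `0` rather than a full turn, so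
    -- one period is added to make the enclosed positions consecutive.
    have hg' : D.Glue (arr (Fin.last B.k)) (arr (Fin.last B.k) + 2 * b + 1) 1 := by
      split_ifs at h1 with hk
      · have h2 : arr (Fin.last B.k) + 2 * b + 1 =
            dep (Fin.last B.k) + 2 * (B.zeroOrder + 1) := by omega
        rw [h2]
        exact hg.symm.of_add_period.symm
      · have h2 : arr (Fin.last B.k) + 2 * b + 1 = dep (Fin.last B.k) := by omega
        rw [h2]
        exact hg
    rw [← h.mult_last]
    refine ((D.rootMultiplicity_of_loop hb1 hg' fun j hj1 hj2 => ?_).2 (h.sgn_arr _)).symm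
    rcases h.petal_or_range (n := arr (Fin.last B.k) + j) (by omega) with ⟨-, h2⟩ | ⟨l, h2⟩ | ⟨l, h2⟩
    · exact h2
    · exfalso
      have := (hpos l).2
      have h3 := hle w l
      split_ifs at this with hl
      · omega
      · omega
    · exfalso
      have := (hpos l).1
      have h3 := hle u l
      omega
  -- In type (i) the sum is zero; in type (ii) `a ≥ 1` would give `q₀` order at least `2`. In type
  -- (iii) at least one loop encloses rays, and the order of its pole together with the sum fixes
  -- the other.
  have haz : a = B.first.zeroOrder := by
    rcases hB with ⟨-, h1, h2⟩ | ⟨h1, c, h2⟩ | ⟨⟨c, h1⟩, d, h2⟩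
    · rw [h1, h2] at hsum'
      rw [h1]
      simp only [BlockEnd.zeroOrder] at *
      omega
    · rw [h1] at hloop₀ ⊢
      simp only [BlockEnd.poleOrder, BlockEnd.zeroOrder] at *
      omega
    · rw [h1, h2] at hsum'
      rw [h1] at hloop₀ ⊢
      rw [h2] at hloop₁
      simp only [BlockEnd.poleOrder, BlockEnd.zeroOrder] at *
      omega
  refine ⟨u, w, hui, hwi, fun j => ?_⟩
  rw [← haz]
  exact hpos j

/-- Both families of positions are the same function of the block, and every other ray is infinite
in both models. -/
theorem sameRays (hB : B.IsTypeI ∨ B.IsTypeII ∨ B.IsTypeIII) {D' : FlatModel B.zeroOrder}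
    {dep' arr' : Fin (B.k + 1) → ℕ} (h : SaddleSystem B D dep arr)
    (h' : SaddleSystem B D' dep' arr') : D.SameRays D' ∧ dep = dep' := by
  obtain ⟨u, w, hu, hw, hpos⟩ := h.positions hB
  obtain ⟨u', w', hu', hw', hpos'⟩ := h'.positions hB
  have hsum : ∀ f g : ℕ → ℕ, (∀ i : Fin B.k, f i = g i) → ∀ j : Fin (B.k + 1),
      ∑ i ∈ Finset.range j, f i = ∑ i ∈ Finset.range j, g i := fun f g hfg j =>
    Finset.sum_congr rfl fun i hi => hfg ⟨i, by
      have := Finset.mem_range.1 hi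
      have := j.2
      omega⟩
  have harr : arr = arr' := by
    funext j
    rw [(hpos j).1, (hpos' j).1, hsum u u' (fun i => by rw [hu, hu'])]
  have hdep : dep = dep' := by
    funext j
    have h1 := (hpos j).2
    have h2 := (hpos' j).2
    rw [← hsum w w' (fun i => by rw [hw, hw']), ← h1] at h2
    omega
  subst harr hdep
  refine ⟨FlatModel.sameRays_of_lt fun n hn => ?_, rfl⟩
  rcases h.petal_or_range hn with ⟨h1, -⟩ | ⟨j, rfl⟩ | ⟨j, rfl⟩
  · rcases h'.petal_or_range hn with ⟨h2, -⟩ | ⟨j, rfl⟩ | ⟨j, rfl⟩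
    · exact Or.inl ⟨h1, h2⟩
    · exact absurd h1 (h.glue j).not_infinite
    · exact absurd h1 (h.glue j).symm.not_infinite
  · exact Or.inr ⟨_, h.glue j, h'.glue j⟩
  · exact Or.inr ⟨_, (h.glue j).symm, (h'.glue j).symm⟩

end SaddleSystem

/-! ### The given saddle connections are rays -/

/-- Uniqueness of real trajectories of a polynomial vector field. -/
theorem trajectory_unique {P : Polynomial ℂ} {f g : ℝ → ℂ} {a b : ℝ}
    (hf : ∀ t ∈ Set.Icc a b, HasDerivAt f (P.eval (f t)) t)
    (hg : ∀ t ∈ Set.Icc a b, HasDerivAt g (P.eval (g t)) t) (h : f a = g a) :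
    Set.EqOn f g (Set.Icc a b) := by
  have hfc : ContinuousOn f (Set.Icc a b) := fun t ht => (hf t ht).continuousAt.continuousWithinAt
  have hgc : ContinuousOn g (Set.Icc a b) := fun t ht => (hg t ht).continuousAt.continuousWithinAt
  obtain ⟨C₁, h1⟩ := isCompact_Icc.exists_bound_of_continuousOn hfc
  obtain ⟨C₂, h2⟩ := isCompact_Icc.exists_bound_of_continuousOn hgc
  obtain ⟨L, hL⟩ := (isCompact_closedBall (0 : ℂ) (max C₁ C₂)).exists_bound_of_continuousOn
    (f := fun z => P.derivative.eval z) P.derivative.continuous.continuousOn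
  have hlip : LipschitzOnWith L.toNNReal (fun z => P.eval z) (Metric.closedBall 0 (max C₁ C₂)) := by
    refine Convex.lipschitzOnWith_of_nnnorm_deriv_le (fun z _ => P.differentiable z) (fun z hz => ?_)
      (convex_closedBall _ _)
    rw [Polynomial.deriv, ← NNReal.coe_le_coe, coe_nnnorm]
    exact (hL z hz).trans (Real.le_coe_toNNReal L)
  exact ODE_solution_unique_of_mem_Icc_right (v := fun _ z => P.eval z)
    (s := fun _ => Metric.closedBall 0 (max C₁ C₂)) (K := L.toNNReal)
    (fun t _ => hlip) hfc (fun t ht => (hf t ⟨ht.1, ht.2.le⟩).hasDerivWithinAt)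
    (fun t ht => by simpa using Or.inl (h1 t ⟨ht.1, ht.2.le⟩)) hgc
    (fun t ht => (hg t ⟨ht.1, ht.2.le⟩).hasDerivWithinAt)
    (fun t ht => by simpa using Or.inr (h2 t ⟨ht.1, ht.2.le⟩)) h

namespace FlatModel

variable {m : ℕ} (D : FlatModel m)

/-- A trajectory of unit time from the zero to itself is a ray. -/
theorem exists_saddle {z : ℝ → ℂ} (hz : ∀ t ∈ Set.Ioo (0 : ℝ) 1, HasDerivAt z (D.P.eval (z t)) t)
    (hP : ∀ t ∈ Set.Ioo (0 : ℝ) 1, D.P.eval (z t) ≠ 0)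
    (h0 : Tendsto z (𝓝[>] 0) (Bornology.cobounded ℂ))
    (h1 : Tendsto z (𝓝[<] 1) (Bornology.cobounded ℂ)) :
    ∃ n < 2 * (m + 1), ∃ n' < 2 * (m + 1), sgn n = 1 ∧ D.Glue n n' 1 ∧
      (∀ t ∈ Set.Ioo (0 : ℝ) 1, z t = D.ray n t) ∧
      (∀ᶠ t in 𝓝[>] 0, z t = D.coord.Y (omega m ^ n * ((t ^ ((m + 1 : ℝ)⁻¹) : ℝ) : ℂ))) ∧
      ∀ᶠ t in 𝓝[<] 1,
        z t = D.coord.Y (omega m ^ n' * (((1 - t) ^ ((m + 1 : ℝ)⁻¹) : ℝ) : ℂ)) := by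
  obtain ⟨ξ, hξ, hev⟩ := D.coord.exists_start zero_lt_one (v := 1) (by simpa using hz) hP h0
  obtain ⟨n, hn, rfl, hs⟩ := exists_omega_pow m (Or.inl rfl) (by simpa using hξ)
  have hsC : (sgn n : ℂ) = 1 := by rw [hs]; simp
  have hdep : ∀ᶠ t in 𝓝[>] (0 : ℝ),
      z t = D.coord.Y (omega m ^ n * ((t ^ ((m + 1 : ℝ)⁻¹) : ℝ) : ℂ)) := by
    filter_upwards [hev] with t ht
    simpa using ht.1
  have hstart : ∀ᶠ t in 𝓝[>] (0 : ℝ), z t = D.ray n t := by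
    filter_upwards [hdep, Ioo_mem_nhdsGT (pow_pos D.coord.r_pos (m + 1))] with t ht ht'
    have h2 := D.ray_eq_cone (D.ofReal_mul_sgn_mem_coneDom n ht'.1 ht'.2)
    rw [D.cone_ofReal_mul_sgn n ht'.1, hsC, mul_one] at h2
    rw [h2, ht]
  have hder : ∀ t : ℝ, (t : ℂ) ∈ D.rayDom n →
      HasDerivAt (fun t : ℝ => D.ray n t) (D.P.eval (D.ray n t)) t := by
    intro t ht
    have := D.hasDerivAt_ray_real (n := n) (t := t) (by rwa [hsC, mul_one])
    simpa only [hsC, mul_one, one_mul] using this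
  have hagree : ∀ T ∈ Set.Ioo (0 : ℝ) 1, (T : ℂ) ∈ D.rayDom n → z T = D.ray n T := by
    intro T hT hTd
    obtain ⟨a, h2, h3⟩ := (hstart.and (Ioo_mem_nhdsGT hT.1)).exists
    refine trajectory_unique (P := D.P) (a := a) (b := T)
      (fun t ht => hz t ⟨h3.1.trans_le ht.1, ht.2.trans_lt hT.2⟩)
      (fun t ht => hder t ?_) h2 ⟨h3.2.le, le_rfl⟩
    have := D.ofReal_mul_sgn_mem_rayDom (n := n) (h3.1.trans_le ht.1) ht.2
      (by rwa [hsC, mul_one])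
    rwa [hsC, mul_one] at this
  -- Were the ray defined at time one, it would be continuous there, while the trajectory agreeing
  -- with it before that time tends to `∞`.
  have hnot : ((1 : ℝ) : ℂ) * sgn n ∉ D.rayDom n := by
    intro hmem
    refine D.not_tendsto_cobounded_of_mem hmem (h1.congr' ?_)
    filter_upwards [Ioo_mem_nhdsLT zero_lt_one] with t ht
    rw [hsC, mul_one]
    refine hagree t ht ?_
    have := D.ofReal_mul_sgn_mem_rayDom ht.1 ht.2.le hmem
    rwa [hsC, mul_one] at this
  -- The ray cannot break off earlier either, since the trajectory is continuous inside the unit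
  -- interval. So it returns at time exactly one.
  obtain ⟨T, hT0, hT1, hTd, hTinf⟩ := D.exists_ray_blowup zero_lt_one hnot
  have hTeq : T = 1 := by
    refine le_antisymm hT1 (not_lt.1 fun hlt => ?_)
    have hc := (hz T ⟨hT0, hlt⟩).continuousAt.tendsto.mono_left
      (nhdsWithin_le_nhds (s := Set.Iio T))
    refine hc.not_tendsto (Metric.disjoint_nhds_cobounded _) (hTinf.congr' ?_)
    filter_upwards [Ioo_mem_nhdsLT hT0] with t ht
    have := hTd t ht
    rw [hsC, mul_one] at this ⊢
    exact (hagree t ⟨ht.1, ht.2.trans hlt⟩ this).symm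
  subst hTeq
  obtain ⟨n', hn', k, hk, hg⟩ := D.exists_glue_of_blowup hT0 hTd hTinf
  obtain rfl : k = 1 := by exact_mod_cast hk.symm
  have hray : ∀ t ∈ Set.Ioo (0 : ℝ) 1, z t = D.ray n t := fun t ht => by
    have := hTd t ht
    rw [hsC, mul_one] at this
    exact hagree t ht this
  have hs' : (sgn n' : ℂ) = -1 := by rw [hg.sgn_eq, hs]; simp
  refine ⟨n, hn, n', hn', hs, hg, hray, hdep, ?_⟩
  have hsmall : ∀ᶠ t in 𝓝[<] (1 : ℝ), 1 - t < D.coord.r ^ (m + 1) := by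
    have : 1 - D.coord.r ^ (m + 1) < 1 := by linarith [pow_pos D.coord.r_pos (m + 1)]
    filter_upwards [Ioo_mem_nhdsLT this] with t ht
    linarith [ht.1]
  filter_upwards [Ioo_mem_nhdsLT zero_lt_one, hsmall] with t ht ht'
  have hpos : 0 < 1 - t := by linarith [ht.2]
  have h2 : ((1 - t : ℝ) : ℂ) * sgn n' ∈ strip n' ((1 : ℕ) : ℝ) :=
    ofReal_mul_sgn_mem_strip hpos (by push_cast; linarith [ht.1])
  have h3 := hg.ray_eq _ h2
  have h4 : ((1 - t : ℝ) : ℂ) * sgn n' + ((1 : ℕ) : ℂ) * sgn n = t := by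
    rw [hs', hsC]; push_cast; ring
  rw [h4] at h3
  rw [hray t ht, h3, D.ray_eq_cone (D.ofReal_mul_sgn_mem_coneDom n' hpos ht'),
    D.cone_ofReal_mul_sgn n' hpos]

end FlatModel

/-! ### Partial fractions and the construction of a model -/

/-- `h` is, off the finite set `S`, the sum of a derivative and of simple poles in `S`. -/
def HasResidueDecomposition (S : Finset ℂ) (h : ℂ → ℂ) : Prop :=
  ∃ (r : ℂ → ℂ) (K : ℂ → ℂ), ∀ u ∉ S, HasDerivAt K (h u - ∑ p ∈ S, r p / (u - p)) u

theorem HasResidueDecomposition.sub {S : Finset ℂ} {h₁ h₂ : ℂ → ℂ}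
    (H₁ : HasResidueDecomposition S h₁) (H₂ : HasResidueDecomposition S h₂) (c : ℂ) :
    HasResidueDecomposition S (fun u => c * (h₁ u - h₂ u)) := by
  obtain ⟨r₁, K₁, h1⟩ := H₁
  obtain ⟨r₂, K₂, h2⟩ := H₂
  refine ⟨fun p => c * (r₁ p - r₂ p), fun u => c * (K₁ u - K₂ u), fun u hu => ?_⟩
  refine (((h1 u hu).sub (h2 u hu)).const_mul c).congr_deriv ?_
  have : ∑ p ∈ S, c * (r₁ p - r₂ p) / (u - p) =
      c * (∑ p ∈ S, r₁ p / (u - p) - ∑ p ∈ S, r₂ p / (u - p)) := by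
    rw [← Finset.sum_sub_distrib, Finset.mul_sum]
    exact Finset.sum_congr rfl fun p _ => by ring
  rw [this]
  ring

theorem HasResidueDecomposition.congr {S : Finset ℂ} {h₁ h₂ : ℂ → ℂ}
    (H : HasResidueDecomposition S h₁) (h : ∀ u ∉ S, h₁ u = h₂ u) :
    HasResidueDecomposition S h₂ := by
  obtain ⟨r, K, hK⟩ := H
  exact ⟨r, K, fun u hu => by rw [← h u hu]; exact hK u hu⟩

theorem hasResidueDecomposition_inv_pow {S : Finset ℂ} {a : ℂ} (ha : a ∈ S) (n : ℕ) :
    HasResidueDecomposition S (fun u => ((u - a) ^ (n + 1))⁻¹) := by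
  classical
  rcases Nat.eq_zero_or_pos n with rfl | hn
  · refine ⟨fun p => if p = a then 1 else 0, fun _ => 0, fun u _ => ?_⟩
    have : ∑ p ∈ S, (if p = a then 1 else 0) / (u - p) = (u - a)⁻¹ := by
      rw [Finset.sum_eq_single a (fun p _ hp => by simp [hp]) (fun h => absurd ha h)]
      simp
    rw [this]
    simpa using hasDerivAt_const u (0 : ℂ)
  · refine ⟨fun _ => 0, fun u => -((u - a) ^ n)⁻¹ / n, fun u hu => ?_⟩
    have hua : u - a ≠ 0 := sub_ne_zero.2 fun h => hu (h ▸ ha)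
    have h1 := ((((hasDerivAt_id u).sub_const a).fun_pow n).fun_inv (pow_ne_zero n hua)).neg.div_const
      (n : ℂ)
    refine h1.congr_deriv ?_
    obtain ⟨l, rfl⟩ := Nat.exists_eq_succ_of_ne_zero hn.ne'
    have hl : ((l : ℂ) + 1) ≠ 0 := by exact_mod_cast Nat.succ_ne_zero l
    simp only [id, zero_div, Finset.sum_const_zero, sub_zero, Nat.succ_eq_add_one,
      Nat.add_sub_cancel]
    push_cast
    field_simp
    ring

/-- Partial fractions for the inverse of a product of linear factors. -/
theorem hasResidueDecomposition_inv_prod {S : Finset ℂ} (n : ℕ) : ∀ s : Multiset ℂ,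
    s.card = n + 1 → (∀ a ∈ s, a ∈ S) →
    HasResidueDecomposition S (fun u => ((s.map fun a => u - a).prod)⁻¹) := by
  induction n with
  | zero =>
    intro s hs hsS
    obtain ⟨a, rfl⟩ := Multiset.card_eq_one.1 hs
    simpa using hasResidueDecomposition_inv_pow (hsS a (by simp)) 0
  | succ n ih =>
    intro s hs hsS
    by_cases hall : ∃ a, s = Multiset.replicate (n + 2) a
    · obtain ⟨a, rfl⟩ := hall
      refine (hasResidueDecomposition_inv_pow
        (hsS a (Multiset.mem_replicate.2 ⟨by omega, rfl⟩)) (n + 1)).congr fun u _ => ?_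
      rw [Multiset.map_replicate, Multiset.prod_replicate]
    obtain ⟨a, ha⟩ := Multiset.card_pos_iff_exists_mem.1 (by omega : 0 < s.card)
    obtain ⟨b, hb, hba⟩ : ∃ b ∈ s, b ≠ a := by
      by_contra! hcon
      exact hall ⟨a, Multiset.eq_replicate.2 ⟨hs, hcon⟩⟩
    obtain ⟨t, rfl⟩ := Multiset.exists_cons_of_mem ha
    have hbt : b ∈ t := (Multiset.mem_cons.1 hb).resolve_left hba
    obtain ⟨v, rfl⟩ := Multiset.exists_cons_of_mem hbt
    rw [Multiset.card_cons, Multiset.card_cons] at hs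
    have h1 := ih (a ::ₘ v) (by rw [Multiset.card_cons]; omega) fun x hx => by
      rcases Multiset.mem_cons.1 hx with rfl | hx
      · exact hsS _ (by simp)
      · exact hsS _ (by simp [hx])
    have h2 := ih (b ::ₘ v) (by rw [Multiset.card_cons]; omega) fun x hx => by
      rcases Multiset.mem_cons.1 hx with rfl | hx
      · exact hsS _ (by simp)
      · exact hsS _ (by simp [hx])
    -- Two different factors are separated by `1/((u-a)(u-b)) = ((u-a)⁻¹ - (u-b)⁻¹) / (a-b)`.
    refine (h1.sub h2 (a - b)⁻¹).congr fun u hu => ?_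
    have hua : u - a ≠ 0 := sub_ne_zero.2 fun h => hu (h ▸ hsS a (by simp))
    have hub : u - b ≠ 0 := sub_ne_zero.2 fun h => hu (h ▸ hsS b (by simp))
    have hab : a - b ≠ 0 := sub_ne_zero.2 hba.symm
    simp only [Multiset.map_cons, Multiset.prod_cons, mul_inv]
    field_simp
    ring

theorem exists_residueDecomposition {P : Polynomial ℂ} (hP : 0 < P.natDegree) :
    ∃ (r : ℂ → ℂ) (K : ℂ → ℂ), ∀ u, P.eval u ≠ 0 →
      HasDerivAt K ((P.eval u)⁻¹ - ∑ p ∈ P.roots.toFinset, r p / (u - p)) u := by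
  have hP0 : P ≠ 0 := by rintro rfl; simp at hP
  have hcard : P.roots.card = P.natDegree - 1 + 1 := by
    rw [IsAlgClosed.card_roots_eq_natDegree]; omega
  obtain ⟨r, K, h⟩ := ((hasResidueDecomposition_inv_prod (P.natDegree - 1) P.roots hcard
    (fun a ha => Multiset.mem_toFinset.2 ha)).sub (h₂ := fun _ => 0)
      ⟨fun _ => 0, fun _ => 0, fun u _ => by simpa using hasDerivAt_const u (0 : ℂ)⟩
      P.leadingCoeff⁻¹)
  refine ⟨r, K, fun u hu => ?_⟩
  have hnot : u ∉ P.roots.toFinset := fun hmem =>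
    hu (Polynomial.isRoot_of_mem_roots (Multiset.mem_toFinset.1 hmem))
  refine (h u hnot).congr_deriv ?_
  have h1 := (IsAlgClosed.splits P).eval_eq_prod_roots u
  simp only [h1, mul_inv, sub_zero]

/-- The exponential maps a half-plane, which is convex, onto the punctured disc. -/
theorem isPreconnected_punctured_ball (r : ℝ) :
    IsPreconnected {ζ : ℂ | ζ ≠ 0 ∧ ‖ζ‖ < r} := by
  have himg : {ζ : ℂ | ζ ≠ 0 ∧ ‖ζ‖ < r} = Complex.exp '' {w : ℂ | Real.exp w.re < r} := by
    ext ζ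
    constructor
    · rintro ⟨h0, h1⟩
      exact ⟨Complex.log ζ, by
        simpa [Complex.log_re, Real.exp_log (norm_pos_iff.2 h0)] using h1, Complex.exp_log h0⟩
    · rintro ⟨w, hw, rfl⟩
      exact ⟨Complex.exp_ne_zero w, by rw [Complex.norm_exp]; exact hw⟩
  rw [himg]
  refine IsPreconnected.image ?_ _ Complex.continuous_exp.continuousOn
  rcases le_or_gt r 0 with hr | hr
  · have : {w : ℂ | Real.exp w.re < r} = ∅ := by
      ext w
      simp only [Set.mem_ofPred_eq, Set.mem_empty_iff_false, iff_false, not_lt]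
      exact hr.trans (Real.exp_pos _).le
    rw [this]
    exact isPreconnected_empty
  · have : {w : ℂ | Real.exp w.re < r} = {w : ℂ | w.re < Real.log r} := by
      ext w
      simp only [Set.mem_ofPred_eq]
      exact (Real.lt_log_iff_exp_lt hr).symm
    rw [this]
    exact (convex_halfSpace_re_lt _).isPreconnected

open Classical in
/-- A polynomial with residues `±1 / (2πi)` at two zeros of `P` and no others gives a model, with a
prescribed coordinate at `∞`. -/
theorem exists_flatModel {m : ℕ} {P : Polynomial ℂ} (hdeg : P.natDegree = m + 2)
    (coord : InfCoord P m) {q₀ q₁ : ℂ} (hne : q₀ ≠ q₁) (h₀ : P.eval q₀ = 0) (h₁ : P.eval q₁ = 0)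
    {K : ℂ → ℂ} (hK : ∀ u, P.eval u ≠ 0 → HasDerivAt K
      ((P.eval u)⁻¹ - (2 * Real.pi * Complex.I)⁻¹ * ((u - q₀)⁻¹ - (u - q₁)⁻¹)) u) :
    ∃ D : FlatModel m, D.P = P ∧ D.coord.Y = coord.Y ∧ D.coord.r = coord.r ∧
      D.coord.κ = coord.κ ∧ D.q₀ = q₀ ∧ D.q₁ = q₁ := by
  have h2pi := Complex.two_pi_I_ne_zero
  -- The exponential of `2πi` times the primitive, written without logarithms: the residues
  -- `±1/(2πi)` become exponents `±1`.
  set E₁ : ℂ → ℂ := fun u => Complex.exp (2 * Real.pi * Complex.I * K u) * ((u - q₀) / (u - q₁))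
    with hE₁
  have hE₁ne : ∀ u, P.eval u ≠ 0 → E₁ u ≠ 0 := fun u hu =>
    mul_ne_zero (Complex.exp_ne_zero _) (div_ne_zero (sub_ne_zero.2 fun h => hu (h ▸ h₀))
      (sub_ne_zero.2 fun h => hu (h ▸ h₁)))
  have hE₁d : ∀ u, P.eval u ≠ 0 →
      HasDerivAt E₁ (2 * Real.pi * Complex.I * E₁ u / P.eval u) u := by
    intro u hu
    have hu0 : u - q₀ ≠ 0 := sub_ne_zero.2 fun h => hu (h ▸ h₀)
    have hu1 : u - q₁ ≠ 0 := sub_ne_zero.2 fun h => hu (h ▸ h₁)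
    have h1 := (((hK u hu).const_mul (2 * Real.pi * Complex.I)).cexp).mul
      (((hasDerivAt_id u).sub_const q₀).div ((hasDerivAt_id u).sub_const q₁) hu1)
    refine h1.congr_deriv ?_
    simp only [hE₁, id, Pi.div_apply]
    have h3 : (2 * Real.pi * Complex.I) * ((P.eval u)⁻¹ -
        (2 * Real.pi * Complex.I)⁻¹ * ((u - q₀)⁻¹ - (u - q₁)⁻¹)) =
        2 * Real.pi * Complex.I / P.eval u - ((u - q₀)⁻¹ - (u - q₁)⁻¹) := by
      rw [mul_sub, mul_inv_cancel_left₀ h2pi, div_eq_mul_inv]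
    rw [h3]
    generalize (2 * Real.pi * Complex.I : ℂ) = J at *
    field_simp
    ring
  -- On the connected punctured disc the two exponentials have the same logarithmic derivative.
  -- Division by their constant ratio gives the normalization at the zero.
  have hconst : ∃ c : ℂ, c ≠ 0 ∧ ∀ ζ, ζ ≠ 0 → ‖ζ‖ < coord.r →
      E₁ (coord.Y ζ) * Complex.exp (-(2 * Real.pi * Complex.I * ζ ^ (m + 1))) = c := by
    set U : Set ℂ := {ζ : ℂ | ζ ≠ 0 ∧ ‖ζ‖ < coord.r} with hU
    have hUo : IsOpen U := isOpen_ne.inter (isOpen_lt continuous_norm continuous_const)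
    have hder : ∀ ζ ∈ U, HasDerivAt (fun ζ => E₁ (coord.Y ζ) *
        Complex.exp (-(2 * Real.pi * Complex.I * ζ ^ (m + 1)))) 0 ζ := by
      rintro ζ ⟨hζ0, hζr⟩
      obtain ⟨hPz, hY⟩ := coord.deriv_Y ζ hζ0 hζr
      have h1 := ((hE₁d _ hPz).comp ζ hY).mul
        ((((hasDerivAt_id ζ).fun_pow (m + 1)).const_mul (2 * Real.pi * Complex.I)).neg.cexp)
      refine h1.congr_deriv ?_
      simp only [id, Nat.add_sub_cancel, Function.comp, Pi.neg_apply]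
      push_cast
      field_simp
      ring
    have hmem : ((coord.r / 2 : ℝ) : ℂ) ∈ U := by
      have := coord.r_pos
      refine ⟨by exact_mod_cast (half_pos this).ne', ?_⟩
      rw [Complex.norm_real, Real.norm_of_nonneg (half_pos this).le]
      exact half_lt_self this
    refine ⟨E₁ (coord.Y ((coord.r / 2 : ℝ) : ℂ)) * Complex.exp
        (-(2 * Real.pi * Complex.I * ((coord.r / 2 : ℝ) : ℂ) ^ (m + 1))),
      mul_ne_zero (hE₁ne _ (coord.deriv_Y _ hmem.1 hmem.2).1) (Complex.exp_ne_zero _),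
      fun ζ h1 h2 => ?_⟩
    exact hUo.is_const_of_deriv_eq_zero (isPreconnected_punctured_ball coord.r)
      (fun y hy => (hder y hy).differentiableAt.differentiableWithinAt)
      (fun y hy => (hder y hy).deriv) ⟨h1, h2⟩ hmem
  obtain ⟨c, hc0, hc⟩ := hconst
  refine ⟨{ P := P, natDegree_P := hdeg, coord := coord, E := fun u => c⁻¹ * E₁ u
            E_ne := fun u hu => mul_ne_zero (inv_ne_zero hc0) (hE₁ne u hu)
            deriv_E := fun u hu => ((hE₁d u hu).const_mul c⁻¹).congr_deriv (by ring)
            E_Y := fun ζ h1 h2 => ?_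
            q₀ := q₀, q₁ := q₁, q_ne := hne, P_q₀ := h₀, P_q₁ := h₁, K := K, deriv_K := hK },
    rfl, rfl, rfl, rfl, rfl, rfl⟩
  have h3 := hc ζ h1 h2
  rw [Complex.exp_neg] at h3
  rw [← h3, mul_inv, inv_inv]
  have h4 := hE₁ne _ (coord.deriv_Y ζ h1 h2).1
  field_simp

/-! ### Differentials on the sphere are determined by their divisors -/

/-- A meromorphic function on the sphere without zeros and poles is constant. -/
theorem exists_const_of_meromorphicOrderAt_eq_zero {h : ℂ → ℂ} {T : Set ℂ} (hT : T.Finite)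
    (hmer : ∀ z, MeromorphicAt h z) (hord : ∀ z, meromorphicOrderAt h z = 0)
    (han : ∀ z ∉ T, AnalyticAt ℂ h z) (hmer' : MeromorphicAt (fun w => h w⁻¹) 0)
    (hord' : meromorphicOrderAt (fun w => h w⁻¹) 0 = 0) :
    ∃ C : ℂ, C ≠ 0 ∧ ∀ z ∉ T, h z = C := by
  have hm : MeromorphicOn h Set.univ := fun z _ => hmer z
  -- The normal form corrects the conventional values at the points of `T`. Order zero everywhere
  -- makes it entire, and order zero at infinity gives it a finite nonzero limit there.
  set H := toMeromorphicNFOn h Set.univ with hH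
  have hHd : Differentiable ℂ H := fun z => by
    refine AnalyticAt.differentiableAt ?_
    refine (MeromorphicNFAt.meromorphicOrderAt_nonneg_iff_analyticAt
      (meromorphicNFOn_toMeromorphicNFOn h Set.univ (Set.mem_univ z))).1 ?_
    rw [meromorphicOrderAt_toMeromorphicNFOn hm (Set.mem_univ z), hord z]
  have heq : ∀ z ∉ T, H z = h z := fun z hz => by
    rw [hH, toMeromorphicNFOn_eq_toMeromorphicNFAt hm (Set.mem_univ z),
      toMeromorphicNFAt_eq_self.2 (han z hz).meromorphicNFAt]
  obtain ⟨C, hC, hlim⟩ := tendsto_ne_zero_of_meromorphicOrderAt_eq_zero hmer' hord'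
  have hlim2 : Tendsto h (Bornology.cobounded ℂ) (𝓝 C) := by
    have := hlim.comp (tendsto_inv₀_cobounded' (α := ℂ))
    simpa [Function.comp_def] using this
  have hlim3 : Tendsto H (cocompact ℂ) (𝓝 C) := by
    rw [← Metric.cobounded_eq_cocompact]
    refine hlim2.congr' ?_
    have hb : Tᶜ ∈ Bornology.cobounded ℂ := Bornology.isBounded_def.1 hT.isBounded
    filter_upwards [hb] with z hz
    exact (heq z hz).symm
  exact ⟨C, hC, fun z hz => by
    rw [← heq z hz]; exact hHd.apply_eq_of_tendsto_cocompact z hlim3⟩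

/-- The local equation of the point `p` in the affine chart. -/
noncomputable def linearFactor (p : Sphere) (z : ℂ) : ℂ :=
  Option.elim p 1 (fun a => z - a)

@[simp] theorem linearFactor_infty (z : ℂ) : linearFactor OnePoint.infty z = 1 := rfl

@[simp] theorem linearFactor_coe (a z : ℂ) : linearFactor (a : Sphere) z = z - a := rfl

@[simp] theorem zCoord_coe (a : ℂ) : zCoord (a : Sphere) = a := rfl

@[simp] theorem wCoord_coe (a : ℂ) : wCoord (a : Sphere) = a⁻¹ := rfl

@[simp] theorem zCoord_infty : zCoord OnePoint.infty = 0 := rfl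

@[simp] theorem wCoord_infty : wCoord OnePoint.infty = 0 := rfl

theorem linearFactor_ne_zero {p : Sphere} {z : ℂ} (h : p ≠ z) : linearFactor p z ≠ 0 := by
  induction p using OnePoint.rec with
  | infty => simp
  | coe a => exact sub_ne_zero.2 fun h' => h (by rw [h'])

theorem analyticAt_linearFactor (p : Sphere) (z : ℂ) : AnalyticAt ℂ (linearFactor p) z := by
  induction p using OnePoint.rec with
  | infty => exact analyticAt_const
  | coe a => exact analyticAt_id.sub analyticAt_const

open Classical in
theorem meromorphicOrderAt_linearFactor (p : Sphere) (z : ℂ) :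
    meromorphicOrderAt (linearFactor p) z = ((if p = z then 1 else 0 : ℤ) : WithTop ℤ) := by
  by_cases h : p = z
  · subst h
    rw [if_pos rfl]
    exact meromorphicOrderAt_id_sub_const (x := z)
  · rw [if_neg h, meromorphicOrderAt_eq_int_iff (analyticAt_linearFactor p z).meromorphicAt]
    exact ⟨_, analyticAt_linearFactor p z, linearFactor_ne_zero h, by simp⟩

open Classical in
theorem meromorphicAt_linearFactor_inv (p : Sphere) :
    MeromorphicAt (fun w => linearFactor p w⁻¹) 0 ∧
    meromorphicOrderAt (fun w => linearFactor p w⁻¹) 0 =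
      ((if p = OnePoint.infty then 0 else -1 : ℤ) : WithTop ℤ) := by
  induction p using OnePoint.rec with
  | infty =>
    have h1 : MeromorphicAt (fun _ : ℂ => (1 : ℂ)) 0 := MeromorphicAt.const _ _
    refine ⟨h1, ?_⟩
    rw [if_pos rfl]
    exact (meromorphicOrderAt_eq_int_iff h1).2 ⟨_, analyticAt_const, one_ne_zero, by simp⟩
  | coe a =>
    have h1 : MeromorphicAt (fun w : ℂ => w⁻¹ - a) 0 :=
      (MeromorphicAt.id 0).inv.sub (MeromorphicAt.const _ _)
    refine ⟨h1, ?_⟩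
    rw [if_neg (OnePoint.coe_ne_infty a)]
    refine (meromorphicOrderAt_eq_int_iff h1).2 ⟨fun w => 1 - a * w, by fun_prop, by simp, ?_⟩
    filter_upwards [self_mem_nhdsWithin] with w hw
    have hw : w ≠ 0 := hw
    simp only [sub_zero, zpow_neg_one, smul_eq_mul]
    field_simp

theorem MeroDifferential.analyticAt_of_ord_eq_zero (η : MeroDifferential) {z : ℂ}
    (h : η.ord z = 0) : AnalyticAt ℂ η.f z := by
  rw [MeroDifferential.ord, if_neg (OnePoint.coe_ne_infty z)] at h
  exact (η.meromorphic_f (Set.mem_univ z)).meromorphicOrderAt_nonneg_iff_analyticAt.1 h.ge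

/-- At a pole this is the convention of the normal form. It matches `0⁻¹ = 0`, so formulas with
inverses remain valid at the poles. -/
theorem MeroDifferential.f_eq_zero_of_ord_ne_zero (η : MeroDifferential) {z : ℂ}
    (h : η.ord z ≠ 0) : η.f z = 0 := by
  rw [MeroDifferential.ord, if_neg (OnePoint.coe_ne_infty z)] at h
  by_contra hne
  exact h ((η.meromorphic_f (Set.mem_univ z)).meromorphicOrderAt_eq_zero_iff.2 hne)

open Classical in
/-- A meromorphic differential on the sphere is determined up to scale by its divisor. -/
theorem MeroDifferential.exists_eq_prod (η : MeroDifferential) {ι : Type*} [Fintype ι]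
    {x : ι → Sphere} (hx : Function.Injective x) {n : ι → ℤ}
    (hn : ∀ i, η.ord (x i) = (n i : WithTop ℤ)) (hother : ∀ p ∉ Set.range x, η.ord p = 0)
    (hsum : ∑ i, n i = -2) :
    ∃ C : ℂ, C ≠ 0 ∧ ∀ z : ℂ, (z : Sphere) ∉ Set.range x →
      η.f z = C * ∏ i, linearFactor (x i) z ^ n i := by
  have hord : ∀ p, η.ord p = ((∑ i, if x i = p then n i else 0 : ℤ) : WithTop ℤ) := by
    intro p
    by_cases hp : p ∈ Set.range x
    · obtain ⟨i, rfl⟩ := hp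
      rw [hn, Finset.sum_eq_single i (fun j _ hj => if_neg fun h => hj (hx h)) (by simp),
        if_pos rfl]
    · rw [hother p hp, Finset.sum_eq_zero fun i _ => if_neg fun h => hp ⟨i, h⟩]
      rfl
  -- The quotient by the expected product should be a nonzero constant; its order is checked at
  -- every point, infinity included.
  set h : ℂ → ℂ := fun z => η.f z * ∏ i, linearFactor (x i) z ^ (-n i) with hh
  have mf : ∀ z, MeromorphicAt η.f z := fun z => (η.meromorphic_f (Set.mem_univ z)).meromorphicAt
  have ml : ∀ z i, MeromorphicAt (linearFactor (x i) ^ (-n i)) z := fun z i =>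
    (analyticAt_linearFactor (x i) z).meromorphicAt.zpow _
  have mprod : ∀ z, MeromorphicAt (fun z => ∏ i, linearFactor (x i) z ^ (-n i)) z := fun z => by
    simpa using MeromorphicAt.fun_prod (s := Finset.univ) (fun i _ => ml z i)
  have key : ∀ z, meromorphicOrderAt h z = 0 := by
    intro z
    rw [hh]
    have h1 : meromorphicOrderAt (fun z => ∏ i, linearFactor (x i) z ^ (-n i)) z =
        ((∑ i, if x i = z then -n i else 0 : ℤ) : WithTop ℤ) := by
      have := meromorphicOrderAt_fun_prod (s := Finset.univ) (fun i _ => ml z i)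
      simp only [Pi.pow_apply] at this
      rw [this, WithTop.coe_sum]
      refine Finset.sum_congr rfl fun i _ => ?_
      rw [meromorphicOrderAt_zpow (analyticAt_linearFactor (x i) z).meromorphicAt,
        meromorphicOrderAt_linearFactor, ← WithTop.coe_mul]
      congr 1
      split_ifs <;> simp
    have h2 := hord z
    rw [MeroDifferential.ord, if_neg (OnePoint.coe_ne_infty z), zCoord_coe] at h2
    rw [show (fun z => η.f z * ∏ i, linearFactor (x i) z ^ (-n i)) =
      η.f * (fun z => ∏ i, linearFactor (x i) z ^ (-n i)) from rfl,
      meromorphicOrderAt_mul (mf z) (mprod z), h1, h2, ← WithTop.coe_add, ← Finset.sum_add_distrib,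
      Finset.sum_eq_zero fun i _ => by split_ifs <;> simp]
    rfl
  have mg : MeromorphicAt η.g 0 := (η.meromorphic_g (Set.mem_univ 0)).meromorphicAt
  have mfi : (fun w => η.f w⁻¹) =ᶠ[𝓝[≠] 0] (fun w => -w ^ 2) * η.g := by
    filter_upwards [self_mem_nhdsWithin] with w hw
    have hw : w ≠ 0 := hw
    rw [Pi.mul_apply, η.compat w hw]
    field_simp
  have hsq : MeromorphicAt (fun w : ℂ => -w ^ 2) 0 := by fun_prop
  have ml' : ∀ i, MeromorphicAt ((fun w => linearFactor (x i) w⁻¹) ^ (-n i)) 0 := fun i =>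
    (meromorphicAt_linearFactor_inv (x i)).1.zpow _
  have mprod' : MeromorphicAt (fun w => ∏ i, linearFactor (x i) w⁻¹ ^ (-n i)) 0 := by
    simpa using MeromorphicAt.fun_prod (s := Finset.univ) (fun i _ => ml' i)
  have mfi' : MeromorphicAt (fun w => η.f w⁻¹) 0 := (hsq.mul mg).congr mfi.symm
  have key' : meromorphicOrderAt (fun w => h w⁻¹) 0 = 0 := by
    have h1 : meromorphicOrderAt (fun w => ∏ i, linearFactor (x i) w⁻¹ ^ (-n i)) 0 =
        ((∑ i, if x i = OnePoint.infty then 0 else n i : ℤ) : WithTop ℤ) := by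
      have := meromorphicOrderAt_fun_prod (s := Finset.univ) (fun i _ => ml' i)
      simp only [Pi.pow_apply] at this
      rw [this, WithTop.coe_sum]
      refine Finset.sum_congr rfl fun i _ => ?_
      rw [meromorphicOrderAt_zpow (meromorphicAt_linearFactor_inv (x i)).1,
        (meromorphicAt_linearFactor_inv (x i)).2, ← WithTop.coe_mul]
      congr 1
      split_ifs <;> simp
    have h2 := hord OnePoint.infty
    rw [MeroDifferential.ord, if_pos rfl] at h2
    have h3 : meromorphicOrderAt (fun w : ℂ => -w ^ 2) 0 = ((2 : ℤ) : WithTop ℤ) :=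
      (meromorphicOrderAt_eq_int_iff hsq).2 ⟨fun _ => -1, analyticAt_const, by simp, by
        filter_upwards with w
        simp [zpow_ofNat]⟩
    rw [show (fun w => h w⁻¹) =
      (fun w => η.f w⁻¹) * (fun w => ∏ i, linearFactor (x i) w⁻¹ ^ (-n i)) from rfl,
      meromorphicOrderAt_mul mfi' mprod', meromorphicOrderAt_congr mfi, meromorphicOrderAt_mul hsq mg,
      h1, h2, h3, ← WithTop.coe_add, ← WithTop.coe_add]
    -- At infinity the orders add up to the total degree `-2`, which the factor `w ^ 2` from the
    -- change of chart compensates.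
    have h4 : (∑ i, if x i = OnePoint.infty then n i else 0) +
        (∑ i, if x i = OnePoint.infty then 0 else n i) = -2 := by
      rw [← Finset.sum_add_distrib, ← hsum]
      exact Finset.sum_congr rfl fun i _ => by split_ifs <;> simp
    rw [add_assoc, h4]
    rfl
  set T : Set ℂ := {z | (z : Sphere) ∈ Set.range x} with hT
  have hTf : T.Finite := (Set.finite_range x).preimage (OnePoint.coe_injective.injOn)
  obtain ⟨C, hC, hCz⟩ := exists_const_of_meromorphicOrderAt_eq_zero hTf
    (fun z => (mf z).mul (mprod z)) key
    (fun z hz => (η.analyticAt_of_ord_eq_zero (hother z hz)).mul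
      (Finset.analyticAt_fun_prod _ fun i _ => (analyticAt_linearFactor (x i) z).zpow
        (linearFactor_ne_zero fun h => hz ⟨i, h⟩))) (mfi'.mul mprod') key'
  refine ⟨C, hC, fun z hz => ?_⟩
  have h1 : η.f z * ∏ i, linearFactor (x i) z ^ (-n i) = C := hCz z hz
  rw [← h1, mul_assoc, ← Finset.prod_mul_distrib, Finset.prod_eq_one fun i _ => ?_, mul_one]
  rw [← zpow_add₀ (linearFactor_ne_zero fun h => hz ⟨i, h⟩), neg_add_cancel, zpow_zero]

/-! ### Residues in an arbitrary coordinate -/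

/-- Away from its zero, the logarithmic derivative of a function with a simple zero at `x₀` differs
from `1 / (x - x₀)` by a holomorphic function. -/
theorem exists_logDeriv_sub_inv {U : ℂ → ℂ} {x₀ p : ℂ} (hU : AnalyticAt ℂ U x₀) (hp : U x₀ = p)
    (hU' : deriv U x₀ ≠ 0) : ∃ G : ℂ → ℂ, AnalyticAt ℂ G x₀ ∧
      ∀ᶠ x in 𝓝[≠] x₀, U x ≠ p ∧ deriv U x / (U x - p) = (x - x₀)⁻¹ + G x := by
  set k := dslope U x₀ with hk
  have hka : AnalyticAt ℂ k x₀ := by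
    obtain ⟨s, hs, hd⟩ := hU.eventually_analyticAt.exists_mem
    obtain ⟨r, hr, hball⟩ := Metric.mem_nhds_iff.1 hs
    have h1 : DifferentiableOn ℂ U (Metric.ball x₀ r) := fun y hy =>
      (hd y (hball hy)).differentiableAt.differentiableWithinAt
    exact ((Complex.differentiableOn_dslope (Metric.ball_mem_nhds x₀ hr)).2 h1).analyticAt
      (Metric.ball_mem_nhds x₀ hr)
  have hk0 : k x₀ ≠ 0 := by rwa [hk, dslope_same]
  have hfac : ∀ x, U x - p = (x - x₀) * k x := fun x => by
    rw [hk, ← hp, ← smul_eq_mul, sub_smul_dslope]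
  refine ⟨fun x => deriv k x / k x, hka.deriv.div hka hk0, ?_⟩
  have h1 : ∀ᶠ x in 𝓝[≠] x₀, AnalyticAt ℂ k x ∧ k x ≠ 0 :=
    (hka.eventually_analyticAt.and (hka.continuousAt.eventually_ne hk0)).filter_mono
      nhdsWithin_le_nhds
  filter_upwards [h1, self_mem_nhdsWithin] with x ⟨hx1, hx2⟩ hx3
  have hx3 : x - x₀ ≠ 0 := sub_ne_zero.2 hx3
  have h2 : HasDerivAt U (1 * k x + (x - x₀) * deriv k x) x := by
    have h3 := ((hasDerivAt_id x).sub_const x₀).mul hx1.differentiableAt.hasDerivAt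
    refine (h3.add_const p).congr_of_eventuallyEq (Eventually.of_forall fun y => ?_)
    simp only [Pi.mul_apply, id]
    rw [← hfac y]; ring
  refine ⟨fun h => ?_, ?_⟩
  · exact mul_ne_zero hx3 hx2 (by rw [← hfac, h, sub_self])
  rw [h2.deriv, hfac]
  field_simp

/-- The residue of `(1/P) du` at a zero `p` of `P`, computed in an arbitrary coordinate. -/
theorem eq_residue_of_circleIntegral {P : Polynomial ℂ} {r K : ℂ → ℂ}
    (hK : ∀ u, P.eval u ≠ 0 →
      HasDerivAt K ((P.eval u)⁻¹ - ∑ p ∈ P.roots.toFinset, r p / (u - p)) u)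
    {U φ : ℂ → ℂ} {x₀ p : ℂ} (hU : AnalyticAt ℂ U x₀) (hp : U x₀ = p) (hU' : deriv U x₀ ≠ 0)
    (hP : P ≠ 0) (hroot : P.eval p = 0)
    (hφ : ∀ᶠ x in 𝓝[≠] x₀, φ x = (P.eval (U x))⁻¹ * deriv U x) {ρ : ℂ}
    (hρ : ∀ᶠ R : ℝ in 𝓝[>] 0, (∮ x in C(x₀, R), φ x) = 2 * Real.pi * Complex.I * ρ) :
    r p = ρ := by
  classical
  obtain ⟨G, hG, hGe⟩ := exists_logDeriv_sub_inv hU hp hU'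
  obtain ⟨r₀, hr₀, hsep⟩ := exists_root_separation hP p
  set S := P.roots.toFinset with hS
  have hmemS : ∀ {a}, a ∈ S ↔ P.eval a = 0 := fun {a} => by
    rw [hS, Multiset.mem_toFinset, Polynomial.mem_roots hP]; rfl
  -- The holomorphic part of the polar terms: the remainder of the term at `p`, and the terms at the
  -- other roots, which are regular at `x₀`.
  set G₁ : ℂ → ℂ := fun x => r p * G x + ∑ a ∈ S.erase p, r a * (deriv U x / (U x - a)) with hG₁
  have hG₁a : AnalyticAt ℂ G₁ x₀ := by
    refine (analyticAt_const.mul hG).add (Finset.analyticAt_fun_sum _ fun a ha => ?_)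
    refine analyticAt_const.mul (hU.deriv.div (hU.sub analyticAt_const) ?_)
    rw [hp]
    exact sub_ne_zero.2 (Finset.ne_of_mem_erase ha).symm
  obtain ⟨r₁, hr₁, hball⟩ := Metric.eventually_nhds_iff_ball.1 hG₁a.eventually_analyticAt
  obtain ⟨L, hL⟩ := DifferentiableOn.isExactOn_ball (c := x₀) (r := r₁) (f := G₁)
    (fun x hx => (hball x hx).differentiableAt.differentiableWithinAt)
  have hnear : ∀ᶠ x in 𝓝[≠] x₀, P.eval (U x) ≠ 0 := by
    have h1 : ∀ᶠ x in 𝓝[≠] x₀, ‖p - U x‖ < r₀ := by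
      refine Filter.Eventually.filter_mono nhdsWithin_le_nhds ?_
      have h2 : Tendsto (fun x => ‖p - U x‖) (𝓝 x₀) (𝓝 ‖p - U x₀‖) :=
        (continuousAt_const.sub hU.continuousAt).norm
      rw [hp, sub_self, norm_zero] at h2
      exact h2.eventually_lt_const hr₀
    filter_upwards [h1, hGe] with x hx hx' hzero
    exact absurd (hsep _ hzero hx'.1) (not_le.2 hx)
  have hUa : ∀ᶠ x in 𝓝[≠] x₀, AnalyticAt ℂ U x :=
    hU.eventually_analyticAt.filter_mono nhdsWithin_le_nhds
  have hb : ∀ᶠ x in 𝓝[≠] x₀, x ∈ Metric.ball x₀ r₁ :=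
    Filter.Eventually.filter_mono nhdsWithin_le_nhds (Metric.ball_mem_nhds x₀ hr₁)
  -- Up to the term `r p / (x - x₀)` the differential is exact near `x₀`, so its integral over a
  -- small circle is `2πi r p`.
  have hall : ∀ᶠ x in 𝓝[≠] x₀, φ x = (P.eval (U x))⁻¹ * deriv U x ∧ P.eval (U x) ≠ 0 ∧
      AnalyticAt ℂ U x ∧
      HasDerivAt (fun x => K (U x) + L x) (φ x - r p * (x - x₀)⁻¹) x := by
    filter_upwards [hφ, hnear, hUa, hb, hGe] with x h1 h2 h3 h4 h5
    refine ⟨h1, h2, h3, ?_⟩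
    refine (((hK _ h2).comp x h3.differentiableAt.hasDerivAt).add (hL x h4)).congr_deriv ?_
    rw [h1, ← Finset.add_sum_erase S _ (hmemS.2 hroot), hG₁, sub_mul, add_mul]
    have h6 : (∑ a ∈ S.erase p, r a / (U x - a)) * deriv U x =
        ∑ a ∈ S.erase p, r a * (deriv U x / (U x - a)) := by
      rw [Finset.sum_mul]
      exact Finset.sum_congr rfl fun a _ => by ring
    have h7 : r p / (U x - p) * deriv U x = r p * ((x - x₀)⁻¹ + G x) := by
      rw [← h5.2]; ring
    simp only []
    rw [h6, h7]
    ring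
  obtain ⟨r₂, hr₂, hr₂b⟩ := Metric.mem_nhdsWithin_iff.1 hall
  obtain ⟨R, hRρ, hR0, hRr⟩ := (hρ.and (Ioo_mem_nhdsGT hr₂)).exists
  have hsph : ∀ x ∈ Metric.sphere x₀ R, φ x = (P.eval (U x))⁻¹ * deriv U x ∧ P.eval (U x) ≠ 0 ∧
      AnalyticAt ℂ U x ∧
      HasDerivAt (fun x => K (U x) + L x) (φ x - r p * (x - x₀)⁻¹) x := fun x hx =>
    hr₂b ⟨by rw [Metric.mem_ball, Metric.mem_sphere.1 hx]; exact hRr,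
      fun h => by
        have h' : x = x₀ := h
        rw [h', Metric.mem_sphere, dist_self] at hx
        exact hR0.ne hx⟩
  have hzero := circleIntegral.integral_eq_zero_of_hasDerivWithinAt hR0.le
    fun x hx => (hsph x hx).2.2.2.hasDerivWithinAt
  have i1 : CircleIntegrable φ x₀ R := by
    refine ContinuousOn.circleIntegrable hR0.le ?_
    refine ContinuousOn.congr (f := fun x => (P.eval (U x))⁻¹ * deriv U x) ?_
      fun x hx => (hsph x hx).1
    intro x hx
    obtain ⟨-, h2, h3, -⟩ := hsph x hx
    exact (((P.continuous.continuousAt.comp h3.continuousAt).inv₀ h2).mul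
      h3.deriv.continuousAt).continuousWithinAt
  have i2 : CircleIntegrable (fun x => r p * (x - x₀)⁻¹) x₀ R := by
    refine ContinuousOn.circleIntegrable hR0.le ?_
    refine continuousOn_const.mul ((continuousOn_id.sub continuousOn_const).inv₀ fun x hx h => ?_)
    have h' : x = x₀ := sub_eq_zero.1 h
    rw [h', Metric.mem_sphere, dist_self] at hx
    exact hR0.ne hx
  have hsub := circleIntegral.integral_sub i1 i2
  rw [hzero, hRρ, circleIntegral.integral_const_mul,
    circleIntegral.integral_sub_center_inv _ hR0.ne'] at hsub
  have h2pi := Complex.two_pi_I_ne_zero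
  refine mul_left_cancel₀ h2pi ?_
  linear_combination hsub

/-! ### Moving the zero to infinity -/

/-- An affine coordinate on the complement of `σ`. -/
noncomputable def awayCoord (σ x : Sphere) : ℂ :=
  Option.elim σ (zCoord x) (fun s => Option.elim x 0 (fun z => (z - s)⁻¹))

@[simp] theorem awayCoord_infty (x : Sphere) : awayCoord OnePoint.infty x = zCoord x := rfl

@[simp] theorem awayCoord_coe_infty (s : ℂ) : awayCoord (s : Sphere) OnePoint.infty = 0 := rfl

@[simp] theorem awayCoord_coe_coe (s z : ℂ) : awayCoord (s : Sphere) (z : Sphere) = (z - s)⁻¹ := rfl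

/-- A Möbius transformation taking `σ` to `∞`. -/
noncomputable def toInfinity (σ : Sphere) : GL (Fin 2) ℂ :=
  Option.elim σ 1 (fun s => Matrix.GeneralLinearGroup.mkOfDetNeZero !![0, 1; 1, -s] (by simp))

@[simp] theorem toInfinity_infty : toInfinity OnePoint.infty = 1 := rfl

theorem toInfinity_coe (s : ℂ) : (toInfinity (s : Sphere) : Matrix (Fin 2) (Fin 2) ℂ) =
    !![0, 1; 1, -s] := rfl

theorem toInfinity_smul_self (σ : Sphere) : toInfinity σ • σ = OnePoint.infty := by
  induction σ using OnePoint.rec with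
  | infty => simp
  | coe s => rw [OnePoint.smul_some_eq_ite, if_pos (by simp [toInfinity_coe])]

theorem toInfinity_smul {σ x : Sphere} (h : x ≠ σ) :
    toInfinity σ • x = (awayCoord σ x : Sphere) := by
  induction σ using OnePoint.rec with
  | infty =>
    induction x using OnePoint.rec with
    | infty => exact absurd rfl h
    | coe z => simp
  | coe s =>
    induction x using OnePoint.rec with
    | infty =>
      rw [OnePoint.smul_infty_eq_ite, if_neg (by simp [toInfinity_coe])]
      simp [toInfinity_coe]
    | coe z =>
      have hz : z - s ≠ 0 := sub_ne_zero.2 fun h' => h (by rw [h'])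
      rw [OnePoint.smul_some_eq_ite, if_neg (by simpa [toInfinity_coe, ← sub_eq_add_neg] using hz)]
      simp [toInfinity_coe, ← sub_eq_add_neg]

theorem awayCoord_injOn {σ x y : Sphere} (hx : x ≠ σ) (hy : y ≠ σ)
    (h : awayCoord σ x = awayCoord σ y) : x = y := by
  have : toInfinity σ • x = toInfinity σ • y := by rw [toInfinity_smul hx, toInfinity_smul hy, h]
  exact smul_left_cancel _ this

/-- The determinant of `toInfinity σ`. -/
noncomputable def detInfinity (σ : Sphere) : ℂ :=
  toInfinity σ 0 0 * toInfinity σ 1 1 - toInfinity σ 0 1 * toInfinity σ 1 0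

@[simp] theorem detInfinity_infty : detInfinity OnePoint.infty = 1 := by simp [detInfinity]

@[simp] theorem detInfinity_coe (s : ℂ) : detInfinity (s : Sphere) = -1 := by
  simp [detInfinity, toInfinity_coe]

theorem detInfinity_ne_zero (σ : Sphere) : detInfinity σ ≠ 0 := by
  induction σ using OnePoint.rec with
  | infty => simp
  | coe s => simp

theorem toInfinity_row_one (σ : Sphere) (z : ℂ) :
    toInfinity σ 1 0 * z + toInfinity σ 1 1 = linearFactor σ z := by
  induction σ using OnePoint.rec with
  | infty => simp
  | coe s => simp [toInfinity_coe, sub_eq_add_neg]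

theorem hasDerivAt_awayCoord {σ : Sphere} {z : ℂ} (h : (z : Sphere) ≠ σ) :
    HasDerivAt (fun z : ℂ => awayCoord σ z) (detInfinity σ / linearFactor σ z ^ 2) z := by
  induction σ using OnePoint.rec with
  | infty => simpa using! hasDerivAt_id z
  | coe s =>
    have hz : z - s ≠ 0 := sub_ne_zero.2 fun h' => h (by rw [h'])
    simpa using ((hasDerivAt_id z).sub_const s).fun_inv hz

theorem analyticAt_awayCoord {σ : Sphere} {z : ℂ} (h : (z : Sphere) ≠ σ) :
    AnalyticAt ℂ (fun z : ℂ => awayCoord σ z) z := by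
  induction σ using OnePoint.rec with
  | infty => simpa using! analyticAt_id
  | coe s =>
    have hz : z - s ≠ 0 := sub_ne_zero.2 fun h' => h (by rw [h'])
    simpa using! (analyticAt_id.sub analyticAt_const).inv hz

/-- The equation of `p` in terms of the coordinate `awayCoord σ`. -/
theorem linearFactor_eq_mul {σ p : Sphere} (hp : p ≠ σ) : ∃ e : ℂ, e ≠ 0 ∧ ∀ z : ℂ,
    (z : Sphere) ≠ σ →
      linearFactor p z = e * (awayCoord σ z - awayCoord σ p) * linearFactor σ z := by
  induction σ using OnePoint.rec with
  | infty =>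
    induction p using OnePoint.rec with
    | infty => exact absurd rfl hp
    | coe a => exact ⟨1, one_ne_zero, fun z _ => by simp⟩
  | coe s =>
    induction p using OnePoint.rec with
    | infty =>
      refine ⟨1, one_ne_zero, fun z h => ?_⟩
      have hz : z - s ≠ 0 := sub_ne_zero.2 fun h' => h (by rw [h'])
      simp [hz]
    | coe a =>
      have ha : a - s ≠ 0 := sub_ne_zero.2 fun h' => hp (by rw [h'])
      refine ⟨-(a - s), neg_ne_zero.2 ha, fun z h => ?_⟩
      have hz : z - s ≠ 0 := sub_ne_zero.2 fun h' => h (by rw [h'])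
      simp only [linearFactor_coe, awayCoord_coe_coe]
      field_simp
      ring

/-! ### A differential with a single zero is the inverse of a polynomial -/

/-- The polynomial with zeros of order `d i` at the points `u i`. -/
noncomputable def polePolynomial {ι : Type*} [Fintype ι] (c : ℂ) (u : ι → ℂ) (d : ι → ℕ) :
    Polynomial ℂ :=
  Polynomial.C c * ∏ i, (Polynomial.X - Polynomial.C (u i)) ^ d i

section polePolynomial

variable {ι : Type*} [Fintype ι] {c : ℂ} {u : ι → ℂ} {d : ι → ℕ}

theorem eval_polePolynomial (z : ℂ) :
    (polePolynomial c u d).eval z = c * ∏ i, (z - u i) ^ d i := by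
  simp [polePolynomial, Polynomial.eval_prod]

theorem polePolynomial_ne_zero (hc : c ≠ 0) : polePolynomial c u d ≠ 0 :=
  mul_ne_zero (Polynomial.C_ne_zero.2 hc) (Finset.prod_ne_zero_iff.2 fun _ _ =>
    pow_ne_zero _ (Polynomial.X_sub_C_ne_zero _))

theorem eval_polePolynomial_eq_zero_iff (hc : c ≠ 0) (hd : ∀ i, 0 < d i) {z : ℂ} :
    (polePolynomial c u d).eval z = 0 ↔ ∃ i, u i = z := by
  rw [eval_polePolynomial, mul_eq_zero, or_iff_right hc, Finset.prod_eq_zero_iff]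
  refine exists_congr fun i => ?_
  rw [pow_eq_zero_iff (hd i).ne', sub_eq_zero]
  simp [eq_comm]

theorem natDegree_polePolynomial (hc : c ≠ 0) : (polePolynomial c u d).natDegree = ∑ i, d i := by
  rw [polePolynomial, Polynomial.natDegree_C_mul hc, Polynomial.natDegree_prod _ _ fun i _ =>
    pow_ne_zero _ (Polynomial.X_sub_C_ne_zero _)]
  simp

theorem rootMultiplicity_polePolynomial (hc : c ≠ 0) (hu : Function.Injective u) (i : ι) :
    (polePolynomial c u d).rootMultiplicity (u i) = d i := by
  classical
  have h1 : polePolynomial c u d = (Polynomial.C c * ∏ j ∈ Finset.univ.erase i,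
      (Polynomial.X - Polynomial.C (u j)) ^ d j) * (Polynomial.X - Polynomial.C (u i)) ^ d i := by
    rw [polePolynomial, mul_assoc, Finset.prod_erase_mul _ _ (Finset.mem_univ i)]
  have h2 : (Polynomial.C c * ∏ j ∈ Finset.univ.erase i,
      (Polynomial.X - Polynomial.C (u j)) ^ d j).eval (u i) ≠ 0 := by
    rw [Polynomial.eval_mul, Polynomial.eval_prod, Polynomial.eval_C]
    refine mul_ne_zero hc (Finset.prod_ne_zero_iff.2 fun j hj => ?_)
    simp only [Polynomial.eval_pow, Polynomial.eval_sub, Polynomial.eval_X, Polynomial.eval_C]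
    exact pow_ne_zero _ (sub_ne_zero.2 fun h => Finset.ne_of_mem_erase hj (hu h).symm)
  rw [h1, Polynomial.rootMultiplicity_mul_X_sub_C_pow (fun h => h2 (by rw [h]; simp)),
    Polynomial.rootMultiplicity_eq_zero h2, zero_add]

theorem card_roots_polePolynomial (hc : c ≠ 0) (hd : ∀ i, 0 < d i) (hu : Function.Injective u) :
    (polePolynomial c u d).roots.toFinset.card = Fintype.card ι := by
  classical
  have h1 : (polePolynomial c u d).roots.toFinset = Finset.univ.image u := by
    ext z
    rw [Multiset.mem_toFinset, Polynomial.mem_roots (polePolynomial_ne_zero hc),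
      Polynomial.IsRoot.def, eval_polePolynomial_eq_zero_iff hc hd]
    simp
  rw [h1, Finset.card_image_of_injective _ hu, Finset.card_univ]

end polePolynomial

/-- A differential with a single zero, in a coordinate for which the zero lies at infinity. -/
theorem MeroDifferential.exists_polePolynomial (η : MeroDifferential) {ι : Type*} [Fintype ι]
    {σ : Sphere} {q : ι → Sphere} (hq : Function.Injective q) {d : ι → ℕ} (hd : ∀ i, 0 < d i)
    {m : ℕ} (hσ : η.ord σ = ((m : ℤ) : WithTop ℤ))
    (hord : ∀ i, η.ord (q i) = ((-(d i : ℤ) : ℤ) : WithTop ℤ))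
    (hother : ∀ p, p ≠ σ → p ∉ Set.range q → η.ord p = 0) (hsum : ∑ i, d i = m + 2) :
    ∃ c : ℂ, c ≠ 0 ∧ ∀ z : ℂ, (z : Sphere) ≠ σ →
      η.f z = ((polePolynomial c (fun i => awayCoord σ (q i)) d).eval (awayCoord σ z))⁻¹ *
        (detInfinity σ / linearFactor σ z ^ 2) := by
  have hqσ : ∀ i, q i ≠ σ := fun i h => by
    have h1 := hord i
    rw [h, hσ, WithTop.coe_inj] at h1
    have := hd i
    omega
  set x : Option ι → Sphere := fun o => o.elim σ q with hx
  set n : Option ι → ℤ := fun o => o.elim (m : ℤ) (fun i => -(d i : ℤ)) with hn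
  have hxinj : Function.Injective x := by
    rintro (_ | i) (_ | j) h
    · rfl
    · exact absurd h.symm (hqσ j)
    · exact absurd h (hqσ i)
    · exact congrArg some (hq h)
  obtain ⟨C, hC, hCf⟩ := η.exists_eq_prod (x := x) (n := n) hxinj
    (by rintro (_ | i); exacts [hσ, hord i])
    (fun p hp => hother p (fun h => hp ⟨none, h.symm⟩) fun ⟨i, hi⟩ => hp ⟨some i, hi⟩)
    (by
      rw [Fintype.sum_option]
      simp only [hn, Option.elim, Finset.sum_neg_distrib]
      rw [← Nat.cast_sum, hsum]
      push_cast; ring)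
  choose e he heq using fun i => linearFactor_eq_mul (hqσ i)
  have hprod : ∏ i, e i ^ d i ≠ 0 := Finset.prod_ne_zero_iff.2 fun i _ => pow_ne_zero _ (he i)
  refine ⟨detInfinity σ * C⁻¹ * ∏ i, e i ^ d i,
    mul_ne_zero (mul_ne_zero (detInfinity_ne_zero σ) (inv_ne_zero hC)) hprod, fun z hz => ?_⟩
  -- At a pole both sides are `0`, the left by the normal form and the right because the inverse of
  -- `0` is `0`.
  by_cases hzq : (z : Sphere) ∈ Set.range q
  · obtain ⟨i, hi⟩ := hzq
    rw [η.f_eq_zero_of_ord_ne_zero, (eval_polePolynomial_eq_zero_iff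
      (mul_ne_zero (mul_ne_zero (detInfinity_ne_zero σ) (inv_ne_zero hC)) hprod) hd).2 ⟨i, by rw [hi]⟩,
      inv_zero, zero_mul]
    · rw [← hi, hord i, ← WithTop.coe_zero, Ne, WithTop.coe_inj]
      have := hd i
      omega
  have hzx : (z : Sphere) ∉ Set.range x := by
    rintro ⟨_ | i, h⟩
    · exact hz h.symm
    · exact hzq ⟨i, h⟩
  have hl : linearFactor σ z ≠ 0 := linearFactor_ne_zero hz.symm
  rw [hCf z hzx, Fintype.prod_option, eval_polePolynomial]
  simp only [hx, hn, Option.elim, zpow_neg, zpow_natCast]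
  simp only [heq _ z hz, mul_pow, Finset.prod_mul_distrib, mul_inv, Finset.prod_inv_distrib]
  -- The factor at `σ` occurs with exponent `m - (m + 2) = -2`, which is the derivative of
  -- `awayCoord σ` up to the determinant.
  rw [Finset.prod_pow_eq_pow_sum, hsum]
  have hdet := detInfinity_ne_zero σ
  field_simp
  rw [← pow_add]

namespace MeroDifferential

/-- In the coordinate `u = awayCoord σ`, the differential is `du / P(u)`. -/
def IsInvPolynomial (η : MeroDifferential) (σ : Sphere) (P : Polynomial ℂ) : Prop :=
  ∀ z : ℂ, (z : Sphere) ≠ σ →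
    η.f z = (P.eval (awayCoord σ z))⁻¹ * (detInfinity σ / linearFactor σ z ^ 2)

variable {η : MeroDifferential} {σ : Sphere} {P : Polynomial ℂ}

/-- At `z = 1/w` the affine coordinate `(z - s)⁻¹` is `w / (1 - s w)`, which is regular at `w = 0`.
-/
theorem IsInvPolynomial.g_eq {s : ℂ} (h : η.IsInvPolynomial (s : Sphere) P) {w : ℂ} (hw : w ≠ 0)
    (hs : 1 - s * w ≠ 0) : η.g w = (P.eval (w / (1 - s * w)))⁻¹ * ((1 - s * w) ^ 2)⁻¹ := by
  have h1 : w⁻¹ - s ≠ 0 := fun h0 => hs (by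
    have : (w⁻¹ - s) * w = 1 - s * w := by field_simp
    rw [← this, h0, zero_mul])
  have h2 : (w⁻¹ - s)⁻¹ = w / (1 - s * w) := by field_simp
  rw [η.compat w hw, h w⁻¹ (fun h0 => h1 (sub_eq_zero.2 (OnePoint.coe_injective h0)))]
  simp only [awayCoord_coe_coe, linearFactor_coe, detInfinity_coe, h2]
  have h3 : w⁻¹ - s = (1 - s * w) / w := by field_simp
  rw [h3]
  field_simp

theorem hasDerivAt_div_one_sub (s : ℂ) {w : ℂ} (hs : 1 - s * w ≠ 0) :
    HasDerivAt (fun w => w / (1 - s * w)) ((1 - s * w) ^ 2)⁻¹ w := by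
  have h1 : HasDerivAt (fun w => 1 - s * w) (-s) w := by
    simpa using ((hasDerivAt_id w).const_mul s).const_sub 1
  refine ((hasDerivAt_id w).fun_div h1 hs).congr_deriv ?_
  simp only [id]
  field_simp
  ring

theorem eventually_one_sub_ne (s : ℂ) : ∀ᶠ w in 𝓝 (0 : ℂ), 1 - s * w ≠ 0 := by
  have : ContinuousAt (fun w : ℂ => 1 - s * w) 0 := by fun_prop
  exact this.eventually_ne (by simp)

theorem IsInvPolynomial.residue_eq (h : η.IsInvPolynomial σ P) (hP : P ≠ 0) {r K : ℂ → ℂ}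
    (hK : ∀ u, P.eval u ≠ 0 →
      HasDerivAt K ((P.eval u)⁻¹ - ∑ p ∈ P.roots.toFinset, r p / (u - p)) u)
    {x : Sphere} (hx : x ≠ σ) (hroot : P.eval (awayCoord σ x) = 0) {ρ : ℂ}
    (hρ : η.HasResidue x ρ) : r (awayCoord σ x) = ρ := by
  induction x using OnePoint.rec with
  | coe z =>
    refine eq_residue_of_circleIntegral (φ := η.f) hK (analyticAt_awayCoord hx) rfl ?_ hP hroot ?_
      (ρ := ρ) ?_
    · rw [(hasDerivAt_awayCoord hx).deriv]
      exact div_ne_zero (detInfinity_ne_zero σ) (pow_ne_zero _ (linearFactor_ne_zero hx.symm))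
    · have h1 : ∀ᶠ y in 𝓝[≠] z, (OnePoint.some y : Sphere) ≠ σ :=
        nhdsWithin_le_nhds (OnePoint.continuous_coe.continuousAt.eventually_ne hx)
      filter_upwards [h1] with y hy
      rw [(hasDerivAt_awayCoord hy).deriv, h y hy]
    · filter_upwards [hρ] with R hR
      rwa [if_neg (OnePoint.coe_ne_infty z)] at hR
  | infty =>
    induction σ using OnePoint.rec with
    | infty => exact absurd rfl hx
    | coe s =>
      have han : AnalyticAt ℂ (fun w : ℂ => w / (1 - s * w)) 0 :=
        analyticAt_id.div (analyticAt_const.sub (analyticAt_const.mul analyticAt_id)) (by simp)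
      refine eq_residue_of_circleIntegral (φ := η.g) hK han (by simp) ?_ hP hroot ?_ (ρ := ρ) ?_
      · rw [(hasDerivAt_div_one_sub s (by simp)).deriv]
        simp
      · filter_upwards [(eventually_one_sub_ne s).filter_mono nhdsWithin_le_nhds,
          self_mem_nhdsWithin] with w hw hw0
        rw [(hasDerivAt_div_one_sub s hw).deriv, h.g_eq hw0 hw]
      · filter_upwards [hρ] with R hR
        rwa [if_pos rfl] at hR

/-- Trajectories in the coordinate `awayCoord σ`. -/
theorem IsInvPolynomial.hasDerivAt_comp (h : η.IsInvPolynomial σ P) {γ : ℝ → Sphere} {t : ℝ}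
    (hγ : ContinuousAt γ t) (hσ : γ t ≠ σ) (hord : η.ord (γ t) = 0)
    (hP : P.eval (awayCoord σ (γ t)) ≠ 0) {V : ℂ} (hV : η.HasVelocity γ V t) :
    HasDerivAt (fun s => awayCoord σ (γ s)) (V * P.eval (awayCoord σ (γ t))) t := by
  have hopen : IsOpen ({OnePoint.infty}ᶜ : Set Sphere) := isOpen_compl_singleton
  by_cases hinf : γ t = OnePoint.infty
  · obtain ⟨v, hv, hvV⟩ := hV.2 hinf
    induction σ using OnePoint.rec with
    | infty => exact absurd hinf hσ
    | coe s =>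
      rw [hinf, awayCoord_coe_infty] at hP
      rw [hinf, wCoord_infty] at hvV
      rw [hinf, MeroDifferential.ord, if_pos rfl] at hord
      have hga : ContinuousAt η.g 0 :=
        ((η.meromorphic_g (Set.mem_univ 0)).meromorphicOrderAt_nonneg_iff_analyticAt.1
          hord.ge).continuousAt
      have hlim : Tendsto (fun w => (P.eval (w / (1 - s * w)))⁻¹ * ((1 - s * w) ^ 2)⁻¹) (𝓝 0)
          (𝓝 (P.eval 0)⁻¹) := by
        have hc : ContinuousAt (fun w => (P.eval (w / (1 - s * w)))⁻¹ * ((1 - s * w) ^ 2)⁻¹) 0 := by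
          have h1 : ContinuousAt (fun w : ℂ => w / (1 - s * w)) 0 :=
            (hasDerivAt_div_one_sub s (by simp)).continuousAt
          refine ((P.continuous.continuousAt.comp h1).inv₀ (by simpa using hP)).mul
            (ContinuousAt.inv₀ (by fun_prop) (by simp))
        simpa [ContinuousAt] using hc
      -- The compatibility of the two charts says nothing at `w = 0`; the value there follows by
      -- continuity, since `η` has order zero at infinity.
      have hg0 : η.g 0 = (P.eval 0)⁻¹ := by
        refine tendsto_nhds_unique (hga.tendsto.mono_left (nhdsWithin_le_nhds (s := {0}ᶜ)))
          ((hlim.mono_left nhdsWithin_le_nhds).congr' ?_)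
        filter_upwards [(eventually_one_sub_ne s).filter_mono nhdsWithin_le_nhds,
          self_mem_nhdsWithin] with w hw hw0
        exact (h.g_eq hw0 hw).symm
      have h2 := (hasDerivAt_div_one_sub s (w := wCoord (γ t)) (by simp [hinf])).comp t hv
      rw [hinf] at h2
      simp only [wCoord_infty, mul_zero, sub_zero, one_pow, inv_one, one_mul] at h2
      rw [hinf, awayCoord_coe_infty]
      have h3 : v = V * P.eval 0 := by
        rw [← hvV, hg0]; field_simp
      rw [← h3]
      refine h2.congr_of_eventuallyEq ?_
      have h0 : ∀ᶠ y in 𝓝 t, γ y ≠ ((0 : ℂ) : Sphere) :=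
        hγ.eventually_ne (by rw [hinf]; exact OnePoint.infty_ne_coe 0)
      filter_upwards [h0] with y hy
      simp only [Function.comp]
      generalize γ y = x at hy ⊢
      induction x using OnePoint.rec with
      | infty => simp
      | coe z =>
        have hz : z ≠ 0 := fun h => hy (by rw [h])
        simp only [awayCoord_coe_coe, wCoord_coe]
        have h4 : z - s = z * (1 - s * z⁻¹) := by field_simp
        rw [h4, mul_inv, div_eq_mul_inv]
  · obtain ⟨v, hv, hvV⟩ := hV.1 hinf
    obtain ⟨z, hz⟩ := OnePoint.ne_infty_iff_exists.1 hinf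
    have hzσ : (z : Sphere) ≠ σ := hz ▸ hσ
    rw [← hz] at hvV hP ⊢
    rw [zCoord_coe, h z hzσ] at hvV
    have h1 : HasDerivAt (fun z : ℂ => awayCoord σ z) (detInfinity σ / linearFactor σ z ^ 2)
        (zCoord (γ t)) := by
      rw [← hz]; exact hasDerivAt_awayCoord hzσ
    refine ((h1.comp t hv).congr_of_eventuallyEq ?_).congr_deriv ?_
    · filter_upwards [hγ.eventually_mem (hopen.mem_nhds hinf)] with y hy
      obtain ⟨a, ha⟩ := OnePoint.ne_infty_iff_exists.1 hy
      simp only [Function.comp]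
      rw [← ha, zCoord_coe]
    · rw [← hvV]
      field_simp

end MeroDifferential

/-! ### Limits and tangent directions at the zero -/

theorem tendsto_awayCoord (σ : Sphere) :
    Tendsto (awayCoord σ) (𝓝[≠] σ) (Bornology.cobounded ℂ) := by
  induction σ using OnePoint.rec with
  | infty =>
    rw [OnePoint.nhdsNE_infty_eq, coclosedCompact_eq_cocompact, ← Metric.cobounded_eq_cocompact,
      tendsto_map'_iff]
    exact tendsto_id
  | coe s =>
    have h0 : ((↑) : ℂ → Sphere) ⁻¹' {(s : Sphere)}ᶜ = {s}ᶜ := by ext; simp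
    rw [OnePoint.nhdsWithin_coe, h0, tendsto_map'_iff]
    have h1 : Tendsto (fun z : ℂ => z - s) (𝓝[≠] s) (𝓝[≠] 0) := by
      refine tendsto_nhdsWithin_iff.2 ⟨?_, ?_⟩
      · have : ContinuousAt (fun z : ℂ => z - s) s := by fun_prop
        have h2 := this.tendsto
        rw [sub_self] at h2
        exact h2.mono_left nhdsWithin_le_nhds
      · filter_upwards [self_mem_nhdsWithin] with z hz
        exact sub_ne_zero.2 hz
    exact tendsto_inv₀_nhdsNE_zero.comp h1

theorem continuousAt_awayCoord {σ x : Sphere} (h : x ≠ σ) : ContinuousAt (awayCoord σ) x := by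
  induction x using OnePoint.rec with
  | coe z =>
    rw [OnePoint.continuousAt_coe]
    exact (analyticAt_awayCoord h).continuousAt
  | infty =>
    induction σ using OnePoint.rec with
    | infty => exact absurd rfl h
    | coe s =>
      rw [OnePoint.continuousAt_infty', coclosedCompact_eq_cocompact,
        ← Metric.cobounded_eq_cocompact, awayCoord_coe_infty]
      have h1 : Tendsto (fun z : ℂ => z - s) (Bornology.cobounded ℂ) (Bornology.cobounded ℂ) :=
        tendsto_sub_const_cobounded s
      exact tendsto_inv₀_cobounded.comp h1

theorem continuous_toInfinity_smul (σ : Sphere) :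
    Continuous (fun x : Sphere => toInfinity σ • x) := by
  refine continuous_iff_continuousAt.2 fun x => ?_
  by_cases h : x = σ
  · subst h
    rw [continuousAt_iff_punctured_nhds, toInfinity_smul_self]
    have h1 : Tendsto (fun z : ℂ => (z : Sphere)) (Bornology.cobounded ℂ) (𝓝 OnePoint.infty) := by
      rw [Metric.cobounded_eq_cocompact, ← coclosedCompact_eq_cocompact]
      exact OnePoint.tendsto_coe_infty
    refine (h1.comp (tendsto_awayCoord x)).congr' ?_
    filter_upwards [self_mem_nhdsWithin] with y hy
    exact (toInfinity_smul hy).symm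
  · refine (OnePoint.continuous_coe.continuousAt.comp (continuousAt_awayCoord h)).congr ?_
    filter_upwards [isOpen_compl_singleton.mem_nhds h] with y hy
    exact (toInfinity_smul hy).symm

/-- Since `(Y ζ)⁻¹` behaves like `κ ζ`, every direction `θ` of the coordinate `ζ` is turned by the
same factor `κ / ‖κ‖`. This factor cancels in all angles between directions. -/
theorem InfCoord.tendsto_direction {P : Polynomial ℂ} {m : ℕ} (D : InfCoord P m) {θ : ℂ}
    (hθ : ‖θ‖ = 1) :
    Tendsto (fun s : ℝ => (D.Y (θ * s))⁻¹ / (‖(D.Y (θ * s))⁻¹‖ : ℂ)) (𝓝[>] 0)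
      (𝓝 (D.κ / ‖D.κ‖ * θ)) := by
  have hθ0 : θ ≠ 0 := norm_pos_iff.1 (by rw [hθ]; exact one_pos)
  have h1 : Tendsto (fun s : ℝ => θ * (s : ℂ)) (𝓝[>] 0) (𝓝[≠] 0) := by
    refine tendsto_nhdsWithin_iff.2 ⟨?_, ?_⟩
    · have : Continuous (fun s : ℝ => θ * (s : ℂ)) := by fun_prop
      exact (this.tendsto' 0 0 (by simp)).mono_left nhdsWithin_le_nhds
    · filter_upwards [self_mem_nhdsWithin] with s hs
      have hs : (0 : ℝ) < s := hs
      exact mul_ne_zero hθ0 (by exact_mod_cast hs.ne')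
  have h2 := D.tendsto_Y.comp h1
  have h3 : Tendsto (fun s : ℝ => (D.Y (θ * s))⁻¹ / (θ * s) /
      (‖(D.Y (θ * s))⁻¹ / (θ * s)‖ : ℂ) * θ) (𝓝[>] 0) (𝓝 (D.κ / ‖D.κ‖ * θ)) := by
    refine (h2.div ?_ ?_).mul_const θ
    · exact (Complex.continuous_ofReal.tendsto _).comp h2.norm
    · exact_mod_cast (norm_pos_iff.2 D.κ_ne).ne'
  refine h3.congr' ?_
  filter_upwards [self_mem_nhdsWithin] with s hs
  have hs : (0 : ℝ) < s := hs
  have hsC : (s : ℂ) ≠ 0 := by exact_mod_cast hs.ne'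
  rw [norm_div, norm_mul, hθ, one_mul, Complex.norm_real, Real.norm_of_nonneg hs.le]
  push_cast
  by_cases hz : ((‖(D.Y (θ * s))⁻¹‖ : ℝ) : ℂ) = 0
  · rw [hz]; simp
  · field_simp

/-- For finite `σ` the point `∞` is excluded, because `centredCoord` uses the default value of
`zCoord` there. -/
theorem centredCoord_eq_inv {σ x : Sphere} (h : σ = OnePoint.infty ∨ x ≠ OnePoint.infty) :
    centredCoord σ x = (awayCoord σ x)⁻¹ := by
  induction σ using OnePoint.rec with
  | infty =>
    rw [centredCoord, if_pos rfl]
    induction x using OnePoint.rec with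
    | infty => simp
    | coe z => simp
  | coe s =>
    rw [centredCoord, if_neg (OnePoint.coe_ne_infty s)]
    induction x using OnePoint.rec with
    | infty => simp at h
    | coe z => simp

theorem eventually_centredCoord_eq_inv (σ : Sphere) :
    ∀ᶠ x in 𝓝 σ, centredCoord σ x = (awayCoord σ x)⁻¹ := by
  by_cases h : σ = OnePoint.infty
  · exact Eventually.of_forall fun x => centredCoord_eq_inv (Or.inl h)
  · filter_upwards [isOpen_compl_singleton.mem_nhds h] with x hx
    exact centredCoord_eq_inv (Or.inr hx)

theorem flatTurn_mul_left {m : ℕ} {e e₁ e₂ : ℂ} (he : e ≠ 0) {θ : ℝ} :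
    FlatTurn m (e * e₁) (e * e₂) θ ↔ FlatTurn m e₁ e₂ θ := by
  rw [FlatTurn, FlatTurn, mul_assoc, mul_right_inj' he]

theorem omega_pow_injOn {m i j : ℕ} (hi : i < 2 * (m + 1)) (hj : j < 2 * (m + 1))
    (h : omega m ^ i = omega m ^ j) : i = j :=
  (isPrimitiveRoot_omega m).pow_inj hi hj h

/-- A positive order distinguishes `σ` from regular points, so saddle connections do not pass
through `σ` in their interior. -/
theorem Block.one_le_zeroOrder {B : Block} (hB : B.IsTypeI ∨ B.IsTypeII ∨ B.IsTypeIII) :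
    0 < B.zeroOrder := by
  rcases hB with ⟨h1, h2, h3⟩ | ⟨h1, c, h2⟩ | ⟨⟨c, h1⟩, d, h2⟩
  · have : B.c' ⟨0, h1⟩ + B.c'' ⟨0, h1⟩ + 2 ≤ ∑ i, (B.c' i + B.c'' i + 2) :=
      Finset.single_le_sum (f := fun i => B.c' i + B.c'' i + 2) (fun _ _ => Nat.zero_le _)
        (Finset.mem_univ _)
    rw [Block.zeroOrder]
    omega
  · rw [Block.zeroOrder, h2, BlockEnd.zeroOrder]
    omega
  · rw [Block.zeroOrder, h2, BlockEnd.zeroOrder]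
    omega

/-! ### Pole orders and first consequences of admitting a configuration -/

/-- The orders of the poles. -/
noncomputable def Block.poleOrder (B : Block) (i : Fin (B.k + 2)) : ℕ :=
  Fin.cases B.first.poleOrder
    (Fin.lastCases B.last.poleOrder (fun j => B.c' j + B.c'' j + 2)) i

theorem Block.poleOrder_zero (B : Block) : B.poleOrder 0 = B.first.poleOrder := rfl

theorem Block.poleOrder_last (B : Block) :
    B.poleOrder (Fin.last (B.k + 1)) = B.last.poleOrder := by
  rw [← Fin.succ_last, Block.poleOrder, Fin.cases_succ, Fin.lastCases_last]

theorem Block.poleOrder_mid (B : Block) (i : Fin B.k) :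
    B.poleOrder i.castSucc.succ = B.c' i + B.c'' i + 2 := by
  rw [Block.poleOrder, Fin.cases_succ, Fin.lastCases_castSucc]

theorem Block.forall_pole {B : Block} {p : Fin (B.k + 2) → Prop} (h0 : p 0)
    (hl : p (Fin.last (B.k + 1))) (hm : ∀ i : Fin B.k, p i.castSucc.succ) (i : Fin (B.k + 2)) :
    p i := by
  refine Fin.cases h0 (fun j => ?_) i
  refine Fin.lastCases ?_ (fun j => hm j) j
  rwa [Fin.succ_last]

theorem BlockEnd.poleOrder_eq (e : BlockEnd) : e.poleOrder = e.zeroOrder + 1 := by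
  cases e <;> rfl

theorem Block.poleOrder_pos (B : Block) (i : Fin (B.k + 2)) : 0 < B.poleOrder i := by
  refine Block.forall_pole (p := fun i => 0 < B.poleOrder i) ?_ ?_ (fun i => ?_) i
  · rw [B.poleOrder_zero, BlockEnd.poleOrder_eq]; omega
  · rw [B.poleOrder_last, BlockEnd.poleOrder_eq]; omega
  · rw [B.poleOrder_mid]; omega

theorem Block.sum_poleOrder (B : Block) : ∑ i, B.poleOrder i = B.zeroOrder + 2 := by
  rw [Fin.sum_univ_succ, Fin.sum_univ_castSucc, Fin.succ_last, B.poleOrder_last, B.poleOrder_zero,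
    BlockEnd.poleOrder_eq, BlockEnd.poleOrder_eq]
  simp only [B.poleOrder_mid, Block.zeroOrder]
  omega

namespace Admits

variable {B : Block} {η : MeroDifferential} {σ : Sphere} {q : Fin (B.k + 2) → Sphere} {ρ : ℂ}
  {γ : Fin (B.k + 1) → Path σ σ}

theorem ord_pole (h : Admits B η σ q ρ γ) (i : Fin (B.k + 2)) :
    η.ord (q i) = ((-(B.poleOrder i : ℤ) : ℤ) : WithTop ℤ) := by
  refine Block.forall_pole (p := fun i => η.ord (q i) = ((-(B.poleOrder i : ℤ) : ℤ) : WithTop ℤ))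
    ?_ ?_ (fun i => ?_) i
  · rw [B.poleOrder_zero]; exact h.ord_first
  · rw [B.poleOrder_last]; exact h.ord_last
  · rw [B.poleOrder_mid]; exact h.ord_mid i

theorem q_ne_zero (h : Admits B η σ q ρ γ) (i : Fin (B.k + 2)) : q i ≠ σ := fun hi => by
  have h1 := h.ord_pole i
  rw [hi, h.ord_zero, WithTop.coe_inj] at h1
  have := B.poleOrder_pos i
  omega

theorem saddle (h : Admits B η σ q ρ γ) (j : Fin (B.k + 1)) :
    η.IsSelfSaddle (2 * Real.pi * Complex.I * ρ) (γ j) := by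
  have : γ j ∈ Set.range γ := ⟨j, rfl⟩
  rwa [h.saddles] at this

theorem saddle_ne_zero (hm : 0 < B.zeroOrder) (h : Admits B η σ q ρ γ) (j : Fin (B.k + 1)) {t : ℝ}
    (ht : t ∈ Set.Ioo (0 : ℝ) 1) : (γ j).extend t ≠ σ := fun hσ => by
  have h1 := (h.saddle j t ht).1
  rw [hσ, h.ord_zero, ← WithTop.coe_zero, WithTop.coe_inj] at h1
  omega

theorem tendsto_extend_zero (hm : 0 < B.zeroOrder) (h : Admits B η σ q ρ γ) (j : Fin (B.k + 1)) :
    Tendsto (γ j).extend (𝓝[>] 0) (𝓝[≠] σ) := by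
  refine tendsto_nhdsWithin_iff.2 ⟨?_, ?_⟩
  · have := (γ j).continuous_extend.tendsto 0
    rw [Path.extend_zero] at this
    exact this.mono_left nhdsWithin_le_nhds
  · filter_upwards [Ioo_mem_nhdsGT zero_lt_one] with t ht
    exact h.saddle_ne_zero hm j ht

theorem tendsto_extend_one (hm : 0 < B.zeroOrder) (h : Admits B η σ q ρ γ) (j : Fin (B.k + 1)) :
    Tendsto (γ j).extend (𝓝[<] 1) (𝓝[≠] σ) := by
  refine tendsto_nhdsWithin_iff.2 ⟨?_, ?_⟩
  · have := (γ j).continuous_extend.tendsto 1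
    rw [Path.extend_one] at this
    exact this.mono_left nhdsWithin_le_nhds
  · filter_upwards [Ioo_mem_nhdsLT zero_lt_one] with t ht
    exact h.saddle_ne_zero hm j ht

end Admits

theorem path_ext_of_Ioo {X : Type*} [TopologicalSpace X] {x y : X} {p p' : Path x y}
    (h : ∀ t ∈ Set.Ioo (0 : ℝ) 1, p.extend t = p'.extend t) : p = p' := by
  ext t
  rcases eq_or_ne t 0 with rfl | h0
  · simp
  rcases eq_or_ne t 1 with rfl | h1
  · simp
  have h2 := h t ⟨lt_of_le_of_ne t.2.1 fun h => h0 (Subtype.ext h.symm),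
    lt_of_le_of_ne t.2.2 fun h => h1 (Subtype.ext h)⟩
  simpa [Path.extend_apply] using h2

/-! ### The model of an admitted configuration -/

/-- The flat model `D` describes the differential `η` in the coordinate `awayCoord σ`. -/
structure IsModelOf (B : Block) (η : MeroDifferential) (σ : Sphere) (q : Fin (B.k + 2) → Sphere)
    (ρ : ℂ) (γ : Fin (B.k + 1) → Path σ σ) (D : FlatModel B.zeroOrder)
    (dep arr : Fin (B.k + 1) → ℕ) : Prop where
  system : SaddleSystem B D dep arr
  coeff : ∀ z : ℂ, (z : Sphere) ≠ σ → η.f z = 2 * Real.pi * Complex.I * ρ *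
    ((D.P.eval (awayCoord σ z))⁻¹ * (detInfinity σ / linearFactor σ z ^ 2))
  eval_eq_zero_iff : ∀ p, D.P.eval p = 0 ↔ ∃ i, awayCoord σ (q i) = p
  first : awayCoord σ (q 0) = D.q₀
  last : awayCoord σ (q (Fin.last (B.k + 1))) = D.q₁
  trajectory : ∀ j, ∀ t ∈ Set.Ioo (0 : ℝ) 1, awayCoord σ ((γ j).extend t) = D.ray (dep j) t

theorem InfCoord.tendsto_unitVector {σ : Sphere} {δ : Path σ σ} {m : ℕ} {P : Polynomial ℂ}
    (D : InfCoord P m) {l : Filter ℝ} (hl : Tendsto δ.extend l (𝓝[≠] σ)) {θ : ℂ} (hθ : ‖θ‖ = 1) {s : ℝ → ℝ}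
    (hs : Tendsto s l (𝓝[>] 0)) (hev : ∀ᶠ t in l, awayCoord σ (δ.extend t) = D.Y (θ * s t)) :
    Tendsto (fun t : ℝ => centredCoord σ (δ.extend t) /
      (‖centredCoord σ (δ.extend t)‖ : ℂ)) l (𝓝 (D.κ / ‖D.κ‖ * θ)) := by
  refine ((D.tendsto_direction hθ).comp hs).congr' ?_
  filter_upwards [hev, (hl.mono_right nhdsWithin_le_nhds).eventually
    (eventually_centredCoord_eq_inv σ)] with t h1 h2
  rw [h2, h1]
  rfl

theorem tendsto_rpow_zero {m : ℕ} :
    Tendsto (fun t : ℝ => t ^ ((m + 1 : ℝ)⁻¹)) (𝓝[>] 0) (𝓝[>] 0) := by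
  have hm : (0 : ℝ) < (m + 1 : ℝ)⁻¹ := by positivity
  refine tendsto_nhdsWithin_iff.2 ⟨?_, ?_⟩
  · have := (Real.continuous_rpow_const hm.le).tendsto 0
    rw [Real.zero_rpow hm.ne'] at this
    exact this.mono_left nhdsWithin_le_nhds
  · filter_upwards [self_mem_nhdsWithin] with t ht
    exact Real.rpow_pos_of_pos ht _

namespace Admits

variable {B : Block} {η : MeroDifferential} {σ : Sphere} {q : Fin (B.k + 2) → Sphere} {ρ : ℂ}
  {γ : Fin (B.k + 1) → Path σ σ}

theorem awayCoord_q_injective (h : Admits B η σ q ρ γ) :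
    Function.Injective (fun i => awayCoord σ (q i)) := fun _ _ hij =>
  h.q_injective (awayCoord_injOn (h.q_ne_zero _) (h.q_ne_zero _) hij)

theorem exists_polynomial (h : Admits B η σ q ρ γ) :
    ∃ c : ℂ, c ≠ 0 ∧
      η.IsInvPolynomial σ (polePolynomial c (fun i => awayCoord σ (q i)) B.poleOrder) :=
  η.exists_polePolynomial h.q_injective B.poleOrder_pos h.ord_zero h.ord_pole h.ord_other
    B.sum_poleOrder

/-- The residues at the middle poles vanish, so the polar part reduces to the terms of the two end
poles. -/
theorem hasResidue_sum (h : Admits B η σ q ρ γ) {P : Polynomial ℂ}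
    (hP : η.IsInvPolynomial σ P) (hP0 : P ≠ 0)
    (hroot : ∀ p, P.eval p = 0 ↔ ∃ i, awayCoord σ (q i) = p) {r K : ℂ → ℂ}
    (hK : ∀ u, P.eval u ≠ 0 →
      HasDerivAt K ((P.eval u)⁻¹ - ∑ p ∈ P.roots.toFinset, r p / (u - p)) u) (u : ℂ) :
    ∑ p ∈ P.roots.toFinset, r p / (u - p) = ρ *
      ((u - awayCoord σ (q 0))⁻¹ - (u - awayCoord σ (q (Fin.last (B.k + 1))))⁻¹) := by
  classical
  have hres : ∀ i {ρ' : ℂ}, η.HasResidue (q i) ρ' → r (awayCoord σ (q i)) = ρ' := fun i ρ' hi =>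
    hP.residue_eq hP0 hK (h.q_ne_zero i) ((hroot _).2 ⟨i, rfl⟩) hi
  have himg : P.roots.toFinset = Finset.univ.image (fun i => awayCoord σ (q i)) := by
    ext p
    rw [Multiset.mem_toFinset, Polynomial.mem_roots hP0, Polynomial.IsRoot.def, hroot]
    simp
  rw [himg, Finset.sum_image fun i _ j _ hij => h.awayCoord_q_injective hij, Fin.sum_univ_succ,
    Fin.sum_univ_castSucc, Finset.sum_eq_zero (fun i _ => ?_), Fin.succ_last,
    hres 0 h.res_first, hres _ h.res_last]
  · ring
  · rw [hres _ (h.res_mid i), zero_div]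

/-- Division by `V = 2πiρ` gives the saddle connections holonomy one and the end poles the residues
`±1/(2πi)`, as a flat model requires. The tangent directions at `σ` then become powers of `ω` up to
a common factor. -/
theorem exists_model (hB : B.IsTypeI ∨ B.IsTypeII ∨ B.IsTypeIII) (h : Admits B η σ q ρ γ) :
    ∃ (D : FlatModel B.zeroOrder) (dep arr : Fin (B.k + 1) → ℕ),
      IsModelOf B η σ q ρ γ D dep arr := by
  have hm := Block.one_le_zeroOrder hB
  obtain ⟨c, hc, hinv⟩ := h.exists_polynomial
  have h2pi := Complex.two_pi_I_ne_zero
  set u : Fin (B.k + 2) → ℂ := fun i => awayCoord σ (q i) with hu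
  have huinj : Function.Injective u := h.awayCoord_q_injective
  set V : ℂ := 2 * Real.pi * Complex.I * ρ with hV
  have hV0 : V ≠ 0 := mul_ne_zero h2pi h.res_ne_zero
  set P₀ := polePolynomial c u B.poleOrder with hP₀
  set P := polePolynomial (V * c) u B.poleOrder with hP
  have hVc : V * c ≠ 0 := mul_ne_zero hV0 hc
  have hPP : ∀ z, P.eval z = V * P₀.eval z := fun z => by
    rw [hP, hP₀, eval_polePolynomial, eval_polePolynomial, mul_assoc]
  have hroot₀ : ∀ p, P₀.eval p = 0 ↔ ∃ i, u i = p := fun p =>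
    eval_polePolynomial_eq_zero_iff hc B.poleOrder_pos
  have hroot : ∀ p, P.eval p = 0 ↔ ∃ i, u i = p := fun p =>
    eval_polePolynomial_eq_zero_iff hVc B.poleOrder_pos
  have hdeg : P.natDegree = B.zeroOrder + 2 := by
    rw [hP, natDegree_polePolynomial hVc, B.sum_poleOrder]
  have hdeg₀ : P₀.natDegree = B.zeroOrder + 2 := by
    rw [hP₀, natDegree_polePolynomial hc, B.sum_poleOrder]
  obtain ⟨r, K, hK⟩ := exists_residueDecomposition (P := P₀) (by omega)
  have hsum := h.hasResidue_sum hinv (polePolynomial_ne_zero hc) hroot₀ hK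
  have hK' : ∀ z, P.eval z ≠ 0 → HasDerivAt (fun z => V⁻¹ * K z) ((P.eval z)⁻¹ -
      (2 * Real.pi * Complex.I)⁻¹ * ((z - u 0)⁻¹ - (z - u (Fin.last (B.k + 1)))⁻¹)) z := by
    intro z hz
    have hz0 : P₀.eval z ≠ 0 := fun h0 => hz (by rw [hPP, h0, mul_zero])
    refine ((hK z hz0).const_mul V⁻¹).congr_deriv ?_
    rw [hsum z, hPP, mul_sub, ← mul_assoc V⁻¹ ρ, hV, mul_inv]
    have hρ := h.res_ne_zero
    simp only [hu]
    field_simp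
  -- the saddle connections in the affine coordinate
  set z : Fin (B.k + 1) → ℝ → ℂ := fun j t => awayCoord σ ((γ j).extend t) with hz
  have hzP₀ : ∀ j, ∀ t ∈ Set.Ioo (0 : ℝ) 1, P₀.eval (z j t) ≠ 0 := by
    intro j t ht h0
    obtain ⟨i, hi⟩ := (hroot₀ _).1 h0
    have h1 := awayCoord_injOn (h.q_ne_zero i) (h.saddle_ne_zero hm j ht) hi
    have h2 := (h.saddle j t ht).1
    rw [← h1, h.ord_pole, ← WithTop.coe_zero, WithTop.coe_inj] at h2
    have := B.poleOrder_pos i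
    omega
  have hzP : ∀ j, ∀ t ∈ Set.Ioo (0 : ℝ) 1, P.eval (z j t) ≠ 0 := fun j t ht => by
    rw [hPP]; exact mul_ne_zero hV0 (hzP₀ j t ht)
  have hzd : ∀ j, ∀ t ∈ Set.Ioo (0 : ℝ) 1, HasDerivAt (z j) (P.eval (z j t)) t := by
    intro j t ht
    obtain ⟨h1, h2⟩ := h.saddle j t ht
    rw [hPP]
    exact hinv.hasDerivAt_comp (γ j).continuous_extend.continuousAt (h.saddle_ne_zero hm j ht) h1
      (hzP₀ j t ht) h2
  have hz0 : ∀ j, Tendsto (z j) (𝓝[>] 0) (Bornology.cobounded ℂ) := fun j =>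
    (tendsto_awayCoord σ).comp (h.tendsto_extend_zero hm j)
  have hz1 : ∀ j, Tendsto (z j) (𝓝[<] 1) (Bornology.cobounded ℂ) := fun j =>
    (tendsto_awayCoord σ).comp (h.tendsto_extend_one hm j)
  obtain ⟨coord⟩ := exists_infCoord P hdeg
  -- The coordinate at the zero is unique only up to an `(m+1)`-st root of unity. It is rotated so
  -- that `γ₁` leaves in direction `ω ^ 0`, which makes positions in two models comparable.
  obtain ⟨ξ, hξ, hξev⟩ := coord.exists_start zero_lt_one (v := 1)
    (fun t ht => by simpa using hzd 0 t ht) (hzP 0) (hz0 0)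
  obtain ⟨D, hDP, hDY, -, -, hDq₀, hDq₁⟩ := exists_flatModel hdeg (coord.rotate ξ hξ)
    (fun h0 => by simpa using huinj h0) ((hroot _).2 ⟨0, rfl⟩) ((hroot _).2 ⟨_, rfl⟩) hK'
  choose dep hdep arr harr hsgn hglue hray hstart hend using fun j =>
    D.exists_saddle (z := z j) (by rw [hDP]; exact hzd j) (by rw [hDP]; exact hzP j) (hz0 j) (hz1 j)
  have hr1 := fun j => D.coord.tendsto_unitVector (h.tendsto_extend_zero hm j)
    (θ := omega B.zeroOrder ^ dep j) (by rw [norm_pow, norm_omega, one_pow])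
    (tendsto_rpow_zero (m := B.zeroOrder)) (hstart j)
  have hlim1 : Tendsto (fun t : ℝ => 1 - t) (𝓝[<] 1) (𝓝[>] 0) := by
    refine tendsto_nhdsWithin_iff.2 ⟨?_, ?_⟩
    · have : Continuous (fun t : ℝ => 1 - t) := by fun_prop
      exact (this.tendsto' 1 0 (by simp)).mono_left nhdsWithin_le_nhds
    · filter_upwards [self_mem_nhdsWithin] with t ht
      exact sub_pos.2 (show t < 1 from ht)
  have hr2 := fun j => D.coord.tendsto_unitVector (h.tendsto_extend_one hm j)
    (θ := omega B.zeroOrder ^ arr j) (by rw [norm_pow, norm_omega, one_pow])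
    ((tendsto_rpow_zero (m := B.zeroOrder)).comp hlim1) (hend j)
  have hκ : D.coord.κ / ‖D.coord.κ‖ ≠ 0 :=
    div_ne_zero D.coord.κ_ne (by exact_mod_cast (norm_pos_iff.2 D.coord.κ_ne).ne')
  refine ⟨D, dep, arr, ?_, ?_, ?_, hDq₀.symm, hDq₁.symm, hray⟩
  · refine ⟨hdep, harr, ?_, ?_, ?_, hsgn, hglue, ?_, ?_, ?_, ?_⟩
    · have h1 : Tendsto (fun t : ℝ => centredCoord σ ((γ 0).extend t) /
          (‖centredCoord σ ((γ 0).extend t)‖ : ℂ)) (𝓝[>] 0)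
          (𝓝 (D.coord.κ / ‖D.coord.κ‖ * omega B.zeroOrder ^ 0)) :=
        D.coord.tendsto_unitVector (h.tendsto_extend_zero hm 0) (by simp)
          (tendsto_rpow_zero (m := B.zeroOrder)) (by
            filter_upwards [hξev] with t ht
            rw [hDY]
            simpa [InfCoord.rotate] using ht.1)
      exact omega_pow_injOn (hdep 0) (by omega)
        (mul_left_cancel₀ hκ (tendsto_nhds_unique (hr1 0) h1))
    · intro i j hij
      refine h.saddles_injective (path_ext_of_Ioo fun t ht => ?_)
      refine awayCoord_injOn (h.saddle_ne_zero hm i ht) (h.saddle_ne_zero hm j ht) ?_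
      exact (hray i t ht).trans (hij ▸ (hray j t ht).symm)
    · intro i j hij
      refine h.saddles_injective (path_ext_of_Ioo fun t ht => ?_)
      refine awayCoord_injOn (h.saddle_ne_zero hm i ht) (h.saddle_ne_zero hm j ht) ?_
      -- Seen from its returning end a saddle connection is the ray `arr l` run backwards, so the
      -- returning position determines the path as well.
      have hback : ∀ l, z l t = D.ray (arr l) (t - 1) := by
        intro l
        have h1 : (t : ℂ) * sgn (dep l) ∈ strip (dep l) ((1 : ℕ) : ℝ) :=
          ofReal_mul_sgn_mem_strip ht.1 (by exact_mod_cast ht.2)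
        rw [hsgn l, Complex.ofReal_one, mul_one] at h1
        have h2 := (hglue l).symm.ray_eq _ h1
        rw [(hglue l).sgn_eq, hsgn l] at h2
        rw [hray l t ht, ← h2]
        congr 1
        push_cast
        ring
      exact (hback i).trans (hij ▸ (hback j).symm)
    · rw [hDP, hP, card_roots_polePolynomial hVc B.poleOrder_pos huinj, Fintype.card_fin]
    · rw [hDP, hDq₀, hP, rootMultiplicity_polePolynomial hVc huinj, B.poleOrder_zero]
    · rw [hDP, hDq₁, hP, rootMultiplicity_polePolynomial hVc huinj, B.poleOrder_last]
    · obtain ⟨e₁, e₂, α, β, he, hα, hβ, htot, ha, hb, hc'⟩ := h.angles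
      have hd : ∀ j, e₁ j = D.coord.κ / ‖D.coord.κ‖ * omega B.zeroOrder ^ dep j := fun j =>
        tendsto_nhds_unique (he j).1 (hr1 j)
      have hr : ∀ j, e₂ j = D.coord.κ / ‖D.coord.κ‖ * omega B.zeroOrder ^ arr j := fun j =>
        tendsto_nhds_unique (he j).2 (hr2 j)
      simp only [hd, hr, flatTurn_mul_left hκ] at ha hb hc'
      exact ⟨α, β, hα, hβ, htot, ha, hb, hc'⟩
  · intro y hy
    change η.f y = V * _
    rw [hinv y hy, hDP, hPP, mul_inv]
    field_simp
  · rw [hDP]; exact hroot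

end Admits

/-! ### The Möbius transformation -/

theorem continuous_inv_smul {g : GL (Fin 2) ℂ} (hg : Continuous (fun x : Sphere => g • x)) :
    Continuous (fun x : Sphere => g⁻¹ • x) :=
  (Continuous.homeoOfEquivCompactToT2 (f := MulAction.toPerm g) hg).symm.continuous

/-- The affine map `z ↦ a z + b`. -/
noncomputable def affineMatrix (a b : ℂ) (ha : a ≠ 0) : GL (Fin 2) ℂ :=
  Matrix.GeneralLinearGroup.mkOfDetNeZero !![a, b; 0, 1] (by simpa)

theorem affineMatrix_coe (a b : ℂ) (ha : a ≠ 0) :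
    (affineMatrix a b ha : Matrix (Fin 2) (Fin 2) ℂ) = !![a, b; 0, 1] := rfl

theorem affineMatrix_smul_coe (a b : ℂ) (ha : a ≠ 0) (z : ℂ) :
    affineMatrix a b ha • (z : Sphere) = ((a * z + b : ℂ) : Sphere) := by
  rw [OnePoint.smul_some_eq_ite, if_neg (by simp [affineMatrix_coe])]
  simp [affineMatrix_coe]

theorem affineMatrix_smul_infty (a b : ℂ) (ha : a ≠ 0) :
    affineMatrix a b ha • (OnePoint.infty : Sphere) = OnePoint.infty := by
  rw [OnePoint.smul_infty_eq_ite, if_pos (by simp [affineMatrix_coe])]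

theorem continuous_affineMatrix_smul (a b : ℂ) (ha : a ≠ 0) :
    Continuous (fun x : Sphere => affineMatrix a b ha • x) := by
  let e : ℂ ≃ₜ ℂ := affineHomeomorph a b ha
  have : (fun x : Sphere => affineMatrix a b ha • x) = e.onePointCongr := by
    ext x
    induction x using OnePoint.rec with
    | infty => exact affineMatrix_smul_infty a b ha
    | coe z => exact affineMatrix_smul_coe a b ha z
  rw [this]
  exact e.onePointCongr.continuous

/-- The Möbius transformation which is `z ↦ a z + b` in coordinates taking `σ` and `σ'` to `∞`. -/
noncomputable def conjAffine (σ σ' : Sphere) (a b : ℂ) (ha : a ≠ 0) : GL (Fin 2) ℂ :=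
  (toInfinity σ')⁻¹ * affineMatrix a b ha * toInfinity σ

section conjAffine

variable {σ σ' : Sphere} {a b : ℂ} {ha : a ≠ 0}

theorem continuous_conjAffine_smul :
    Continuous (fun x : Sphere => conjAffine σ σ' a b ha • x) := by
  simp only [conjAffine, mul_smul]
  exact (continuous_inv_smul (continuous_toInfinity_smul σ')).comp
    ((continuous_affineMatrix_smul a b ha).comp (continuous_toInfinity_smul σ))

theorem conjAffine_smul_self : conjAffine σ σ' a b ha • σ = σ' := by
  rw [conjAffine, mul_smul, mul_smul, toInfinity_smul_self, affineMatrix_smul_infty,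
    ← toInfinity_smul_self σ', inv_smul_smul]

theorem conjAffine_smul_eq_iff {x y : Sphere} (hx : x ≠ σ) (hy : y ≠ σ') :
    conjAffine σ σ' a b ha • x = y ↔ a * awayCoord σ x + b = awayCoord σ' y := by
  rw [conjAffine, mul_smul, mul_smul, inv_smul_eq_iff, toInfinity_smul hx, toInfinity_smul hy,
    affineMatrix_smul_coe, OnePoint.coe_eq_coe]

theorem toInfinity_mul_conjAffine : (toInfinity σ' : Matrix (Fin 2) (Fin 2) ℂ) *
    (conjAffine σ σ' a b ha : Matrix (Fin 2) (Fin 2) ℂ) =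
      !![a, b; 0, 1] * (toInfinity σ : Matrix (Fin 2) (Fin 2) ℂ) := by
  have : toInfinity σ' * conjAffine σ σ' a b ha = affineMatrix a b ha * toInfinity σ := by
    rw [conjAffine, ← mul_assoc, ← mul_assoc, mul_inv_cancel, one_mul]
  rw [← affineMatrix_coe a b ha, ← Matrix.GeneralLinearGroup.coe_mul,
    ← Matrix.GeneralLinearGroup.coe_mul, this]

theorem linearFactor_conjAffine {z : ℂ}
    (hz : conjAffine σ σ' a b ha 1 0 * z + conjAffine σ σ' a b ha 1 1 ≠ 0) :
    linearFactor σ' ((conjAffine σ σ' a b ha 0 0 * z + conjAffine σ σ' a b ha 0 1) /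
        (conjAffine σ σ' a b ha 1 0 * z + conjAffine σ σ' a b ha 1 1)) *
      (conjAffine σ σ' a b ha 1 0 * z + conjAffine σ σ' a b ha 1 1) = linearFactor σ z := by
  have h := toInfinity_mul_conjAffine (σ := σ) (σ' := σ') (ha := ha) (b := b)
  have h0 := congrFun (congrFun h 1) 0
  have h1 := congrFun (congrFun h 1) 1
  simp only [Matrix.mul_apply, Fin.sum_univ_two, Matrix.of_apply, Matrix.cons_val', Matrix.cons_val_zero,
    Matrix.cons_val_one, Matrix.cons_val_fin_one, zero_mul, one_mul, zero_add] at h0 h1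
  rw [← toInfinity_row_one, ← toInfinity_row_one, add_mul, mul_assoc, div_mul_cancel₀ _ hz]
  linear_combination z * h0 + h1

theorem det_conjAffine : detInfinity σ' *
    (conjAffine σ σ' a b ha 0 0 * conjAffine σ σ' a b ha 1 1 -
      conjAffine σ σ' a b ha 0 1 * conjAffine σ σ' a b ha 1 0) = a * detInfinity σ := by
  have h := congrArg Matrix.det (toInfinity_mul_conjAffine (σ := σ) (σ' := σ') (ha := ha) (b := b))
  rw [Matrix.det_mul, Matrix.det_mul, Matrix.det_fin_two, Matrix.det_fin_two, Matrix.det_fin_two,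
    Matrix.det_fin_two] at h
  simpa [detInfinity] using h

end conjAffine

/-- A homeomorphism carries the component of `q 0` off `γ j` to the corresponding component for `γ'
j`. So the labels of a pole and of its image lie below the same indices `j`, and these comparisons
determine the label. -/
theorem LabelledInOrder.smul_eq {k : ℕ} {σ σ' : Sphere} {q q' : Fin (k + 2) → Sphere}
    {γ : Fin (k + 1) → Path σ σ} {γ' : Fin (k + 1) → Path σ' σ'} (h : LabelledInOrder q γ)
    (h' : LabelledInOrder q' γ') {A : GL (Fin 2) ℂ} (hA : Continuous (fun x : Sphere => A • x))
    (h0 : A • q 0 = q' 0) (hγ : ∀ j t, A • γ j t = γ' j t) (hq : ∀ i, ∃ i', A • q i = q' i')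
    (i : Fin (k + 2)) : A • q i = q' i := by
  let e : Sphere ≃ₜ Sphere := Continuous.homeoOfEquivCompactToT2 (f := MulAction.toPerm A) hA
  have he : ∀ x, e x = A • x := fun _ => rfl
  obtain ⟨i', hi'⟩ := hq i
  have hiff : ∀ j : Fin (k + 1), (i : ℕ) ≤ j ↔ (i' : ℕ) ≤ j := by
    intro j
    have hmem : q 0 ∈ (Set.range (γ j))ᶜ :=
      connectedComponentIn_subset _ _ ((h 0 j).2 (Nat.zero_le _))
    have hrange : e '' (Set.range (γ j))ᶜ = (Set.range (γ' j))ᶜ := by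
      rw [Set.image_compl_eq e.bijective, ← Set.range_comp]
      congr 2
      ext t
      exact hγ j t
    have himg := e.image_connectedComponentIn hmem
    rw [hrange, he, h0] at himg
    rw [← h i j, ← h' i' j, ← himg, ← hi', ← he, e.injective.mem_set_image]
  have : i' = i := by
    refine Fin.ext (le_antisymm ?_ ?_)
    · by_contra! hlt
      have := (hiff ⟨i, by omega⟩).1 le_rfl
      simp only at this
      omega
    · by_contra! hlt
      have := (hiff ⟨i', by omega⟩).2 le_rfl
      simp only at this
      omega
  rw [hi', this]

section Uniqueness

variable {B : Block} {η η' : MeroDifferential} {σ σ' : Sphere} {q q' : Fin (B.k + 2) → Sphere}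
  {ρ ρ' : ℂ} {γ : Fin (B.k + 1) → Path σ σ} {γ' : Fin (B.k + 1) → Path σ' σ'}
  {D D' : FlatModel B.zeroOrder} {dep arr dep' arr' : Fin (B.k + 1) → ℕ} {a b : ℂ}

theorem Admits.f_eq_zero (hm : 0 < B.zeroOrder) (h : Admits B η σ q ρ γ) {z : ℂ}
    (hz : (z : Sphere) = σ) : η.f z = 0 := by
  refine η.f_eq_zero_of_ord_ne_zero ?_
  rw [hz, h.ord_zero, ← WithTop.coe_zero, Ne, WithTop.coe_inj]
  omega

/-- The affine map intertwines the normalized differentials `du / P`, and the constant compares the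
normalizations `2πiρ` and `2πiρ'`. -/
theorem IsModelOf.pullsBackTo (hm : 0 < B.zeroOrder) (h : Admits B η σ q ρ γ)
    (h' : Admits B η' σ' q' ρ' γ') (hD : IsModelOf B η σ q ρ γ D dep arr)
    (hD' : IsModelOf B η' σ' q' ρ' γ' D' dep' arr') (ha : a ≠ 0)
    (hP : ∀ z, D'.P.eval (a * z + b) = a * D.P.eval z) :
    η'.PullsBackTo (conjAffine σ σ' a b ha) (ρ' / ρ) η := by
  intro z hz
  have hlin := linearFactor_conjAffine hz
  have hdet := det_conjAffine (σ := σ) (σ' := σ') (ha := ha) (b := b)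
  have hsmul : conjAffine σ σ' a b ha • (z : Sphere) = (((conjAffine σ σ' a b ha 0 0 * z +
      conjAffine σ σ' a b ha 0 1) / (conjAffine σ σ' a b ha 1 0 * z +
      conjAffine σ σ' a b ha 1 1) : ℂ) : Sphere) := by
    rw [OnePoint.smul_some_eq_ite, if_neg hz]
  -- The polynomial expression is available only off `σ`; at the zeros themselves both coefficients
  -- vanish because the order is positive.
  by_cases hσ : (z : Sphere) = σ
  · rw [h.f_eq_zero hm hσ, h'.f_eq_zero hm, zero_mul, mul_zero]
    rw [← hsmul, hσ, conjAffine_smul_self]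
  · generalize (conjAffine σ σ' a b ha 0 0 * z + conjAffine σ σ' a b ha 0 1) /
        (conjAffine σ σ' a b ha 1 0 * z + conjAffine σ σ' a b ha 1 1) = z' at *
    have hz' : (z' : Sphere) ≠ σ' := fun hz' => hσ (smul_left_cancel (conjAffine σ σ' a b ha)
      (by rw [hsmul, conjAffine_smul_self, hz']))
    have hu := (conjAffine_smul_eq_iff hσ hz').1 hsmul
    have hl : linearFactor σ z ≠ 0 := linearFactor_ne_zero (Ne.symm hσ)
    have hl' : linearFactor σ' z' ≠ 0 := linearFactor_ne_zero hz'.symm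
    rw [hD'.coeff z' hz', hD.coeff z hσ, ← hu, hP, ← hlin]
    have hρ := h.res_ne_zero
    generalize conjAffine σ σ' a b ha 1 0 * z + conjAffine σ σ' a b ha 1 1 = j at *
    generalize conjAffine σ σ' a b ha 0 0 * conjAffine σ σ' a b ha 1 1 -
      conjAffine σ σ' a b ha 0 1 * conjAffine σ σ' a b ha 1 0 = δ at *
    have h1 : 2 * Real.pi * Complex.I * ρ' * ((a * D.P.eval (awayCoord σ z))⁻¹ *
        (detInfinity σ' / linearFactor σ' z' ^ 2)) * (δ / j ^ 2) =
        2 * Real.pi * Complex.I * ρ' * (a⁻¹ * (D.P.eval (awayCoord σ z))⁻¹ *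
        ((detInfinity σ' * δ) / (linearFactor σ' z' * j) ^ 2)) := by
      rw [mul_inv]; field_simp
    rw [h1, hdet]
    field_simp

theorem IsModelOf.smul_saddle (hm : 0 < B.zeroOrder) (h : Admits B η σ q ρ γ)
    (h' : Admits B η' σ' q' ρ' γ') (hD : IsModelOf B η σ q ρ γ D dep arr)
    (hD' : IsModelOf B η' σ' q' ρ' γ' D' dep arr') (ha : a ≠ 0)
    (hray : ∀ n, ∀ x ∈ D.visDom n, D'.ray n x = a * D.ray n x + b) (j : Fin (B.k + 1))
    (t : unitInterval) : conjAffine σ σ' a b ha • γ j t = γ' j t := by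
  by_cases ht : (t : ℝ) ∈ Set.Ioo (0 : ℝ) 1
  · have h1 := hD.trajectory j t ht
    have h2 := hD'.trajectory j t ht
    have h3 := h.saddle_ne_zero hm j ht
    have h4 := h'.saddle_ne_zero hm j ht
    rw [Path.extend_apply _ t.2] at h1 h2 h3 h4
    refine (conjAffine_smul_eq_iff h3 h4).2 ?_
    rw [h1, h2]
    refine (hray _ _ ⟨?_, ?_⟩).symm
    · refine (hD.system.glue j).dom ?_
      have h5 : ((t : ℝ) : ℂ) * sgn (dep j) ∈ strip (dep j) ((1 : ℕ) : ℝ) :=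
        ofReal_mul_sgn_mem_strip ht.1 (by exact_mod_cast ht.2)
      rwa [hD.system.sgn_dep j, Complex.ofReal_one, mul_one] at h5
    · right
      rw [hD.system.sgn_dep j, mul_one, Complex.ofReal_re]
      exact ht.1
  · have : t = 0 ∨ t = 1 := by
      by_contra! hcon
      exact ht ⟨lt_of_le_of_ne t.2.1 fun h => hcon.1 (Subtype.ext h.symm),
        lt_of_le_of_ne t.2.2 fun h => hcon.2 (Subtype.ext h)⟩
    rcases this with rfl | rfl
    · rw [Path.source, Path.source, conjAffine_smul_self]
    · rw [Path.target, Path.target, conjAffine_smul_self]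

end Uniqueness

end FlatSphere

theorem proposition3p5 (B : FlatSphere.Block)
    (hB : B.IsTypeI ∨ B.IsTypeII ∨ B.IsTypeIII)
    (η η' : FlatSphere.MeroDifferential) (σ σ' : FlatSphere.Sphere)
    (q q' : Fin (B.k + 2) → FlatSphere.Sphere) (ρ ρ' : ℂ)
    (γ : Fin (B.k + 1) → Path σ σ) (γ' : Fin (B.k + 1) → Path σ' σ')
    (h : FlatSphere.Admits B η σ q ρ γ) (h' : FlatSphere.Admits B η' σ' q' ρ' γ') :
    ∃ (A : GL (Fin 2) ℂ) (c : ℂ), c ≠ 0 ∧ η'.PullsBackTo A c η ∧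
      A • σ = σ' ∧ A • q 0 = q' 0 ∧ A • q (Fin.last (B.k + 1)) = q' (Fin.last (B.k + 1)) ∧
      (∀ j t, A • γ j t = γ' j t) ∧
      (FlatSphere.LabelledInOrder q γ → FlatSphere.LabelledInOrder q' γ' →
        ∀ i, A • q i = q' i) := by
  have hm := FlatSphere.Block.one_le_zeroOrder hB
  obtain ⟨D, dep, arr, hD⟩ := h.exists_model hB
  obtain ⟨D', dep', arr', hD'⟩ := h'.exists_model hB
  obtain ⟨hsame, rfl⟩ := hD.system.sameRays hB hD'.system
  obtain ⟨a, b, ha, hP, hray, hq₀, hq₁⟩ := hsame.exists_affine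
  have h0 : FlatSphere.conjAffine σ σ' a b ha • q 0 = q' 0 := by
    refine (FlatSphere.conjAffine_smul_eq_iff (h.q_ne_zero _) (h'.q_ne_zero _)).2 ?_
    rw [hD.first, hD'.first, hq₀]
  have hγ := hD.smul_saddle hm h h' hD' ha hray
  refine ⟨FlatSphere.conjAffine σ σ' a b ha, ρ' / ρ, div_ne_zero h'.res_ne_zero h.res_ne_zero,
    hD.pullsBackTo hm h h' hD' ha hP, FlatSphere.conjAffine_smul_self, h0, ?_, hγ,
    fun hl hl' => hl.smul_eq hl' FlatSphere.continuous_conjAffine_smul h0 hγ fun i => ?_⟩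
  · refine (FlatSphere.conjAffine_smul_eq_iff (h.q_ne_zero _) (h'.q_ne_zero _)).2 ?_
    rw [hD.last, hD'.last, hq₁]
  -- The affine map takes roots to roots, so each pole goes to some pole; the labelling identifies
  -- which one.
  · have h1 := (hD.eval_eq_zero_iff _).2 ⟨i, rfl⟩
    obtain ⟨i', hi'⟩ := (hD'.eval_eq_zero_iff (a * FlatSphere.awayCoord σ (q i) + b)).1
      (by rw [hP, h1, mul_zero])
    exact ⟨i', (FlatSphere.conjAffine_smul_eq_iff (h.q_ne_zero _) (h'.q_ne_zero _)).2 hi'.symm⟩
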